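/- Let $n,r,s,t,\Delta\ge 1$ be integers, let $A^{(1)},\dots,A^{(n)}\in\mathbb Z^{r\times t}$ and $B^{(1)},\dots,B^{(n)}\in\mathbb Z^{s\times t}$ be matrices whose entries all have absolute value at most $\Delta$, and let $$\mathcal A=\begin{pmatrix}A^{(1)}&A^{(2)}&\cdots&A^{(n)}\\ B^{(1)}&0&\cdots&0\\ 0&B^{(2)}&&\vdots\\ \vdots&&\ddots&0\\ 0&\cdots&0&B^{(n)}\end{pmatrix}.$$ Let $b\in\mathbb Z^{r+ns}$ and $l,u\in\mathbb Z^{nt}$ (finite bounds), and let $f:\mathbb Z^{nt}\to\mathbb Z$ be separable convex, i.e. $f(x)=\sum_{p=1}^{nt}f_p(x_p)$ for all $x\in\mathbb Z^{nt}$, with convex functions $f_p:\mathbb R\to\mathbb R$. Consider the generalized $n$-fold integer program $$\min\{f(x):\ \mathcal A x=b,\ l\le x\le u,\ x\in\mathbb Z^{nt}\}.$$ Let $P$ be its set of feasible integer points and $M=\max_{x,y\in P}(f(x)-f(y))$. Let $N$ be the largest absolute value of an entry of $\mathcal A,b,l,u$, and let $\varphi=\log_2\max\{2,N\}$. Then the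 program can be solved in time $$n^2t^2\,\varphi\,\log M\cdot (rs\Delta)^{O(r^2s+rs^2)},$$ where $\log M$ is read as $\log_2\max\{2,M\}$, and as $1$ if $P=\emptyset$. That is, there are one algorithm and one absolute constant $K$ such that on every such input the algorithm outputs an optimal solution, or reports correctly that $P=\emptyset$, after at most $$K\,n^2t^2\,\varphi\,\log M\cdot(rs\Delta)^{K(r^2s+rs^2)}$$ steps. The algorithm is a program for a random access machine on integers in which each addition, subtraction, comparison, (indirect) memory access, and evaluation of $f$ at an integer point with at most one nonzero coordinate (that is, of a summand $f_p$, up to an additive constant) counts as one step. -/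

import Mathlib

namespace NFoldIP

/-! ### Generalized n-fold integer programs -/

/-- The linear data of a generalized `n`-fold integer program: top blocks `A⁽ⁱ⁾ ∈ ℤ^{r × t}`,
diagonal blocks `B⁽ⁱ⁾ ∈ ℤ^{s × t}`, a right-hand side in `ℤ^{r + ns}` and finite lower and upper
bounds in `ℤ^{nt}`.  The variable `(i, j)` is the `j`-th variable of the `i`-th brick. -/
structure Instance (n r s t : ℕ) where
  A : Fin n → Matrix (Fin r) (Fin t) ℤ
  B : Fin n → Matrix (Fin s) (Fin t) ℤ
  b : Fin r ⊕ (Fin n × Fin s) → ℤ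
  l : Fin n × Fin t → ℤ
  u : Fin n × Fin t → ℤ

namespace Instance

variable {n r s t : ℕ}

/-- The constraint matrix: the blocks `A⁽¹⁾ … A⁽ⁿ⁾` side by side in the first `r` rows, and
below them the block diagonal matrix with blocks `B⁽¹⁾, …, B⁽ⁿ⁾`. -/
def constraintMatrix (I : Instance n r s t) :
    Matrix (Fin r ⊕ (Fin n × Fin s)) (Fin n × Fin t) ℤ :=
  Matrix.of fun row col =>
    match row with
    | Sum.inl a => I.A col.1 a col.2
    | Sum.inr ka => if ka.1 = col.1 then I.B col.1 ka.2 col.2 else 0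

/-- The set of feasible integer points. -/
def feasible (I : Instance n r s t) : Set (Fin n × Fin t → ℤ) :=
  {x | I.constraintMatrix.mulVec x = I.b ∧ I.l ≤ x ∧ x ≤ I.u}

/-- `x` is an optimal solution of `min f(x)` over the feasible integer points. -/
def IsOptimal (I : Instance n r s t) (f : (Fin n × Fin t → ℤ) → ℤ)
    (x : Fin n × Fin t → ℤ) : Prop :=
  x ∈ I.feasible ∧ ∀ y ∈ I.feasible, f x ≤ f y

/-- All entries of the constraint matrix have absolute value at most `Δ`. -/
def EntriesBounded (I : Instance n r s t) (Δ : ℕ) : Prop :=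
  (∀ i a j, |I.A i a j| ≤ (Δ : ℤ)) ∧ ∀ i a j, |I.B i a j| ≤ (Δ : ℤ)

/-- The largest absolute value of a number in the input `(A, B, b, l, u)`. -/
def largest (I : Instance n r s t) : ℕ :=
  (Finset.univ.sup fun i => Finset.univ.sup fun a => Finset.univ.sup fun j =>
      (I.A i a j).natAbs) ⊔
  (Finset.univ.sup fun i => Finset.univ.sup fun a => Finset.univ.sup fun j =>
      (I.B i a j).natAbs) ⊔
  (Finset.univ.sup fun k => (I.b k).natAbs) ⊔
  (Finset.univ.sup fun p => (I.l p).natAbs) ⊔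
  (Finset.univ.sup fun p => (I.u p).natAbs)

/-- The (binary) logarithm `φ` of the largest number in the input, read as `1` when that
number is less than `2`. -/
noncomputable def phi (I : Instance n r s t) : ℝ :=
  Real.logb 2 (max 2 (I.largest : ℝ))

end Instance

/-- `f : ℤ^ι → ℤ` is (the restriction to integer points of) a separable convex function:
`f(x) = ∑ f_p(x_p)` with convex `f_p : ℝ → ℝ`. -/
def SeparableConvex {ι : Type} [Fintype ι] (f : (ι → ℤ) → ℤ) : Prop :=
  ∃ g : ι → ℝ → ℝ, (∀ p, ConvexOn ℝ Set.univ (g p)) ∧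
    ∀ x : ι → ℤ, (f x : ℝ) = ∑ p, g p (x p : ℝ)

/-! ### Random access machine programs with a step count

A program works with integer registers and integer arrays; a program names its registers and
arrays by constants, and array cells are addressed indirectly, by the content of a register.
The arithmetic is addition and subtraction (there is no multiplication, so the numbers cannot
explode under repeated squaring).  Every elementary instruction, every test and every query of
the objective takes one step. -/

/-- Memory: the register contents and the array contents. -/
structure State where
  reg : ℕ → ℤ
  arr : ℕ → ℤ → ℤ

namespace State

/-- Write `v` into register `x`. -/
def setReg (σ : State) (x : ℕ) (v : ℤ) : State :=
  { σ with reg := Function.update σ.reg x v }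

/-- Write `v` into cell `p` of array `a`. -/
def setCell (σ : State) (a : ℕ) (p v : ℤ) : State :=
  { σ with arr := Function.update σ.arr a (Function.update (σ.arr a) p v) }

end State

/-- Programs. -/
inductive Prog where
  /-- `x := c` -/
  | const (x : ℕ) (c : ℤ)
  /-- `x := y + z` -/
  | add (x y z : ℕ)
  /-- `x := y - z` -/
  | sub (x y z : ℕ)
  /-- `x := a[y]` -/
  | load (x a y : ℕ)
  /-- `a[x] := y` -/
  | store (a x y : ℕ)
  /-- `x := ` answer of the oracle to the query `(y, z)` -/
  | query (x y z : ℕ)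
  /-- first `c`, then `d` -/
  | seq (c d : Prog)
  /-- if `0 < x` then `c` else `d` -/
  | ite (x : ℕ) (c d : Prog)
  /-- while `0 < x` do `c` -/
  | loop (x : ℕ) (c : Prog)

/-- `Exec O c σ T σ'`: with oracle `O`, the program `c` started in `σ` halts in `σ'` after
exactly `T` steps. -/
inductive Exec (O : ℤ → ℤ → ℤ) : Prog → State → ℕ → State → Prop where
  | const (x : ℕ) (c : ℤ) (σ : State) : Exec O (.const x c) σ 1 (σ.setReg x c)
  | add (x y z : ℕ) (σ : State) : Exec O (.add x y z) σ 1 (σ.setReg x (σ.reg y + σ.reg z))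
  | sub (x y z : ℕ) (σ : State) : Exec O (.sub x y z) σ 1 (σ.setReg x (σ.reg y - σ.reg z))
  | load (x a y : ℕ) (σ : State) : Exec O (.load x a y) σ 1 (σ.setReg x (σ.arr a (σ.reg y)))
  | store (a x y : ℕ) (σ : State) :
      Exec O (.store a x y) σ 1 (σ.setCell a (σ.reg x) (σ.reg y))
  | query (x y z : ℕ) (σ : State) :
      Exec O (.query x y z) σ 1 (σ.setReg x (O (σ.reg y) (σ.reg z)))
  | seq {c d : Prog} {σ σ₁ σ₂ : State} {T₁ T₂ : ℕ} :
      Exec O c σ T₁ σ₁ → Exec O d σ₁ T₂ σ₂ → Exec O (.seq c d) σ (T₁ + T₂) σ₂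
  | ite_pos {x : ℕ} {c d : Prog} {σ σ₁ : State} {T : ℕ} :
      0 < σ.reg x → Exec O c σ T σ₁ → Exec O (.ite x c d) σ (T + 1) σ₁
  | ite_neg {x : ℕ} {c d : Prog} {σ σ₁ : State} {T : ℕ} :
      ¬ 0 < σ.reg x → Exec O d σ T σ₁ → Exec O (.ite x c d) σ (T + 1) σ₁
  | loop_done {x : ℕ} {c : Prog} {σ : State} :
      ¬ 0 < σ.reg x → Exec O (.loop x c) σ 1 σ
  | loop_step {x : ℕ} {c : Prog} {σ σ₁ σ₂ : State} {T₁ T₂ : ℕ} :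
      0 < σ.reg x → Exec O c σ T₁ σ₁ → Exec O (.loop x c) σ₁ T₂ σ₂ →
      Exec O (.loop x c) σ (T₁ + T₂ + 1) σ₂

/-- The machine is deterministic, so the running time and the result are well defined. -/
theorem Exec.deterministic {O : ℤ → ℤ → ℤ} {c : Prog} {σ σ₁ σ₂ : State} {T₁ T₂ : ℕ}
    (h₁ : Exec O c σ T₁ σ₁) (h₂ : Exec O c σ T₂ σ₂) : T₁ = T₂ ∧ σ₁ = σ₂ := by
  induction h₁ generalizing T₂ σ₂ with
  | const | add | sub | load | store | query => cases h₂; exact ⟨rfl, rfl⟩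
  | seq _ _ ih₁ ih₂ =>
    cases h₂ with
    | seq k₁ k₂ =>
      obtain ⟨rfl, rfl⟩ := ih₁ k₁
      obtain ⟨rfl, rfl⟩ := ih₂ k₂
      exact ⟨rfl, rfl⟩
  | ite_pos hx _ ih =>
    cases h₂ with
    | ite_pos _ k => obtain ⟨rfl, rfl⟩ := ih k; exact ⟨rfl, rfl⟩
    | ite_neg hx' _ => exact absurd hx hx'
  | ite_neg hx _ ih =>
    cases h₂ with
    | ite_pos hx' _ => exact absurd hx' hx
    | ite_neg _ k => obtain ⟨rfl, rfl⟩ := ih k; exact ⟨rfl, rfl⟩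
  | loop_done hx =>
    cases h₂ with
    | loop_done _ => exact ⟨rfl, rfl⟩
    | loop_step hx' _ _ => exact absurd hx' hx
  | loop_step hx _ _ ih₁ ih₂ =>
    cases h₂ with
    | loop_done hx' => exact absurd hx hx'
    | loop_step _ k₁ k₂ =>
      obtain ⟨rfl, rfl⟩ := ih₁ k₁
      obtain ⟨rfl, rfl⟩ := ih₂ k₂
      exact ⟨rfl, rfl⟩

/-! ### Input, oracle and output -/

/-- An array with the entries of `v` in the cells `0, …, k - 1` and zeros elsewhere. -/
def arrayOf {k : ℕ} (v : Fin k → ℤ) : ℤ → ℤ := fun p =>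
  if h : 0 ≤ p ∧ p.toNat < k then v ⟨p.toNat, h.2⟩ else 0

/-- A matrix row by row: entry `(i, j)` stands in cell `i * m + j`. -/
def rowMajor {k m : ℕ} (v : Fin k × Fin m → ℤ) : ℤ → ℤ :=
  arrayOf fun p => v (finProdFinEquiv.symm p)

theorem rowMajor_apply {k m : ℕ} (v : Fin k × Fin m → ℤ) (i : Fin k) (j : Fin m) :
    rowMajor v ((i : ℤ) * m + j) = v (i, j) := by
  have hp : (finProdFinEquiv (i, j) : ℕ) = (i : ℕ) * m + j := by
    simp [finProdFinEquiv, Nat.mul_comm, Nat.add_comm]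
  have hc : ((i : ℤ) * m + j) = ((finProdFinEquiv (i, j) : ℕ) : ℤ) := by
    rw [hp]; push_cast; rfl
  have hlt : ((finProdFinEquiv (i, j) : ℕ) : ℤ).toNat < k * m := by
    simp only [Int.toNat_natCast]; exact (finProdFinEquiv (i, j)).2
  rw [hc, rowMajor, arrayOf, dif_pos ⟨Int.natCast_nonneg _, hlt⟩]
  simp only [Int.toNat_natCast, Fin.eta, Equiv.symm_apply_apply]

/-- The initial memory.  Registers `0, 1, 2, 3` hold `n, r, s, t`.  Array `0` holds the entry
`(a, j)` of `A⁽ⁱ⁾` in cell `i * (r * t) + (a * t + j)`, array `1` likewise the blocks `B⁽ⁱ⁾`;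
array `2` holds the first `r` entries of the right-hand side, array `3` its remaining bricks in
cells `i * s + a`; arrays `4` and `5` hold the lower and upper bounds of the variable `(i, j)`
in cell `i * t + j`.  Everything else is zero. -/
def Instance.encode {n r s t : ℕ} (I : Instance n r s t) : State where
  reg := fun x =>
    match x with
    | 0 => n
    | 1 => r
    | 2 => s
    | 3 => t
    | _ => 0
  arr := fun a =>
    match a with
    | 0 => rowMajor fun p : Fin n × Fin (r * t) =>
        I.A p.1 (finProdFinEquiv.symm p.2).1 (finProdFinEquiv.symm p.2).2
    | 1 => rowMajor fun p : Fin n × Fin (s * t) =>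
        I.B p.1 (finProdFinEquiv.symm p.2).1 (finProdFinEquiv.symm p.2).2
    | 2 => arrayOf fun a : Fin r => I.b (Sum.inl a)
    | 3 => rowMajor fun p : Fin n × Fin s => I.b (Sum.inr p)
    | 4 => rowMajor I.l
    | 5 => rowMajor I.u
    | _ => fun _ => 0

/-- Access to the objective, one coordinate at a time: the query `(i * t + j, v)` is answered by
the value of `f` at the point whose coordinate `(i, j)` is `v` and whose other coordinates are
`0`.  For a separable `f` this is the summand of the coordinate `(i, j)` at `v`, up to an
additive constant.  It is less than access to all values of `f`. -/
def coordinateOracle {n t : ℕ} (f : (Fin n × Fin t → ℤ) → ℤ) : ℤ → ℤ → ℤ := fun p v =>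
  rowMajor (fun ij : Fin n × Fin t => f (Pi.single ij v)) p

/-- The final memory is a correct answer: either register `0` is `1` and array `6` holds an
optimal solution, the variable `(i, j)` in cell `i * t + j`; or register `0` is `0` and there is
no feasible integer point. -/
def Instance.IsAnswer {n r s t : ℕ} (I : Instance n r s t) (f : (Fin n × Fin t → ℤ) → ℤ)
    (σ : State) : Prop :=
  (σ.reg 0 = 1 ∧
    I.IsOptimal f fun ij : Fin n × Fin t => σ.arr 6 (((ij.1 : ℕ) : ℤ) * t + ((ij.2 : ℕ) : ℤ))) ∨
  (σ.reg 0 = 0 ∧ I.feasible = ∅)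

end NFoldIP

namespace NFoldIP

open Finset

/-! ### The Steinitz lemma and short zero sums -/

/-! The algorithm augments along short kernel vectors, found by dynamic programming, in a search for
a feasible point followed by an optimization.

Short vectors. By the Steinitz lemma, more than `(2dC + 1) ^ d` integer vectors in dimension `d`
with entries at most `C` and sum zero have a proper zero-sum subfamily (`exists_short_zeroSum`).
Applied to the columns of the blocks `B⁽ⁱ⁾`, and then to the images under the top rows of the pieces
so obtained, this shows that every nonzero kernel vector of the `n`-fold matrix has below it, in the
conformal order, a nonzero kernel vector of `ℓ₁`-norm at most `L = graverBound r s Δ`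
(`exists_conf_nker`), which is `(rsΔ) ^ O(rs)`. Separable convex functions are superadditive along
conformal sums. Hence an improving kernel move yields a short improving one
(`exists_improving_conf`), and if no short move with a power of two as step length gains more than
`B`, then the optimum is at most `2 · (number of variables) · L · B` away (`gap_le`).

Finding the best short vector. The partial sums of the columns along a vector of norm at most `L`
have entries at most `ΔL`, so the `r + s` rows are packed as balanced digits in base `2ΔL + 1` into
a single residual. The rows of a brick are the high digits, and they vanish exactly if the residual
is small at the brick boundaries (`digits_low_iff`). The paths of the dynamic program over position,
remaining norm and residual are therefore exactly the short admissible kernel vectors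
(`DP.NFold.path_iff`). There are `(rsΔ) ^ O(r²s + rs²)` residuals, which gives the parameter
dependence, and one table costs `nt` times such a factor.

Feasibility. Every row of every brick gets a slack variable, and the total slack is minimized by
scaling. At scale `2 ^ k` the remainder of the slack modulo `2 ^ k` is ignored. Rounding a feasible
point gives a target of small slack (`Flat.Good.exists_target`), so a number of moves proportional
to `nt` suffices at each of the `O(φ)` scales.

Optimization. With the slack frozen at zero, the best step over all powers of two shrinks the gap to
the optimum by a factor `1 - 1/(2m)`, where `m` is the number of positions times `L`. After `O(m log
M)` rounds the gap is below `1`, hence zero (`runs_opt`). Each round builds `O(φ)` tables, and all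
costs multiply to the bound. The rest of the file verifies the machine program, whose behaviour is
described by `Runs`, and adds up its steps. -/

/-- The polytope of weights in `[0, 1]` with total `m` under which the vectors `v` cancel. -/
def weightPolytope {ι : Type*} [Fintype ι] {d : ℕ} (v : ι → Fin d → ℝ) (m : ℝ) :
    Set (ι → ℝ) :=
  {x | (∀ i, 0 ≤ x i ∧ x i ≤ 1) ∧ ∑ i, x i = m ∧ ∀ a, ∑ i, x i * v i a = 0}

/-- Compactness is needed only to have a vertex. -/
theorem isCompact_weightPolytope {ι : Type*} [Fintype ι] {d : ℕ} (v : ι → Fin d → ℝ) (m : ℝ) :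
    IsCompact (weightPolytope v m) := by
  have h1 : weightPolytope v m = Set.Icc (0 : ι → ℝ) 1 ∩
      ({x | ∑ i, x i = m} ∩ ⋂ a, {x | ∑ i, x i * v i a = 0}) := by
    ext x
    simp only [weightPolytope, Set.mem_ofPred_eq, Set.mem_inter_iff, Set.mem_Icc, Pi.le_def,
      Pi.zero_apply, Pi.one_apply, Set.mem_iInter, forall_and]
  rw [h1]
  refine isCompact_Icc.inter_right (IsClosed.inter ?_ (isClosed_iInter fun a => ?_))
  · exact isClosed_eq (by fun_prop) (by fun_prop)
  · exact isClosed_eq (by fun_prop) (by fun_prop)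

/-- A vertex of the polytope of weights has at most `d + 1` fractional coordinates. -/
theorem card_fractional_le {ι : Type*} [Fintype ι] {d : ℕ} (v : ι → Fin d → ℝ)
    (m : ℝ) {x : ι → ℝ} (hx : x ∈ (weightPolytope v m).extremePoints ℝ) :
    (univ.filter fun i => 0 < x i ∧ x i < 1).card ≤ d + 1 := by
  classical
  by_contra! hlt
  set F := univ.filter fun i => 0 < x i ∧ x i < 1 with hF
  let φ : (F → ℝ) →ₗ[ℝ] (Fin d → ℝ) × ℝ :=
    { toFun := fun y => (fun a => ∑ i : F, y i * v i a, ∑ i : F, y i)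
      map_add' := by
        intro y z
        ext <;> simp [add_mul, sum_add_distrib]
      map_smul' := by
        intro c y
        ext <;> simp [mul_sum, mul_assoc] }
  -- More than `d + 1` free coordinates against `d + 1` linear equations: some nonzero direction
  -- supported on the fractional coordinates preserves all equations.
  have hker : LinearMap.ker φ ≠ ⊥ := by
    apply LinearMap.ker_ne_bot_of_finrank_lt
    simp only [Module.finrank_prod, Module.finrank_self, Module.finrank_fintype_fun_eq_card,
      Fintype.card_coe, Fintype.card_fin]
    omega
  obtain ⟨y, hy, hy0⟩ := (Submodule.ne_bot_iff _).1 hker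
  rw [LinearMap.mem_ker] at hy
  have hy1 : ∀ a, ∑ i : F, y i * v i a = 0 := fun a => congrFun (congrArg Prod.fst hy) a
  have hy2 : ∑ i : F, y i = 0 := congrArg Prod.snd hy
  let z : ι → ℝ := fun i => if h : i ∈ F then y ⟨i, h⟩ else 0
  have hsum : ∀ g : ι → ℝ, ∑ i, z i * g i = ∑ i : F, y i * g i := by
    intro g
    rw [← sum_subset (subset_univ F) (by intro i _ hi; simp [z, hi]), ← sum_coe_sort F]
    exact sum_congr rfl fun i _ => by simp [z]
  have hz1 : ∀ a, ∑ i, z i * v i a = 0 := fun a => by rw [hsum, hy1]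
  have hz2 : ∑ i, z i = 0 := by
    have := hsum fun _ => 1
    simp only [mul_one] at this
    rw [this, hy2]
  -- Fractional coordinates have room on both sides, so short moves in the directions `z` and `-z`
  -- stay in the polytope, and `x` is the midpoint of two such points.
  have hev : ∀ᶠ ε in nhds (0 : ℝ), ∀ i, 0 ≤ x i + ε * z i ∧ x i + ε * z i ≤ 1 := by
    rw [Filter.eventually_all]
    intro i
    by_cases hi : i ∈ F
    · have hi' := (mem_filter.1 hi).2
      have hc : Filter.Tendsto (fun ε : ℝ => x i + ε * z i) (nhds 0) (nhds (x i)) := by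
        have : Continuous fun ε : ℝ => x i + ε * z i := by fun_prop
        simpa using this.tendsto 0
      filter_upwards [hc.eventually (lt_mem_nhds hi'.1), hc.eventually (gt_mem_nhds hi'.2)]
        with ε h1 h2 using ⟨h1.le, h2.le⟩
    · simp only [z, hi, dite_false, mul_zero, add_zero]
      exact Filter.Eventually.of_forall fun _ => hx.1.1 i
  obtain ⟨δ, hδ, hball⟩ := Metric.eventually_nhds_iff.1 hev
  have hmem : ∀ ε : ℝ, |ε| < δ → (fun i => x i + ε * z i) ∈ weightPolytope v m := by
    intro ε hε
    refine ⟨hball (by simpa [Real.dist_eq] using hε), ?_, fun a => ?_⟩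
    · rw [sum_add_distrib, ← mul_sum, hz2, hx.1.2.1]; ring
    · simp only [add_mul, sum_add_distrib, mul_assoc, ← mul_sum, hz1, hx.1.2.2]; ring
  have hp := hmem (δ / 2) (by rw [abs_of_pos (by linarith)]; linarith)
  have hn := hmem (-(δ / 2)) (by rw [abs_neg, abs_of_pos (by linarith)]; linarith)
  have hseg : x ∈ openSegment ℝ (fun i => x i + δ / 2 * z i) (fun i => x i + -(δ / 2) * z i) := by
    refine ⟨1 / 2, 1 / 2, by norm_num, by norm_num, by norm_num, ?_⟩
    ext i
    simp only [Pi.add_apply, Pi.smul_apply, smul_eq_mul]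
    ring
  have hxx := hx.2 hp hn hseg
  apply hy0
  ext i
  have h3 := congrFun hxx i
  simp only [z, i.2, dite_true, Subtype.coe_eta, add_eq_left, mul_eq_zero] at h3
  rcases h3 with h3 | h3
  · linarith
  · simpa using h3

/-- At a vertex without a zero coordinate all but at most `d + 1` coordinates are `1`, so at least
`m` of them are. A fractional coordinate would then push the total above `m`, and without one the
total would be `m + d + 1`. -/
theorem exists_weight_eq_zero {ι : Type*} [Fintype ι] {d m : ℕ} (v : ι → Fin d → ℝ)
    (hcard : Fintype.card ι = m + d + 1) (hne : (weightPolytope v m).Nonempty) :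
    ∃ x ∈ weightPolytope v m, ∃ j, x j = 0 := by
  classical
  obtain ⟨x, hx⟩ := (isCompact_weightPolytope v m).extremePoints_nonempty hne
  refine ⟨x, hx.1, ?_⟩
  by_contra! h0
  have hfrac := card_fractional_le v m hx
  set F := univ.filter fun i => 0 < x i ∧ x i < 1 with hF
  have hone : ∀ i ∈ Fᶜ, x i = 1 := by
    intro i hi
    simp only [hF, mem_compl, mem_filter, mem_univ, true_and, not_and, not_lt] at hi
    have := hx.1.1 i
    exact le_antisymm this.2 (hi (lt_of_le_of_ne this.1 (h0 i).symm))
  have hsum : ∑ i ∈ F, x i + (Fᶜ.card : ℝ) = m := by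
    rw [← hx.1.2.1, ← sum_add_sum_compl F, sum_congr rfl hone]
    simp
  have hcc : F.card + Fᶜ.card = m + d + 1 := by rw [card_add_card_compl, hcard]
  have hFn : F.Nonempty ∨ F = ∅ := F.eq_empty_or_nonempty.symm
  rcases hFn with hFn | hFe
  · have hpos : 0 < ∑ i ∈ F, x i := sum_pos (fun i hi => (mem_filter.1 hi).2.1) hFn
    have : (m : ℝ) ≤ Fᶜ.card := by exact_mod_cast (by omega : m ≤ Fᶜ.card)
    linarith
  · rw [hFe] at hsum hcc
    simp only [sum_empty, zero_add, compl_empty, card_empty] at hsum hcc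
    have : (univ : Finset ι).card = m := by exact_mod_cast hsum
    omega

/-- `S` carries weights in `[0, 1]` with total `|S| - d` under which the vectors cancel. -/
def Balanced {ι : Type*} {d : ℕ} (v : ι → Fin d → ℝ) (S : Finset ι) : Prop :=
  ∃ x : ι → ℝ, (∀ i ∈ S, 0 ≤ x i ∧ x i ≤ 1) ∧ ∑ i ∈ S, x i + d = S.card ∧
    ∀ a, ∑ i ∈ S, x i * v i a = 0

/-- With `m = |S| - d - 1`, scaling the weights by `m / (m + 1)` lowers their total from `|S| - d`
by exactly one, which is the total that `S` without one element needs. A vertex of that polytope has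
a zero coordinate, and this is the element to drop. -/
theorem Balanced.exists_erase {ι : Type*} [DecidableEq ι] {d : ℕ} {v : ι → Fin d → ℝ}
    {S : Finset ι} (h : Balanced v S) (hd : d < S.card) : ∃ j ∈ S, Balanced v (S.erase j) := by
  obtain ⟨x, h01, hsum, hv⟩ := h
  obtain ⟨m, hm⟩ : ∃ m, S.card = m + d + 1 := ⟨S.card - d - 1, by omega⟩
  have hsum' : ∑ i ∈ S, x i = m + 1 := by rw [hm] at hsum; push_cast at hsum; linarith
  have hpos : (0 : ℝ) < m + 1 := by positivity
  obtain ⟨y, hy, j, hj⟩ := exists_weight_eq_zero (m := m) (fun i : S => v i)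
    (by simpa using hm) (by
      refine ⟨fun i => (m / (m + 1)) * x i, fun i => ⟨?_, ?_⟩, ?_, fun a => ?_⟩
      · have := (h01 i i.2).1; positivity
      · have := h01 i i.2
        calc (m / (m + 1) : ℝ) * x i ≤ 1 * 1 := by
              gcongr
              · exact this.1
              · rw [div_le_one hpos]; linarith
              · exact this.2
          _ = 1 := by norm_num
      · rw [← mul_sum, sum_coe_sort S x, hsum']; field_simp
      · simp only [mul_assoc]
        rw [← mul_sum, sum_coe_sort S fun i => x i * v i a, hv a, mul_zero])
  let z : ι → ℝ := fun i => if h : i ∈ S then y ⟨i, h⟩ else 0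
  have hz : ∀ i : S, z i = y i := fun i => by simp [z]
  have herase : ∀ g : ι → ℝ, ∑ i ∈ S.erase j, z i * g i = ∑ i : S, y i * g i := by
    intro g
    rw [sum_erase _ (by rw [hz, hj, zero_mul]), ← sum_coe_sort S]
    exact sum_congr rfl fun i _ => by rw [hz]
  refine ⟨j, j.2, z, fun i hi => ?_, ?_, fun a => ?_⟩
  · have := hy.1 ⟨i, mem_of_mem_erase hi⟩
    rwa [← hz] at this
  · have := herase fun _ => 1
    simp only [mul_one] at this
    rw [this, hy.2.1, card_erase_of_mem j.2, hm]
    push_cast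
    simp
  · rw [herase, hy.2.2 a]

/-- Since the vectors cancel under the weights `x`, their sum is also the sum with weights `1 - x`;
these are nonnegative with total `d`. -/
theorem Balanced.abs_sum_le {ι : Type*} {d : ℕ} {v : ι → Fin d → ℝ} {S : Finset ι}
    (h : Balanced v S) {C : ℝ} (hC : ∀ i a, |v i a| ≤ C) (a : Fin d) :
    |∑ i ∈ S, v i a| ≤ d * C := by
  obtain ⟨x, h01, hsum, hv⟩ := h
  calc |∑ i ∈ S, v i a| = |∑ i ∈ S, (1 - x i) * v i a| := by
        simp only [sub_mul, one_mul, sum_sub_distrib, hv a, sub_zero]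
    _ ≤ ∑ i ∈ S, |(1 - x i) * v i a| := abs_sum_le_sum_abs _ _
    _ ≤ ∑ i ∈ S, (1 - x i) * C := by
        refine sum_le_sum fun i hi => ?_
        have := h01 i hi
        rw [abs_mul, abs_of_nonneg (by linarith)]
        exact mul_le_mul_of_nonneg_left (hC i a) (by linarith)
    _ = d * C := by
        rw [← sum_mul, sum_sub_distrib]
        simp only [sum_const, nsmul_eq_mul, mul_one]
        rw [← hsum]; ring

/-- **Steinitz lemma**, in terms of a chain of subsets instead of an ordering. -/
theorem steinitz_chain {ι : Type*} {d : ℕ} {v : ι → Fin d → ℝ} {C : ℝ} (hC0 : 0 ≤ C)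
    (hC : ∀ i a, |v i a| ≤ C) (k : ℕ) (S : Finset ι) (hk : S.card = k)
    (hS : Balanced v S ∨ S.card ≤ d) :
    ∃ s : ℕ → Finset ι, s k = S ∧ (∀ l ≤ k, (s l).card = l ∧ ∀ a, |∑ i ∈ s l, v i a| ≤ d * C) ∧
      ∀ l m, l ≤ m → m ≤ k → s l ⊆ s m := by
  classical
  have hbound : ∀ a, |∑ i ∈ S, v i a| ≤ d * C := by
    intro a
    rcases hS with hS | hS
    · exact hS.abs_sum_le hC a
    · calc |∑ i ∈ S, v i a| ≤ ∑ i ∈ S, |v i a| := abs_sum_le_sum_abs _ _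
        _ ≤ ∑ _i ∈ S, C := sum_le_sum fun i _ => hC i a
        _ = S.card * C := by simp
        _ ≤ d * C := by gcongr
  induction k generalizing S with
  | zero =>
    obtain rfl := card_eq_zero.1 hk
    exact ⟨fun _ => ∅, rfl, fun l hl => ⟨by simp; omega, hbound⟩, fun _ _ _ _ => by simp⟩
  | succ k ih =>
    -- Once at most `d` elements are left, no weights are needed: the triangle inequality gives the
    -- bound, and any element may be removed.
    obtain ⟨j, hj, hS'⟩ : ∃ j ∈ S, Balanced v (S.erase j) ∨ (S.erase j).card ≤ d := by
      by_cases hd : d < S.card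
      · rcases hS with hS | hS
        · obtain ⟨j, hj, h⟩ := hS.exists_erase hd
          exact ⟨j, hj, Or.inl h⟩
        · omega
      · obtain ⟨j, hj⟩ := card_pos.1 (by omega : 0 < S.card)
        exact ⟨j, hj, Or.inr ((card_erase_le).trans (by omega))⟩
    have hcard : (S.erase j).card = k := by rw [card_erase_of_mem hj, hk]; rfl
    obtain ⟨s, hs1, hs2, hs3⟩ := ih (S.erase j) hcard hS' (by
      intro a
      rcases hS' with hS | hS
      · exact hS.abs_sum_le hC a
      · calc |∑ i ∈ S.erase j, v i a| ≤ ∑ i ∈ S.erase j, |v i a| := abs_sum_le_sum_abs _ _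
          _ ≤ ∑ _i ∈ S.erase j, C := sum_le_sum fun i _ => hC i a
          _ = (S.erase j).card * C := by simp
          _ ≤ d * C := by gcongr)
    refine ⟨fun l => if l ≤ k then s l else S, by simp, fun l hl => ?_, fun l m hlm hm => ?_⟩
    · by_cases h : l ≤ k
      · simpa only [h, if_true] using hs2 l h
      · simp only [h, if_false]
        exact ⟨by omega, hbound⟩
    · by_cases h : m ≤ k
      · simpa only [h, hlm.trans h, if_true] using hs3 l m hlm h
      · by_cases h' : l ≤ k
        · simp only [h, h', if_true, if_false]
          exact (hs3 l k h' le_rfl).trans (hs1 ▸ erase_subset _ _)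
        · simp only [h, h', if_false, subset_refl]

/-- More than `(2dC + 1) ^ d` integer vectors with sum zero have a proper zero-sum subfamily. -/
theorem exists_zeroSum_ssubset {ι : Type*} {d C : ℕ} {v : ι → Fin d → ℤ}
    (hC : ∀ i a, |v i a| ≤ C) {S : Finset ι} (hS : ∑ i ∈ S, v i = 0)
    (hcard : (2 * d * C + 1) ^ d < S.card) :
    ∃ T ⊂ S, T.Nonempty ∧ ∑ i ∈ T, v i = 0 := by
  classical
  have hS' : ∀ a, ∑ i ∈ S, v i a = 0 := fun a => by
    have := congrFun hS a; rwa [Finset.sum_apply] at this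
  have hbal : Balanced (fun i a => (v i a : ℝ)) S ∨ S.card ≤ d := by
    by_cases hd : S.card ≤ d
    · exact Or.inr hd
    · have hpos : (0 : ℝ) < S.card := by exact_mod_cast (by omega : 0 < S.card)
      have hd' : (d : ℝ) ≤ S.card := by exact_mod_cast (by omega : d ≤ S.card)
      -- Equal weights balance a zero-sum family.
      refine Or.inl ⟨fun _ => (S.card - d) / S.card, fun i _ => ⟨?_, ?_⟩, ?_, fun a => ?_⟩
      · exact div_nonneg (by linarith) hpos.le
      · rw [div_le_one hpos]; linarith [(Nat.cast_nonneg d : (0 : ℝ) ≤ d)]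
      · simp only [sum_const, nsmul_eq_mul]; field_simp; ring
      · rw [← mul_sum]
        have : ∑ i ∈ S, (v i a : ℝ) = 0 := by exact_mod_cast hS' a
        rw [this, mul_zero]
  obtain ⟨s, hs1, hs2, hs3⟩ := steinitz_chain (C := (C : ℝ)) (by positivity)
    (v := fun i a => (v i a : ℝ)) (fun i a => by exact_mod_cast hC i a) S.card S rfl hbal
  -- Only the members `s 0, …, s (|S| - 1)` of the chain enter the pigeonhole. Leaving out `s |S| =
  -- S` makes the difference of two members with equal sums a proper subset of `S`.
  have hmaps : Set.MapsTo (fun k => ∑ i ∈ s k, v i) (Finset.range S.card)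
      (Fintype.piFinset fun _ : Fin d => Finset.Icc (-(d * C : ℤ)) (d * C)) := by
    intro k hk
    have hk' : k < S.card := by simpa using hk
    simp only [Finset.mem_coe, Fintype.mem_piFinset, Finset.mem_Icc, Finset.sum_apply]
    intro a
    rw [← abs_le]
    exact_mod_cast (hs2 k hk'.le).2 a
  have hc : (Fintype.piFinset fun _ : Fin d => Finset.Icc (-(d * C : ℤ)) (d * C)).card <
      (Finset.range S.card).card := by
    rw [Fintype.card_piFinset_const, Int.card_Icc, Finset.card_range]
    convert hcard using 2
    have : (d * C + 1 - -(d * C) : ℤ) = ((2 * d * C + 1 : ℕ) : ℤ) := by push_cast; ring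
    rw [this, Int.toNat_natCast]
  obtain ⟨k, hk, l, hl, hkl, heq⟩ := Finset.exists_ne_map_eq_of_card_lt_of_maps_to hc hmaps
  wlog h : k < l generalizing k l
  · exact this l hl k hk hkl.symm heq.symm (by omega)
  rw [Finset.mem_range] at hk hl
  have hsub := hs3 k l h.le hl.le
  refine ⟨s l \ s k, ?_, ?_, ?_⟩
  · refine (Finset.ssubset_iff_subset_ne).2 ⟨?_, fun he => ?_⟩
    · exact sdiff_subset.trans (hs1 ▸ hs3 l S.card hl.le le_rfl)
    · have h1 := card_le_card (sdiff_subset : s l \ s k ⊆ s l)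
      rw [he, (hs2 l hl.le).1] at h1
      omega
  · rw [← card_pos, card_sdiff_of_subset hsub, (hs2 l hl.le).1, (hs2 k hk.le).1]
    omega
  · have := sum_sdiff hsub (f := v)
    rw [← heq] at this
    simpa using this

/-- Every nonempty zero-sum family has a nonempty zero-sum subfamily with at most
`(2dC + 1) ^ d` members. -/
theorem exists_short_zeroSum {ι : Type*} {d C : ℕ} {v : ι → Fin d → ℤ}
    (hC : ∀ i a, |v i a| ≤ C) (S : Finset ι) (hne : S.Nonempty) (hS : ∑ i ∈ S, v i = 0) :
    ∃ T ⊆ S, T.Nonempty ∧ T.card ≤ (2 * d * C + 1) ^ d ∧ ∑ i ∈ T, v i = 0 := by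
  induction S using Finset.strongInduction with
  | H S ih =>
    by_cases h : S.card ≤ (2 * d * C + 1) ^ d
    · exact ⟨S, subset_rfl, hne, h, hS⟩
    · obtain ⟨T, hT, hTne, hT0⟩ := exists_zeroSum_ssubset hC hS (by omega)
      obtain ⟨U, hU, h⟩ := ih T hT hTne hT0
      exact ⟨U, hU.trans hT.1, h⟩

end NFoldIP

namespace NFoldIP

open Finset

/-! ### Conformal decompositions -/

section Conformal

variable {ι : Type*}

/-- `g` is conformal to `h`: in every coordinate it lies between `0` and `h`. -/
def Conf (g h : ι → ℤ) : Prop := ∀ p, (0 ≤ g p ∧ g p ≤ h p) ∨ (h p ≤ g p ∧ g p ≤ 0)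

theorem Conf.refl (h : ι → ℤ) : Conf h h := fun p => by omega

theorem Conf.trans {f g h : ι → ℤ} (h₁ : Conf f g) (h₂ : Conf g h) : Conf f h := fun p => by
  have := h₁ p; have := h₂ p; omega

theorem Conf.sub {g h : ι → ℤ} (h₁ : Conf g h) : Conf (h - g) h := fun p => by
  have := h₁ p
  simp only [Pi.sub_apply]
  omega

theorem Conf.mul_sub_nonneg {g h : ι → ℤ} (h₁ : Conf g h) (p : ι) : 0 ≤ g p * (h - g) p := by
  simp only [Pi.sub_apply]
  rcases h₁ p with h | h
  · exact mul_nonneg h.1 (by omega)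
  · exact mul_nonneg_of_nonpos_of_nonpos h.2 (by omega)

/-- In each coordinate all summands have the sign of `h`, so neither a partial sum nor the sum over
the complement can cross zero, and together they give `h`. -/
theorem conf_sum_of_conf {κ : Type*} [Fintype κ] {G : κ → ι → ℤ} {h : ι → ℤ}
    (hsum : ∑ k, G k = h) (hG : ∀ k, Conf (G k) h) (T : Finset κ) : Conf (∑ k ∈ T, G k) h := by
  classical
  intro p
  have h1 : ∑ k, G k p = h p := by rw [← hsum, Finset.sum_apply]
  have h2 := sum_add_sum_compl T fun k => G k p
  rw [Finset.sum_apply]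
  rcases le_total 0 (h p) with hp | hp
  · have h3 : ∀ k, 0 ≤ G k p := fun k => by have := hG k p; omega
    have h4 := sum_nonneg (s := T) fun k _ => h3 k
    have h5 := sum_nonneg (s := Tᶜ) fun k _ => h3 k
    omega
  · have h3 : ∀ k, G k p ≤ 0 := fun k => by have := hG k p; omega
    have h4 := sum_nonpos (s := T) fun k _ => h3 k
    have h5 := sum_nonpos (s := Tᶜ) fun k _ => h3 k
    omega

/-- A coordinate in which `g` does not vanish bounds the multiples by `|h p|`. Maximality matters
later: after subtracting the multiple, some coordinate of the rest is smaller than that of `g`. -/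
theorem exists_max_multiple {g h : ι → ℤ} (hg : Conf g h) (hg0 : g ≠ 0) :
    ∃ m : ℕ, 0 < m ∧ Conf ((m : ℤ) • g) h ∧ ¬ Conf (((m + 1 : ℕ) : ℤ) • g) h := by
  classical
  obtain ⟨p, hp⟩ := Function.ne_iff.1 hg0
  have hbd : ∀ m : ℕ, Conf ((m : ℤ) • g) h → m ≤ (h p).natAbs := by
    intro m hm
    have h1 := hm p
    simp only [Pi.smul_apply, smul_eq_mul, Pi.zero_apply] at h1 hp
    have h2 : ((m : ℤ) * g p).natAbs ≤ (h p).natAbs := by omega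
    rw [Int.natAbs_mul, Int.natAbs_natCast] at h2
    exact (Nat.le_mul_of_pos_right m (Int.natAbs_pos.2 hp)).trans h2
  have h1 : Conf (((1 : ℕ) : ℤ) • g) h := by simpa using hg
  set P : ℕ → Prop := fun m => Conf ((m : ℤ) • g) h
  have hm := Nat.findGreatest_spec (P := P) (hbd 1 h1) h1
  refine ⟨Nat.findGreatest P (h p).natAbs, ?_, hm, fun hcon => ?_⟩
  · exact Nat.le_findGreatest (P := P) (hbd 1 h1) h1
  · have := Nat.le_findGreatest (P := P) (hbd _ hcon) hcon
    omega

variable [Fintype ι]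

/-- The `ℓ₁`-norm of an integer vector. -/
def norm1 (h : ι → ℤ) : ℕ := ∑ p, (h p).natAbs

/-- Additivity makes the `ℓ₁`-norm the induction measure whenever conformal vectors are split off.
-/
theorem Conf.norm1_sub {g h : ι → ℤ} (h₁ : Conf g h) : norm1 g + norm1 (h - g) = norm1 h := by
  rw [norm1, norm1, norm1, ← sum_add_distrib]
  refine sum_congr rfl fun p _ => ?_
  have := h₁ p
  simp only [Pi.sub_apply]
  omega

theorem norm1_pos {h : ι → ℤ} (h0 : h ≠ 0) : 0 < norm1 h := by
  obtain ⟨p, hp⟩ := Function.ne_iff.1 h0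
  exact sum_pos' (fun _ _ => Nat.zero_le _) ⟨p, mem_univ _, by simpa [Int.natAbs_pos] using hp⟩

theorem natAbs_le_norm1 (h : ι → ℤ) (p : ι) : (h p).natAbs ≤ norm1 h :=
  single_le_sum (f := fun p => (h p).natAbs) (fun _ _ => Nat.zero_le _) (mem_univ p)

theorem abs_sum_mul_le_norm1 {C : ℕ} {c : ι → ℤ} (hc : ∀ p, |c p| ≤ C) (g : ι → ℤ) :
    |∑ p, g p * c p| ≤ (norm1 g * C : ℕ) := by
  calc |∑ p, g p * c p| ≤ ∑ p, |g p * c p| := abs_sum_le_sum_abs _ _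
    _ ≤ ∑ p, |g p| * C := sum_le_sum fun p _ => by
        rw [abs_mul]; exact mul_le_mul_of_nonneg_left (hc p) (abs_nonneg _)
    _ = _ := by rw [← sum_mul, norm1]; push_cast; simp

/-- A nonzero vector in the kernel of a matrix with `d` rows has a short conformal nonzero
vector in the kernel below it. -/
theorem exists_conf_ker {d C : ℕ} {col : ι → Fin d → ℤ} (hC : ∀ p a, |col p a| ≤ C)
    {h : ι → ℤ} (h0 : h ≠ 0) (hker : ∀ a, ∑ p, h p * col p a = 0) :
    ∃ g, Conf g h ∧ g ≠ 0 ∧ (∀ a, ∑ p, g p * col p a = 0) ∧ norm1 g ≤ (2 * d * C + 1) ^ d := by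
  classical
  -- The vector `h` is split into `|h p|` signed unit vectors for each `p`; `v` lists their images,
  -- which are columns up to sign with sum zero.
  let v : (Σ p, Fin (h p).natAbs) → Fin d → ℤ := fun x a => (h x.1).sign * col x.1 a
  have hv : ∀ x a, |v x a| ≤ C := by
    intro x a
    have h1 : |(h x.1).sign| ≤ 1 := by
      rcases lt_trichotomy (h x.1) 0 with h | h | h
      · simp [Int.sign_eq_neg_one_of_neg h]
      · simp [h]
      · simp [Int.sign_eq_one_of_pos h]
    rw [show v x a = (h x.1).sign * col x.1 a from rfl, abs_mul]
    calc _ ≤ 1 * |col x.1 a| := mul_le_mul_of_nonneg_right h1 (abs_nonneg _)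
      _ ≤ C := by rw [one_mul]; exact hC _ _
  have hsum : ∑ x, v x = 0 := by
    ext a
    rw [Finset.sum_apply, Fintype.sum_sigma, Pi.zero_apply, ← hker a]
    refine sum_congr rfl fun p _ => ?_
    simp only [v, sum_const, card_univ, Fintype.card_fin, nsmul_eq_mul]
    rw [← mul_assoc, mul_comm ((h p).natAbs : ℤ), Int.sign_mul_natAbs]
  have hne : (univ : Finset (Σ p, Fin (h p).natAbs)).Nonempty := by
    obtain ⟨p, hp⟩ := Function.ne_iff.1 h0
    exact ⟨⟨p, 0, Int.natAbs_pos.2 hp⟩, mem_univ _⟩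
  obtain ⟨T, -, hT, hTc, hT0⟩ := exists_short_zeroSum hv univ hne hsum
  -- The multiplicity of `p` in `T` is at most `|h p|`, so the signed multiplicities form a vector
  -- conformal to `h` whose `ℓ₁`-norm is `|T|`.
  let cnt : ι → ℕ := fun p => (T.filter fun x => x.1 = p).card
  have hcnt : ∀ p, cnt p ≤ (h p).natAbs := by
    intro p
    calc cnt p ≤ ((univ : Finset (Fin (h p).natAbs)).image
          fun k => (⟨p, k⟩ : Σ p, Fin (h p).natAbs)).card := by
          refine card_le_card fun x hx => ?_
          obtain ⟨q, k⟩ := x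
          obtain rfl : q = p := (mem_filter.1 hx).2
          exact mem_image.2 ⟨k, mem_univ _, rfl⟩
      _ ≤ _ := card_image_le.trans (by simp)
  have hcard : T.card = ∑ p, cnt p := card_eq_sum_card_fiberwise fun x _ => mem_univ _
  have habs : ∀ p, ((h p).sign * (cnt p : ℤ)).natAbs = cnt p := by
    intro p
    have := hcnt p
    rcases lt_trichotomy (h p) 0 with h | h | h
    · simp [Int.sign_eq_neg_one_of_neg h]
    · rw [h] at this; simp only [Int.natAbs_zero, Nat.le_zero] at this; simp [this]
    · simp [Int.sign_eq_one_of_pos h]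
  have hnorm : norm1 (fun p => (h p).sign * (cnt p : ℤ)) = T.card := by
    rw [hcard, norm1]; exact sum_congr rfl fun p _ => habs p
  refine ⟨fun p => (h p).sign * cnt p, fun p => ?_, fun hz => ?_, fun a => ?_, ?_⟩
  · have := hcnt p
    rcases lt_trichotomy (h p) 0 with h | h | h
    · simp only [Int.sign_eq_neg_one_of_neg h]; omega
    · simp [h]
    · simp only [Int.sign_eq_one_of_pos h]; omega
  · rw [hz] at hnorm
    simp only [norm1, Pi.zero_apply, Int.natAbs_zero, sum_const_zero] at hnorm
    exact absurd (card_pos.2 hT) (by omega)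
  · have h1 : ∑ x ∈ T, v x a = 0 := by
      have := congrFun hT0 a; rwa [Finset.sum_apply] at this
    rw [← h1, ← sum_fiberwise_of_maps_to (g := Sigma.fst) (t := univ) fun x _ => mem_univ _]
    refine sum_congr rfl fun p _ => ?_
    rw [sum_congr rfl (g := fun _ => (h p).sign * col p a)
      fun x hx => by rw [← (mem_filter.1 hx).2], sum_const, nsmul_eq_mul]
    ring
  · rw [hnorm]; exact hTc

/-- Conformal decomposition into short vectors. -/
theorem exists_conf_list {K Pr : (ι → ℤ) → Prop} (hsub : ∀ g h, K h → K g → K (h - g))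
    (hstep : ∀ h, K h → h ≠ 0 → ∃ g, Conf g h ∧ g ≠ 0 ∧ K g ∧ Pr g) (h : ι → ℤ) (hK : K h) :
    ∃ l : List (ι → ℤ), l.sum = h ∧ ∀ g ∈ l, Conf g h ∧ g ≠ 0 ∧ Pr g := by
  induction hn : norm1 h using Nat.strong_induction_on generalizing h with
  | _ m ih =>
    by_cases h0 : h = 0
    · exact ⟨[], by simp [h0], by simp⟩
    · obtain ⟨g, hg, hg0, hgK, hgP⟩ := hstep h hK h0
      have hlt : norm1 (h - g) < m := by
        have := hg.norm1_sub; have := norm1_pos hg0; omega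
      obtain ⟨l, hl, hlP⟩ := ih _ hlt (h - g) (hsub _ _ hK hgK) rfl
      refine ⟨g :: l, by simp [hl], fun f hf => ?_⟩
      rcases List.mem_cons.1 hf with rfl | hf
      · exact ⟨hg, hg0, hgP⟩
      · obtain ⟨h1, h2⟩ := hlP f hf
        exact ⟨h1.trans hg.sub, h2⟩

/-! ### Short conformal kernel vectors of the `n`-fold matrix. -/

/-- The kernel of the generalized `n`-fold matrix with columns `(colA p, colB p)`. -/
def NKer {κ : Type*} [DecidableEq κ] {r s : ℕ} (brick : ι → κ) (colA : ι → Fin r → ℤ)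
    (colB : ι → Fin s → ℤ) (h : ι → ℤ) : Prop :=
  (∀ a, ∑ p, h p * colA p a = 0) ∧
    ∀ k a, ∑ p, (if brick p = k then h p * colB p a else 0) = 0

theorem NKer.sub {κ : Type*} [DecidableEq κ] {r s : ℕ} {brick : ι → κ} {colA : ι → Fin r → ℤ}
    {colB : ι → Fin s → ℤ} {g h : ι → ℤ} (hh : NKer brick colA colB h)
    (hg : NKer brick colA colB g) : NKer brick colA colB (h - g) := by
  refine ⟨fun a => ?_, fun k a => ?_⟩
  · simp only [Pi.sub_apply, sub_mul, sum_sub_distrib, hh.1, hg.1, sub_zero]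
  · have h1 : ∀ p, (if brick p = k then (h - g) p * colB p a else 0) =
        (if brick p = k then h p * colB p a else 0) -
          if brick p = k then g p * colB p a else 0 := by
      intro p; split_ifs <;> simp [sub_mul]
    simp only [h1, sum_sub_distrib, hh.2, hg.2, sub_zero]

/-- The bound on the conformal decomposition for a single block `B⁽ⁱ⁾`. -/
def blockBound (s Δ : ℕ) : ℕ := (2 * s * Δ + 1) ^ s

/-- The bound on the conformal decomposition for the whole matrix. -/
def graverBound (r s Δ : ℕ) : ℕ :=
  blockBound s Δ * (2 * r * (blockBound s Δ * Δ) + 1) ^ r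

/-- The short-sum argument is used at two levels. The block rows alone split `h` into conformal
pieces of norm at most `blockBound s Δ`, each supported on one brick. The top rows map these pieces
to vectors in dimension `r` with entries at most `blockBound s Δ * Δ` and sum zero. A short zero-sum
subfamily of pieces adds up to the required vector. -/
theorem exists_conf_nker {κ : Type*} [DecidableEq κ] {r s Δ : ℕ} {brick : ι → κ}
    {colA : ι → Fin r → ℤ} {colB : ι → Fin s → ℤ} (hA : ∀ p a, |colA p a| ≤ Δ)
    (hB : ∀ p a, |colB p a| ≤ Δ) {h : ι → ℤ} (h0 : h ≠ 0) (hker : NKer brick colA colB h) :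
    ∃ g, Conf g h ∧ g ≠ 0 ∧ NKer brick colA colB g ∧ norm1 g ≤ graverBound r s Δ := by
  let K : (ι → ℤ) → Prop := fun h => ∀ k a, ∑ p, (if brick p = k then h p * colB p a else 0) = 0
  obtain ⟨l, hl, hlP⟩ := exists_conf_list (K := K)
    (Pr := fun g => K g ∧ norm1 g ≤ blockBound s Δ)
    (fun g h hh hg => by
      -- With no top rows, `NKer.sub` is the closure of `K` under differences.
      have := (NKer.sub (r := 0) (colA := fun _ => Fin.elim0) ⟨fun a => a.elim0, hh⟩
        ⟨fun a => a.elim0, hg⟩).2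
      exact this)
    (fun h hh h0 => by
      obtain ⟨p₀, hp₀⟩ := Function.ne_iff.1 h0
      -- The restriction of `h` to one brick that meets its support is still in the kernel of the
      -- block rows, and a vector conformal to it vanishes on the other bricks.
      let h' : ι → ℤ := fun p => if brick p = brick p₀ then h p else 0
      obtain ⟨g, hg, hg0, hgk, hgn⟩ := exists_conf_ker (h := h') hB
        (Function.ne_iff.2 ⟨p₀, by simpa [h'] using hp₀⟩) (fun a => by
          rw [← hh (brick p₀) a]
          exact sum_congr rfl fun p _ => by simp only [h']; split_ifs <;> simp)
      have hout : ∀ p, brick p ≠ brick p₀ → g p = 0 := fun p hp => by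
        have := hg p; simp only [h', hp, if_false] at this; omega
      have hgK : K g := by
        intro k a
        by_cases hk : k = brick p₀
        · refine (sum_congr rfl fun p _ => ?_).trans (hgk a)
          split_ifs with hp
          · rfl
          · rw [hout p (hk ▸ hp), zero_mul]
        · refine sum_eq_zero fun p _ => ?_
          split_ifs with hp
          · rw [hout p (hp ▸ hk), zero_mul]
          · rfl
      refine ⟨g, hg.trans fun p => ?_, hg0, hgK, hgK, hgn⟩
      simp only [h']
      split_ifs <;> omega) h hker.2
  have hsum : ∑ k : Fin l.length, l.get k = h := by
    rw [← hl]
    conv_rhs => rw [← List.ofFn_get l]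
    rw [List.sum_ofFn]
  have hG : ∀ k : Fin l.length, Conf (l.get k) h ∧ l.get k ≠ 0 ∧ K (l.get k) ∧
      norm1 (l.get k) ≤ blockBound s Δ := fun k => hlP _ (List.get_mem l k)
  -- The images of the pieces under the top rows.
  let v : Fin l.length → Fin r → ℤ := fun k a => ∑ p, l.get k p * colA p a
  have hv : ∀ k a, |v k a| ≤ ((blockBound s Δ * Δ : ℕ) : ℤ) := fun k a =>
    (abs_sum_mul_le_norm1 (fun p => hA p a) _).trans (by
      exact_mod_cast Nat.mul_le_mul_right _ (hG k).2.2.2)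
  have hne : (univ : Finset (Fin l.length)).Nonempty := by
    rw [univ_nonempty_iff]
    by_contra hemp
    rw [not_nonempty_iff] at hemp
    exact h0 (by rw [← hsum]; simp)
  have hv0 : ∑ k, v k = 0 := by
    ext a
    simp only [Finset.sum_apply, v, Pi.zero_apply]
    rw [sum_comm, ← hker.1 a]
    refine sum_congr rfl fun p _ => ?_
    rw [← sum_mul, ← hsum, Finset.sum_apply]
  obtain ⟨T, -, hT, hTc, hT0⟩ := exists_short_zeroSum hv univ hne hv0
  refine ⟨∑ k ∈ T, l.get k, conf_sum_of_conf hsum (fun k => (hG k).1) T, fun hz => ?_,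
    ⟨fun a => ?_, fun i a => ?_⟩, ?_⟩
  · obtain ⟨k, hk⟩ := hT
    obtain ⟨p, hp⟩ := Function.ne_iff.1 (hG k).2.1
    have h1 : ∑ k ∈ T, l.get k p = 0 := by
      have := congrFun hz p; rwa [Finset.sum_apply] at this
    simp only [Pi.zero_apply] at hp
    -- Conformal pieces have equal signs in each coordinate, so they cannot cancel and a zero sum
    -- would force each of them to vanish there.
    rcases le_total 0 (h p) with hp' | hp'
    · have := (sum_eq_zero_iff_of_nonneg fun k _ => by have := (hG k).1 p; omega).1 h1 k hk
      exact hp this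
    · have := (sum_eq_zero_iff_of_nonpos fun k _ => by have := (hG k).1 p; omega).1 h1 k hk
      exact hp this
  · have h1 := congrFun hT0 a
    simp only [Finset.sum_apply, v, Pi.zero_apply] at h1
    rw [sum_comm] at h1
    simpa only [Finset.sum_apply, sum_mul] using h1
  · have h1 : ∀ p, (if brick p = i then (∑ k ∈ T, l.get k) p * colB p a else 0) =
        ∑ k ∈ T, if brick p = i then l.get k p * colB p a else 0 := by
      intro p
      split_ifs
      · rw [Finset.sum_apply, sum_mul]
      · simp
    simp only [h1]
    rw [sum_comm]
    exact sum_eq_zero fun k _ => (hG k).2.2.1 i a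
  · calc norm1 (∑ k ∈ T, l.get k) ≤ ∑ k ∈ T, norm1 (l.get k) := by
          simp only [norm1]
          rw [sum_comm]
          refine sum_le_sum fun p _ => ?_
          rw [Finset.sum_apply]
          exact Int.natAbs_sum_le _ _
      _ ≤ ∑ _k ∈ T, blockBound s Δ := sum_le_sum fun k _ => (hG k).2.2.2
      _ = T.card * blockBound s Δ := by simp
      _ ≤ (2 * r * (blockBound s Δ * Δ) + 1) ^ r * blockBound s Δ := by gcongr
      _ = _ := by rw [graverBound, mul_comm]

end Conformal

/-! ### Separable convex functions along conformal decompositions -/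

/-- Convexity of a function on the integers. -/
def DConvex (c : ℤ → ℤ) : Prop :=
  ∀ x a b : ℤ, 0 ≤ a * b → c (x + a) + c (x + b) ≤ c x + c (x + a + b)

section Convex

variable {ι : Type*} [Fintype ι] {c : ι → ℤ → ℤ}

/-- The separable function with summands `c`. -/
def sepSum (c : ι → ℤ → ℤ) (x : ι → ℤ) : ℤ := ∑ p, c p (x p)

/-- Read with the terms rearranged: the gain of a joint move is at most the sum of the gains of its
parts, if the parts agree in sign. This is the only form in which convexity enters the comparison of
conformal moves. -/
theorem sepSum_superadditive (hc : ∀ p, DConvex (c p)) (x a b : ι → ℤ)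
    (hab : ∀ p, 0 ≤ a p * b p) :
    sepSum c (x + a) + sepSum c (x + b) ≤ sepSum c x + sepSum c (x + a + b) := by
  simp only [sepSum, ← sum_add_distrib]
  exact sum_le_sum fun p _ => hc p _ _ _ (hab p)

/-- The slopes of the chords from `0` increase; `key` compares the chords to `n` and `n + 1`. -/
theorem mul_sub_le_of_midpoint_convex {φ : ℕ → ℤ}
    (hφ : ∀ n, 2 * φ (n + 1) ≤ φ n + φ (n + 2)) (n a : ℕ) (ha : a ≤ n) :
    n * (φ a - φ 0) ≤ a * (φ n - φ 0) := by
  have key : ∀ n : ℕ, ((n : ℤ) + 1) * (φ n - φ 0) ≤ n * (φ (n + 1) - φ 0) := by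
    intro n
    induction n with
    | zero => simp
    | succ n ih =>
      have := hφ n
      push_cast
      nlinarith
  induction n with
  | zero => obtain rfl : a = 0 := by omega
            simp
  | succ n ih =>
    rcases Nat.lt_or_ge n a with h | h
    · obtain rfl : a = n + 1 := by omega
      rfl
    · have h1 := ih h
      have h2 := key n
      rcases Nat.eq_zero_or_pos n with rfl | hn
      · obtain rfl : a = 0 := by omega
        simp
      · have hn' : (0 : ℤ) < n := by exact_mod_cast hn
        refine le_of_mul_le_mul_left ?_ hn'
        have ha' : (0 : ℤ) ≤ a := by positivity
        push_cast
        nlinarith [mul_le_mul_of_nonneg_left h2 ha']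

variable {K : (ι → ℤ) → Prop} {L : ℕ}

/-- If moving by `lam • h` improves the objective, so does moving by `lam • g` for some short
`g` conformal to `h`. -/
theorem exists_improving_conf (hc : ∀ p, DConvex (c p)) (hsub : ∀ g h, K h → K g → K (h - g))
    (hstep : ∀ h, K h → h ≠ 0 → ∃ g, Conf g h ∧ g ≠ 0 ∧ K g ∧ norm1 g ≤ L)
    (x : ι → ℤ) (lam : ℤ) (h : ι → ℤ) (hK : K h)
    (hlt : sepSum c (x + lam • h) < sepSum c x) :
    ∃ g, Conf g h ∧ K g ∧ norm1 g ≤ L ∧ sepSum c (x + lam • g) < sepSum c x := by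
  induction hn : norm1 h using Nat.strong_induction_on generalizing h with
  | _ m ih =>
    by_cases h0 : h = 0
    · simp [h0] at hlt
    · obtain ⟨g, hg, hg0, hgK, hgL⟩ := hstep h hK h0
      by_cases hgi : sepSum c (x + lam • g) < sepSum c x
      · exact ⟨g, hg, hgK, hgL, hgi⟩
      -- If `lam • g` does not improve, superadditivity leaves the improvement to `lam • (h - g)`,
      -- and `h - g` has smaller norm.
      · have h1 := sepSum_superadditive hc x (lam • g) (lam • (h - g)) (fun p => by
          have := hg.mul_sub_nonneg p
          simp only [Pi.smul_apply, smul_eq_mul]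
          nlinarith [mul_nonneg (mul_self_nonneg lam) this])
        have h2 : x + lam • g + lam • (h - g) = x + lam • h := by rw [smul_sub]; abel
        rw [h2] at h1
        obtain ⟨f, hf, h3⟩ := ih (norm1 (h - g))
          (by have := hg.norm1_sub; have := norm1_pos hg0; omega) (h - g) (hsub _ _ hK hgK)
          (by omega) rfl
        exact ⟨f, hf.trans hg.sub, h3⟩

/-- If no power of two times a short conformal vector gains more than `B`, then the whole
conformal move gains at most `2 |ι| L B`. -/
theorem gap_le (hc : ∀ p, DConvex (c p)) (hsub : ∀ g h, K h → K g → K (h - g))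
    (hstep : ∀ h, K h → h ≠ 0 → ∃ g, Conf g h ∧ g ≠ 0 ∧ K g ∧ norm1 g ≤ L)
    (hsmul : ∀ (m : ℤ) g, K g → K (m • g))
    (x : ι → ℤ) (h : ι → ℤ) (hK : K h) {B : ℤ} (hB0 : 0 ≤ B)
    (hB : ∀ (k : ℕ) g, K g → g ≠ 0 → norm1 g ≤ L → Conf ((2 ^ k : ℤ) • g) h →
      sepSum c x - sepSum c (x + (2 ^ k : ℤ) • g) ≤ B) :
    sepSum c x - sepSum c (x + h) ≤ 2 * (Fintype.card ι * L) * B := by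
  -- The gain along a ray is concave, so passing from the multiple `m` down to the largest power of
  -- two below it loses at most a factor two.
  have hmult : ∀ (m : ℕ) g, 0 < m → K g → g ≠ 0 → norm1 g ≤ L → Conf ((m : ℤ) • g) h →
      sepSum c x - sepSum c (x + (m : ℤ) • g) ≤ 2 * B := by
    intro m g hm hgK hg0 hgL hmg
    obtain ⟨k, hk1, hk2⟩ : ∃ k, 2 ^ k ≤ m ∧ m < 2 ^ (k + 1) :=
      ⟨Nat.log 2 m, Nat.pow_log_le_self 2 (by omega), Nat.lt_pow_succ_log_self (by omega) m⟩
    have hconf : Conf ((2 ^ k : ℤ) • g) h := by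
      refine Conf.trans (fun p => ?_) hmg
      have hk1' : (2 ^ k : ℤ) ≤ m := by exact_mod_cast hk1
      have hk0 : (0 : ℤ) ≤ 2 ^ k := by positivity
      simp only [Pi.smul_apply, smul_eq_mul]
      rcases le_total 0 (g p) with h | h
      · exact Or.inl ⟨mul_nonneg hk0 h, mul_le_mul_of_nonneg_right hk1' h⟩
      · exact Or.inr ⟨mul_le_mul_of_nonpos_right hk1' h, mul_nonpos_of_nonneg_of_nonpos hk0 h⟩
    have h1 := hB k g hgK hg0 hgL hconf
    have h2 := mul_sub_le_of_midpoint_convex (φ := fun j => sepSum c (x + (j : ℤ) • g))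
      (fun n => by
        have := sepSum_superadditive hc (x + (n : ℤ) • g) g g (fun p => mul_self_nonneg _)
        have e1 : x + (n : ℤ) • g + g = x + ((n + 1 : ℕ) : ℤ) • g := by
          push_cast; rw [add_smul, one_smul, add_assoc]
        have e2 : x + ((n + 1 : ℕ) : ℤ) • g + g = x + ((n + 2 : ℕ) : ℤ) • g := by
          push_cast; simp only [add_smul, one_smul]; rw [two_smul]; abel
        rw [e1, e2] at this
        linarith) m (2 ^ k) hk1
    simp only [Nat.cast_zero, zero_smul, add_zero] at h2
    push_cast at h2
    have hk2' : (m : ℤ) ≤ 2 * 2 ^ k := by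
      have : m ≤ 2 * 2 ^ k := by rw [pow_succ] at hk2; omega
      exact_mod_cast this
    have hk0 : (0 : ℤ) < 2 ^ k := by positivity
    refine le_of_mul_le_mul_left ?_ hk0
    have hm0 : (0 : ℤ) ≤ m := by positivity
    nlinarith [mul_le_mul_of_nonneg_left h1 hm0, mul_le_mul_of_nonneg_right hk2' hB0]
  -- Splitting off maximal multiples of short vectors, each at a gain of at most `2 * B`, takes at
  -- most as many rounds as the potential `∑ min |f p| L` allows, and this potential is at most `|ι|
  -- L`.
  have main : ∀ (N : ℕ) (f : ι → ℤ), ∑ p, min (f p).natAbs L = N → K f → Conf f h →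
      sepSum c x - sepSum c (x + f) ≤ 2 * (N : ℤ) * B := by
    intro N
    induction N using Nat.strong_induction_on with
    | _ N ih =>
      intro f hN hfK hfh
      by_cases hf0 : f = 0
      · simp only [hf0, add_zero, sub_self]; positivity
      · obtain ⟨g, hg, hg0, hgK, hgL⟩ := hstep f hfK hf0
        obtain ⟨m, hm0, hm1, hm2⟩ := exists_max_multiple hg hg0
        -- By maximality of `m`, in some coordinate the rest is smaller than `|g p|`. As `|g p|` is
        -- at most both `L` and `|f p|`, the potential drops there.
        have hlt : ∑ p, min ((f - (m : ℤ) • g) p).natAbs L < N := by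
          rw [← hN]
          refine sum_lt_sum (fun p _ => ?_) ?_
          · have := hm1 p
            simp only [Pi.sub_apply]
            omega
          · unfold Conf at hm2
            push Not at hm2
            obtain ⟨p, hp⟩ := hm2
            refine ⟨p, mem_univ p, ?_⟩
            have h1 := hm1 p
            have h2 := hg p
            have h3 := (natAbs_le_norm1 g p).trans hgL
            simp only [Pi.sub_apply, Pi.smul_apply, smul_eq_mul] at hp h1 ⊢
            push_cast at hp
            rw [add_mul, one_mul] at hp
            generalize (m : ℤ) * g p = y at *
            omega
        have h1 := ih _ hlt (f - (m : ℤ) • g) rfl (hsub _ _ hfK (hsmul _ _ hgK))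
          (hm1.sub.trans hfh)
        have h2 := hmult m g hm0 hgK hg0 hgL (hm1.trans hfh)
        have h3 := sepSum_superadditive hc x ((m : ℤ) • g) (f - (m : ℤ) • g)
          hm1.mul_sub_nonneg
        rw [add_assoc, add_sub_cancel] at h3
        have h4 : ((∑ p, min ((f - (m : ℤ) • g) p).natAbs L : ℕ) : ℤ) + 1 ≤ N := by
          exact_mod_cast hlt
        nlinarith
  refine (main _ h rfl hK (Conf.refl h)).trans ?_
  have : ∑ p, min (h p).natAbs L ≤ Fintype.card ι * L :=
    (sum_le_sum fun p _ => min_le_right _ _).trans (by simp)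
  have : ((∑ p, min (h p).natAbs L : ℕ) : ℤ) ≤ Fintype.card ι * L := by exact_mod_cast this
  nlinarith

end Convex

end NFoldIP

namespace NFoldIP

/-! ### Running programs -/

/-- The registers that a program writes. -/
def Prog.wregs : Prog → List ℕ
  | .const x _ => [x]
  | .add x _ _ => [x]
  | .sub x _ _ => [x]
  | .load x _ _ => [x]
  | .store _ _ _ => []
  | .query x _ _ => [x]
  | .seq c d => c.wregs ++ d.wregs
  | .ite _ c d => c.wregs ++ d.wregs
  | .loop _ c => c.wregs

/-- The arrays that a program writes. -/
def Prog.warrs : Prog → List ℕ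
  | .store a _ _ => [a]
  | .seq c d => c.warrs ++ d.warrs
  | .ite _ c d => c.warrs ++ d.warrs
  | .loop _ c => c.warrs
  | _ => []

/-- `σ'` agrees with `σ` outside the registers `R` and the arrays `A`. -/
structure Keep (R A : List ℕ) (σ σ' : State) : Prop where
  reg : ∀ y, y ∉ R → σ'.reg y = σ.reg y
  arr : ∀ a, a ∉ A → σ'.arr a = σ.arr a

theorem Keep.refl (R A : List ℕ) (σ : State) : Keep R A σ σ := ⟨fun _ _ => rfl, fun _ _ => rfl⟩

theorem Keep.trans {R A : List ℕ} {σ σ₁ σ₂ : State} (h₁ : Keep R A σ σ₁) (h₂ : Keep R A σ₁ σ₂) :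
    Keep R A σ σ₂ :=
  ⟨fun y hy => (h₂.reg y hy).trans (h₁.reg y hy), fun a ha => (h₂.arr a ha).trans (h₁.arr a ha)⟩

theorem Keep.mono {R A R' A' : List ℕ} {σ σ' : State} (h : Keep R A σ σ') (hR : R ⊆ R')
    (hA : A ⊆ A') : Keep R' A' σ σ' :=
  ⟨fun y hy => h.reg y fun h' => hy (hR h'), fun a ha => h.arr a fun h' => ha (hA h')⟩

theorem Exec.keep {O : ℤ → ℤ → ℤ} {c : Prog} {σ σ' : State} {T : ℕ} (h : Exec O c σ T σ') :
    Keep c.wregs c.warrs σ σ' := by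
  induction h with
  | const | add | sub | load | query =>
    exact ⟨fun y hy => Function.update_of_ne (by simpa [Prog.wregs] using hy) _ _, fun _ _ => rfl⟩
  | store =>
    exact ⟨fun _ _ => rfl, fun y hy => Function.update_of_ne (by simpa [Prog.warrs] using hy) _ _⟩
  | seq _ _ ih₁ ih₂ =>
    exact (ih₁.mono (List.subset_append_left _ _) (List.subset_append_left _ _)).trans
      (ih₂.mono (List.subset_append_right _ _) (List.subset_append_right _ _))
  | ite_pos _ _ ih => exact ih.mono (List.subset_append_left _ _) (List.subset_append_left _ _)
  | ite_neg _ _ ih => exact ih.mono (List.subset_append_right _ _) (List.subset_append_right _ _)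
  | loop_done => exact Keep.refl _ _ _
  | loop_step _ _ _ ih₁ ih₂ => exact ih₁.trans ih₂

/-- `c` started in `σ` halts within `T` steps in a state with the property `Q`. -/
def Runs (O : ℤ → ℤ → ℤ) (c : Prog) (σ : State) (T : ℕ) (Q : State → Prop) : Prop :=
  ∃ τ σ', Exec O c σ τ σ' ∧ τ ≤ T ∧ Q σ'

section Runs

variable {O : ℤ → ℤ → ℤ} {c d : Prog} {σ : State} {T T₁ T₂ : ℕ} {P Q : State → Prop}

theorem Runs.le (h : Runs O c σ T P) (hT : T ≤ T₁) : Runs O c σ T₁ P := by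
  obtain ⟨τ, σ', h1, h2, h3⟩ := h
  exact ⟨τ, σ', h1, h2.trans hT, h3⟩

/-- The `Keep` fact comes from the program text alone. Specifications therefore mention only what
changes, and everything else is recovered by checking that a register or array is not in the write
list. -/
theorem Runs.imp (h : Runs O c σ T P) (hQ : ∀ σ', P σ' → Keep c.wregs c.warrs σ σ' → Q σ') :
    Runs O c σ T Q := by
  obtain ⟨τ, σ', h1, h2, h3⟩ := h
  exact ⟨τ, σ', h1, h2, hQ _ h3 h1.keep⟩

/-- This makes the truncated subtractions in `Runs.bind` and `Runs.ite` sound: a time bound left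
over for a second program cannot be zero, since that program takes a step. -/
theorem Exec.one_le {O : ℤ → ℤ → ℤ} {c : Prog} {σ σ' : State} {T : ℕ} (h : Exec O c σ T σ') :
    1 ≤ T := by
  induction h <;> omega

theorem Runs.bind (h₁ : Runs O c σ T₁ P)
    (h₂ : ∀ σ', P σ' → Keep c.wregs c.warrs σ σ' → Runs O d σ' (T - T₁) Q) :
    Runs O (.seq c d) σ T Q := by
  obtain ⟨τ, σ₁, e1, t1, p1⟩ := h₁
  obtain ⟨τ', σ₂, e2, t2, p2⟩ := h₂ σ₁ p1 e1.keep
  have := e2.one_le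
  exact ⟨_, _, .seq e1 e2, by omega, p2⟩

theorem Runs.ite {x : ℕ} (h₁ : 0 < σ.reg x → Runs O c σ (T - 1) P)
    (h₂ : ¬ 0 < σ.reg x → Runs O d σ (T - 1) P) : Runs O (.ite x c d) σ T P := by
  by_cases h : 0 < σ.reg x
  · obtain ⟨τ, σ₁, e1, t1, p1⟩ := h₁ h
    have := e1.one_le
    exact ⟨_, _, .ite_pos h e1, by omega, p1⟩
  · obtain ⟨τ, σ₁, e1, t1, p1⟩ := h₂ h
    have := e1.one_le
    exact ⟨_, _, .ite_neg h e1, by omega, p1⟩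

end Runs

/-! ### Loop-free programs and their weakest preconditions. -/

/-- No loops. -/
def Prog.noLoop : Prog → Bool
  | .seq c d => c.noLoop && d.noLoop
  | .ite _ c d => c.noLoop && d.noLoop
  | .loop _ _ => false
  | _ => true

/-- The number of instructions. -/
def Prog.size : Prog → ℕ
  | .seq c d => c.size + d.size
  | .ite _ c d => c.size + d.size + 1
  | _ => 1

/-- The final state of a program without loops. -/
def ev (O : ℤ → ℤ → ℤ) : Prog → State → State
  | .const x c, σ => σ.setReg x c
  | .add x y z, σ => σ.setReg x (σ.reg y + σ.reg z)
  | .sub x y z, σ => σ.setReg x (σ.reg y - σ.reg z)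
  | .load x a y, σ => σ.setReg x (σ.arr a (σ.reg y))
  | .store a x y, σ => σ.setCell a (σ.reg x) (σ.reg y)
  | .query x y z, σ => σ.setReg x (O (σ.reg y) (σ.reg z))
  | .seq c d, σ => ev O d (ev O c σ)
  | .ite x c d, σ => if 0 < σ.reg x then ev O c σ else ev O d σ
  | .loop _ _, σ => σ

/-- For a conditional, `size` counts both branches and is thus an upper bound for the steps. The
values of `size` and `ev` at loops are dummies that `noLoop` excludes. -/
theorem runs_ev {O : ℤ → ℤ → ℤ} {c : Prog} (hc : c.noLoop = true) {σ : State} {Q : State → Prop}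
    (h : Q (ev O c σ)) : Runs O c σ c.size Q := by
  suffices hs : ∀ (c : Prog), c.noLoop = true → ∀ σ, ∃ τ, Exec O c σ τ (ev O c σ) ∧ τ ≤ c.size by
    obtain ⟨τ, h1, h2⟩ := hs c hc σ
    exact ⟨τ, _, h1, h2, h⟩
  intro c
  induction c with
  | const => exact fun _ σ => ⟨1, .const _ _ _, le_rfl⟩
  | add => exact fun _ σ => ⟨1, .add _ _ _ _, le_rfl⟩
  | sub => exact fun _ σ => ⟨1, .sub _ _ _ _, le_rfl⟩
  | load => exact fun _ σ => ⟨1, .load _ _ _ _, le_rfl⟩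
  | store => exact fun _ σ => ⟨1, .store _ _ _ _, le_rfl⟩
  | query => exact fun _ σ => ⟨1, .query _ _ _ _, le_rfl⟩
  | seq c d ih₁ ih₂ =>
    intro h σ
    simp only [Prog.noLoop, Bool.and_eq_true] at h
    obtain ⟨τ₁, e₁, t₁⟩ := ih₁ h.1 σ
    obtain ⟨τ₂, e₂, t₂⟩ := ih₂ h.2 (ev O c σ)
    exact ⟨_, .seq e₁ e₂, Nat.add_le_add t₁ t₂⟩
  | ite x c d ih₁ ih₂ =>
    intro h σ
    simp only [Prog.noLoop, Bool.and_eq_true] at h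
    by_cases hx : 0 < σ.reg x
    · obtain ⟨τ₁, e₁, t₁⟩ := ih₁ h.1 σ
      simp only [ev, hx, if_true, Prog.size]
      exact ⟨_, .ite_pos hx e₁, by omega⟩
    · obtain ⟨τ₁, e₁, t₁⟩ := ih₂ h.2 σ
      simp only [ev, hx, if_false, Prog.size]
      exact ⟨_, .ite_neg hx e₁, by omega⟩
  | loop => intro h; simp [Prog.noLoop] at h

/-- The weakest precondition of a program without loops. -/
def wp (O : ℤ → ℤ → ℤ) : Prog → State → (State → Prop) → Prop
  | .seq c d, σ, Q => wp O c σ fun σ' => wp O d σ' Q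
  | .ite x c d, σ, Q => (0 < σ.reg x → wp O c σ Q) ∧ (¬ 0 < σ.reg x → wp O d σ Q)
  | .const x c, σ, Q => Q (σ.setReg x c)
  | .add x y z, σ, Q => Q (σ.setReg x (σ.reg y + σ.reg z))
  | .sub x y z, σ, Q => Q (σ.setReg x (σ.reg y - σ.reg z))
  | .load x a y, σ, Q => Q (σ.setReg x (σ.arr a (σ.reg y)))
  | .store a x y, σ, Q => Q (σ.setCell a (σ.reg x) (σ.reg y))
  | .query x y z, σ, Q => Q (σ.setReg x (O (σ.reg y) (σ.reg z)))
  | .loop _ _, σ, Q => Q σ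

theorem wp_iff {O : ℤ → ℤ → ℤ} (c : Prog) (σ : State) (Q : State → Prop) :
    wp O c σ Q ↔ Q (ev O c σ) := by
  induction c generalizing σ Q with
  | seq c d ih₁ ih₂ => simp only [wp, ev, ih₁, ih₂]
  | ite x c d ih₁ ih₂ =>
    simp only [wp, ev, ih₁, ih₂]
    split_ifs with h <;> simp [h]
  | _ => rfl

/-- Loop-free code is verified by unfolding `wp`, which leaves arithmetic side conditions along each
branch without duplicating states. -/
theorem runs_wp {O : ℤ → ℤ → ℤ} {c : Prog} (hc : c.noLoop = true) {σ : State}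
    {Q : State → Prop} (h : wp O c σ Q) : Runs O c σ c.size Q :=
  runs_ev hc ((wp_iff c σ Q).1 h)

@[simp] theorem State.setReg_reg (σ : State) (x y : ℕ) (v : ℤ) :
    (σ.setReg x v).reg y = if y = x then v else σ.reg y := by
  simp [State.setReg, Function.update_apply]

@[simp] theorem State.setReg_arr (σ : State) (x : ℕ) (v : ℤ) : (σ.setReg x v).arr = σ.arr := rfl

@[simp] theorem State.setCell_reg (σ : State) (a : ℕ) (p v : ℤ) :
    (σ.setCell a p v).reg = σ.reg := rfl

@[simp] theorem State.setCell_arr (σ : State) (a b : ℕ) (p v : ℤ) :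
    (σ.setCell a p v).arr b = if b = a then Function.update (σ.arr a) p v else σ.arr b := by
  simp only [State.setCell, Function.update_apply]

/-- The register that holds the constant `1`. -/
notation "rOne" => (4 : ℕ)

infixr:60 " ;; " => Prog.seq

/-! ### Loop rules. -/

/-- `x` counts down to zero, and `c` runs after each decrement. -/
def Prog.forDown (x : ℕ) (c : Prog) : Prog := .loop x (.sub x x rOne ;; c)

/-- The invariant is indexed by the number of rounds left. It must not depend on the counter
(`hstab`), because the decrement precedes the body. A round costs the body, the decrement and the
test, and one last test ends the loop. -/
theorem runs_forDown {O : ℤ → ℤ → ℤ} {c : Prog} {x N B : ℕ} {σ₀ : State}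
    (Inv : ℕ → State → Prop) (hx : (σ₀.reg x).toNat = N) (h1 : σ₀.reg rOne = 1)
    (hxc : x ∉ c.wregs) (h4 : rOne ∉ c.wregs) (hx4 : rOne ≠ x) (hI : Inv N σ₀)
    (hstab : ∀ k σ v, Inv k σ → Inv k (σ.setReg x v))
    (hstep : ∀ k < N, ∀ σ, Inv (k + 1) σ → σ.reg x = k → Keep (x :: c.wregs) c.warrs σ₀ σ →
      Runs O c σ B (Inv k)) :
    Runs O (Prog.forDown x c) σ₀ (N * (B + 2) + 1) (Inv 0) := by
  suffices hs : ∀ k ≤ N, ∀ σ, Inv k σ → (σ.reg x).toNat = k →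
      Keep (x :: c.wregs) c.warrs σ₀ σ →
      Runs O (Prog.forDown x c) σ (k * (B + 2) + 1) (Inv 0) from
    hs N le_rfl σ₀ hI hx (Keep.refl _ _ _)
  intro k
  induction k with
  | zero =>
    intro _ σ hσ hx _
    exact ⟨1, σ, .loop_done (by omega), by omega, hσ⟩
  | succ k ih =>
    intro hk σ hσ hxk hkeep
    have h1' : σ.reg rOne = 1 := by
      rw [hkeep.reg _ (by simp only [List.mem_cons, not_or]; exact ⟨hx4, h4⟩), h1]
    have hkeep' : Keep (x :: c.wregs) c.warrs σ₀ (σ.setReg x (σ.reg x - σ.reg rOne)) :=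
      hkeep.trans ⟨fun y hy => by
        simp only [List.mem_cons, not_or] at hy
        simp [hy.1], fun _ _ => rfl⟩
    obtain ⟨τ, σ', e, t, q⟩ := hstep k (by omega) (σ.setReg x (σ.reg x - σ.reg rOne))
      (hstab _ _ _ hσ) (by rw [State.setReg_reg, if_pos rfl]; omega) hkeep'
    have hx' : σ'.reg x = k := by
      rw [e.keep.reg x hxc, State.setReg_reg, if_pos rfl]; omega
    obtain ⟨τ', σ'', e', t', q'⟩ := ih (by omega) σ' q (by rw [hx']; simp)
      (hkeep'.trans (e.keep.mono (by simp) (by simp)))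
    refine ⟨_, σ'', .loop_step (by omega) (.seq (.sub _ _ _ _) e) e', ?_, q'⟩
    rw [add_mul]
    omega

/-- Here the bound `N` need not be known to the program: it suffices that the index of the invariant
falls by one in every round in which the guard is positive. -/
theorem runs_loop {O : ℤ → ℤ → ℤ} {c : Prog} {x N B : ℕ} {σ₀ : State}
    (Inv : ℕ → State → Prop) (hI : Inv N σ₀)
    (hstep : ∀ k σ, Inv k σ → 0 < σ.reg x → Keep c.wregs c.warrs σ₀ σ →
      ∃ k', k = k' + 1 ∧ Runs O c σ B (Inv k')) :
    Runs O (.loop x c) σ₀ (N * (B + 1) + 1) fun σ => (∃ k, Inv k σ) ∧ ¬ 0 < σ.reg x := by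
  suffices hs : ∀ k σ, Inv k σ → Keep c.wregs c.warrs σ₀ σ →
      Runs O (.loop x c) σ (k * (B + 1) + 1) fun σ => (∃ k, Inv k σ) ∧ ¬ 0 < σ.reg x from
    hs N σ₀ hI (Keep.refl _ _ _)
  intro k
  induction k with
  | zero =>
    intro σ hσ hk
    by_cases hx : 0 < σ.reg x
    · obtain ⟨k', h, -⟩ := hstep 0 σ hσ hx hk
      omega
    · exact ⟨1, σ, .loop_done hx, by omega, ⟨0, hσ⟩, hx⟩
  | succ k ih =>
    intro σ hσ hk
    by_cases hx : 0 < σ.reg x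
    · obtain ⟨k', h, τ, σ', e, t, q⟩ := hstep _ σ hσ hx hk
      obtain rfl : k = k' := by omega
      obtain ⟨τ', σ'', e', t', q'⟩ := ih σ' q (hk.trans e.keep)
      refine ⟨_, σ'', .loop_step hx e e', ?_, q'⟩
      rw [add_mul]
      omega
    · exact ⟨1, σ, .loop_done hx, by omega, ⟨_, hσ⟩, hx⟩

/-! ### Arithmetic subroutines -/

namespace Prog

/-- `x := y` -/
def copy (x y : ℕ) : Prog := .const x 0 ;; .add x x y

/-- `x := -y` -/
def neg (x y : ℕ) : Prog := .const x 0 ;; .sub x x y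

/-- `x := |y|` -/
def abs (x y : ℕ) : Prog := .ite y (copy x y) (neg x y)

/-- No effect outside a register that is never read. -/
def skip : Prog := .const 29 0

/-- `z := x * y` -/
def mul (z x y : ℕ) : Prog :=
  .const z 0 ;; copy 30 y ;; forDown 30 (.add z z x) ;; neg 30 y ;; forDown 30 (.sub z z x)

/-- `z := x ^ y` -/
def pow (z x y : ℕ) : Prog :=
  .const z 1 ;; copy 31 y ;; forDown 31 (mul 32 z x ;; copy z 32)

end Prog

open Prog

theorem State.setReg_setReg (σ : State) (x : ℕ) (v w : ℤ) :
    (σ.setReg x v).setReg x w = σ.setReg x w := by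
  simp [State.setReg]

theorem wp_copy {O : ℤ → ℤ → ℤ} {x y : ℕ} (hxy : y ≠ x) (σ : State) (Q : State → Prop) :
    wp O (copy x y) σ Q ↔ Q (σ.setReg x (σ.reg y)) := by
  simp [copy, wp, hxy, State.setReg_setReg]

theorem wp_neg {O : ℤ → ℤ → ℤ} {x y : ℕ} (hxy : y ≠ x) (σ : State) (Q : State → Prop) :
    wp O (neg x y) σ Q ↔ Q (σ.setReg x (-σ.reg y)) := by
  simp [neg, wp, hxy, State.setReg_setReg]

theorem wp_abs {O : ℤ → ℤ → ℤ} {x y : ℕ} (hxy : y ≠ x) (σ : State) (Q : State → Prop) :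
    wp O (Prog.abs x y) σ Q ↔ Q (σ.setReg x |σ.reg y|) := by
  simp only [Prog.abs, wp, wp_copy hxy, wp_neg hxy]
  rcases lt_or_ge 0 (σ.reg y) with h | h
  · simp [h, abs_of_pos h]
  · simp [not_lt.2 h, abs_of_nonpos h]

theorem wp_skip {O : ℤ → ℤ → ℤ} (σ : State) (Q : State → Prop) :
    wp O skip σ Q ↔ Q (σ.setReg 29 0) := Iff.rfl

/-- Repeated addition, with one loop for each sign of `b`, of which at least one is empty. The time
depends on the second factor only, so callers put the factor that is bounded by the parameters
second and a possibly huge number first. -/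
theorem runs_mul {O : ℤ → ℤ → ℤ} {z x y : ℕ} {σ : State} {a b : ℤ} (hx : σ.reg x = a)
    (hy : σ.reg y = b) (h1 : σ.reg rOne = 1) (hzx : z ≠ x) (hzy : z ≠ y) (hz : z ≠ 30)
    (hx30 : x ≠ 30) (hy30 : y ≠ 30) (hz4 : z ≠ rOne) :
    Runs O (mul z x y) σ (3 * b.natAbs + 7) fun σ' => σ'.reg z = a * b := by
  refine Runs.bind (runs_ev (Q := fun σ' => σ'.reg z = 0) rfl (by simp [ev])) fun σ₁ e₁ k₁ => ?_
  have k₁' : ∀ y, y ≠ z → σ₁.reg y = σ.reg y := fun y hy => k₁.reg y (by simpa [wregs] using hy)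
  refine Runs.bind (runs_ev (Q := fun σ' => σ'.reg 30 = b) rfl
    (by simp [ev, copy, hy30, k₁' y hzy.symm, hy])) fun σ₂ e₂ k₂ => ?_
  have k₂' : ∀ y, y ≠ 30 → σ₂.reg y = σ₁.reg y := fun y hy =>
    k₂.reg y (by simpa [wregs, copy] using hy)
  refine Runs.bind (runs_forDown (N := b.toNat) (B := 1)
    (fun k σ' => σ'.reg z = a * (b.toNat - k)) (by rw [e₂])
    (by rw [k₂' _ (by decide), k₁' _ hz4.symm, h1]) (by simpa [wregs] using hz.symm)
    (by simpa [wregs] using hz4.symm) (by decide) (by simp [k₂' z hz, e₁])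
    (fun k σ v h => by simpa [hz] using h) (fun k hk σ' h hc hkeep => runs_ev rfl ?_))
    fun σ₃ e₃ k₃ => ?_
  · have hxx : σ'.reg x = a := by
      rw [hkeep.reg x (by simp [wregs, hx30, hzx.symm]), k₂' x hx30, k₁' x hzx.symm, hx]
    simp only [ev, State.setReg_reg, if_true, h, hxx]
    push_cast; ring
  have k₃' : ∀ y, y ≠ 30 → y ≠ z → σ₃.reg y = σ.reg y := fun y hy hy' => by
    rw [k₃.reg y (by simp [wregs, forDown, hy, hy']), k₂' y hy, k₁' y hy']
  refine Runs.bind (runs_ev (Q := fun σ' => σ'.reg 30 = -b) rfl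
    (by simp [ev, neg, hy30, k₃' y hy30 hzy.symm, hy])) fun σ₄ e₄ k₄ => ?_
  have k₄' : ∀ y, y ≠ 30 → σ₄.reg y = σ₃.reg y := fun y hy =>
    k₄.reg y (by simpa [wregs, neg] using hy)
  refine ((runs_forDown (N := (-b).toNat) (B := 1)
    (fun k σ' => σ'.reg z = a * (b.toNat - ((-b).toNat - k))) (by rw [e₄])
    (by rw [k₄' _ (by decide), k₃' _ (by decide) hz4.symm, h1]) (by simpa [wregs] using hz.symm)
    (by simpa [wregs] using hz4.symm) (by decide) (by rw [k₄' z hz, e₃]; simp)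
    (fun k σ v h => by simpa [hz] using h) (fun k hk σ' h hc hkeep => runs_ev rfl ?_)).le
    (by simp only [size, copy, neg]; omega)).imp fun σ₅ e₅ k₅ => ?_
  · have hxx : σ'.reg x = a := by
      rw [hkeep.reg x (by simp [wregs, hx30, hzx.symm]), k₄' x hx30, k₃' x hx30 hzx.symm, hx]
    simp only [ev, State.setReg_reg, if_true, h, hxx]
    push_cast; ring
  rw [e₅]
  congr 1
  omega

theorem runs_pow {O : ℤ → ℤ → ℤ} {z x y : ℕ} {σ : State} {a : ℤ} {n : ℕ} (hx : σ.reg x = a)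
    (hy : σ.reg y = n) (h1 : σ.reg rOne = 1) (hzx : z ≠ x) (hzy : z ≠ y)
    (hz : z ∉ [4, 30, 31, 32]) (hx' : x ∉ [30, 31, 32]) (hy' : y ∉ [30, 31, 32]) :
    Runs O (pow z x y) σ (n * (3 * a.natAbs + 11) + 4) fun σ' => σ'.reg z = a ^ n := by
  simp only [List.mem_cons, List.not_mem_nil, or_false, not_or] at hz hx' hy'
  refine Runs.bind (runs_ev (Q := fun σ' => σ'.reg z = 1) rfl (by simp [ev])) fun σ₁ e₁ k₁ => ?_
  have k₁' : ∀ y, y ≠ z → σ₁.reg y = σ.reg y := fun y hy => k₁.reg y (by simpa [wregs] using hy)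
  refine Runs.bind (runs_ev (Q := fun σ' => σ'.reg 31 = n) rfl
    (by simp [ev, copy, hy', k₁' y hzy.symm, hy])) fun σ₂ e₂ k₂ => ?_
  have k₂' : ∀ y, y ≠ 31 → σ₂.reg y = σ₁.reg y := fun y hy =>
    k₂.reg y (by simpa [wregs, copy] using hy)
  refine ((runs_forDown (N := n) (B := 3 * a.natAbs + 9)
    (fun k σ' => σ'.reg z = a ^ (n - k)) (by rw [e₂]; rfl)
    (by rw [k₂' _ (by decide), k₁' _ (Ne.symm hz.1), h1])
    (by simp [wregs, mul, copy, neg, forDown, Ne.symm hz.2.2.1])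
    (by simp [wregs, mul, copy, neg, forDown, Ne.symm hz.1]) (by decide)
    (by simp [k₂' z hz.2.2.1, e₁])
    (fun k σ v h => by simpa [hz] using h) (fun k hk σ' h hc hkeep => ?_)).le
    (by simp only [size, copy, Nat.add_assoc, Nat.reduceAdd]; omega)).imp fun σ₅ e₅ k₅ => by simpa using e₅
  have hk : ∀ y, y ∉ [30, 31, 32] → y ≠ z → σ'.reg y = σ.reg y := fun y hy hyz => by
    simp only [List.mem_cons, List.not_mem_nil, or_false, not_or] at hy
    rw [hkeep.reg y (by simp [wregs, mul, copy, neg, forDown, hy, hyz]), k₂' y hy.2.1, k₁' y hyz]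
  refine Runs.bind (runs_mul (a := a ^ (n - (k + 1))) (b := a) h
    (by rw [hk x (by simpa using hx') hzx.symm, hx])
    (by rw [hk 4 (by decide) (Ne.symm hz.1), h1]) (Ne.symm hz.2.2.2)
    (Ne.symm hx'.2.2) (by decide) hz.2.1 hx'.1 (by decide)) fun σ₃ e₃ k₃ =>
      (runs_ev rfl ?_).le (by simp only [size, copy]; omega)
  simp only [ev, copy, State.setReg_reg, if_true, Ne.symm hz.2.2.2, if_false, zero_add, e₃]
  rw [← pow_succ]
  congr 1
  omega

end NFoldIP

namespace NFoldIP

/-! ### The dynamic program: program text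

The registers `rPos, …` hold parameters, those from `30` on are scratch. -/

notation "rL" => (6 : ℕ)
notation "rTop" => (8 : ℕ)
notation "rShift" => (9 : ℕ)
notation "rWidth" => (10 : ℕ)
notation "rPos" => (11 : ℕ)
notation "rPhase" => (15 : ℕ)
notation "rLam" => (16 : ℕ)
notation "rTot" => (17 : ℕ)
notation "rLevels" => (19 : ℕ)
notation "rSteps" => (20 : ℕ)
notation "cPos" => (40 : ℕ)
notation "cStep" => (41 : ℕ)
notation "cBud" => (42 : ℕ)
notation "cRes" => (43 : ℕ)
notation "vCol" => (44 : ℕ)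
notation "vX" => (45 : ℕ)
notation "vQ" => (46 : ℕ)
notation "vMark" => (47 : ℕ)
notation "vStep" => (48 : ℕ)
notation "vNew" => (49 : ℕ)
notation "vCost" => (50 : ℕ)
notation "vGain" => (52 : ℕ)
notation "vDiff" => (53 : ℕ)
notation "vAbs" => (54 : ℕ)
notation "vBud" => (55 : ℕ)
notation "vRow" => (56 : ℕ)
notation "vNext" => (57 : ℕ)
notation "aLow" => (4 : ℕ)
notation "aUpp" => (5 : ℕ)
notation "aCol" => (7 : ℕ)
notation "aMark" => (8 : ℕ)
notation "aQ" => (11 : ℕ)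
notation "aX" => (14 : ℕ)
notation "aCh" => (20 : ℕ)
notation "aVal" => (21 : ℕ)

open Prog

/-- The cost of the value in `vNew` for the variable whose query index is in `vQ`. -/
def costProg : Prog :=
  .ite rPhase (.query vCost vQ vNew)
    (neg 58 vQ ;; .ite 58 (abs vCost vNew) (.const vCost 0))

/-- Sets register `60` to `1` if the value in `vNew` is admissible and to `0` otherwise. -/
def admProg : Prog :=
  .load 58 aLow vQ ;; .load 59 aUpp vQ ;; .const 60 1 ;;
  .sub 61 58 vNew ;; .ite 61 (.const 60 0) skip ;;
  .sub 61 vNew 59 ;; .ite 61 (.const 60 0) skip ;;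
  .ite rPhase skip (neg 61 vQ ;; .ite 61 (.const 60 1) skip)

/-- One relaxation: step `cStep` at position `cPos`, budget `cBud`, residual `cRes`. -/
def relaxProg : Prog :=
  .sub 58 cRes vDiff ;; .add 59 58 rOne ;;
  .ite 59 (.sub 59 rWidth 58 ;;
    .ite 59 (.add 59 vNext 58 ;; .load 61 aCh 59 ;;
      .ite 61 (.load 62 aVal 59 ;; .add 62 62 vGain ;;
        .sub 63 cRes rShift ;; .add 63 63 63 ;; abs 64 63 ;; .sub 64 rTop 64 ;;
        .ite vMark skip (.const 64 1) ;;
        .ite 64 (.add 63 vRow cRes ;; .load 65 aCh 63 ;; .load 66 aVal 63 ;; .sub 66 66 62 ;;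
          .ite 65 skip (.const 66 1) ;;
          .ite 66 (.store aVal 63 62 ;; .add 65 cStep rOne ;; .store aCh 63 65) skip)
        skip) skip) skip) skip

/-- `z` := address of the first cell with position `x` and budget `y` -/
def rowProg (z x y : ℕ) : Prog := mul 58 x rLevels ;; .add 58 58 y ;; mul z 58 rWidth

/-- All relaxations for one position, step and budget. -/
def budgetProg : Prog :=
  (.sub vBud cBud vAbs ;; .add 59 vBud rOne) ;;
  .ite 59 (rowProg vRow cPos cBud ;; .add 59 cPos rOne ;; rowProg vNext 59 vBud ;;
    copy cRes rWidth ;; forDown cRes relaxProg) skip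

/-- All relaxations for one position and step. -/
def stepProg : Prog :=
  .sub vStep cStep rL ;; mul vNew rLam vStep ;; (.add vNew vNew vX ;; admProg) ;;
  .ite 60 ((costProg ;; copy vGain vCost ;; copy vNew vX ;; costProg ;;
    .sub vGain vGain vCost) ;; mul vDiff vCol vStep ;; (abs vAbs vStep ;;
    copy cBud rLevels) ;; forDown cBud budgetProg) skip

/-- All relaxations for one position. -/
def positionProg : Prog :=
  (.load vCol aCol cPos ;; .load vX aX cPos ;; .load vQ aQ cPos ;; .load vMark aMark cPos ;;
  copy cStep rSteps) ;; forDown cStep stepProg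

/-- The whole table. -/
def tableProg : Prog :=
  (.const 60 0 ;; copy cPos rTot) ;; forDown cPos (.store aCh cPos 60) ;;
  copy cBud rLevels ;;
  forDown cBud (rowProg 61 rPos cBud ;; (.add 61 61 rShift ;;
    .store aCh 61 rOne ;; .store aVal 61 60)) ;;
  copy cPos rPos ;; forDown cPos positionProg

/-- Follow the table and move along the chosen steps. -/
def applyProg : Prog :=
  (.const cPos 0 ;; copy cBud rL ;; copy cRes rShift ;; copy cStep rPos) ;;
  forDown cStep (rowProg 59 cPos cBud ;; (.add 59 59 cRes ;;
    .load 60 aCh 59 ;; .sub 60 60 rOne ;; .sub vStep 60 rL) ;; mul vNew rLam vStep ;;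
    (.load vX aX cPos ;; .add vX vX vNew ;; .store aX cPos vX ;; abs vAbs vStep ;;
    .sub cBud cBud vAbs ;; .load vCol aCol cPos) ;; mul vDiff vCol vStep ;;
    (.sub cRes cRes vDiff ;; .add cPos cPos rOne))

/-- The second alternative carries the exact negation of the guard, since `Layer.relax` has to know
why no update took place. -/
theorem runs_relax {O : ℤ → ℤ → ℤ} {σ : State} {C V : ℤ → ℤ} {row next e dE w gain h S R mk : ℤ}
    (hC : σ.arr aCh = C) (hV : σ.arr aVal = V) (h1 : σ.reg rOne = 1) (hrow : σ.reg vRow = row)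
    (hnext : σ.reg vNext = next) (he : σ.reg cRes = e) (hdE : σ.reg vDiff = dE)
    (hw : σ.reg rWidth = w) (hg : σ.reg vGain = gain) (hh : σ.reg cStep = h)
    (hS : σ.reg rShift = S) (hR : σ.reg rTop = R) (hmk : σ.reg vMark = mk) :
    Runs O relaxProg σ 40 fun σ' =>
      ((0 ≤ e - dE ∧ e - dE < w ∧ 0 < C (next + (e - dE)) ∧ (0 < mk → 2 * |e - S| < R) ∧
        (0 < C (row + e) → V (next + (e - dE)) + gain < V (row + e))) ∧
        σ'.arr aCh = Function.update C (row + e) (h + 1) ∧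
        σ'.arr aVal = Function.update V (row + e) (V (next + (e - dE)) + gain)) ∨
      (¬ (0 ≤ e - dE ∧ e - dE < w ∧ 0 < C (next + (e - dE)) ∧ (0 < mk → 2 * |e - S| < R) ∧
        (0 < C (row + e) → V (next + (e - dE)) + gain < V (row + e))) ∧
        σ'.arr aCh = C ∧ σ'.arr aVal = V) := by
  refine (runs_wp rfl ?_).le (by decide : relaxProg.size ≤ 40)
  -- The program doubles `e - S` by an addition before taking the absolute value.
  have habs : 2 * |e - S| = |e - S + (e - S)| := by rw [← two_mul, abs_mul]; rfl
  rw [habs]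
  simp only [relaxProg, wp, wp_skip, wp_abs, ne_eq, Nat.reduceEqDiff, not_false_eq_true,
    State.setReg_reg, State.setReg_arr, State.setCell_arr, State.setCell_reg,
    if_true, if_false, h1, hrow, hnext, he, hdE, hw, hg, hh, hS, hR, hmk, hC, hV]
  generalize C (next + (e - dE)) = c2
  generalize V (next + (e - dE)) = v2
  generalize |e - S + (e - S)| = ab
  repeat' (first | apply And.intro | intro _)
  all_goals first
    | exact Or.inl ⟨by omega, by trivial, by trivial⟩
    | exact Or.inr ⟨by omega, by trivial, by trivial⟩

/-! ### The dynamic program: data and table -/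

/-- The data of a dynamic program: positions `< P`, budget `L`, residuals in `[-S, S]`, and at
marked positions in `(-R / 2, R / 2)`; the state of a position `p` changes by `lam * h`. -/
structure DP where
  P : ℕ
  L : ℕ
  S : ℕ
  R : ℕ
  E : ℕ → ℤ
  mark : ℕ → ℤ
  phase : ℤ
  lam : ℤ
  X : ℕ → ℤ
  q : ℕ → ℤ
  lo : ℤ → ℤ
  hi : ℤ → ℤ

namespace DP

variable (O : ℤ → ℤ → ℤ) (F : DP)

/-- The number of residuals. -/
def w : ℕ := 2 * F.S + 1

/-- The value `v` is admissible at position `p`. -/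
def Adm (p : ℕ) (v : ℤ) : Prop :=
  (F.lo (F.q p) ≤ v ∧ v ≤ F.hi (F.q p)) ∨ (¬ 0 < F.phase ∧ F.q p < 0)

/-- The cost of the value `v` at position `p`. -/
def cost (p : ℕ) (v : ℤ) : ℤ :=
  if 0 < F.phase then O (F.q p) v else if F.q p < 0 then |v| else 0

/-- The change of the cost at position `p` by the step `h`. -/
def gain (p : ℕ) (h : ℤ) : ℤ := F.cost O p (F.lam * h + F.X p) - F.cost O p (F.X p)

/-- The address of a cell of the table. -/
def idx (p b e : ℕ) : ℤ := ((p * (F.L + 1) + b) * F.w + e : ℕ)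

/-- Cells are numbered in mixed radix. Injectivity is what keeps an update of one cell from touching
another. -/
theorem idx_inj {p b e p' b' e' : ℕ} (hb : b ≤ F.L) (hb' : b' ≤ F.L) (he : e < F.w)
    (he' : e' < F.w) (h : F.idx p b e = F.idx p' b' e') : p = p' ∧ b = b' ∧ e = e' := by
  have h' : (p * (F.L + 1) + b) * F.w + e = (p' * (F.L + 1) + b') * F.w + e' := by
    unfold idx at h
    exact_mod_cast h
  have h1 : p * (F.L + 1) + b = p' * (F.L + 1) + b' := by
    have := congrArg (· / F.w) h'
    simpa [Nat.add_div_of_dvd_right, Nat.div_eq_of_lt he, Nat.div_eq_of_lt he',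
      Nat.pos_of_ne_zero (show F.w ≠ 0 by omega)] using this
  have h2 : p = p' := by
    have := congrArg (· / (F.L + 1)) h1
    simpa [Nat.add_div_of_dvd_right, Nat.div_eq_of_lt (Nat.lt_succ_of_le hb),
      Nat.div_eq_of_lt (Nat.lt_succ_of_le hb')] using this
  subst h2
  have h3 : b = b' := by omega
  subst h3
  exact ⟨rfl, rfl, by omega⟩

/-- The step `h` leads from the cell `(p, b, e)` to a defined cell of the next layer, with total
cost `v`. -/
def Tr (C V : ℤ → ℤ) (p b e : ℕ) (h v : ℤ) : Prop :=
  h.natAbs ≤ b ∧ F.Adm p (F.lam * h + F.X p) ∧ (0 < F.mark p → 2 * |(e : ℤ) - F.S| < F.R) ∧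
    0 ≤ (e : ℤ) - F.E p * h ∧ (e : ℤ) - F.E p * h < F.w ∧
    0 < C (F.idx (p + 1) (b - h.natAbs) ((e : ℤ) - F.E p * h).toNat) ∧
    v = V (F.idx (p + 1) (b - h.natAbs) ((e : ℤ) - F.E p * h).toNat) + F.gain O p h

/-- In the table `(C, V)` the cell `(p, b, e)` is correct with respect to the steps `h' - L`,
`k ≤ h' ≤ 2L`, into the next layer of the table `(C₀, V₀)`. -/
def CellOK (C₀ V₀ C V : ℤ → ℤ) (k p b e : ℕ) : Prop :=
  (C (F.idx p b e) = 0 ∨ ∃ h' : ℕ, k ≤ h' ∧ h' ≤ 2 * F.L ∧ C (F.idx p b e) = h' + 1 ∧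
    F.Tr O C₀ V₀ p b e ((h' : ℤ) - F.L) (V (F.idx p b e))) ∧
  ∀ h' : ℕ, k ≤ h' → h' ≤ 2 * F.L → ∀ v, F.Tr O C₀ V₀ p b e ((h' : ℤ) - F.L) v →
    0 < C (F.idx p b e) ∧ V (F.idx p b e) ≤ v

/-- The table `(C, V)` arises from `(C₀, V₀)` by changes in layer `p`, in which the cell
`(p, b, e)` takes into account the steps `h' - L` with `thr b e ≤ h'`. -/
def Layer (C₀ V₀ : ℤ → ℤ) (p : ℕ) (thr : ℕ → ℕ → ℕ) (C V : ℤ → ℤ) : Prop :=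
  (∀ p' b e, p' ≠ p → b ≤ F.L → e < F.w →
    C (F.idx p' b e) = C₀ (F.idx p' b e) ∧ V (F.idx p' b e) = V₀ (F.idx p' b e)) ∧
  ∀ b ≤ F.L, ∀ e < F.w, F.CellOK O C₀ V₀ C V (thr b e) p b e

/-- The layers from `p` on are correct and the earlier ones are empty. -/
def Tab (p : ℕ) (C V : ℤ → ℤ) : Prop :=
  (∀ b ≤ F.L, ∀ e < F.w, C (F.idx F.P b e) = (if e = F.S then 1 else 0) ∧
    (e = F.S → V (F.idx F.P b e) = 0)) ∧
  (∀ p', p ≤ p' → p' < F.P → ∀ b ≤ F.L, ∀ e < F.w, F.CellOK O C V C V 0 p' b e) ∧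
  ∀ p' < p, ∀ b ≤ F.L, ∀ e < F.w, C (F.idx p' b e) = 0

variable {O F}

/-! ### Preservation of the table invariants. -/

theorem Layer.congr {C₀ V₀ C V : ℤ → ℤ} {p : ℕ} {thr thr' : ℕ → ℕ → ℕ}
    (h : F.Layer O C₀ V₀ p thr C V) (ht : ∀ b ≤ F.L, ∀ e < F.w, thr b e = thr' b e) :
    F.Layer O C₀ V₀ p thr' C V :=
  ⟨h.1, fun b hb e he => ht b hb e he ▸ h.2 b hb e he⟩

/-- Lowering the threshold costs one comparison, with the step `k - L`. -/
theorem CellOK.of_succ {C₀ V₀ C V : ℤ → ℤ} {k p b e : ℕ} (h : F.CellOK O C₀ V₀ C V (k + 1) p b e)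
    (hk : ∀ v, F.Tr O C₀ V₀ p b e ((k : ℤ) - F.L) v → 0 < C (F.idx p b e) ∧ V (F.idx p b e) ≤ v) :
    F.CellOK O C₀ V₀ C V k p b e := by
  refine ⟨h.1.imp id fun ⟨h', h1, h2⟩ => ⟨h', by omega, h2⟩, fun h' h1 h2 v hv => ?_⟩
  rcases Nat.eq_or_lt_of_le h1 with rfl | h3
  · exact hk v hv
  · exact h.2 h' h3 h2 v hv

/-- If the guard holds, the new entry is the candidate through step `h`, and the last guard makes it
cheaper than all steps above `k` seen so far. If the guard fails, either the step is no transition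
or the entry is already as cheap. In both cases the cell `(b, e)` now accounts for the step `k - L`,
and no other cell changes. -/
theorem Layer.relax {C₀ V₀ C V C' V' : ℤ → ℤ} {p : ℕ} {thr : ℕ → ℕ → ℕ} {k b e : ℕ}
    (hl : F.Layer O C₀ V₀ p thr C V) (hb : b ≤ F.L) (he : e < F.w) (hk : k ≤ 2 * F.L)
    (hthr : thr b e = k + 1) {h : ℤ} (hh : h = (k : ℤ) - F.L) (hhb : h.natAbs ≤ b)
    (hadm : F.Adm p (F.lam * h + F.X p)) {next dE : ℤ} (hdE : dE = F.E p * h)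
    (hnext : next = F.idx (p + 1) (b - h.natAbs) 0) {row : ℤ} (hrow : row = F.idx p b 0)
    (hres : ((0 ≤ e - dE ∧ e - dE < F.w ∧ 0 < C (next + (e - dE)) ∧
        (0 < F.mark p → 2 * |(e : ℤ) - F.S| < F.R) ∧
        (0 < C (row + e) → V (next + (e - dE)) + F.gain O p h < V (row + e))) ∧
        C' = Function.update C (row + e) (k + 1) ∧
        V' = Function.update V (row + e) (V (next + (e - dE)) + F.gain O p h)) ∨
      (¬ (0 ≤ e - dE ∧ e - dE < F.w ∧ 0 < C (next + (e - dE)) ∧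
        (0 < F.mark p → 2 * |(e : ℤ) - F.S| < F.R) ∧
        (0 < C (row + e) → V (next + (e - dE)) + F.gain O p h < V (row + e))) ∧
        C' = C ∧ V' = V)) :
    F.Layer O C₀ V₀ p (fun b' e' => if b' = b ∧ e' = e then k else thr b' e') C' V' := by
  subst hdE
  have hidx : ∀ p b e, F.idx p b 0 + (e : ℕ) = F.idx p b e := fun p b e => by simp [idx]
  have hold := hthr ▸ hl.2 b hb e he
  -- While layer `p` is filled, layer `p + 1` is untouched, so reading the current table there is
  -- reading `(C₀, V₀)`.
  have hnx : 0 ≤ e - F.E p * h → e - F.E p * h < F.w →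
      next + (e - F.E p * h) = F.idx (p + 1) (b - h.natAbs) (e - F.E p * h).toNat ∧
      C (next + (e - F.E p * h)) =
        C₀ (F.idx (p + 1) (b - h.natAbs) (e - F.E p * h).toNat) ∧
      V (next + (e - F.E p * h)) =
        V₀ (F.idx (p + 1) (b - h.natAbs) (e - F.E p * h).toNat) := by
    intro h0 h1
    have h2 : next + (e - F.E p * h) = F.idx (p + 1) (b - h.natAbs) (e - F.E p * h).toNat := by
      rw [hnext, ← hidx (p + 1) _ (Int.toNat _), Int.toNat_of_nonneg h0]
    rw [h2]
    exact ⟨rfl, hl.1 _ _ _ (by omega) (by omega) (by omega)⟩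
  rw [hrow, hidx] at hres
  rcases hres with ⟨⟨c1, c2, c3, c4, c5⟩, rfl, rfl⟩ | ⟨hn, rfl, rfl⟩
  · obtain ⟨-, n2, n3⟩ := hnx c1 c2
    have htr : F.Tr O C₀ V₀ p b e h (V (next + (e - F.E p * h)) + F.gain O p h) :=
      ⟨hhb, hadm, c4, c1, c2, n2 ▸ c3, by rw [n3]⟩
    have hne : ∀ p' b' e', b' ≤ F.L → e' < F.w → ¬ (p' = p ∧ b' = b ∧ e' = e) →
        F.idx p' b' e' ≠ F.idx p b e := fun p' b' e' hb' he' hcon h =>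
      hcon (F.idx_inj hb' hb he' he h)
    refine ⟨fun p' b' e' hp' hb' he' => ?_, fun b' hb' e' he' => ?_⟩
    · have := hne p' b' e' hb' he' (by tauto)
      simp only [Function.update_of_ne this]
      exact hl.1 p' b' e' hp' hb' he'
    · by_cases hbe : b' = b ∧ e' = e
      · obtain ⟨rfl, rfl⟩ := hbe
        simp only [and_self, if_true]
        refine ⟨Or.inr ⟨k, le_rfl, hk, by simp, ?_⟩, fun h' h1 h2 v hv => ?_⟩
        · rw [Function.update_self, ← hh]; exact htr
        · simp only [Function.update_self]
          refine ⟨by omega, ?_⟩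
          rcases Nat.eq_or_lt_of_le h1 with rfl | h3
          · rw [← hh] at hv
            rw [hv.2.2.2.2.2.2, ← n3]
          · obtain ⟨h4, h5⟩ := hold.2 h' h3 h2 v hv
            exact (c5 h4).le.trans h5
      · have := hne p b' e' hb' he' (by tauto)
        simp only [hbe, if_false]
        have h1 := hl.2 b' hb' e' he'
        unfold CellOK at h1 ⊢
        simpa only [Function.update_of_ne this] using h1
  · refine ⟨hl.1, fun b' hb' e' he' => ?_⟩
    by_cases hbe : b' = b ∧ e' = e
    · obtain ⟨rfl, rfl⟩ := hbe
      simp only [and_self, if_true]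
      refine hold.of_succ fun v hv => ?_
      rw [← hh] at hv
      obtain ⟨-, -, t3, t4, t5, t6, t7⟩ := hv
      obtain ⟨-, n2, n3⟩ := hnx t4 t5
      -- A transition exists but no update happened, so the failed condition is the comparison: the
      -- cell is defined and at most as expensive.
      have : ¬ (0 < C' (F.idx p b' e') →
          V' (next + (e' - F.E p * h)) + F.gain O p h < V' (F.idx p b' e')) :=
        fun hc => hn ⟨t4, t5, n2 ▸ t6, t3, hc⟩
      rw [n3, ← t7] at this
      push Not at this
      exact this
    · simp only [hbe, if_false]
      exact hl.2 b' hb' e' he'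

/-- A step that exceeds the budget or leads to an inadmissible value has no transition, so the
threshold may be lowered without any work. -/
theorem Layer.skip {C₀ V₀ C V : ℤ → ℤ} {p k : ℕ} {thr thr' : ℕ → ℕ → ℕ}
    (hl : F.Layer O C₀ V₀ p thr C V)
    (h : ∀ b ≤ F.L, ∀ e < F.w, thr' b e = thr b e ∨ (thr b e = k + 1 ∧ thr' b e = k ∧
      ¬ (((k : ℤ) - F.L).natAbs ≤ b ∧ F.Adm p (F.lam * ((k : ℤ) - F.L) + F.X p)))) :
    F.Layer O C₀ V₀ p thr' C V := by
  refine ⟨hl.1, fun b hb e he => ?_⟩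
  have h1 := hl.2 b hb e he
  rcases h b hb e he with h2 | ⟨h2, h3, h4⟩
  · rwa [h2]
  · rw [h3]
    rw [h2] at h1
    exact h1.of_succ fun v hv => absurd ⟨hv.1, hv.2.1⟩ h4

/-- Correctness of a cell involves only the cell itself and the next layer. -/
theorem CellOK.congr {C₀ V₀ C₁ V₁ C V C' V' : ℤ → ℤ} {k p b e : ℕ} (hb : b ≤ F.L)
    (h : F.CellOK O C₀ V₀ C V k p b e)
    (h₁ : ∀ b ≤ F.L, ∀ e < F.w, C₁ (F.idx (p + 1) b e) = C₀ (F.idx (p + 1) b e) ∧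
      V₁ (F.idx (p + 1) b e) = V₀ (F.idx (p + 1) b e))
    (h₂ : C' (F.idx p b e) = C (F.idx p b e) ∧ V' (F.idx p b e) = V (F.idx p b e)) :
    F.CellOK O C₁ V₁ C' V' k p b e := by
  have key : ∀ h v, F.Tr O C₁ V₁ p b e h v ↔ F.Tr O C₀ V₀ p b e h v := by
    intro h v
    unfold Tr
    refine and_congr_right fun _ => and_congr_right fun _ => and_congr_right fun _ =>
      and_congr_right fun h0 => and_congr_right fun h1 => ?_
    have := h₁ (b - h.natAbs) (by omega) ((e : ℤ) - F.E p * h).toNat (by omega)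
    rw [this.1, this.2]
  unfold CellOK
  simp only [key, h₂.1, h₂.2]
  exact h

/-- With threshold `2L + 1` no step has to be considered, so an empty layer is correct; filling
layer `p` runs from here to threshold `0` in `Layer.tab`. -/
theorem Tab.layer {C₀ V₀ : ℤ → ℤ} {p : ℕ} (h : F.Tab O (p + 1) C₀ V₀) :
    F.Layer O C₀ V₀ p (fun _ _ => 2 * F.L + 1) C₀ V₀ :=
  ⟨fun _ _ _ _ _ _ => ⟨rfl, rfl⟩, fun b hb e he =>
    ⟨Or.inl (h.2.2 p (by omega) b hb e he), fun h' (h1 : 2 * F.L + 1 ≤ h') h2 => by omega⟩⟩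

theorem Layer.tab {C₀ V₀ C V : ℤ → ℤ} {p : ℕ} (h : F.Tab O (p + 1) C₀ V₀) (hp : p < F.P)
    (hl : F.Layer O C₀ V₀ p (fun _ _ => 0) C V) : F.Tab O p C V := by
  refine ⟨fun b hb e he => ?_, fun p' h1 h2 b hb e he => ?_, fun p' h1 b hb e he => ?_⟩
  · have := hl.1 F.P b e (by omega) hb he
    rw [this.1, this.2]
    exact h.1 b hb e he
  · rcases Nat.eq_or_lt_of_le h1 with rfl | h3
    · exact (hl.2 b hb e he).congr hb (fun b hb e he => hl.1 _ b e (by omega) hb he) ⟨rfl, rfl⟩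
    · exact (h.2.1 p' h3 h2 b hb e he).congr hb (fun b hb e he => hl.1 _ b e (by omega) hb he)
        (hl.1 _ b e (by omega) hb he)
  · rw [(hl.1 p' b e (by omega) hb he).1]
    exact h.2.2 p' (by omega) b hb e he

/-! ### What the table computes -/

variable (O F)

/-- `h` describes an admissible completion from position `p` with budget `b` and residual `e`;
`m` positions remain. -/
def Path : ℕ → ℕ → ℕ → ℕ → (ℕ → ℤ) → Prop
  | 0, _, _, e, _ => e = F.S
  | m + 1, p, b, e, h => (h p).natAbs ≤ b ∧ F.Adm p (F.lam * h p + F.X p) ∧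
      (0 < F.mark p → 2 * |(e : ℤ) - F.S| < F.R) ∧
      0 ≤ (e : ℤ) - F.E p * h p ∧ (e : ℤ) - F.E p * h p < F.w ∧
      Path m (p + 1) (b - (h p).natAbs) ((e : ℤ) - F.E p * h p).toNat h

/-- The cost of a completion. -/
def pathCost : ℕ → ℕ → (ℕ → ℤ) → ℤ
  | 0, _, _ => 0
  | m + 1, p, h => pathCost m (p + 1) h + F.gain O p (h p)

/-- The choices in the table along the completion `h`. -/
def Follows (C : ℤ → ℤ) : ℕ → ℕ → ℕ → ℕ → (ℕ → ℤ) → Prop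
  | 0, _, _, _, _ => True
  | m + 1, p, b, e, h => C (F.idx p b e) = h p + F.L + 1 ∧
      Follows C m (p + 1) (b - (h p).natAbs) ((e : ℤ) - F.E p * h p).toNat h

variable {O F}

theorem Path.congr {m p b e : ℕ} {h h' : ℕ → ℤ} (hh : ∀ i, p ≤ i → h i = h' i)
    (hp : F.Path m p b e h) : F.Path m p b e h' := by
  induction m generalizing p b e with
  | zero => exact hp
  | succ m ih =>
    obtain ⟨h1, h2, h3, h4, h5, h6⟩ := hp
    rw [hh p le_rfl] at *
    exact ⟨h1, h2, h3, h4, h5, ih (fun i hi => hh i (by omega)) h6⟩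

theorem pathCost_congr {m p : ℕ} {h h' : ℕ → ℤ} (hh : ∀ i, p ≤ i → h i = h' i) :
    F.pathCost O m p h = F.pathCost O m p h' := by
  induction m generalizing p with
  | zero => rfl
  | succ m ih => simp only [pathCost]; rw [hh p le_rfl, ih fun i hi => hh i (by omega)]

theorem Follows.congr {C : ℤ → ℤ} {m p b e : ℕ} {h h' : ℕ → ℤ} (hh : ∀ i, p ≤ i → h i = h' i)
    (hp : F.Follows C m p b e h) : F.Follows C m p b e h' := by
  induction m generalizing p b e with
  | zero => exact hp
  | succ m ih =>
    obtain ⟨h1, h2⟩ := hp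
    rw [hh p le_rfl] at *
    exact ⟨h1, ih (fun i hi => hh i (by omega)) h2⟩

/-- No completion is cheaper than the table says. -/
theorem Tab.le_pathCost {C V : ℤ → ℤ} (ht : F.Tab O 0 C V) {m p b e : ℕ} (hm : p + m = F.P)
    (hb : b ≤ F.L) (he : e < F.w) {h : ℕ → ℤ} (hp : F.Path m p b e h) :
    0 < C (F.idx p b e) ∧ V (F.idx p b e) ≤ F.pathCost O m p h := by
  induction m generalizing p b e with
  | zero =>
    obtain rfl : p = F.P := by omega
    obtain rfl : e = F.S := hp
    have := ht.1 b hb _ he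
    rw [this.1, this.2 rfl]
    simp [pathCost]
  | succ m ih =>
    obtain ⟨h1, h2, h3, h4, h5, h6⟩ := hp
    obtain ⟨h7, h8⟩ := ih (by omega) (by omega) (by omega) h6
    have hcell := ht.2.1 p (by omega) (by omega) b hb e he
    -- Steps are stored shifted by `L` to be natural numbers; the budget gives `|h p| ≤ L`.
    obtain ⟨h9, h10⟩ := hcell.2 (h p + F.L).toNat (by omega) (by omega)
      (V (F.idx (p + 1) (b - (h p).natAbs) ((e : ℤ) - F.E p * h p).toNat) + F.gain O p (h p))
      (by
        rw [Int.toNat_of_nonneg (by omega), add_sub_cancel_right]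
        exact ⟨h1, h2, h3, h4, h5, h7, rfl⟩)
    refine ⟨h9, h10.trans ?_⟩
    simp only [pathCost]
    omega

/-- The table entry is attained by the completion that follows the choices. -/
theorem Tab.exists_path {C V : ℤ → ℤ} (ht : F.Tab O 0 C V) {m p b e : ℕ} (hm : p + m = F.P)
    (hb : b ≤ F.L) (he : e < F.w) (hc : 0 < C (F.idx p b e)) :
    ∃ h, F.Path m p b e h ∧ F.pathCost O m p h = V (F.idx p b e) ∧ F.Follows C m p b e h := by
  induction m generalizing p b e with
  | zero =>
    obtain rfl : p = F.P := by omega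
    have := ht.1 b hb e he
    have h1 : e = F.S := by
      by_contra h1
      simp [this.1, h1] at hc
    exact ⟨fun _ => 0, h1, (this.2 h1).symm, trivial⟩
  | succ m ih =>
    have hcell := ht.2.1 p (by omega) (by omega) b hb e he
    rcases hcell.1 with h0 | ⟨h', -, h2, h3, ⟨t1, t2, t3, t4, t5, t6, t7⟩⟩
    · omega
    · obtain ⟨g, g1, g2, g3⟩ := ih (by omega) (by omega) (by omega) t6
      -- The completion `g` matters from `p + 1` on only, so its value at `p` may be overwritten by
      -- the stored step.
      have hg : ∀ i, p + 1 ≤ i → g i = Function.update g p ((h' : ℤ) - F.L) i := fun i hi =>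
        (Function.update_of_ne (by omega) _ _).symm
      refine ⟨Function.update g p ((h' : ℤ) - F.L), ?_, ?_, ?_⟩
      · simp only [Path, Function.update_self]
        exact ⟨t1, t2, t3, t4, t5, g1.congr hg⟩
      · simp only [pathCost, Function.update_self]
        rw [← pathCost_congr hg, g2, t7]
      · simp only [Follows, Function.update_self]
        exact ⟨by omega, g3.congr hg⟩

end DP

end NFoldIP

namespace NFoldIP

open Prog

/-! ### The dynamic program: correctness of the programs -/

/-- The registers and arrays of `σ` hold the data of `F`. -/
structure DP.Ctx (F : DP) (σ : State) : Prop where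
  one : σ.reg rOne = 1
  hL : σ.reg rL = F.L
  hR : σ.reg rTop = F.R
  hS : σ.reg rShift = F.S
  hw : σ.reg rWidth = F.w
  hP : σ.reg rPos = F.P
  hphase : σ.reg rPhase = F.phase
  hlam : σ.reg rLam = F.lam
  hTot : σ.reg rTot = ((F.P + 1) * (F.L + 1) * F.w : ℕ)
  hLev : σ.reg rLevels = (F.L + 1 : ℕ)
  hSteps : σ.reg rSteps = (2 * F.L + 1 : ℕ)
  hE : ∀ p : ℕ, σ.arr aCol p = F.E p
  hmark : ∀ p : ℕ, σ.arr aMark p = F.mark p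
  hX : ∀ p : ℕ, σ.arr aX p = F.X p
  hq : ∀ p : ℕ, σ.arr aQ p = F.q p
  hlo : σ.arr aLow = F.lo
  hhi : σ.arr aUpp = F.hi

/-- Parameters live in registers below `29` and arrays below `20`, scratch data above, so the side
conditions are decidable statements about write lists. -/
theorem DP.Ctx.keep {F : DP} {σ σ' : State} {R A : List ℕ} (h : F.Ctx σ) (hk : Keep R A σ σ')
    (hR : ∀ y < 29, y ∉ R) (hA : ∀ a < 20, a ∉ A) : F.Ctx σ' := by
  have r : ∀ y < 29, σ'.reg y = σ.reg y := fun y hy => hk.reg y (hR y hy)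
  have a : ∀ y < 20, σ'.arr y = σ.arr y := fun y hy => hk.arr y (hA y hy)
  exact
    { one := (r 4 (by decide)).trans h.one
      hL := (r rL (by decide)).trans h.hL
      hR := (r rTop (by decide)).trans h.hR
      hS := (r rShift (by decide)).trans h.hS
      hw := (r rWidth (by decide)).trans h.hw
      hP := (r rPos (by decide)).trans h.hP
      hphase := (r rPhase (by decide)).trans h.hphase
      hlam := (r rLam (by decide)).trans h.hlam
      hTot := (r rTot (by decide)).trans h.hTot
      hLev := (r rLevels (by decide)).trans h.hLev
      hSteps := (r rSteps (by decide)).trans h.hSteps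
      hE := fun p => (congrFun (a aCol (by decide)) p).trans (h.hE p)
      hmark := fun p => (congrFun (a aMark (by decide)) p).trans (h.hmark p)
      hX := fun p => (congrFun (a aX (by decide)) p).trans (h.hX p)
      hq := fun p => (congrFun (a aQ (by decide)) p).trans (h.hq p)
      hlo := (a aLow (by decide)).trans h.hlo
      hhi := (a aUpp (by decide)).trans h.hhi }

/-- The context of the relaxations for position `p` and step `k - L`. -/
structure DP.StepCtx (O : ℤ → ℤ → ℤ) (F : DP) (p k : ℕ) (σ : State) : Prop extends F.Ctx σ where
  pos : σ.reg cPos = p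
  step : σ.reg cStep = k
  marked : σ.reg vMark = F.mark p
  gain : σ.reg vGain = F.gain O p ((k : ℤ) - F.L)
  diff : σ.reg vDiff = F.E p * ((k : ℤ) - F.L)
  abs : σ.reg vAbs = ((k : ℤ) - F.L).natAbs

theorem DP.StepCtx.keep {O : ℤ → ℤ → ℤ} {F : DP} {p k : ℕ} {σ σ' : State} {R A : List ℕ}
    (h : F.StepCtx O p k σ) (hk : Keep R A σ σ') (hR : ∀ y < 29, y ∉ R) (hA : ∀ a < 20, a ∉ A)
    (hR' : ∀ y ∈ [cPos, cStep, vMark, vGain, vDiff, vAbs], y ∉ R) : F.StepCtx O p k σ' := by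
  have r : ∀ y ∈ [cPos, cStep, vMark, vGain, vDiff, vAbs], σ'.reg y = σ.reg y :=
    fun y hy => hk.reg y (hR' y hy)
  exact
    { h.toCtx.keep hk hR hA with
      pos := (r cPos (by decide)).trans h.pos
      step := (r cStep (by decide)).trans h.step
      marked := (r vMark (by decide)).trans h.marked
      gain := (r vGain (by decide)).trans h.gain
      diff := (r vDiff (by decide)).trans h.diff
      abs := (r vAbs (by decide)).trans h.abs }

variable {O : ℤ → ℤ → ℤ} {F : DP}

theorem runs_rowProg {z x y p b : ℕ} {σ : State} (h : F.Ctx σ) (hx : σ.reg x = p)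
    (hy : σ.reg y = b) (hz : z ∉ [4, 10, 30, 58]) (hx' : x ∉ [30, 58]) (hy' : y ∉ [30, 58]) :
    Runs O (rowProg z x y) σ (6 * F.S + 3 * F.L + 24) fun σ' => σ'.reg z = F.idx p b 0 := by
  simp only [List.mem_cons, List.not_mem_nil, or_false, not_or] at hz hx' hy'
  unfold rowProg
  refine Runs.bind (runs_mul (a := p) (b := (F.L + 1 : ℕ)) hx h.hLev h.one
    (Ne.symm hx'.2) (by decide) (by decide) hx'.1 (by decide) (by decide)) fun σ₁ e₁ k₁ => ?_
  have h₁ : F.Ctx σ₁ := h.keep k₁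
    (show ∀ y < 29, y ∉ [58, 30, 30, 30, 58, 30, 30, 30, 58] by decide)
    (show ∀ a < 20, a ∉ [] by decide)
  have hy₁ : σ₁.reg y = b := by
    rw [k₁.reg y (by simp [wregs, mul, copy, neg, forDown, hy']), hy]
  refine Runs.bind (runs_wp (Q := fun σ' => σ'.reg 58 = p * (F.L + 1 : ℕ) + b) rfl
    (by simp [wp, e₁, hy₁])) fun σ₂ e₂ k₂ => ?_
  have h₂ : F.Ctx σ₂ := h₁.keep k₂ (show ∀ y < 29, y ∉ [58] by decide)
    (show ∀ a < 20, a ∉ [] by decide)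
  refine ((runs_mul e₂ h₂.hw h₂.one hz.2.2.2 hz.2.1 hz.2.2.1 (by decide) (by decide) hz.1).le
    ?_).imp fun σ₃ e₃ k₃ => ?_
  · simp only [size, Int.natAbs_natCast, DP.w]
    omega
  · rw [e₃, DP.idx]
    push_cast
    ring

/-- Budgets count down, so the rows with larger budget already account for the step `k - L`. If the
step is longer than the budget, nothing has to be done by `Layer.skip`. -/
theorem runs_budget {C₀ V₀ : ℤ → ℤ} {σ : State} {p k b : ℕ} (hs : F.StepCtx O p k σ)
    (hk : k ≤ 2 * F.L) (hadm : F.Adm p (F.lam * ((k : ℤ) - F.L) + F.X p)) (hb : b ≤ F.L)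
    (hbud : σ.reg cBud = b)
    (hl : F.Layer O C₀ V₀ p (fun b' _ => if b + 1 ≤ b' then k else k + 1)
      (σ.arr aCh) (σ.arr aVal)) :
    Runs O budgetProg σ (96 * F.S + 6 * F.L + 100) fun σ' =>
      F.Layer O C₀ V₀ p (fun b' _ => if b ≤ b' then k else k + 1) (σ'.arr aCh) (σ'.arr aVal) := by
  unfold budgetProg
  refine Runs.bind (runs_wp (Q := fun σ' => σ'.reg vBud = b - ((k : ℤ) - F.L).natAbs ∧
      σ'.reg 59 = b - ((k : ℤ) - F.L).natAbs + 1) rfl (by simp [wp, hbud, hs.abs, hs.one]))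
    fun σ₁ e₁ k₁ => ?_
  have hs₁ := hs.keep k₁ (by decide) (by decide) (by decide)
  have hl₁ := hl
  rw [← k₁.arr aCh (by decide), ← k₁.arr aVal (by decide)] at hl₁
  refine Runs.ite (fun hpos => ?_) (fun hneg => ?_)
  · have hkb : ((k : ℤ) - F.L).natAbs ≤ b := by omega
    refine Runs.bind (runs_rowProg hs₁.toCtx hs₁.pos ((k₁.reg cBud (by decide)).trans hbud)
      (by decide) (by decide) (by decide)) fun σ₂ e₂ k₂ => ?_
    have hs₂ := hs₁.keep k₂ (by decide) (by decide) (by decide)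
    refine Runs.bind (runs_wp (Q := fun σ' => σ'.reg 59 = (p + 1 : ℕ)) rfl
      (by simp [wp, hs₂.pos, hs₂.one])) fun σ₃ e₃ k₃ => ?_
    have hs₃ := hs₂.keep k₃ (by decide) (by decide) (by decide)
    refine Runs.bind (runs_rowProg (b := b - ((k : ℤ) - F.L).natAbs) hs₃.toCtx e₃
      (by rw [k₃.reg vBud (by decide), k₂.reg vBud (by decide), e₁.1]; omega)
      (by decide) (by decide) (by decide)) fun σ₄ e₄ k₄ => ?_
    have hs₄ := hs₃.keep k₄ (by decide) (by decide) (by decide)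
    refine Runs.bind (runs_wp (Q := fun σ' => σ'.reg cRes = F.w) rfl
      (by simp [wp_copy, hs₄.hw])) fun σ₅ e₅ k₅ => ?_
    have hs₅ := hs₄.keep k₅ (by decide) (by decide) (by decide)
    have hl₅ := hl₁
    rw [← k₂.arr aCh (by decide), ← k₂.arr aVal (by decide), ← k₃.arr aCh (by decide),
      ← k₃.arr aVal (by decide), ← k₄.arr aCh (by decide), ← k₄.arr aVal (by decide),
      ← k₅.arr aCh (by decide), ← k₅.arr aVal (by decide)] at hl₅
    have hrow : σ₅.reg vRow = F.idx p b 0 := by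
      rw [k₅.reg vRow (by decide), k₄.reg vRow (by decide), k₃.reg vRow (by decide), e₂]
    have hnext : σ₅.reg vNext = F.idx (p + 1) (b - ((k : ℤ) - F.L).natAbs) 0 := by
      rw [k₅.reg vNext (by decide), e₄]
    refine ((runs_forDown (N := F.w) (B := 40)
      -- In the row `b` the residuals from `i` on are done.
      (fun i σ' => F.Layer O C₀ V₀ p
        (fun b' e' => if b + 1 ≤ b' ∨ (b' = b ∧ i ≤ e') then k else k + 1)
        (σ'.arr aCh) (σ'.arr aVal))
      (by rw [e₅]; rfl) hs₅.one (by decide) (by decide) (by decide)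
      (hl₅.congr fun b' _ e' he' => by
        have : ¬ (b' = b ∧ F.w ≤ e') := by omega
        simp only [this, or_false])
      (fun _ _ _ h => h) (fun i hi σ' hl' hi' hk' => ?_)).le ?_).imp fun σ₆ hl₆ k₆ => ?_
    · have hs' := hs₅.keep hk' (by decide) (by decide) (by decide)
      refine (runs_relax rfl rfl hs'.one ((hk'.reg vRow (by decide)).trans hrow)
        ((hk'.reg vNext (by decide)).trans hnext) hi' hs'.diff hs'.hw hs'.gain hs'.step hs'.hS
        hs'.hR hs'.marked).imp fun σ'' hr _ => ?_
      refine (hl'.relax (k := k) (b := b) (e := i) hb hi hk (by simp) rfl hkb hadm rfl rfl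
        rfl hr).congr fun b' hb' e' he' => ?_
      by_cases h1 : b + 1 ≤ b'
      · simp [h1]
      · by_cases h2 : b' = b ∧ i ≤ e'
        · by_cases h3 : e' = i
          · simp [h2, h3]
          · have : i + 1 ≤ e' := by omega
            simp [h2, this]
        · have h3 : ¬ (b' = b ∧ e' = i) := by omega
          have h4 : ¬ (b' = b ∧ i + 1 ≤ e') := by omega
          simp only [h1, h2, h3, h4, or_false, if_false]
    · simp only [size, copy, DP.w]
      omega
    · refine hl₆.congr fun b' _ e' _ => ?_
      have : (b + 1 ≤ b' ∨ (b' = b ∧ 0 ≤ e')) ↔ b ≤ b' := by omega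
      simp only [this]
  · refine (runs_wp (c := skip) rfl ?_).le (by simp only [size, skip]; omega)
    refine hl₁.skip (k := k) fun b' hb' e he => ?_
    by_cases h : b' = b
    · right
      subst h
      refine ⟨by simp, by simp, fun h => ?_⟩
      omega
    · left
      have : b ≤ b' ↔ b + 1 ≤ b' := by omega
      simp only [this]

theorem wp_costProg {F : DP} {σ : State} {p : ℕ} {v : ℤ} (h : F.Ctx σ)
    (hq : σ.reg vQ = F.q p) (hv : σ.reg vNew = v) {Q : State → Prop}
    (hQ : ∀ σ', σ'.reg vCost = F.cost O p v → Keep [vCost, 58] [] σ σ' → Q σ') :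
    wp O costProg σ Q := by
  have hk : ∀ x y, Keep [vCost, 58] [] σ ((σ.setReg 58 x).setReg vCost y) := fun x y =>
    ⟨fun z hz => by simp only [List.mem_cons, List.not_mem_nil, or_false, not_or] at hz
                    simp [hz], fun _ _ => rfl⟩
  have hk' : ∀ y, Keep [vCost, 58] [] σ (σ.setReg vCost y) := fun y =>
    ⟨fun z hz => by simp only [List.mem_cons, List.not_mem_nil, or_false, not_or] at hz
                    simp [hz], fun _ _ => rfl⟩
  simp only [costProg, wp, wp_neg, wp_abs, ne_eq, Nat.reduceEqDiff, not_false_eq_true,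
    State.setReg_reg, if_true, if_false, h.hphase, hq, hv]
  refine ⟨fun h1 => hQ _ ?_ (hk' _), fun h1 => ⟨fun h2 => hQ _ ?_ (hk _ _),
    fun h2 => hQ _ ?_ (hk _ _)⟩⟩
  · simp [DP.cost, h1]
  · simp [DP.cost, h1, show F.q p < 0 by omega]
  · simp [DP.cost, h1, show ¬ F.q p < 0 by omega]

/-- Admissibility and the gain depend on position and step only, so they are computed once, outside
the loops over budgets and residuals. An inadmissible step is skipped for all cells at once. -/
theorem runs_step {C₀ V₀ : ℤ → ℤ} {σ : State} {p k : ℕ} (h : F.Ctx σ) (hk : k ≤ 2 * F.L)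
    (hpos : σ.reg cPos = p) (hstep : σ.reg cStep = k) (hmk : σ.reg vMark = F.mark p)
    (hX : σ.reg vX = F.X p) (hq : σ.reg vQ = F.q p) (hE : σ.reg vCol = F.E p)
    (hl : F.Layer O C₀ V₀ p (fun _ _ => k + 1) (σ.arr aCh) (σ.arr aVal)) :
    Runs O stepProg σ ((F.L + 1) * (96 * F.S + 6 * F.L + 102) + 6 * F.L + 100) fun σ' =>
      F.Layer O C₀ V₀ p (fun _ _ => k) (σ'.arr aCh) (σ'.arr aVal) := by
  unfold stepProg
  refine Runs.bind (runs_wp (Q := fun σ' => σ'.reg vStep = (k : ℤ) - F.L) rfl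
    (by simp [wp, hstep, h.hL])) fun σ₁ e₁ k₁ => ?_
  have h₁ := h.keep k₁ (by decide) (by decide)
  refine Runs.bind (runs_mul h₁.hlam e₁ h₁.one (by decide) (by decide) (by decide) (by decide)
    (by decide) (by decide)) fun σ₂ e₂ k₂ => ?_
  have h₂ := h₁.keep k₂ (by decide) (by decide)
  have hX₂ : σ₂.reg vX = F.X p := by rw [k₂.reg vX (by decide), k₁.reg vX (by decide), hX]
  have hq₂ : σ₂.reg vQ = F.q p := by rw [k₂.reg vQ (by decide), k₁.reg vQ (by decide), hq]
  refine Runs.bind (runs_wp (Q := fun σ' => σ'.reg vNew = F.lam * ((k : ℤ) - F.L) + F.X p ∧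
      (0 < σ'.reg 60 ↔ F.Adm p (F.lam * ((k : ℤ) - F.L) + F.X p))) rfl ?_) fun σ₃ e₃ k₃ => ?_
  · simp only [admProg, wp, wp_neg, wp_skip, ne_eq, Nat.reduceEqDiff, not_false_eq_true,
      State.setReg_reg, State.setReg_arr, if_true, if_false, e₂, hX₂, hq₂, h₂.hlo, h₂.hhi,
      h₂.hphase, DP.Adm]
    generalize F.lam * ((k : ℤ) - F.L) + F.X p = v
    generalize F.lo (F.q p) = lo
    generalize F.hi (F.q p) = hi
    repeat' (first | apply And.intro | intro _)
    all_goals first | rfl | trivial | omega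
  have h₃ := h₂.keep k₃ (by decide) (by decide)
  have hl₃ := hl
  rw [← k₁.arr aCh (by decide), ← k₁.arr aVal (by decide), ← k₂.arr aCh (by decide),
    ← k₂.arr aVal (by decide), ← k₃.arr aCh (by decide), ← k₃.arr aVal (by decide)] at hl₃
  refine Runs.ite (fun hadm => ?_) (fun hadm => ?_)
  · rw [e₃.2] at hadm
    have hX₃ : σ₃.reg vX = F.X p := by rw [k₃.reg vX (by decide), hX₂]
    have hq₃ : σ₃.reg vQ = F.q p := by rw [k₃.reg vQ (by decide), hq₂]
    refine Runs.bind (runs_wp (Q := fun σ' => σ'.reg vGain = F.gain O p ((k : ℤ) - F.L)) rfl ?_)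
      fun σ₄ e₄ k₄ => ?_
    · simp only [wp]
      refine wp_costProg h₃ hq₃ e₃.1 fun τ t₁ u₁ => ?_
      rw [wp_copy (by decide), wp_copy (by decide)]
      refine wp_costProg (p := p) (v := F.X p) (h₃.keep (R := [vCost, 58, vGain, vNew]) (A := [])
        ⟨fun y hy => ?_, fun a ha => ?_⟩ (by decide) (by decide)) ?_ ?_ fun τ' t₂ u₂ => ?_
      · simp only [List.mem_cons, List.not_mem_nil, or_false, not_or] at hy
        simp only [State.setReg_reg, hy, if_false]
        exact u₁.reg y (by simp [hy])
      · exact u₁.arr a (by simp)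
      · simp [u₁.reg vQ (by decide), hq₃]
      · simp [u₁.reg vX (by decide), hX₃]
      · simp [t₂, u₂.reg vGain (by decide), t₁, DP.gain]
    have h₄ := h₃.keep k₄ (by decide) (by decide)
    have hE₄ : σ₄.reg vCol = F.E p := by
      rw [k₄.reg vCol (by decide), k₃.reg vCol (by decide), k₂.reg vCol (by decide),
        k₁.reg vCol (by decide), hE]
    have hS₄ : σ₄.reg vStep = (k : ℤ) - F.L := by
      rw [k₄.reg vStep (by decide), k₃.reg vStep (by decide), k₂.reg vStep (by decide), e₁]
    refine Runs.bind (runs_mul hE₄ hS₄ h₄.one (by decide) (by decide) (by decide) (by decide)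
      (by decide) (by decide)) fun σ₅ e₅ k₅ => ?_
    have h₅ := h₄.keep k₅ (by decide) (by decide)
    refine Runs.bind (runs_wp (Q := fun σ' => σ'.reg vAbs = ((k : ℤ) - F.L).natAbs ∧
      σ'.reg cBud = (F.L + 1 : ℕ)) rfl (by
        simp only [wp, wp_abs, wp_copy, ne_eq, Nat.reduceEqDiff, not_false_eq_true,
          State.setReg_reg, if_true, if_false, h₅.hLev, k₅.reg vStep (by decide), hS₄]
        simp)) fun σ₆ e₆ k₆ => ?_
    have h₆ := h₅.keep k₆ (by decide) (by decide)
    have r₆ : ∀ y ∈ [cPos, cStep, vMark], σ₆.reg y = σ.reg y := fun y hy => by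
      simp only [List.mem_cons, List.not_mem_nil, or_false] at hy
      rcases hy with rfl | rfl | rfl <;>
      rw [k₆.reg _ (by decide), k₅.reg _ (by decide), k₄.reg _ (by decide), k₃.reg _ (by decide),
        k₂.reg _ (by decide), k₁.reg _ (by decide)]
    have hs : F.StepCtx O p k σ₆ :=
      { h₆ with
        pos := by rw [r₆ _ (by decide), hpos]
        step := by rw [r₆ _ (by decide), hstep]
        marked := by rw [r₆ _ (by decide), hmk]
        gain := by rw [k₆.reg _ (by decide), k₅.reg _ (by decide), e₄]
        diff := by rw [k₆.reg _ (by decide), e₅]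
        abs := e₆.1 }
    have hl₆ := hl₃
    rw [← k₄.arr aCh (by decide), ← k₄.arr aVal (by decide), ← k₅.arr aCh (by decide),
      ← k₅.arr aVal (by decide), ← k₆.arr aCh (by decide), ← k₆.arr aVal (by decide)] at hl₆
    refine ((runs_forDown (N := F.L + 1) (B := 96 * F.S + 6 * F.L + 100)
      (fun b σ' => F.Layer O C₀ V₀ p (fun b' _ => if b ≤ b' then k else k + 1)
        (σ'.arr aCh) (σ'.arr aVal))
      (by rw [e₆.2]; rfl) h₆.one (by decide) (by decide) (by decide)
      (hl₆.congr fun b' hb' e' he' => by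
        have : ¬ F.L + 1 ≤ b' := by omega
        simp only [this, if_false])
      (fun _ _ _ h => h) (fun b hb σ' hl' hb' hk' => ?_)).le ?_).imp fun σ₆ hl₆ k₆ => ?_
    · exact runs_budget (hs.keep hk' (by decide) (by decide) (by decide)) hk hadm (by omega) hb' hl'
    · simp only [size, copy, Prog.abs, neg, admProg, costProg, skip, Nat.add_assoc, Nat.reduceAdd]
      omega
    · exact hl₆.congr fun b' _ e' _ => by simp
  · rw [e₃.2] at hadm
    refine (runs_wp (c := skip) rfl ?_).le ?_
    · exact hl₃.skip (k := k) fun b' hb' e he => Or.inr ⟨rfl, rfl, fun h => hadm h.2⟩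
    · simp only [size, skip, admProg, neg]; omega

/-- The loop counter over the shifted steps serves as the common threshold of all cells of the
layer. -/
theorem runs_position {σ : State} {p : ℕ} (h : F.Ctx σ) (hp : p < F.P)
    (hpos : σ.reg cPos = p) (hl : F.Tab O (p + 1) (σ.arr aCh) (σ.arr aVal)) :
    Runs O positionProg σ
      ((2 * F.L + 1) * ((F.L + 1) * (96 * F.S + 6 * F.L + 102) + 6 * F.L + 102) + 10) fun σ' =>
      F.Tab O p (σ'.arr aCh) (σ'.arr aVal) := by
  unfold positionProg
  refine Runs.bind (runs_wp (Q := fun σ' => σ'.reg vCol = F.E p ∧ σ'.reg vX = F.X p ∧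
    σ'.reg vQ = F.q p ∧ σ'.reg vMark = F.mark p ∧ σ'.reg cStep = (2 * F.L + 1 : ℕ)) rfl
    (by
      simp only [wp, wp_copy, ne_eq, Nat.reduceEqDiff, not_false_eq_true, State.setReg_reg,
        State.setReg_arr, if_true, if_false, hpos, h.hE, h.hX, h.hq, h.hmark, h.hSteps, and_self]))
    fun σ₁ e₁ k₁ => ?_
  have h₁ := h.keep k₁ (by decide) (by decide)
  obtain ⟨e1, e2, e3, e4, e5⟩ := e₁
  refine ((runs_forDown (N := 2 * F.L + 1)
    (B := (F.L + 1) * (96 * F.S + 6 * F.L + 102) + 6 * F.L + 100)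
    (fun k σ' => F.Layer O (σ.arr aCh) (σ.arr aVal) p (fun _ _ => k) (σ'.arr aCh) (σ'.arr aVal))
    (by rw [e5]; rfl) h₁.one (by decide) (by decide) (by decide)
    (by rw [k₁.arr aCh (by decide), k₁.arr aVal (by decide)]; exact hl.layer)
    (fun _ _ _ h => h) (fun k hk σ' hl' hk' hkeep => ?_)).le ?_).imp fun σ₂ hl₂ k₂ => hl₂.tab hl hp
  · exact runs_step (h₁.keep hkeep (by decide) (by decide)) (by omega)
      (by rw [hkeep.reg _ (by decide), k₁.reg _ (by decide), hpos]) hk'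
      (by rw [hkeep.reg _ (by decide), e4]) (by rw [hkeep.reg _ (by decide), e2])
      (by rw [hkeep.reg _ (by decide), e3]) (by rw [hkeep.reg _ (by decide), e1]) hl'
  · simp only [size, copy, Nat.add_assoc, Nat.reduceAdd]
    omega

/-! ### The whole table and the move read off from it. -/

/-- The running time of `tableProg`. -/
def tableTime (P L S : ℕ) : ℕ :=
  3 * ((P + 1) * (L + 1) * (2 * S + 1)) + (L + 1) * (6 * S + 3 * L + 29) +
    P * ((2 * L + 1) * ((L + 1) * (96 * S + 6 * L + 102) + 6 * L + 102) + 12) + 20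

theorem DP.idx_lt {F : DP} {p b e : ℕ} (hp : p ≤ F.P) (hb : b ≤ F.L) (he : e < F.w) :
    (p * (F.L + 1) + b) * F.w + e < (F.P + 1) * (F.L + 1) * F.w := by
  calc (p * (F.L + 1) + b) * F.w + e < (p * (F.L + 1) + b) * F.w + F.w := by omega
    _ = (p * (F.L + 1) + b + 1) * F.w := by ring
    _ ≤ ((F.P + 1) * (F.L + 1)) * F.w := by
        refine Nat.mul_le_mul_right _ ?_
        calc p * (F.L + 1) + b + 1 ≤ p * (F.L + 1) + (F.L + 1) := by omega
          _ = (p + 1) * (F.L + 1) := by ring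
          _ ≤ _ := Nat.mul_le_mul_right _ (by omega)

/-- Only the choices are cleared, because values are meaningful only at cells with positive choice.
In the final layer the cell with residual `S` is defined for every budget, as the norm need not be
used up. -/
theorem runs_table {σ : State} (h : F.Ctx σ) :
    Runs O tableProg σ (tableTime F.P F.L F.S) fun σ' =>
      F.Tab O 0 (σ'.arr aCh) (σ'.arr aVal) := by
  have hSw : F.S < F.w := by simp only [DP.w]; omega
  unfold tableProg
  refine Runs.bind (runs_wp (Q := fun σ' => σ'.reg 60 = 0 ∧
      σ'.reg cPos = ((F.P + 1) * (F.L + 1) * F.w : ℕ)) rfl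
    (by
      simp only [wp, wp_copy, ne_eq, Nat.reduceEqDiff, not_false_eq_true, State.setReg_reg,
        if_true, if_false, h.hTot, and_self])) fun σ₁ e₁ k₁ => ?_
  have h₁ := h.keep k₁ (by decide) (by decide)
  refine Runs.bind (runs_forDown (N := (F.P + 1) * (F.L + 1) * F.w) (B := 1)
    (fun k σ' => ∀ i : ℕ, k ≤ i → i < (F.P + 1) * (F.L + 1) * F.w → σ'.arr aCh i = 0)
    (by rw [e₁.2]; rfl) h₁.one (by decide) (by decide) (by decide)
    (fun i h1 h2 => by omega) (fun _ _ _ h => h) (fun k hk σ' hi hk' hkeep => runs_wp rfl ?_))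
    fun σ₂ e₂ k₂ => ?_
  · have h60 : σ'.reg 60 = 0 := by rw [hkeep.reg _ (by decide), e₁.1]
    intro i h1 h2
    simp only [State.setCell_arr, if_true, hk', h60, Function.update_apply, Nat.cast_inj]
    split_ifs with h3
    · rfl
    · exact hi i (by omega) h2
  have h₂ := h₁.keep k₂ (by decide) (by decide)
  have h60₂ : σ₂.reg 60 = 0 := by rw [k₂.reg _ (by decide), e₁.1]
  refine Runs.bind (runs_wp (Q := fun σ' => σ'.reg cBud = (F.L + 1 : ℕ)) rfl
    (by rw [wp_copy (by decide)]; simp [h₂.hLev])) fun σ₃ e₃ k₃ => ?_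
  have h₃ := h₂.keep k₃ (by decide) (by decide)
  refine Runs.bind (runs_forDown (N := F.L + 1) (B := 6 * F.S + 3 * F.L + 27)
    (fun j σ' => (∀ p ≤ F.P, ∀ b ≤ F.L, ∀ e < F.w,
      σ'.arr aCh (F.idx p b e) = if p = F.P ∧ j ≤ b ∧ e = F.S then 1 else 0) ∧
      ∀ b ≤ F.L, j ≤ b → σ'.arr aVal (F.idx F.P b F.S) = 0)
    (by rw [e₃]; rfl) h₃.one (by decide) (by decide) (by decide)
    ⟨fun p hp b hb e he => ?_, fun b h1 h2 => by omega⟩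
    (fun _ _ _ h => h) (fun j hj σ' hi hj' hkeep => ?_))
    fun σ₄ e₄ k₄ => ?_
  · have : ¬ (p = F.P ∧ F.L + 1 ≤ b ∧ e = F.S) := by omega
    rw [if_neg this, k₃.arr _ (by decide)]
    exact e₂ _ (Nat.zero_le _) (DP.idx_lt hp hb he)
  · have h' := h₃.keep hkeep (by decide) (by decide)
    refine Runs.bind (runs_rowProg h' h'.hP hj' (by decide) (by decide) (by decide))
      fun σ₄ e₄ k₄ => ?_
    have h₄ := h'.keep k₄ (by decide) (by decide)
    have h60₄ : σ₄.reg 60 = 0 := by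
      rw [k₄.reg _ (by decide), hkeep.reg _ (by decide), k₃.reg _ (by decide), h60₂]
    have hidx : F.idx F.P j 0 + F.S = F.idx F.P j F.S := by simp [DP.idx]
    refine (runs_wp rfl ?_).le (by simp only [size]; omega)
    simp only [wp, State.setReg_reg, State.setCell_arr, State.setCell_reg, State.setReg_arr,
      Nat.reduceEqDiff, if_true, if_false, e₄, h₄.hS, h₄.one, h60₄, hidx]
    rw [k₄.arr _ (by decide), k₄.arr _ (by decide)]
    refine ⟨fun p hp b hb e he => ?_, fun b hb hjb => ?_⟩
    · rw [Function.update_apply, hi.1 p hp b hb e he]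
      by_cases h1 : p = F.P ∧ b = j ∧ e = F.S
      · obtain ⟨rfl, rfl, rfl⟩ := h1
        simp
      · have h2 : F.idx p b e ≠ F.idx F.P j F.S := fun hcon =>
          h1 (F.idx_inj hb (by omega) he hSw hcon)
        have h3 : (p = F.P ∧ j + 1 ≤ b ∧ e = F.S) ↔ (p = F.P ∧ j ≤ b ∧ e = F.S) := by omega
        rw [if_neg h2]
        simp only [h3]
    · rw [Function.update_apply]
      split_ifs with h1
      · rfl
      · refine hi.2 b hb ?_
        by_contra h2
        exact h1 (by rw [show b = j by omega])
  have h₄ := h₃.keep k₄ (by decide) (by decide)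
  refine Runs.bind (runs_wp (Q := fun σ' => σ'.reg cPos = F.P) rfl
    (by rw [wp_copy (by decide)]; simp [h₄.hP])) fun σ₅ e₅ k₅ => ?_
  have h₅ := h₄.keep k₅ (by decide) (by decide)
  refine (runs_forDown (N := F.P)
    (B := (2 * F.L + 1) * ((F.L + 1) * (96 * F.S + 6 * F.L + 102) + 6 * F.L + 102) + 10)
    (fun p σ' => F.Tab O p (σ'.arr aCh) (σ'.arr aVal))
    (by rw [e₅]; rfl) h₅.one (by decide) (by decide) (by decide) ?_
    (fun _ _ _ h => h) (fun p hp σ' hi hp' hkeep =>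
      runs_position (h₅.keep hkeep (by decide) (by decide)) hp hp' hi)).le ?_
  · rw [k₅.arr _ (by decide), k₅.arr _ (by decide)]
    refine ⟨fun b hb e he => ?_, fun p' h1 h2 => by omega, fun p' hp' b hb e he => ?_⟩
    · rw [e₄.1 F.P le_rfl b hb e he]
      refine ⟨by simp, fun h1 => ?_⟩
      rw [h1]
      exact e₄.2 b hb (Nat.zero_le _)
    · rw [e₄.1 p' hp'.le b hb e he, if_neg (by omega)]
  · simp only [size, copy, Nat.add_assoc, Nat.reduceAdd, tableTime, DP.w]
    omega

/-- The phase, the step length and the point are the data that change during the run. Reading them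
off from the new state restores a context after any move. -/
theorem DP.Ctx.keep_data {F : DP} {σ σ' : State} {R A : List ℕ} (h : F.Ctx σ)
    (hk : Keep R A σ σ') (hR : ∀ y < 29, y ≠ rPhase → y ≠ rLam → y ∉ R)
    (hA : ∀ a ∈ [aLow, aUpp, aCol, aMark, aQ], a ∉ A) :
    ({ F with phase := σ'.reg rPhase, lam := σ'.reg rLam, X := fun p => σ'.arr aX p } : DP).Ctx
      σ' := by
  have r : ∀ y < 29, y ≠ rPhase → y ≠ rLam → σ'.reg y = σ.reg y :=
    fun y hy h1 h2 => hk.reg y (hR y hy h1 h2)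
  have a : ∀ y ∈ [aLow, aUpp, aCol, aMark, aQ], σ'.arr y = σ.arr y := fun y hy =>
    hk.arr y (hA y hy)
  exact
    { one := (r 4 (by decide) (by decide) (by decide)).trans h.one
      hL := (r rL (by decide) (by decide) (by decide)).trans h.hL
      hR := (r rTop (by decide) (by decide) (by decide)).trans h.hR
      hS := (r rShift (by decide) (by decide) (by decide)).trans h.hS
      hw := (r rWidth (by decide) (by decide) (by decide)).trans h.hw
      hP := (r rPos (by decide) (by decide) (by decide)).trans h.hP
      hphase := rfl
      hlam := rfl
      hTot := (r rTot (by decide) (by decide) (by decide)).trans h.hTot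
      hLev := (r rLevels (by decide) (by decide) (by decide)).trans h.hLev
      hSteps := (r rSteps (by decide) (by decide) (by decide)).trans h.hSteps
      hE := fun p => (congrFun (a aCol (by decide)) p).trans (h.hE p)
      hmark := fun p => (congrFun (a aMark (by decide)) p).trans (h.hmark p)
      hX := fun _ => rfl
      hq := fun p => (congrFun (a aQ (by decide)) p).trans (h.hq p)
      hlo := (a aLow (by decide)).trans h.hlo
      hhi := (a aUpp (by decide)).trans h.hhi }

/-- The walk repeats the recursion of `Path`: registers hold the current cell, and the stored choice
minus `1` minus `L` is the next step. -/
theorem runs_apply {σ : State} {h : ℕ → ℤ} (hc : F.Ctx σ) (hp : F.Path F.P 0 F.L F.S h)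
    (hf : F.Follows (σ.arr aCh) F.P 0 F.L F.S h) :
    Runs O applyProg σ (F.P * (6 * F.S + 9 * F.L + 60) + 20) fun σ' =>
      ∀ i : ℕ, σ'.arr aX i = if i < F.P then F.X i + F.lam * h i else F.X i := by
  unfold applyProg
  refine Runs.bind (runs_wp (Q := fun σ' => σ'.reg cPos = 0 ∧ σ'.reg cBud = F.L ∧
      σ'.reg cRes = F.S ∧ σ'.reg cStep = F.P) rfl
    (by
      simp only [wp, wp_copy, ne_eq, Nat.reduceEqDiff, not_false_eq_true, State.setReg_reg,
        if_true, if_false, hc.hL, hc.hS, hc.hP, and_self])) fun σ₁ e₁ k₁ => ?_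
  have h₁ := hc.keep k₁ (by decide) (by decide)
  refine ((runs_forDown (N := F.P) (B := 6 * F.S + 9 * F.L + 58)
    (fun k σ' => ∃ p b e : ℕ, p + k = F.P ∧ b ≤ F.L ∧ e < F.w ∧ F.Path k p b e h ∧
      F.Follows (σ.arr aCh) k p b e h ∧ σ'.reg cPos = p ∧ σ'.reg cBud = b ∧ σ'.reg cRes = e ∧
      ∀ i : ℕ, σ'.arr aX i = if i < p then F.X i + F.lam * h i else F.X i)
    (by rw [e₁.2.2.2]; rfl) h₁.one (by decide) (by decide) (by decide)
    ⟨0, F.L, F.S, by omega, le_rfl, by simp only [DP.w]; omega, hp, hf, by simp [e₁.1], e₁.2.1,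
      e₁.2.2.1, fun i => by simp [h₁.hX]⟩
    (fun _ _ _ h => by simpa using h) (fun k hk σ' hi hk' hkeep => ?_)).le ?_).imp
    fun σ₂ e₂ k₂ => ?_
  · obtain ⟨p, b, e, hpk, hb, he, ⟨t1, -, -, t4, t5, t6⟩, ⟨f1, f2⟩, hpos, hbud, hres, hX⟩ := hi
    have h' := h₁.keep_data hkeep (by decide) (by decide)
    refine Runs.bind (runs_rowProg h' hpos hbud (by decide) (by decide) (by decide))
      fun σ₂ e₂ k₂ => ?_
    have h₂ := h'.keep k₂ (by decide) (by decide)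
    have r₂ : ∀ y ∈ [cPos, cBud, cRes], σ₂.reg y = σ'.reg y := fun y hy => by
      simp only [List.mem_cons, List.not_mem_nil, or_false] at hy
      rcases hy with rfl | rfl | rfl <;> rw [k₂.reg _ (by decide)]
    have hch : σ₂.arr aCh = σ.arr aCh := by
      rw [k₂.arr _ (by decide), hkeep.arr _ (by decide), k₁.arr _ (by decide)]
    have e₂' : σ₂.reg 59 = F.idx p b 0 := e₂
    have hidx : F.idx p b 0 + (e : ℕ) = F.idx p b e := by simp [DP.idx]
    refine Runs.bind (runs_wp (Q := fun σ' => σ'.reg vStep = h p) rfl (by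
      simp only [wp, State.setReg_reg, State.setReg_arr, Nat.reduceEqDiff, if_true, if_false,
        e₂', r₂ cRes (by decide), hres, hidx, hch, f1, h₂.one, h₂.hL]
      ring)) fun σ₃ e₃ k₃ => ?_
    have h₃ := h₂.keep k₃ (by decide) (by decide)
    have hlam : σ₃.reg rLam = F.lam := by
      rw [k₃.reg _ (by decide), k₂.reg _ (by decide), hkeep.reg _ (by decide), h₁.hlam]
    refine Runs.bind (runs_mul hlam e₃ h₃.one (by decide) (by decide) (by decide) (by decide)
      (by decide) (by decide)) fun σ₄ e₄ k₄ => ?_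
    have h₄ := h₃.keep k₄ (by decide) (by decide)
    have r₄ : ∀ y ∈ [cPos, cBud, cRes], σ₄.reg y = σ'.reg y := fun y hy => by
      rw [← r₂ y hy]
      simp only [List.mem_cons, List.not_mem_nil, or_false] at hy
      rcases hy with rfl | rfl | rfl <;> rw [k₄.reg _ (by decide), k₃.reg _ (by decide)]
    have hS₄ : σ₄.reg vStep = h p := by rw [k₄.reg _ (by decide), e₃]
    have hX₄ : σ₄.arr aX = σ'.arr aX := by
      rw [k₄.arr _ (by decide), k₃.arr _ (by decide), k₂.arr _ (by decide)]
    have hcol : σ₄.arr aCol p = F.E p := h₄.hE p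
    refine Runs.bind (runs_wp (Q := fun σ' => (∀ i : ℕ, σ'.arr aX i =
        if i < p + 1 then F.X i + F.lam * h i else F.X i) ∧
        σ'.reg cBud = (b - (h p).natAbs : ℕ) ∧ σ'.reg vCol = F.E p) rfl ?_) fun σ₅ e₅ k₅ => ?_
    · simp only [wp, wp_abs, ne_eq, not_false_eq_true, State.setReg_reg, State.setReg_arr,
        State.setCell_arr, State.setCell_reg, Nat.reduceEqDiff, if_true, if_false, e₄, hS₄, hcol,
        r₄ cPos (by decide), r₄ cBud (by decide), hpos, hbud, hX₄, and_true]
      refine ⟨fun i => ?_, by rw [← Int.natCast_natAbs]; omega⟩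
      rw [Function.update_apply, hX, hX]
      by_cases hip : i = p
      · subst hip
        simp
      · have h1 : (i : ℤ) ≠ p := by exact_mod_cast hip
        have h2 : i < p + 1 ↔ i < p := by omega
        simp only [h1, if_false, h2]
    have h₅ := h₄.keep_data k₅ (by decide) (by decide)
    have hS₅ : σ₅.reg vStep = h p := by rw [k₅.reg _ (by decide), hS₄]
    refine Runs.bind (runs_mul e₅.2.2 hS₅ h₅.one (by decide) (by decide) (by decide) (by decide)
      (by decide) (by decide)) fun σ₆ e₆ k₆ => ?_
    have h₆ := h₅.keep k₆ (by decide) (by decide)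
    have r₆ : ∀ y ∈ [cPos, cRes], σ₆.reg y = σ'.reg y := fun y hy => by
      rw [← r₄ y (by simp only [List.mem_cons, List.not_mem_nil, or_false] at hy ⊢; tauto)]
      simp only [List.mem_cons, List.not_mem_nil, or_false] at hy
      rcases hy with rfl | rfl <;> rw [k₆.reg _ (by decide), k₅.reg _ (by decide)]
    refine (runs_wp rfl ?_).le ?_
    · refine ⟨p + 1, b - (h p).natAbs, ((e : ℤ) - F.E p * h p).toNat, by omega, by omega,
        by omega, t6, f2, ?_, ?_, ?_, ?_⟩
      · simp [r₆ cPos (by decide), hpos, h₆.one]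
      · simp only [State.setReg_reg, Nat.reduceEqDiff, if_false]
        rw [k₆.reg _ (by decide), e₅.2.1]
      · simp only [State.setReg_reg, Nat.reduceEqDiff, if_true, if_false,
          r₆ cRes (by decide), hres, e₆]
        omega
      · simp only [State.setReg_arr]
        rw [k₆.arr _ (by decide)]
        exact e₅.1
    · simp only [size, Prog.abs, copy, neg, Nat.add_assoc, Nat.reduceAdd]
      omega
  · simp only [size, copy, Nat.add_assoc, Nat.reduceAdd]
    omega
  · obtain ⟨p, -, -, hpk, -, -, -, -, -, -, -, hX⟩ := e₂
    obtain rfl : p = F.P := by omega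
    exact hX

/-- One optimal augmentation step. -/
def moveProg : Prog := tableProg ;; applyProg

/-- The running time of `moveProg`. -/
def moveTime (P L S : ℕ) : ℕ := tableTime P L S + (P * (6 * S + 9 * L + 60) + 20)

/-- The existence of some path guarantees that the start cell `(0, L, S)` is defined; its entry is
then attained and minimal. -/
theorem runs_move {σ : State} (hc : F.Ctx σ) (hne : ∃ h, F.Path F.P 0 F.L F.S h) :
    Runs O moveProg σ (moveTime F.P F.L F.S) fun σ' =>
      ∃ h, F.Path F.P 0 F.L F.S h ∧
        (∀ h', F.Path F.P 0 F.L F.S h' → F.pathCost O F.P 0 h ≤ F.pathCost O F.P 0 h') ∧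
        ∀ i : ℕ, σ'.arr aX i = if i < F.P then F.X i + F.lam * h i else F.X i := by
  have hw : F.S < F.w := by simp only [DP.w]; omega
  unfold moveProg
  refine Runs.bind (runs_table hc) fun σ₁ ht k₁ => ?_
  have h₁ := hc.keep k₁ (by decide) (by decide)
  obtain ⟨h₀, hh₀⟩ := hne
  obtain ⟨h, hp, hcost, hf⟩ := ht.exists_path (zero_add _) le_rfl hw
    (ht.le_pathCost (zero_add _) le_rfl hw hh₀).1
  refine ((runs_apply (O := O) h₁ hp hf).le (by simp only [moveTime]; omega)).imp
    fun σ₂ hX _ => ⟨h, hp, fun h' hp' => ?_, hX⟩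
  rw [hcost]
  exact (ht.le_pathCost (zero_add _) le_rfl hw hp').2

end NFoldIP

namespace NFoldIP

open Finset

/-! ### Paths of the dynamic program are short kernel vectors -/

/-- Unrolling the recursion: the residual is `S` minus the prefix sum of the coded columns, and the
budget is `L` minus the norm of the prefix. Staying in the table means that prefix sums are at most
`S` in absolute value, and ending at residual `S` means that the total is zero. -/
theorem DP.path_iff {F : DP} {h : ℕ → ℤ} {m p b e : ℕ}
    (hb : b + ∑ i ∈ range p, (h i).natAbs = F.L)
    (he : (e : ℤ) = F.S - ∑ i ∈ range p, F.E i * h i) :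
    F.Path m p b e h ↔ ∑ i ∈ range (p + m), (h i).natAbs ≤ F.L ∧
      (∀ i, p ≤ i → i < p + m → F.Adm i (F.lam * h i + F.X i) ∧
        (0 < F.mark i → 2 * |∑ j ∈ range i, F.E j * h j| < F.R) ∧
        |∑ j ∈ range (i + 1), F.E j * h j| ≤ F.S) ∧
      ∑ i ∈ range (p + m), F.E i * h i = 0 := by
  induction m generalizing p b e with
  | zero =>
    simp only [Path, add_zero]
    constructor
    · intro h1
      exact ⟨by omega, fun i h2 h3 => by omega, by omega⟩
    · rintro ⟨-, -, h1⟩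
      omega
  | succ m ih =>
    have hmono : ∑ i ∈ range (p + 1), (h i).natAbs ≤ ∑ i ∈ range (p + (m + 1)), (h i).natAbs :=
      sum_le_sum_of_subset (range_subset_range.2 (by omega))
    have hab : ∀ x : ℤ, |x| ≤ F.S ↔ 0 ≤ F.S - x ∧ F.S - x < F.w := fun x => by
      rw [abs_le, DP.w]; push_cast; omega
    have h2 : |(e : ℤ) - F.S| = |∑ i ∈ range p, F.E i * h i| := by
      rw [he, sub_sub_cancel_left, abs_neg]
    have h3 : (e : ℤ) - F.E p * h p = F.S - ∑ i ∈ range (p + 1), F.E i * h i := by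
      rw [he, sum_range_succ]; ring
    have hsucc := sum_range_succ (fun i => (h i).natAbs) p
    simp only [Path]
    constructor
    · rintro ⟨c1, c2, c3, c4, c5, c6⟩
      rw [ih (by omega) (by rw [Int.toNat_of_nonneg c4]; exact h3)] at c6
      have e1 : p + 1 + m = p + (m + 1) := by omega
      rw [e1] at c6
      refine ⟨c6.1, fun i hi hi' => ?_, c6.2.2⟩
      rcases Nat.eq_or_lt_of_le hi with rfl | hi2
      · refine ⟨c2, by rw [← h2]; exact c3, ?_⟩
        rw [hab, ← h3]
        exact ⟨c4, c5⟩
      · exact c6.2.1 i hi2 hi'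
    · rintro ⟨c1, c2, c3⟩
      obtain ⟨d1, d2, d3⟩ := c2 p le_rfl (by omega)
      rw [hab, ← h3] at d3
      refine ⟨by omega, d1, by rw [h2]; exact d2, d3.1, d3.2, ?_⟩
      rw [ih (by omega) (by rw [Int.toNat_of_nonneg d3.1]; exact h3)]
      have e1 : p + 1 + m = p + (m + 1) := by omega
      rw [e1]
      exact ⟨c1, fun i hi hi' => c2 i (by omega) hi', c3⟩

theorem DP.pathCost_eq {O : ℤ → ℤ → ℤ} {F : DP} {h : ℕ → ℤ} (m p : ℕ) :
    F.pathCost O m p h = ∑ i ∈ range m, F.gain O (p + i) (h (p + i)) := by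
  induction m generalizing p with
  | zero => rfl
  | succ m ih =>
    rw [pathCost, ih, sum_range_succ']
    simp only [add_zero, add_assoc, add_comm 1]

/-! ### Digits -/

/-- In base `2D + 1`, digits of absolute value at most `D` represent numbers below half of the next
power, as the geometric sum shows. -/
theorem two_mul_abs_digits_lt {D : ℕ} {v : ℕ → ℤ} (n : ℕ) (hv : ∀ a < n, |v a| ≤ D) :
    2 * |∑ a ∈ range n, v a * (2 * D + 1) ^ a| < (2 * D + 1) ^ n := by
  induction n with
  | zero => simp
  | succ n ih =>
    rw [sum_range_succ]
    have h1 := ih fun a ha => hv a (by omega)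
    have h2 := abs_add_le (∑ a ∈ range n, v a * (2 * D + 1) ^ a) (v n * (2 * D + 1) ^ n)
    have h3 : (0 : ℤ) < (2 * D + 1) ^ n := by positivity
    rw [abs_mul, abs_of_pos h3] at h2
    have h4 := mul_le_mul_of_nonneg_right (hv n (by omega)) h3.le
    rw [pow_succ]
    nlinarith

/-- Two numbers of absolute value below `B / 2` differ by less than `B`. This separates the high
digits from the low ones. -/
theorem eq_zero_of_two_mul_abs_lt {x c B : ℤ} (hx : 2 * |x| < B) (h : 2 * |x + c * B| < B) :
    c = 0 := by
  by_contra hc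
  have h1 : 1 ≤ |c| := Int.one_le_abs hc
  have hB : |B| = B := abs_of_pos (by linarith [abs_nonneg x])
  have h2 : |c * B| = |c| * B := by rw [abs_mul, hB]
  have h3 : |c * B| ≤ |x + c * B| + |x| := by
    calc |c * B| = |(x + c * B) - x| := by ring_nf
      _ ≤ _ := abs_sub _ _
  nlinarith [abs_nonneg x]

/-- The top digit vanishes first, because the lower ones cannot compensate it. -/
theorem digits_eq_zero {D : ℕ} {v : ℕ → ℤ} (n : ℕ) (hv : ∀ a < n, |v a| ≤ D)
    (h : ∑ a ∈ range n, v a * (2 * D + 1) ^ a = 0) : ∀ a < n, v a = 0 := by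
  induction n with
  | zero => intro a ha; omega
  | succ n ih =>
    have h1 := two_mul_abs_digits_lt n fun a ha => hv a (by omega)
    have h0 : v n = 0 := by
      refine eq_zero_of_two_mul_abs_lt h1 ?_
      rw [← sum_range_succ (fun a => v a * (2 * (D : ℤ) + 1) ^ a), h]
      simp only [abs_zero, mul_zero]
      positivity
    rw [sum_range_succ, h0, zero_mul, add_zero] at h
    intro a ha
    rcases Nat.lt_succ_iff_lt_or_eq.1 ha with h2 | rfl
    · exact ih (fun a ha => hv a (by omega)) h a h2
    · exact h0

/-- This justifies the test at marked positions. The low `r` digits belong to the top rows and may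
be arbitrary at a brick boundary, and smallness of the whole number says exactly that the rows of
the brick are balanced. -/
theorem digits_low_iff {D r s : ℕ} {v : ℕ → ℤ} (hv : ∀ a < r + s, |v a| ≤ D) :
    2 * |∑ a ∈ range (r + s), v a * (2 * D + 1) ^ a| < (2 * D + 1) ^ r ↔
      ∀ a < s, v (r + a) = 0 := by
  have h1 := two_mul_abs_digits_lt r fun a ha => hv a (by omega)
  have h2 : ∑ a ∈ range (r + s), v a * (2 * (D : ℤ) + 1) ^ a =
      ∑ a ∈ range r, v a * (2 * (D : ℤ) + 1) ^ a +
        (∑ a ∈ range s, v (r + a) * (2 * (D : ℤ) + 1) ^ a) * (2 * D + 1) ^ r := by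
    rw [sum_range_add, sum_mul]
    congr 1
    exact sum_congr rfl fun a _ => by ring
  rw [h2]
  constructor
  · intro h
    exact digits_eq_zero s (fun a ha => hv _ (by omega)) (eq_zero_of_two_mul_abs_lt h1 h)
  · intro h
    rw [sum_eq_zero (s := range s) fun a ha => by rw [h a (mem_range.1 ha), zero_mul], zero_mul,
      add_zero]
    exact h1

/-! ### The `n`-fold structure of the dynamic program -/

/-- The kernel of the `n`-fold matrix with flat columns: `n` bricks of `tt` columns, `r` top rows
and `s` rows for each brick. -/
def IsKer (n tt r s : ℕ) (col : ℕ → ℕ → ℤ) (h : ℕ → ℤ) : Prop :=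
  (∀ a < r, ∑ j ∈ range (n * tt), col j a * h j = 0) ∧
    ∀ i ≤ n, ∀ a < s, ∑ j ∈ range (i * tt), col j (r + a) * h j = 0

/-- `F` encodes the `n`-fold matrix with columns `col`. -/
structure DP.NFold (F : DP) (n tt r s Δ : ℕ) (col : ℕ → ℕ → ℤ) : Prop where
  tt_pos : 0 < tt
  r_pos : 0 < r
  hP : F.P = n * tt
  hL : F.L = graverBound r s Δ
  hcol : ∀ p a, |col p a| ≤ Δ
  hE : ∀ p < F.P, F.E p = ∑ a ∈ range (r + s), col p a * (2 * (Δ * F.L : ℕ) + 1) ^ a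
  hR : F.R = (2 * (Δ * F.L) + 1) ^ r
  hS : F.S = (2 * (Δ * F.L) + 1) ^ (r + s)
  hmark : ∀ p < F.P, 0 < F.mark p ↔ tt ∣ p

namespace DP.NFold

variable {O : ℤ → ℤ → ℤ} {F : DP} {n tt r s Δ : ℕ} {col : ℕ → ℕ → ℤ}

theorem sum_E (hF : F.NFold n tt r s Δ col) {i : ℕ} (hi : i ≤ F.P) (h : ℕ → ℤ) :
    ∑ j ∈ range i, F.E j * h j =
      ∑ a ∈ range (r + s), (∑ j ∈ range i, col j a * h j) * (2 * (Δ * F.L : ℕ) + 1) ^ a := by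
  simp only [sum_mul]
  rw [sum_comm]
  refine sum_congr rfl fun j hj => ?_
  rw [hF.hE j (by have := mem_range.1 hj; omega), sum_mul]
  exact sum_congr rfl fun a _ => by ring

/-- Every prefix of a vector of norm at most `L` has row sums at most `ΔL`, so the digits never
overflow. -/
theorem abs_sum_le (hF : F.NFold n tt r s Δ col) {h : ℕ → ℤ}
    (hn : ∑ i ∈ range F.P, (h i).natAbs ≤ F.L) {i : ℕ} (hi : i ≤ F.P) (a : ℕ) :
    |∑ j ∈ range i, col j a * h j| ≤ (Δ * F.L : ℕ) := by
  calc |∑ j ∈ range i, col j a * h j| ≤ ∑ j ∈ range i, |col j a * h j| := abs_sum_le_sum_abs _ _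
    _ ≤ ∑ j ∈ range i, Δ * |h j| := sum_le_sum fun j _ => by
        rw [abs_mul]; exact mul_le_mul_of_nonneg_right (hF.hcol j a) (abs_nonneg _)
    _ ≤ ∑ j ∈ range F.P, Δ * |h j| :=
        sum_le_sum_of_subset_of_nonneg (range_subset_range.2 hi) fun _ _ _ => by positivity
    _ = ((Δ * ∑ i ∈ range F.P, (h i).natAbs : ℕ) : ℤ) := by
        push_cast; rw [mul_sum]
    _ ≤ _ := by exact_mod_cast Nat.mul_le_mul_left Δ hn

/-- The paths are exactly the short admissible kernel vectors. -/
theorem path_iff (hF : F.NFold n tt r s Δ col) {h : ℕ → ℤ} :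
    F.Path F.P 0 F.L F.S h ↔ ∑ i ∈ range F.P, (h i).natAbs ≤ F.L ∧
      (∀ i < F.P, F.Adm i (F.lam * h i + F.X i)) ∧ IsKer n tt r s col h := by
  rw [DP.path_iff (by simp) (by simp)]
  simp only [zero_add, Nat.zero_le, forall_true_left]
  refine and_congr_right fun hn => ?_
  have hv : ∀ i ≤ F.P, ∀ a < r + s, |∑ j ∈ range i, col j a * h j| ≤ (Δ * F.L : ℕ) :=
    fun i hi a _ => hF.abs_sum_le hn hi a
  have hbr : ∀ i ≤ n, i * tt ≤ F.P := fun i hi => hF.hP ▸ Nat.mul_le_mul_right _ hi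
  constructor
  · rintro ⟨h1, h2⟩
    rw [hF.sum_E le_rfl] at h2
    have h3 := digits_eq_zero _ (hv F.P le_rfl) h2
    refine ⟨fun i hi => (h1 i hi).1, fun a ha => by rw [← hF.hP]; exact h3 a (by omega),
      fun i hi a ha => ?_⟩
    -- The boundary after the last brick is not a position and carries no mark. There the vanishing
    -- of the total sum takes over.
    rcases Nat.eq_or_lt_of_le hi with rfl | hi'
    · rw [← hF.hP]; exact h3 _ (by omega)
    · have hlt : i * tt < F.P := hF.hP ▸ Nat.mul_lt_mul_of_pos_right hi' hF.tt_pos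
      have h4 := (h1 (i * tt) hlt).2.1 ((hF.hmark _ hlt).2 (Dvd.intro_left i rfl))
      rw [hF.sum_E hlt.le, hF.hR] at h4
      push_cast at h4
      exact (digits_low_iff (D := Δ * F.L) (by exact_mod_cast hv _ hlt.le)).1
        (by push_cast; exact h4) a ha
  · rintro ⟨h1, h2, h3⟩
    have hz : ∀ a < r + s, ∑ j ∈ range F.P, col j a * h j = 0 := by
      intro a ha
      by_cases har : a < r
      · rw [hF.hP]; exact h2 a har
      · have := h3 n le_rfl (a - r) (by omega)
        rwa [← hF.hP, show r + (a - r) = a by omega] at this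
    refine ⟨fun i hi => ⟨h1 i hi, fun hm => ?_, ?_⟩, ?_⟩
    · obtain ⟨k, rfl⟩ := (hF.hmark i hi).1 hm
      have hk : k ≤ n := by
        rw [hF.hP, mul_comm] at hi
        exact (Nat.lt_of_mul_lt_mul_right hi).le
      rw [hF.sum_E hi.le, hF.hR]
      have := (digits_low_iff (r := r) (s := s) (D := Δ * F.L) (hv _ hi.le)).2 fun a ha => by
        rw [mul_comm]; exact h3 k hk a ha
      push_cast at this ⊢
      exact this
    · rw [hF.sum_E hi, hF.hS]
      have := two_mul_abs_digits_lt _ (hv _ hi)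
      push_cast at this ⊢
      linarith [abs_nonneg (∑ a ∈ range (r + s), (∑ j ∈ range (i + 1), col j a * h j) *
        (2 * ((Δ : ℤ) * F.L) + 1) ^ a)]
    · rw [hF.sum_E le_rfl]
      exact sum_eq_zero fun a ha => by rw [hz a (mem_range.1 ha), zero_mul]

end DP.NFold

/-! ### From flat vectors to vectors over `Fin` -/

theorem sum_brick {n tt k : ℕ} (htt : 0 < tt) (hk : k < n) (g : ℕ → ℤ) :
    ∑ j ∈ range ((k + 1) * tt), g j = ∑ j ∈ range (k * tt), g j +
      ∑ p : Fin (n * tt), if (p : ℕ) / tt = k then g p else 0 := by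
  rw [Fin.sum_univ_eq_sum_range (fun p => if p / tt = k then g p else 0), ← sum_filter]
  have : (range (n * tt)).filter (fun p => p / tt = k) = Ico (k * tt) ((k + 1) * tt) := by
    ext p
    simp only [mem_filter, mem_range, mem_Ico, Nat.div_eq_iff htt]
    have h1 : (k + 1) * tt ≤ n * tt := Nat.mul_le_mul_right _ hk
    have h2 : (k + 1) * tt = k * tt + tt := by ring
    omega
  rw [this, range_eq_Ico, range_eq_Ico,
    sum_Ico_consecutive _ (Nat.zero_le _) (Nat.mul_le_mul_right _ (Nat.le_succ k))]

/-- `IsKer` asks for vanishing sums up to each brick boundary, which is what the dynamic program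
sees. Consecutive boundaries differ by one brick. -/
theorem isKer_iff_nker {n tt r s : ℕ} {col : ℕ → ℕ → ℤ} (htt : 0 < tt) (h : ℕ → ℤ) :
    IsKer n tt r s col h ↔ NKer (fun p : Fin (n * tt) => (p : ℕ) / tt)
      (fun p (a : Fin r) => col p a) (fun p (a : Fin s) => col p (r + a)) fun p => h p := by
  refine and_congr ⟨fun hk a => ?_, fun hk a ha => ?_⟩ ⟨fun hk k a => ?_, fun hk i hi a ha => ?_⟩
  · rw [Fin.sum_univ_eq_sum_range (fun p => h p * col p a), ← hk a a.2]
    exact sum_congr rfl fun _ _ => mul_comm _ _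
  · rw [← hk ⟨a, ha⟩, Fin.sum_univ_eq_sum_range (fun p => h p * col p a)]
    exact sum_congr rfl fun _ _ => mul_comm _ _
  · simp only [mul_comm (h _)]
    by_cases hkn : k < n
    · have h1 := sum_brick htt hkn fun p => col p (r + a) * h p
      rw [hk (k + 1) hkn a a.2, hk k hkn.le a a.2] at h1
      linarith
    · refine sum_eq_zero fun p _ => if_neg fun hp => hkn ?_
      rw [← hp]
      exact (Nat.div_lt_iff_lt_mul htt).2 p.2
  · induction i with
    | zero => simp
    | succ i ih =>
      have h1 := hk i ⟨a, ha⟩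
      simp only [mul_comm (h _)] at h1
      rw [sum_brick htt hi, ih (by omega), zero_add]
      exact h1

theorem IsKer.sub {n tt r s : ℕ} {col : ℕ → ℕ → ℤ} {g h : ℕ → ℤ} (hh : IsKer n tt r s col h)
    (hg : IsKer n tt r s col g) : IsKer n tt r s col (h - g) := by
  refine ⟨fun a ha => ?_, fun i hi a ha => ?_⟩ <;>
  simp only [Pi.sub_apply, mul_sub, sum_sub_distrib]
  · rw [hh.1 a ha, hg.1 a ha, sub_zero]
  · rw [hh.2 i hi a ha, hg.2 i hi a ha, sub_zero]

theorem isKer_zero {n tt r s : ℕ} {col : ℕ → ℕ → ℤ} : IsKer n tt r s col fun _ => 0 :=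
  ⟨fun _ _ => by simp, fun _ _ _ _ => by simp⟩

theorem IsKer.smul {n tt r s : ℕ} {col : ℕ → ℕ → ℤ} {h : ℕ → ℤ} (hh : IsKer n tt r s col h)
    (m : ℤ) : IsKer n tt r s col (m • h) := by
  refine ⟨fun a ha => ?_, fun i hi a ha => ?_⟩ <;>
  simp only [Pi.smul_apply, smul_eq_mul, mul_left_comm _ m, ← mul_sum]
  · rw [hh.1 a ha, mul_zero]
  · rw [hh.2 i hi a ha, mul_zero]

end NFoldIP

namespace NFoldIP

open Finset

/-! ### Improving steps found by the dynamic program -/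

theorem dconvex_abs : DConvex fun v => |v| := by
  intro x a b hab
  have h : (0 ≤ a ∧ 0 ≤ b) ∨ (a ≤ 0 ∧ b ≤ 0) := by
    rcases lt_trichotomy a 0 with h | rfl | h
    · exact Or.inr ⟨h.le, by nlinarith⟩
    · omega
    · exact Or.inl ⟨h.le, by nlinarith⟩
  dsimp only
  rcases abs_cases (x + a) with h1 | h1 <;> rcases abs_cases (x + b) with h2 | h2 <;>
  rcases abs_cases x with h3 | h3 <;> rcases abs_cases (x + a + b) with h4 | h4 <;> omega

theorem dconvex_zero : DConvex fun _ => 0 := fun _ _ _ _ => le_rfl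

theorem DP.dconvex_cost {O : ℤ → ℤ → ℤ} (hO : ∀ q, DConvex (O q)) (F : DP) (p : ℕ) :
    DConvex (F.cost O p) := by
  unfold DP.cost
  split_ifs
  · exact hO _
  · exact dconvex_abs
  · exact dconvex_zero

/-- The admissible values form an interval, so conformal parts of an admissible move are admissible.
-/
theorem DP.Adm.between {F : DP} {p : ℕ} {v v' u : ℤ} (h : F.Adm p v) (h' : F.Adm p v')
    (hu : (v ≤ u ∧ u ≤ v') ∨ (v' ≤ u ∧ u ≤ v)) : F.Adm p u := by
  rcases h with h | h
  · rcases h' with h' | h'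
    · exact Or.inl (by omega)
    · exact Or.inr h'
  · exact Or.inr h

/-- A function on `ℕ` with given values on `Fin m` and zeros elsewhere. -/
def extendFin {m : ℕ} (g : Fin m → ℤ) (i : ℕ) : ℤ := if h : i < m then g ⟨i, h⟩ else 0

@[simp] theorem extendFin_val {m : ℕ} (g : Fin m → ℤ) (p : Fin m) : extendFin g p = g p := by
  simp [extendFin]

/-- The cost of the values `v` at all positions. -/
def DP.total (O : ℤ → ℤ → ℤ) (F : DP) (v : ℕ → ℤ) : ℤ := ∑ p ∈ range F.P, F.cost O p (v p)

theorem DP.pathCost_total {O : ℤ → ℤ → ℤ} (F : DP) (h : ℕ → ℤ) :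
    F.pathCost O F.P 0 h = F.total O (fun i => F.lam * h i + F.X i) - F.total O F.X := by
  rw [DP.pathCost_eq, total, total, ← sum_sub_distrib]
  simp only [zero_add, gain]

namespace DP.NFold

variable {O : ℤ → ℤ → ℤ} {F : DP} {n tt r s Δ : ℕ} {col : ℕ → ℕ → ℤ}

theorem path_zero (hF : F.NFold n tt r s Δ col) (hX : ∀ i < F.P, F.Adm i (F.X i)) :
    F.Path F.P 0 F.L F.S fun _ => 0 := by
  rw [hF.path_iff]
  exact ⟨by simp, by simpa using hX, isKer_zero⟩

/-- The Graver bound in the form consumed by `exists_improving_conf` and `gap_le`. -/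
theorem graver_step (hF : F.NFold n tt r s Δ col) (h : Fin (n * tt) → ℤ)
    (hh : IsKer n tt r s col (extendFin h)) (h0 : h ≠ 0) :
    ∃ g, Conf g h ∧ g ≠ 0 ∧ IsKer n tt r s col (extendFin g) ∧ norm1 g ≤ F.L := by
  have hx : ∀ g : Fin (n * tt) → ℤ, (fun p : Fin (n * tt) => extendFin g p) = g := fun g =>
    funext (extendFin_val g)
  rw [isKer_iff_nker hF.tt_pos, hx] at hh
  obtain ⟨g, h1, h2, h3, h4⟩ := exists_conf_nker
    (fun (p : Fin (n * tt)) a => hF.hcol p a) (fun p a => hF.hcol p (r + a)) h0 hh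
  exact ⟨g, h1, h2, by rwa [isKer_iff_nker hF.tt_pos, hx], by rwa [hF.hL]⟩

theorem norm1_eq (hF : F.NFold n tt r s Δ col) (g : Fin (n * tt) → ℤ) :
    ∑ i ∈ range F.P, (extendFin g i).natAbs = norm1 g := by
  rw [hF.hP, ← Fin.sum_univ_eq_sum_range fun i => (extendFin g i).natAbs]
  simp [norm1]

theorem total_eq (hF : F.NFold n tt r s Δ col) (v : ℕ → ℤ) :
    F.total O v = sepSum (fun p : Fin (n * tt) => F.cost O p) fun p => v p := by
  rw [total, hF.hP, ← Fin.sum_univ_eq_sum_range fun i => F.cost O i (v i)]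
  rfl

theorem isKer_sub (g h : Fin (n * tt) → ℤ) (hh : IsKer n tt r s col (extendFin h))
    (hg : IsKer n tt r s col (extendFin g)) : IsKer n tt r s col (extendFin (h - g)) := by
  have : extendFin (h - g) = extendFin h - extendFin g := by
    funext i
    simp only [extendFin, Pi.sub_apply]
    split_ifs <;> simp
  rw [this]
  exact hh.sub hg

theorem isKer_smul (m : ℤ) (g : Fin (n * tt) → ℤ) (hg : IsKer n tt r s col (extendFin g)) :
    IsKer n tt r s col (extendFin (m • g)) := by
  have : extendFin (m • g) = m • extendFin g := by
    funext i
    simp only [extendFin, Pi.smul_apply]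
    split_ifs <;> simp
  rw [this]
  exact hg.smul m

theorem isKer_extend (hF : F.NFold n tt r s Δ col) {h : ℕ → ℤ} (hh : IsKer n tt r s col h) :
    IsKer n tt r s col (extendFin fun p : Fin (n * tt) => h p) := by
  rw [isKer_iff_nker hF.tt_pos] at hh ⊢
  simpa using hh

/-- If some kernel move of step length `lam` improves the cost, so does a path. -/
theorem exists_path_neg (hO : ∀ q, DConvex (O q)) (hF : F.NFold n tt r s Δ col)
    (hX : ∀ i < F.P, F.Adm i (F.X i)) (hlam : 0 ≤ F.lam) {h : ℕ → ℤ}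
    (hh : IsKer n tt r s col h) (hadm : ∀ i < F.P, F.Adm i (F.lam * h i + F.X i))
    (hlt : F.total O (fun i => F.lam * h i + F.X i) < F.total O F.X) :
    ∃ g, F.Path F.P 0 F.L F.S g ∧ F.pathCost O F.P 0 g < 0 := by
  rw [hF.total_eq, hF.total_eq] at hlt
  obtain ⟨g, g1, g2, g3, g4⟩ := exists_improving_conf
    (c := fun p : Fin (n * tt) => F.cost O p) (fun p => F.dconvex_cost hO p)
    (fun g h => isKer_sub g h) (hF.graver_step) (fun p => F.X p) F.lam (fun p => h p)
    (hF.isKer_extend hh) (by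
      convert hlt using 2
      funext p
      simp [add_comm])
  refine ⟨extendFin g, hF.path_iff.2 ⟨(hF.norm1_eq g).trans_le g3, fun i hi => ?_, g2⟩, ?_⟩
  · have hi' : i < n * tt := hF.hP ▸ hi
    have h1 : extendFin g i = g ⟨i, hi'⟩ := by simp [extendFin, hi']
    refine (hX i hi).between (hadm i hi) ?_
    rw [h1]
    rcases g1 ⟨i, hi'⟩ with h2 | h2
    · have e1 := mul_nonneg hlam h2.1
      have e2 := mul_le_mul_of_nonneg_left h2.2 hlam
      exact Or.inl (by simp only at e2; omega)
    · have e1 := mul_nonpos_of_nonneg_of_nonpos hlam h2.2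
      have e2 := mul_le_mul_of_nonneg_left h2.1 hlam
      exact Or.inr (by simp only at e2; omega)
  · rw [DP.pathCost_total, hF.total_eq, hF.total_eq]
    have : (fun p : Fin (n * tt) => F.lam * extendFin g p + F.X p) =
        (fun p : Fin (n * tt) => F.X p) + F.lam • g := by
      funext p
      simp [add_comm]
    rw [this]
    linarith

/-- If no path with a power of two as step length gains more than `B`, then the gap to the
optimum is small. -/
theorem gap_le (hO : ∀ q, DConvex (O q)) (hF : F.NFold n tt r s Δ col)
    (hX : ∀ i < F.P, F.Adm i (F.X i)) {h : ℕ → ℤ} (hh : IsKer n tt r s col h)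
    (hadm : ∀ i < F.P, F.Adm i (h i + F.X i)) {B : ℤ} (hB0 : 0 ≤ B)
    (hB : ∀ k : ℕ, (∃ i < F.P, 2 ^ k ≤ |h i|) → ∀ g,
      ({ F with lam := 2 ^ k } : DP).Path F.P 0 F.L F.S g →
      -B ≤ ({ F with lam := 2 ^ k } : DP).pathCost O F.P 0 g) :
    F.total O F.X - F.total O (fun i => h i + F.X i) ≤ 2 * (F.P * F.L) * B := by
  rw [hF.total_eq, hF.total_eq]
  have key := NFoldIP.gap_le
    (c := fun p : Fin (n * tt) => F.cost O p) (fun p => F.dconvex_cost hO p)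
    (fun g h => isKer_sub g h) (hF.graver_step) (fun m g => isKer_smul m g)
    (fun p => F.X p) (fun p => h p) (hF.isKer_extend hh) hB0 (fun k g g1 g2 g3 g4 => ?_)
  · have hcard : (Fintype.card (Fin (n * tt)) : ℤ) = F.P := by rw [Fintype.card_fin, hF.hP]
    have e : (fun p : Fin (n * tt) => F.X p) + (fun p : Fin (n * tt) => h p) =
        fun p : Fin (n * tt) => h p + F.X p := by
      funext p
      simp [add_comm]
    rwa [hcard, e] at key
  · have hF' : ({ F with lam := 2 ^ k } : DP).NFold n tt r s Δ col :=
      ⟨hF.tt_pos, hF.r_pos, hF.hP, hF.hL, hF.hcol, hF.hE, hF.hR, hF.hS, hF.hmark⟩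
    have h0 : (0 : ℤ) < 2 ^ k := by positivity
    have h1 := hB k ?_ (extendFin g) (hF'.path_iff.2
      ⟨(hF.norm1_eq g).trans_le g3, fun i hi => ?_, g1⟩)
    · have h2 := DP.pathCost_total (O := O) ({ F with lam := 2 ^ k } : DP) (extendFin g)
      rw [hF'.total_eq, hF'.total_eq] at h2
      have h3 : (fun p : Fin (n * tt) => (2 ^ k : ℤ) * extendFin g p + F.X p) =
          (fun p : Fin (n * tt) => F.X p) + (2 ^ k : ℤ) • g := by
        funext p
        simp [add_comm]
      change _ = sepSum (fun p : Fin (n * tt) => F.cost O p)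
        (fun p : Fin (n * tt) => (2 ^ k : ℤ) * extendFin g p + F.X p) -
          sepSum (fun p : Fin (n * tt) => F.cost O p) _ at h2
      rw [h3] at h2
      change -B ≤ ({ F with lam := 2 ^ k } : DP).pathCost O F.P 0 (extendFin g) at h1
      change ({ F with lam := 2 ^ k } : DP).pathCost O F.P 0 (extendFin g) = _ at h2
      rw [h2] at h1
      linarith
    -- If `2 ^ k • g` is conformal to `h` and `g` is nonzero, then `2 ^ k ≤ |h p|` for some `p`; so
    -- only finitely many step lengths matter.
    · obtain ⟨p, hp⟩ := Function.ne_iff.1 g2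
      refine ⟨p, by rw [hF.hP]; exact p.2, ?_⟩
      have h5 : 1 ≤ |g p| := Int.one_le_abs hp
      have h6 : |(2 ^ k : ℤ) * g p| = 2 ^ k * |g p| := by rw [abs_mul, abs_of_pos h0]
      have h7 : |(2 ^ k : ℤ) * g p| ≤ |h p| := by
        have := g4 p
        simp only [Pi.smul_apply, smul_eq_mul] at this
        rw [abs_le]
        rcases abs_cases (h p) with h8 | h8 <;> omega
      nlinarith
    · have hi' : i < n * tt := hF.hP ▸ hi
      have h1 : extendFin g i = g ⟨i, hi'⟩ := by simp [extendFin, hi']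
      refine DP.Adm.between (F := F) (hX i hi) (hadm i hi) ?_
      have := g4 ⟨i, hi'⟩
      simp only [Pi.smul_apply, smul_eq_mul] at this
      simp only [h1]
      omega

end DP.NFold

end NFoldIP

namespace NFoldIP

open Finset

/-! ### Instances with flat positions and slack variables -/

/-- The arrays of an instance.  Each brick has, beyond its `t` variables, `r + s` slack variables,
one for each row; the variable `j` of the brick `i` has the position `i * brick + j`. -/
structure Flat where
  (n r s t D N : ℕ)
  (A B b c lo hi : ℤ → ℤ)
  n_pos : 0 < n
  r_pos : 0 < r
  s_pos : 0 < s
  t_pos : 0 < t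
  D_pos : 0 < D
  hA : ∀ z, |A z| ≤ D
  hB : ∀ z, |B z| ≤ D
  hb : ∀ z, |b z| ≤ N
  hc : ∀ z, |c z| ≤ N
  hlo : ∀ z, |lo z| ≤ N
  hhi : ∀ z, |hi z| ≤ N
  lo_neg : lo (-1) = 0
  hi_neg : hi (-1) = 0

theorem sum_range_mul (n m : ℕ) (g : ℕ → ℤ) :
    ∑ p ∈ range (n * m), g p = ∑ i ∈ range n, ∑ j ∈ range m, g (i * m + j) := by
  induction n with
  | zero => simp
  | succ n ih => rw [add_mul, one_mul, sum_range_add, ih, sum_range_succ]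

/-- Division rounded towards zero: the multiple of `lam` stays between `0` and `d`. -/
theorem exists_trunc (d : ℤ) {lam : ℤ} (hlam : 0 < lam) : ∃ k,
    ((0 ≤ lam * k ∧ lam * k ≤ d) ∨ (d ≤ lam * k ∧ lam * k ≤ 0)) ∧ |d - lam * k| ≤ lam - 1 := by
  have key : ∀ d : ℤ, 0 ≤ d → 0 ≤ lam * (d / lam) ∧ lam * (d / lam) ≤ d ∧
      d - lam * (d / lam) ≤ lam - 1 := fun d hd => by
    have h1 := Int.mul_ediv_add_emod d lam
    have h2 := Int.emod_nonneg d hlam.ne'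
    have h3 := Int.emod_lt_of_pos d hlam
    exact ⟨mul_nonneg hlam.le (Int.ediv_nonneg hd hlam.le), by omega, by omega⟩
  rcases le_total 0 d with hd | hd
  · obtain ⟨h1, h2, h3⟩ := key d hd
    exact ⟨d / lam, Or.inl ⟨h1, h2⟩, by rw [abs_of_nonneg (by omega)]; exact h3⟩
  · obtain ⟨h1, h2, h3⟩ := key (-d) (by omega)
    refine ⟨-(-d / lam), ?_⟩
    rw [mul_neg]
    exact ⟨Or.inr ⟨by omega, by omega⟩, by rw [abs_of_nonpos (by omega)]; omega⟩

namespace Flat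

variable (M : Flat)

/-- The number of positions of a brick. -/
def brick : ℕ := M.t + (M.r + M.s)

/-- The number of positions. -/
def size : ℕ := M.n * M.brick

/-- The entry in the row `a` of the column of the position `p`. -/
def col (p a : ℕ) : ℤ :=
  if p % M.brick < M.t then
    if a < M.r then M.A ((p / M.brick : ℕ) * (M.r * M.t : ℕ) + (a * M.t + (p % M.brick) : ℕ))
    else M.B ((p / M.brick : ℕ) * (M.s * M.t : ℕ) + ((a - M.r) * M.t + (p % M.brick) : ℕ))
  else if p % M.brick = M.t + a then 1 else 0

/-- The product of the row `a` with the variables of the brick `i`. -/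
def dot (v : ℕ → ℤ) (i a : ℕ) : ℤ :=
  ∑ j ∈ range M.t, M.col (i * M.brick + j) a * v (i * M.brick + j)

/-- The equations with slack variables. -/
def Sol (v : ℕ → ℤ) : Prop :=
  (∀ a < M.r, ∑ i ∈ range M.n, (M.dot v i a + v (i * M.brick + (M.t + a))) = M.b a) ∧
    ∀ i < M.n, ∀ a < M.s, M.dot v i (M.r + a) + v (i * M.brick + (M.t + (M.r + a))) =
      M.c ((i * M.s + a : ℕ) : ℤ)

/-- The bounds. -/
def Box (v : ℕ → ℤ) : Prop :=
  ∀ i < M.n, ∀ j < M.t, M.lo ((i * M.t + j : ℕ) : ℤ) ≤ v (i * M.brick + j) ∧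
    v (i * M.brick + j) ≤ M.hi ((i * M.t + j : ℕ) : ℤ)

/-- The total absolute value of the slack variables. -/
def slack (v : ℕ → ℤ) : ℤ :=
  ∑ i ∈ range M.n, ∑ a ∈ range (M.r + M.s), |v (i * M.brick + (M.t + a))|

/-- A feasible point. -/
structure Feas (v : ℕ → ℤ) : Prop where
  box : M.Box v
  sol : M.Sol v
  zero : ∀ i < M.n, ∀ a < M.r + M.s, v (i * M.brick + (M.t + a)) = 0

/-- Bound for the slack of a solution rounded to multiples of `lam`, divided by `lam`. -/
def slackBound : ℕ := 2 * ((M.r + M.s) * M.n * M.t * M.D)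

variable {M}

theorem brick_pos : 0 < M.brick := Nat.add_pos_left M.t_pos _

theorem abs_col_le (p a : ℕ) : |M.col p a| ≤ M.D := by
  have := M.D_pos
  unfold col
  split_ifs
  · exact M.hA _
  · exact M.hB _
  · simp only [abs_one]; omega
  · simp

theorem mod_eq {i j : ℕ} (hj : j < M.brick) : (i * M.brick + j) % M.brick = j := by
  rw [Nat.mul_comm, Nat.mul_add_mod, Nat.mod_eq_of_lt hj]

theorem div_eq {i j : ℕ} (hj : j < M.brick) : (i * M.brick + j) / M.brick = i := by
  rw [Nat.mul_comm, Nat.mul_add_div brick_pos, Nat.div_eq_of_lt hj, add_zero]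

theorem col_slack {i a a' : ℕ} (ha : a < M.r + M.s) :
    M.col (i * M.brick + (M.t + a)) a' = if a = a' then 1 else 0 := by
  have h : M.t + a < M.brick := by unfold brick; omega
  rw [col, mod_eq h, if_neg (by omega)]
  congr 1
  exact propext (by omega)

theorem pos_cases {p : ℕ} (hp : p < M.size) :
    (∃ i < M.n, ∃ j < M.t, p = i * M.brick + j) ∨
      ∃ i < M.n, ∃ a < M.r + M.s, p = i * M.brick + (M.t + a) := by
  have h1 : p / M.brick < M.n := (Nat.div_lt_iff_lt_mul brick_pos).2 hp
  have h2 : p % M.brick < M.brick := Nat.mod_lt _ brick_pos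
  have h3 : p = p / M.brick * M.brick + p % M.brick := by
    rw [Nat.mul_comm]; exact (Nat.div_add_mod _ _).symm
  have h4 : M.brick = M.t + (M.r + M.s) := rfl
  by_cases h : p % M.brick < M.t
  · exact Or.inl ⟨_, h1, _, h, h3⟩
  · refine Or.inr ⟨_, h1, p % M.brick - M.t, by omega, ?_⟩
    rwa [Nat.add_sub_cancel' (not_lt.1 h)]

theorem pos_lt {i j : ℕ} (hi : i < M.n) (hj : j < M.brick) : i * M.brick + j < M.size := by
  have : (i + 1) * M.brick ≤ M.n * M.brick := Nat.mul_le_mul_right _ hi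
  rw [add_mul, one_mul] at this
  unfold size
  omega

theorem sum_row (v : ℕ → ℤ) (i : ℕ) {a : ℕ} (ha : a < M.r + M.s) :
    ∑ j ∈ range M.brick, M.col (i * M.brick + j) a * v (i * M.brick + j) =
      M.dot v i a + v (i * M.brick + (M.t + a)) := by
  have h : ∑ j ∈ range M.brick, M.col (i * M.brick + j) a * v (i * M.brick + j) =
      ∑ j ∈ range (M.t + (M.r + M.s)), M.col (i * M.brick + j) a * v (i * M.brick + j) := rfl
  rw [h, sum_range_add]
  congr 1
  rw [sum_eq_single a]
  · rw [col_slack ha, if_pos rfl, one_mul]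
  · intro a' h1 h2
    rw [col_slack (mem_range.1 h1), if_neg h2, zero_mul]
  · intro h1
    exact absurd (mem_range.2 ha) h1

theorem isKer_iff (h : ℕ → ℤ) : IsKer M.n M.brick M.r M.s M.col h ↔
    (∀ a < M.r, ∑ i ∈ range M.n, (M.dot h i a + h (i * M.brick + (M.t + a))) = 0) ∧
      ∀ i < M.n, ∀ a < M.s, M.dot h i (M.r + a) + h (i * M.brick + (M.t + (M.r + a))) = 0 := by
  unfold IsKer
  refine and_congr (forall₂_congr fun a ha => ?_) ⟨fun hk i hi a ha => ?_, fun hk i hi a ha => ?_⟩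
  · rw [sum_range_mul, sum_congr rfl fun i _ => sum_row h i (by omega : a < M.r + M.s)]
  · have h1 := hk (i + 1) hi a ha
    rw [add_mul, one_mul, sum_range_add, hk i hi.le a ha, zero_add, sum_row h i (by omega)] at h1
    exact h1
  · rw [sum_range_mul, sum_congr rfl fun i _ => sum_row h i (by omega : M.r + a < M.r + M.s)]
    exact sum_eq_zero fun j hj => hk j (by have := mem_range.1 hj; omega) a ha

theorem dot_congr {v v' : ℕ → ℤ} {i : ℕ} (h : ∀ j < M.t, v (i * M.brick + j) = v' (i * M.brick + j))
    (a : ℕ) : M.dot v i a = M.dot v' i a :=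
  sum_congr rfl fun j hj => by rw [h j (mem_range.1 hj)]

theorem dot_lin (v v' : ℕ → ℤ) (m : ℤ) (i a : ℕ) :
    M.dot (fun p => m * v p + v' p) i a = m * M.dot v i a + M.dot v' i a := by
  simp only [dot, mul_add, sum_add_distrib, mul_sum, mul_left_comm m]

theorem dot_sub (v v' : ℕ → ℤ) (i a : ℕ) :
    M.dot (fun p => v p - v' p) i a = M.dot v i a - M.dot v' i a := by
  simp only [dot, mul_sub, sum_sub_distrib]

theorem abs_dot_le {v : ℕ → ℤ} {i : ℕ} {C : ℤ} (h : ∀ j < M.t, |v (i * M.brick + j)| ≤ C) (a : ℕ) :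
    |M.dot v i a| ≤ M.t * M.D * C := by
  calc |M.dot v i a| ≤ ∑ j ∈ range M.t, |M.col (i * M.brick + j) a * v (i * M.brick + j)| :=
        abs_sum_le_sum_abs _ _
    _ ≤ ∑ j ∈ range M.t, M.D * C := sum_le_sum fun j hj => by
        rw [abs_mul]
        exact mul_le_mul (abs_col_le _ _) (h j (mem_range.1 hj)) (abs_nonneg _) (by positivity)
    _ = M.t * M.D * C := by rw [sum_const, card_range, nsmul_eq_mul, mul_assoc]

theorem Sol.add_ker {v h : ℕ → ℤ} (hv : M.Sol v) (hh : IsKer M.n M.brick M.r M.s M.col h) (m : ℤ) :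
    M.Sol fun p => m * h p + v p := by
  rw [isKer_iff] at hh
  refine ⟨fun a ha => ?_, fun i hi a ha => ?_⟩
  · have h1 := hv.1 a ha
    have h2 := hh.1 a ha
    simp only [dot_lin, sum_add_distrib, ← mul_sum] at h1 h2 ⊢
    linear_combination h1 + m * h2
  · have h1 := hv.2 i hi a ha
    have h2 := hh.2 i hi a ha
    rw [dot_lin]
    linear_combination h1 + m * h2

theorem Sol.sub {v v' : ℕ → ℤ} (hv : M.Sol v) (hv' : M.Sol v') :
    IsKer M.n M.brick M.r M.s M.col fun p => v p - v' p := by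
  rw [isKer_iff]
  refine ⟨fun a ha => ?_, fun i hi a ha => ?_⟩
  · have h1 := hv.1 a ha
    have h2 := hv'.1 a ha
    simp only [dot_sub, sum_add_distrib, sum_sub_distrib] at h1 h2 ⊢
    linear_combination h1 - h2
  · have h1 := hv.2 i hi a ha
    have h2 := hv'.2 i hi a ha
    rw [dot_sub]
    linear_combination h1 - h2

theorem Sol.congr {v v' : ℕ → ℤ} (hv : M.Sol v) (h : ∀ p < M.size, v' p = v p) : M.Sol v' := by
  have hb : M.brick = M.t + (M.r + M.s) := rfl
  have hd : ∀ i < M.n, ∀ a, M.dot v' i a = M.dot v i a := fun i hi a =>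
    dot_congr (fun j hj => h _ (pos_lt hi (by omega))) a
  refine ⟨fun a ha => ?_, fun i hi a ha => ?_⟩
  · rw [← hv.1 a ha]
    exact sum_congr rfl fun i hi => by
      rw [hd i (mem_range.1 hi), h _ (pos_lt (mem_range.1 hi) (by omega))]
  · rw [← hv.2 i hi a ha, hd i hi, h _ (pos_lt hi (by omega))]

/-! ### Rounding a feasible point to multiples of the step length. -/

/-- An intermediate point of the search for a feasible point: `X` satisfies the bounds, its slack
is divisible by `lam`, and `rem` is the part of the slack that `X` ignores. -/
structure Good (M : Flat) (lam : ℤ) (X rem : ℕ → ℤ) : Prop where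
  box : M.Box X
  sol : M.Sol fun p => X p + rem p
  rem_var : ∀ i < M.n, ∀ j < M.t, rem (i * M.brick + j) = 0
  dvd : ∀ i < M.n, ∀ a < M.r + M.s, lam ∣ X (i * M.brick + (M.t + a))

/-- The difference from `X` to a feasible `z` is rounded towards zero to multiples of `lam`, which
keeps the variables between those of `X` and `z` and hence within the bounds. The slack variables
absorb the change of the rows. What remains in a row is the rounding error and the ignored
remainder, each controlled by `lam - 1`. -/
theorem Good.exists_target {lam : ℤ} {X rem z : ℕ → ℤ} (hlam : 0 < lam) (hg : M.Good lam X rem)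
    (hrem : ∀ i < M.n, ∀ a < M.r + M.s, 0 ≤ rem (i * M.brick + (M.t + a)) ∧
      rem (i * M.brick + (M.t + a)) < lam) (hz : M.Feas z) :
    ∃ h, IsKer M.n M.brick M.r M.s M.col h ∧ M.Box (fun p => lam * h p + X p) ∧
      M.slack (fun p => lam * h p + X p) ≤ M.slackBound * (lam - 1) := by
  choose hx hx1 hx2 using fun p => exists_trunc (z p - X p) hlam
  have hbr : M.brick = M.t + (M.r + M.s) := rfl
  -- A bottom row is repaired by the slack of its own brick. For a top row all slack outside the
  -- brick `0` is cancelled, and the brick `0` collects what is needed. Divisibility of the slack of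
  -- `X` by `lam` makes this possible with multiples of `lam`.
  let h : ℕ → ℤ := fun p =>
    if p % M.brick < M.t then hx p
    else if M.r ≤ p % M.brick - M.t then -M.dot hx (p / M.brick) (p % M.brick - M.t)
    else -(X p / lam) + if p / M.brick = 0 then
      ∑ i ∈ range M.n, X (i * M.brick + p % M.brick) / lam -
        ∑ i ∈ range M.n, M.dot hx i (p % M.brick - M.t) else 0
  have h1 : ∀ i, ∀ j < M.t, h (i * M.brick + j) = hx (i * M.brick + j) := fun i j hj => by
    simp only [h, mod_eq (show j < M.brick by omega), hj, if_true]
  have h2 : ∀ i, ∀ a < M.s, h (i * M.brick + (M.t + (M.r + a))) = -M.dot hx i (M.r + a) :=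
    fun i a ha => by
      have h3 : M.t + (M.r + a) < M.brick := by omega
      simp only [h, mod_eq h3, div_eq h3, Nat.add_sub_cancel_left]
      rw [if_neg (by omega), if_pos (by omega)]
  have h3 : ∀ i, ∀ a < M.r, h (i * M.brick + (M.t + a)) = -(X (i * M.brick + (M.t + a)) / lam) +
      if i = 0 then ∑ i ∈ range M.n, X (i * M.brick + (M.t + a)) / lam -
        ∑ i ∈ range M.n, M.dot hx i a else 0 := fun i a ha => by
    have h3 : M.t + a < M.brick := by omega
    simp only [h, mod_eq h3, div_eq h3, Nat.add_sub_cancel_left]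
    rw [if_neg (by omega), if_neg (by omega)]
  have hd : ∀ i a, M.dot h i a = M.dot hx i a := fun i a => dot_congr (h1 i) a
  have hE : ∀ i < M.n, ∀ a, M.dot (fun p => z p - X p - lam * hx p) i a =
      M.dot z i a - M.dot (fun p => X p + rem p) i a - lam * M.dot hx i a := fun i hi a => by
    rw [dot_congr (v := fun p => X p + rem p) (v' := X)
      fun j hj => by rw [hg.rem_var i hi j hj, add_zero]]
    have h4 := dot_sub (M := M) (fun p => z p - X p) (fun p => lam * hx p) i a
    have h5 := dot_lin (M := M) hx (fun _ => 0) lam i a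
    simp only [add_zero] at h5
    rw [h4, dot_sub, h5]
    simp [dot]
  have hEb : ∀ i a, |M.dot (fun p => z p - X p - lam * hx p) i a| ≤ M.t * M.D * (lam - 1) :=
    fun i a => abs_dot_le (fun j _ => hx2 _) a
  have hdiv : ∀ i < M.n, ∀ a < M.r + M.s, lam * (X (i * M.brick + (M.t + a)) / lam) =
      X (i * M.brick + (M.t + a)) := fun i hi a ha => Int.mul_ediv_cancel' (hg.dvd i hi a ha)
  have hcast : (0 : ℤ) ≤ M.t * M.D := by positivity
  have hone : (1 : ℤ) ≤ M.t * M.D := by exact_mod_cast Nat.mul_pos M.t_pos M.D_pos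
  -- The slack left in a row of one brick: `t * D` times the rounding error of a variable, plus the
  -- remainder, which is at most `lam - 1`.
  set C : ℤ := (M.t * M.D + 1) * (lam - 1) with hC
  have hC0 : 0 ≤ C := by
    rw [hC]; exact mul_nonneg (by omega) (by omega)
  refine ⟨h, (isKer_iff h).2 ⟨fun a ha => ?_, fun i hi a ha => ?_⟩, fun i hi j hj => ?_, ?_⟩
  · rw [sum_congr rfl fun i _ => by rw [hd i a, h3 i a ha], sum_add_distrib, sum_add_distrib,
      sum_neg_distrib, sum_ite_eq', if_pos (mem_range.2 M.n_pos)]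
    ring
  · rw [hd, h2 i a ha]
    ring
  · have h4 := hx1 (i * M.brick + j)
    have h5 := hg.box i hi j hj
    have h6 := hz.box i hi j hj
    simp only [h1 i j hj]
    omega
  · have hbot : ∀ i < M.n, ∀ a < M.s, |lam * h (i * M.brick + (M.t + (M.r + a))) +
        X (i * M.brick + (M.t + (M.r + a)))| ≤ C := fun i hi a ha => by
      have h4 := hg.sol.2 i hi a ha
      have h5 := hz.sol.2 i hi a ha
      rw [hz.zero i hi _ (by omega)] at h5
      have h6 := hE i hi (M.r + a)
      have h7 := hrem i hi (M.r + a) (by omega)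
      have h8 := hEb i (M.r + a)
      rw [h2 i a ha]
      have h9 : lam * -M.dot hx i (M.r + a) + X (i * M.brick + (M.t + (M.r + a))) =
          M.dot (fun p => z p - X p - lam * hx p) i (M.r + a) -
            rem (i * M.brick + (M.t + (M.r + a))) := by
        rw [h6]; linear_combination h4 - h5
      rw [h9, hC]
      refine (abs_sub _ _).trans ?_
      rw [abs_of_nonneg h7.1, add_mul, one_mul]
      omega
    -- A top row sums over all bricks, so its slack variable in the brick `0` may reach `n * C`;
    -- those of the other bricks become zero.
    have htop : ∀ i < M.n, ∀ a < M.r, |lam * h (i * M.brick + (M.t + a)) +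
        X (i * M.brick + (M.t + a))| ≤ if i = 0 then M.n * C else 0 := fun i hi a ha => by
      rw [h3 i a ha]
      by_cases hi0 : i = 0
      · rw [if_pos hi0, if_pos hi0]
        have h4 := hg.sol.1 a ha
        have h5 := hz.sol.1 a ha
        have h9 : lam * (-(X (i * M.brick + (M.t + a)) / lam) +
            (∑ i ∈ range M.n, X (i * M.brick + (M.t + a)) / lam -
            ∑ i ∈ range M.n, M.dot hx i a)) + X (i * M.brick + (M.t + a)) =
            ∑ i ∈ range M.n, (M.dot (fun p => z p - X p - lam * hx p) i a -
              rem (i * M.brick + (M.t + a))) := by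
          have e1 : lam * ∑ i ∈ range M.n, X (i * M.brick + (M.t + a)) / lam =
              ∑ i ∈ range M.n, X (i * M.brick + (M.t + a)) := by
            rw [mul_sum]
            exact sum_congr rfl fun i hi => hdiv i (mem_range.1 hi) a (by omega)
          have e2 := hdiv i hi a (by omega)
          have e3 : ∑ i ∈ range M.n, (M.dot (fun p => z p - X p - lam * hx p) i a -
              rem (i * M.brick + (M.t + a))) = ∑ i ∈ range M.n, (M.dot z i a -
              M.dot (fun p => X p + rem p) i a - lam * M.dot hx i a -
              rem (i * M.brick + (M.t + a))) :=
            sum_congr rfl fun i hi => by rw [hE i (mem_range.1 hi)]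
          have e4 : ∑ i ∈ range M.n, (M.dot z i a + z (i * M.brick + (M.t + a))) =
              ∑ i ∈ range M.n, M.dot z i a :=
            sum_congr rfl fun i hi => by rw [hz.zero i (mem_range.1 hi) a (by omega), add_zero]
          rw [e4] at h5
          rw [e3]
          simp only [sum_sub_distrib, sum_add_distrib, ← mul_sum] at h4 ⊢
          linear_combination h4 - h5 + e1 - e2
        rw [h9]
        calc _ ≤ ∑ i ∈ range M.n, |M.dot (fun p => z p - X p - lam * hx p) i a -
              rem (i * M.brick + (M.t + a))| := abs_sum_le_sum_abs _ _
          _ ≤ ∑ i ∈ range M.n, C := sum_le_sum fun i hi => by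
              have h7 := hrem i (mem_range.1 hi) a (by omega)
              have h8 := hEb i a
              refine (abs_sub _ _).trans ?_
              rw [abs_of_nonneg h7.1, hC, add_mul, one_mul]
              omega
          _ = M.n * C := by rw [sum_const, card_range, nsmul_eq_mul]
      · rw [if_neg hi0, if_neg hi0, add_zero, mul_neg, hdiv i hi a (by omega)]
        simp
    have hsum : M.slack (fun p => lam * h p + X p) ≤
        ∑ i ∈ range M.n, (M.r * (if i = 0 then M.n * C else 0) + M.s * C) := by
      refine sum_le_sum fun i hi => ?_
      rw [sum_range_add]
      refine add_le_add ?_ ?_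
      · refine (sum_le_sum fun a ha => htop i (mem_range.1 hi) a (mem_range.1 ha)).trans ?_
        rw [sum_const, card_range, nsmul_eq_mul]
      · refine (sum_le_sum fun a ha => hbot i (mem_range.1 hi) a (mem_range.1 ha)).trans ?_
        rw [sum_const, card_range, nsmul_eq_mul]
    refine hsum.trans ?_
    rw [sum_add_distrib, ← mul_sum, sum_ite_eq', if_pos (mem_range.2 M.n_pos), sum_const,
      card_range, nsmul_eq_mul]
    have h4 : C ≤ 2 * (M.t * M.D) * (lam - 1) := by
      rw [hC]; exact mul_le_mul_of_nonneg_right (by omega) (by omega)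
    have h5 : (0 : ℤ) ≤ (M.r + M.s) * M.n := by positivity
    have h6 := mul_le_mul_of_nonneg_left h4 h5
    unfold slackBound
    push_cast
    linarith

end Flat

end NFoldIP

namespace NFoldIP

open Finset

/-! ### The dynamic program of an instance -/

/-- `F` is a dynamic program for the instance `M`. -/
structure DP.Rep (F : DP) (M : Flat) : Prop
    extends F.NFold M.n M.brick M.r M.s M.D M.col where
  q_var : ∀ i < M.n, ∀ j < M.t, F.q (i * M.brick + j) = (i * M.t + j : ℕ)
  q_slack : ∀ i < M.n, ∀ a < M.r + M.s, F.q (i * M.brick + (M.t + a)) = -1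
  lo_eq : F.lo = M.lo
  hi_eq : F.hi = M.hi

namespace Flat

variable {M : Flat}

theorem sum_size (g : ℕ → ℤ) : ∑ p ∈ range M.size, g p = ∑ i ∈ range M.n,
    (∑ j ∈ range M.t, g (i * M.brick + j) +
      ∑ a ∈ range (M.r + M.s), g (i * M.brick + (M.t + a))) := by
  unfold size
  rw [sum_range_mul]
  refine sum_congr rfl fun i _ => ?_
  have h : ∑ j ∈ range M.brick, g (i * M.brick + j) =
      ∑ j ∈ range (M.t + (M.r + M.s)), g (i * M.brick + j) := rfl
  rw [h, sum_range_add]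

theorem forall_pos {Q : ℕ → Prop} : (∀ p < M.size, Q p) ↔
    (∀ i < M.n, ∀ j < M.t, Q (i * M.brick + j)) ∧
      ∀ i < M.n, ∀ a < M.r + M.s, Q (i * M.brick + (M.t + a)) := by
  have hbr : M.brick = M.t + (M.r + M.s) := rfl
  refine ⟨fun h => ⟨fun i hi j hj => h _ (pos_lt hi (by omega)),
    fun i hi a ha => h _ (pos_lt hi (by omega))⟩, fun h p hp => ?_⟩
  rcases pos_cases hp with ⟨i, hi, j, hj, rfl⟩ | ⟨i, hi, a, ha, rfl⟩
  · exact h.1 i hi j hj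
  · exact h.2 i hi a ha

/-- The objective, up to a constant. -/
def obj (M : Flat) (O : ℤ → ℤ → ℤ) (v : ℕ → ℤ) : ℤ :=
  ∑ i ∈ range M.n, ∑ j ∈ range M.t, O ((i * M.t + j : ℕ) : ℤ) (v (i * M.brick + j))

theorem slack_nonneg (v : ℕ → ℤ) : 0 ≤ M.slack v :=
  sum_nonneg fun _ _ => sum_nonneg fun _ _ => abs_nonneg _

theorem slack_eq_zero {v : ℕ → ℤ} (h : M.slack v = 0) {i a : ℕ} (hi : i < M.n)
    (ha : a < M.r + M.s) : v (i * M.brick + (M.t + a)) = 0 := by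
  have h1 := (sum_eq_zero_iff_of_nonneg fun i _ => sum_nonneg fun a _ =>
    abs_nonneg (v (i * M.brick + (M.t + a)))).1 h i (mem_range.2 hi)
  exact abs_eq_zero.1 ((sum_eq_zero_iff_of_nonneg fun a _ =>
    abs_nonneg (v (i * M.brick + (M.t + a)))).1 h1 a (mem_range.2 ha))

theorem slack_of_zero {v : ℕ → ℤ}
    (h : ∀ i < M.n, ∀ a < M.r + M.s, v (i * M.brick + (M.t + a)) = 0) : M.slack v = 0 :=
  sum_eq_zero fun i hi => sum_eq_zero fun a ha => by
    rw [h i (mem_range.1 hi) a (mem_range.1 ha), abs_zero]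

theorem slack_congr {v v' : ℕ → ℤ} (h : ∀ p < M.size, v' p = v p) : M.slack v' = M.slack v :=
  sum_congr rfl fun i hi => sum_congr rfl fun a ha => by
    rw [(forall_pos.1 h).2 i (mem_range.1 hi) a (mem_range.1 ha)]

theorem slack_le {v : ℕ → ℤ} {C : ℤ}
    (h : ∀ i < M.n, ∀ a < M.r + M.s, |v (i * M.brick + (M.t + a))| ≤ C) :
    M.slack v ≤ M.n * (M.r + M.s : ℕ) * C := by
  refine (sum_le_sum fun i hi => sum_le_sum fun a ha =>
    h i (mem_range.1 hi) a (mem_range.1 ha)).trans ?_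
  simp only [sum_const, card_range, nsmul_eq_mul, mul_assoc, le_refl]

theorem slackBound_pos : 0 < M.slackBound := by
  have := M.n_pos; have := M.r_pos; have := M.t_pos; have := M.D_pos
  unfold slackBound
  positivity

/-- There are `n * (r + s)` slack variables, each with a remainder below the current scale. So their
joint effect costs at most half of `slackBound` in units of that scale. -/
theorem two_mul_rows_le : 2 * (M.n * (M.r + M.s)) ≤ M.slackBound := by
  have h1 : 1 ≤ M.t * M.D := Nat.mul_pos M.t_pos M.D_pos
  calc 2 * (M.n * (M.r + M.s)) = 2 * ((M.r + M.s) * M.n * 1) := by ring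
    _ ≤ 2 * ((M.r + M.s) * M.n * (M.t * M.D)) := by gcongr
    _ = M.slackBound := by unfold slackBound; ring

theorem Good.congr {lam : ℤ} {X X' rem rem' : ℕ → ℤ} (h : M.Good lam X rem)
    (hX : ∀ p < M.size, X' p = X p) (hr : ∀ p < M.size, rem' p = rem p) : M.Good lam X' rem' := by
  have h1 := forall_pos.1 hX
  have h2 := forall_pos.1 hr
  exact ⟨fun i hi j hj => by rw [h1.1 i hi j hj]; exact h.box i hi j hj,
    h.sol.congr fun p hp => by rw [hX p hp, hr p hp],
    fun i hi j hj => by rw [h2.1 i hi j hj]; exact h.rem_var i hi j hj,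
    fun i hi a ha => by rw [h1.2 i hi a ha]; exact h.dvd i hi a ha⟩

/-- Moving the part of `rem` that is divisible by `lam` to `X`. -/
theorem Good.reduce {lam lam' : ℤ} {X rem : ℕ → ℤ} (hlam : 0 < lam) (hg : M.Good lam' X rem)
    (hd : lam ∣ lam') :
    M.Good lam (fun p => X p + (rem p - rem p % lam)) (fun p => rem p % lam) ∧
      M.slack (fun p => X p + (rem p - rem p % lam)) ≤
        M.slack X + M.slack rem + M.n * (M.r + M.s : ℕ) * lam := by
  refine ⟨⟨fun i hi j hj => ?_, hg.sol.congr fun p _ => by ring, fun i hi j hj => ?_,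
    fun i hi a ha => ?_⟩, ?_⟩
  · simpa [hg.rem_var i hi j hj] using hg.box i hi j hj
  · simp [hg.rem_var i hi j hj]
  · exact dvd_add (hd.trans (hg.dvd i hi a ha)) (Int.dvd_self_sub_emod)
  · have h1 : (M.n * (M.r + M.s : ℕ) * lam : ℤ) =
        ∑ i ∈ range M.n, ∑ a ∈ range (M.r + M.s), lam := by
      simp only [sum_const, card_range, nsmul_eq_mul, mul_assoc]
    rw [h1, slack, slack, slack, ← sum_add_distrib, ← sum_add_distrib]
    refine sum_le_sum fun i _ => ?_
    rw [← sum_add_distrib, ← sum_add_distrib]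
    refine sum_le_sum fun a _ => ?_
    generalize i * M.brick + (M.t + a) = p
    have h2 := Int.emod_nonneg (rem p) hlam.ne'
    have h3 := Int.emod_lt_of_pos (rem p) hlam
    have h4 := abs_add_le (X p) (rem p - rem p % lam)
    have h5 := abs_sub (rem p) (rem p % lam)
    rw [abs_of_nonneg h2] at h5
    omega

/-! ### Invariants of the scaling phase. -/

/-- The state of the search for a feasible point before the scale `2 ^ (k - 1)`. -/
structure ScaleInv (M : Flat) (k : ℕ) (X rem : ℕ → ℤ) : Prop where
  good : M.Good (2 ^ k) X rem
  bound : ∀ p < M.size, |rem p| ≤ 2 ^ k * M.slackBound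
  feas : (∃ z, M.Feas z) → M.slack X + M.slack rem ≤ 2 * M.slackBound * 2 ^ k
  last : k = 0 → (∀ i < M.n, ∀ a < M.r + M.s, rem (i * M.brick + (M.t + a)) = 0) ∧
    ((∃ z, M.Feas z) → M.slack X = 0)

theorem ScaleInv.congr {k : ℕ} {X X' rem rem' : ℕ → ℤ} (h : M.ScaleInv k X rem)
    (hX : ∀ p < M.size, X' p = X p) (hr : ∀ p < M.size, rem' p = rem p) :
    M.ScaleInv k X' rem' := by
  refine ⟨h.good.congr hX hr, fun p hp => by rw [hr p hp]; exact h.bound p hp, ?_, fun hk => ?_⟩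
  · rw [slack_congr hX, slack_congr hr]
    exact h.feas
  · rw [slack_congr hX]
    exact ⟨fun i hi a ha => by rw [(forall_pos.1 hr).2 i hi a ha]; exact (h.last hk).1 i hi a ha,
      (h.last hk).2⟩

/-- The state within the scale `2 ^ k`, with `m` moves to go. -/
structure MoveInv (M : Flat) (k m : ℕ) (X rem : ℕ → ℤ) : Prop where
  good : M.Good (2 ^ k) X rem
  rem_lt : ∀ i < M.n, ∀ a < M.r + M.s, 0 ≤ rem (i * M.brick + (M.t + a)) ∧
    rem (i * M.brick + (M.t + a)) < 2 ^ k
  feas : (∃ z, M.Feas z) → M.slack X ≤ M.slackBound * (2 ^ k - 1) ∨ M.slack X ≤ m * 2 ^ k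

theorem MoveInv.congr {k m : ℕ} {X X' rem rem' : ℕ → ℤ} (h : M.MoveInv k m X rem)
    (hX : ∀ p < M.size, X' p = X p) (hr : ∀ p < M.size, rem' p = rem p) :
    M.MoveInv k m X' rem' := by
  refine ⟨h.good.congr hX hr, fun i hi a ha => ?_, ?_⟩
  · rw [(forall_pos.1 hr).2 i hi a ha]
    exact h.rem_lt i hi a ha
  · rw [slack_congr hX]
    exact h.feas

/-- The constant `5`: halving the scale turns the bound `2 * slackBound` into `4 * slackBound`
units, and moving the multiples of `2 ^ k` from `rem` to `X` adds at most half of `slackBound`. -/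
theorem ScaleInv.move {k : ℕ} {X rem : ℕ → ℤ} (h : M.ScaleInv (k + 1) X rem) :
    M.MoveInv k (5 * M.slackBound) (fun p => X p + (rem p - rem p % 2 ^ k))
      (fun p => rem p % 2 ^ k) := by
  have h0 : (0 : ℤ) < 2 ^ k := by positivity
  obtain ⟨h1, h2⟩ := h.good.reduce h0 (pow_dvd_pow 2 (Nat.le_succ k))
  refine ⟨h1, fun i hi a ha => ⟨Int.emod_nonneg _ h0.ne', Int.emod_lt_of_pos _ h0⟩, fun hz => ?_⟩
  right
  have h3 := h.feas hz
  have h4 : (2 * (M.n * (M.r + M.s : ℕ)) : ℤ) ≤ M.slackBound := by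
    exact_mod_cast two_mul_rows_le (M := M)
  rw [pow_succ] at h3
  push_cast at h2 h4 ⊢
  nlinarith

/-- With no moves left, the second alternative of `feas` forces zero slack, so the slack of `X` is
at most `slackBound * (2 ^ k - 1)` in any case; the remainders add at most half of `slackBound * 2 ^
k`. At `k = 0` both vanish. -/
theorem MoveInv.scale {k : ℕ} {X rem : ℕ → ℤ} (h : M.MoveInv k 0 X rem) :
    M.ScaleInv k X rem := by
  have h0 : (0 : ℤ) < 2 ^ k := by positivity
  have hQ : (1 : ℤ) ≤ M.slackBound := by exact_mod_cast slackBound_pos (M := M)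
  have hf : (∃ z, M.Feas z) → M.slack X ≤ M.slackBound * (2 ^ k - 1) := fun hz => by
    rcases h.feas hz with h1 | h1
    · exact h1
    · have : (0 : ℤ) ≤ M.slackBound * (2 ^ k - 1) := mul_nonneg (by omega) (by omega)
      simp only [Nat.cast_zero, zero_mul] at h1
      omega
  refine ⟨h.good, forall_pos.2 ⟨fun i hi j hj => ?_, fun i hi a ha => ?_⟩, fun hz => ?_,
    fun hk => ⟨fun i hi a ha => ?_, fun hz => ?_⟩⟩
  · rw [h.good.rem_var i hi j hj, abs_zero]
    positivity
  · obtain ⟨h1, h2⟩ := h.rem_lt i hi a ha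
    rw [abs_of_nonneg h1]
    nlinarith
  · have h1 : M.slack rem ≤ M.n * (M.r + M.s : ℕ) * 2 ^ k := slack_le fun i hi a ha => by
      obtain ⟨h1, h2⟩ := h.rem_lt i hi a ha
      rw [abs_of_nonneg h1]
      exact h2.le
    have h2 := hf hz
    have h4 : (2 * (M.n * (M.r + M.s : ℕ)) : ℤ) ≤ M.slackBound := by
      exact_mod_cast two_mul_rows_le (M := M)
    push_cast at h1 h4
    nlinarith
  · obtain ⟨h1, h2⟩ := h.rem_lt i hi a ha
    subst hk
    simp only [pow_zero] at h2
    omega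
  · have h1 := hf hz
    subst hk
    simp only [pow_zero, sub_self, mul_zero] at h1
    exact le_antisymm h1 (slack_nonneg _)

/-- At scale `1` nothing is ignored any more, so `X` itself solves the equations with slack, and
positive slack refutes feasibility. -/
theorem ScaleInv.feas_iff {X rem : ℕ → ℤ} (h : M.ScaleInv 0 X rem) :
    (M.slack X = 0 → M.Feas X) ∧ (M.slack X ≠ 0 → ¬ ∃ z, M.Feas z) := by
  refine ⟨fun h0 => ⟨h.good.box, h.good.sol.congr ?_, fun i hi a ha => slack_eq_zero h0 hi ha⟩,
    fun h0 hz => h0 ((h.last rfl).2 hz)⟩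
  refine forall_pos.2 ⟨fun i hi j hj => ?_, fun i hi a ha => ?_⟩
  · rw [h.good.rem_var i hi j hj, add_zero]
  · rw [(h.last rfl).1 i hi a ha, add_zero]

end Flat

/-! ### The two objectives and the effect of one move. -/

namespace DP.Rep

variable {O : ℤ → ℤ → ℤ} {F : DP} {M : Flat}

theorem data (h : F.Rep M) (ph lam : ℤ) (X : ℕ → ℤ) :
    ({ F with phase := ph, lam := lam, X := X } : DP).Rep M :=
  ⟨⟨h.tt_pos, h.r_pos, h.hP, h.hL, h.hcol, h.hE, h.hR, h.hS, h.hmark⟩, h.q_var, h.q_slack,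
    h.lo_eq, h.hi_eq⟩

theorem P_eq (h : F.Rep M) : F.P = M.size := h.hP

theorem adm_one (h : F.Rep M) (hph : ¬ 0 < F.phase) (v : ℕ → ℤ) :
    (∀ p < F.P, F.Adm p (v p)) ↔ M.Box v := by
  rw [h.P_eq, Flat.forall_pos]
  constructor
  · intro h1 i hi j hj
    rcases h1.1 i hi j hj with h2 | h2
    · rw [h.q_var i hi j hj, h.lo_eq, h.hi_eq] at h2
      exact h2
    · rw [h.q_var i hi j hj] at h2
      omega
  · intro h1
    refine ⟨fun i hi j hj => Or.inl ?_, fun i hi a ha => Or.inr ⟨hph, ?_⟩⟩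
    · rw [h.q_var i hi j hj, h.lo_eq, h.hi_eq]
      exact h1 i hi j hj
    · rw [h.q_slack i hi a ha]
      norm_num

/-- Slack positions have the query index `-1`, at which both bound arrays read `0`. In the second
phase this freezes the slack at zero without a special case in the program. -/
theorem adm_two (h : F.Rep M) (hph : 0 < F.phase) (v : ℕ → ℤ) :
    (∀ p < F.P, F.Adm p (v p)) ↔ M.Box v ∧
      ∀ i < M.n, ∀ a < M.r + M.s, v (i * M.brick + (M.t + a)) = 0 := by
  rw [h.P_eq, Flat.forall_pos]
  simp only [DP.Adm, hph, not_true_eq_false, false_and, or_false, h.lo_eq, h.hi_eq]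
  refine and_congr (forall₄_congr fun i hi j hj => ?_) (forall₄_congr fun i hi a ha => ?_)
  · rw [h.q_var i hi j hj]
  · rw [h.q_slack i hi a ha, M.lo_neg, M.hi_neg]
    omega

theorem total_one (h : F.Rep M) (hph : ¬ 0 < F.phase) (v : ℕ → ℤ) :
    F.total O v = M.slack v := by
  rw [total, h.P_eq, Flat.sum_size, Flat.slack]
  refine sum_congr rfl fun i hi => ?_
  rw [sum_eq_zero, zero_add]
  · refine sum_congr rfl fun a ha => ?_
    rw [DP.cost, if_neg hph, h.q_slack i (mem_range.1 hi) a (mem_range.1 ha), if_pos (by norm_num)]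
  · intro j hj
    rw [DP.cost, if_neg hph, h.q_var i (mem_range.1 hi) j (mem_range.1 hj), if_neg (by omega)]

/-- Since the oracle answers `0` at the index `-1`, the slack positions do not contribute to the
objective. -/
theorem total_two (hO : ∀ v, O (-1) v = 0) (h : F.Rep M) (hph : 0 < F.phase) (v : ℕ → ℤ) :
    F.total O v = M.obj O v := by
  rw [total, h.P_eq, Flat.sum_size, Flat.obj]
  refine sum_congr rfl fun i hi => ?_
  rw [add_eq_left.2]
  · refine sum_congr rfl fun j hj => ?_
    rw [DP.cost, if_pos hph, h.q_var i (mem_range.1 hi) j (mem_range.1 hj)]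
  · refine sum_eq_zero fun a ha => ?_
    rw [DP.cost, if_pos hph, h.q_slack i (mem_range.1 hi) a (mem_range.1 ha), hO]

/-- One move of the search for a feasible point. -/
theorem move_one {k m : ℕ} {rem h X' : ℕ → ℤ} (hO : ∀ q, DConvex (O q)) (hF : F.Rep M)
    (hph : ¬ 0 < F.phase) (hlam : F.lam = 2 ^ k) (hi : M.MoveInv k (m + 1) F.X rem)
    (hp : F.Path F.P 0 F.L F.S h)
    (hmin : ∀ h', F.Path F.P 0 F.L F.S h' → F.pathCost O F.P 0 h ≤ F.pathCost O F.P 0 h')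
    (hX' : ∀ p < M.size, X' p = F.lam * h p + F.X p) : M.MoveInv k m X' rem := by
  have h0 : (0 : ℤ) < 2 ^ k := by positivity
  have hker := (hF.path_iff.1 hp).2.2
  have hadm := (hF.adm_one hph _).1 (hF.path_iff.1 hp).2.1
  have hgood : M.Good (2 ^ k) (fun p => F.lam * h p + F.X p) rem := by
    refine ⟨hadm, (hi.good.sol.add_ker hker F.lam).congr fun p _ => by ring, hi.good.rem_var,
      fun i hi' a ha => dvd_add ?_ (hi.good.dvd i hi' a ha)⟩
    rw [hlam]
    exact Dvd.intro _ rfl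
  refine Flat.MoveInv.congr (X := fun p => F.lam * h p + F.X p) (rem := rem)
    ⟨hgood, hi.rem_lt, fun hz => ?_⟩ hX' fun _ _ => rfl
  have hXadm := (hF.adm_one hph _).2 hi.good.box
  have hle : M.slack (fun p => F.lam * h p + F.X p) ≤ M.slack F.X := by
    have h1 := hmin _ (hF.path_zero hXadm)
    rw [DP.pathCost_total, DP.pathCost_total] at h1
    simp only [mul_zero, zero_add, hF.total_one hph] at h1
    linarith
  by_cases hs : M.slack F.X ≤ M.slackBound * (2 ^ k - 1)
  · exact Or.inl (hle.trans hs)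
  · right
    obtain ⟨z, hz⟩ := hz
    -- The rounded feasible point has smaller slack than `X`, so some short path improves, and the
    -- optimal path improves at least as much.
    obtain ⟨y, y1, y2, y3⟩ := hi.good.exists_target h0 hi.rem_lt hz
    rw [← hlam] at y2 y3
    obtain ⟨g, g1, g2⟩ := hF.exists_path_neg hO hXadm (by omega) y1
      ((hF.adm_one hph _).2 y2) (by
        rw [← hlam] at hs
        rw [hF.total_one hph (fun p => F.lam * y p + F.X p), hF.total_one hph]
        omega)
    have h1 := (hmin g g1).trans_lt g2
    rw [DP.pathCost_total, hF.total_one hph, hF.total_one hph] at h1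
    -- Before and after the move the total slack is a multiple of `2 ^ k`, so a strict decrease is a
    -- decrease by at least `2 ^ k`.
    have hdv : ∀ (v : ℕ → ℤ), (∀ i < M.n, ∀ a < M.r + M.s,
        (2 ^ k : ℤ) ∣ v (i * M.brick + (M.t + a))) → (2 ^ k : ℤ) ∣ M.slack v := fun v hv =>
      dvd_sum fun i hi => dvd_sum fun a ha =>
        (dvd_abs _ _).2 (hv i (mem_range.1 hi) a (mem_range.1 ha))
    have h2 : (2 ^ k : ℤ) ≤ M.slack F.X - M.slack fun p => F.lam * h p + F.X p :=
      Int.le_of_dvd (by omega) (dvd_sub (hdv _ hi.good.dvd) (hdv _ hgood.dvd))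
    rcases hi.feas ⟨z, hz⟩ with h3 | h3
    · exact absurd h3 hs
    · push_cast at h3
      rw [add_mul, one_mul] at h3
      linarith

/-- One move of the optimization. -/
theorem move_two {h X' : ℕ → ℤ} (hO' : ∀ v, O (-1) v = 0) (hF : F.Rep M) (hph : 0 < F.phase)
    (hX : M.Feas F.X) (hp : F.Path F.P 0 F.L F.S h)
    (hX' : ∀ p < M.size, X' p = F.lam * h p + F.X p) :
    M.Feas X' ∧ M.obj O X' = M.obj O F.X + F.pathCost O F.P 0 h := by
  have hker := (hF.path_iff.1 hp).2.2
  have hadm := (hF.adm_two hph _).1 (hF.path_iff.1 hp).2.1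
  have h1 := Flat.forall_pos.1 hX'
  refine ⟨⟨fun i hi j hj => by rw [h1.1 i hi j hj]; exact hadm.1 i hi j hj,
    (hX.sol.add_ker hker F.lam).congr hX',
    fun i hi a ha => by rw [h1.2 i hi a ha]; exact hadm.2 i hi a ha⟩, ?_⟩
  rw [DP.pathCost_total, hF.total_two hO' hph, hF.total_two hO' hph, add_sub_cancel]
  exact sum_congr rfl fun i hi => sum_congr rfl fun j hj => by
    rw [h1.1 i (mem_range.1 hi) j (mem_range.1 hj)]

theorem feas_adm (hF : F.Rep M) (hX : M.Feas F.X) : ∀ p < F.P, F.Adm p (F.X p) := by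
  by_cases hph : 0 < F.phase
  · exact (hF.adm_two hph _).2 ⟨hX.box, hX.zero⟩
  · exact (hF.adm_one hph _).2 hX.box

/-- If no power of two allows a gain of more than `B`, then the gap is small. -/
theorem gap_le {y : ℕ → ℤ} {B : ℤ} {K : ℕ} (hO : ∀ q, DConvex (O q)) (hO' : ∀ v, O (-1) v = 0)
    (hF : F.Rep M) (hph : 0 < F.phase) (hX : M.Feas F.X) (hy : M.Feas y) (hB0 : 0 ≤ B)
    (hK : 2 * M.N < 2 ^ K)
    (hB : ∀ k < K, ∀ g, ({ F with lam := 2 ^ k } : DP).Path F.P 0 F.L F.S g →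
      -B ≤ ({ F with lam := 2 ^ k } : DP).pathCost O F.P 0 g) :
    M.obj O F.X - M.obj O y ≤ 2 * (M.size * F.L) * B := by
  have h1 := hF.toNFold.gap_le hO (hF.feas_adm hX) (hy.sol.sub hX.sol) (by
    simp only [sub_add_cancel]
    exact (hF.adm_two hph y).2 ⟨hy.box, hy.zero⟩) hB0 fun k hk g hg => hB k ?_ g hg
  · simp only [sub_add_cancel] at h1
    rw [hF.total_two hO' hph, hF.total_two hO' hph, hF.P_eq] at h1
    exact h1
  · obtain ⟨p, hp, h2⟩ := hk
    rw [hF.P_eq] at hp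
    -- Feasible points lie in a box with entries at most `N`, so step lengths from `2 ^ K > 2 * N`
    -- on are never needed.
    have h3 : |y p - F.X p| ≤ 2 * M.N := by
      rcases Flat.pos_cases hp with ⟨i, hi, j, hj, rfl⟩ | ⟨i, hi, a, ha, rfl⟩
      · have h4 := hX.box i hi j hj
        have h5 := hy.box i hi j hj
        have h6 := M.hlo ((i * M.t + j : ℕ) : ℤ)
        have h7 := M.hhi ((i * M.t + j : ℕ) : ℤ)
        rw [abs_le] at h6 h7 ⊢
        omega
      · rw [hX.zero i hi a ha, hy.zero i hi a ha, sub_self, abs_zero]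
        positivity
    have h4 : (2 : ℤ) ^ k < 2 ^ K := by
      have : (2 * M.N : ℤ) < 2 ^ K := by exact_mod_cast hK
      omega
    exact (pow_lt_pow_iff_right₀ (by norm_num)).1 h4

end DP.Rep

end NFoldIP

namespace NFoldIP

open Prog Finset

/-! ### The two phases: program text -/

notation "rPows" => (14 : ℕ)
notation "rReps" => (18 : ℕ)
notation "aPow" => (12 : ℕ)
notation "aRem" => (15 : ℕ)
notation "cScale" => (70 : ℕ)
notation "cCell" => (71 : ℕ)
notation "cRep" => (72 : ℕ)
notation "vSlack" => (77 : ℕ)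
notation "vGo" => (78 : ℕ)
notation "vBest" => (79 : ℕ)
notation "vLam" => (80 : ℕ)

/-- Moves one multiple of the step length from `aRem` to `aX` in the cell `cCell`. -/
def shiftProg : Prog :=
  .load 73 aRem cCell ;; .load 75 aX cCell ;; .sub 74 73 rLam ;; .add 74 74 rOne ;;
  .ite 74 (.sub 73 73 rLam ;; .add 75 75 rLam)
    (neg 76 73 ;; .ite 76 (.add 73 73 rLam ;; .sub 75 75 rLam) skip) ;;
  .store aRem cCell 73 ;; .store aX cCell 75

/-- Reduces all cells of `aRem` modulo the step length. -/
def reduceProg : Prog :=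
  copy cCell rPos ;; forDown cCell (copy cRep rReps ;; forDown cRep shiftProg)

/-- One scale of the search for a feasible point. -/
def scaleProg : Prog :=
  .load rLam aPow cScale ;; reduceProg ;; copy cRep rReps ;; forDown cRep moveProg

/-- The search for a feasible point. -/
def feasProg : Prog := copy cScale rPows ;; forDown cScale scaleProg

/-- The total slack. -/
def slackProg : Prog :=
  (.const vSlack 0 ;; copy cCell rPos) ;; forDown cCell (.load 73 aQ cCell ;; neg 74 73 ;;
    .ite 74 (.load 75 aX cCell ;; abs 76 75 ;; .add vSlack vSlack 76) skip)

/-- Compares the best gain for one step length with the best gain so far. -/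
def probeProg : Prog :=
  .load rLam aPow cScale ;; tableProg ;; .const 74 0 ;; rowProg 73 74 rL ;;
  (.add 73 73 rShift ;; .load 75 aVal 73 ;; .sub 76 vBest 75 ;;
    .ite 76 (copy vBest 75 ;; copy vLam rLam) skip)

/-- One augmentation with the best step length. -/
def augmentProg : Prog :=
  (.const vBest 0 ;; .const vLam 0 ;; copy cScale rPows) ;; forDown cScale probeProg ;;
  copy rLam vLam ;; moveProg ;; neg vGo vBest

/-- The optimization. -/
def optProg : Prog := (.const rPhase 1 ;; .const vGo 1) ;; .loop vGo augmentProg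

/-- Writes the answer. -/
def outputProg : Prog :=
  copy cCell rPos ;;
  forDown cCell (.load 73 aQ cCell ;; .load 75 aX cCell ;; .store 6 73 75) ;; .const 0 1

/-- Everything after the preparation. -/
def solveProg : Prog :=
  (.const rPhase 0 ;; .const rLam 0) ;; feasProg ;; slackProg ;;
    .ite vSlack (.const 0 0) (optProg ;; outputProg)

/-! ### Reduction -/

variable {O : ℤ → ℤ → ℤ}

/-- One pass brings the entry one multiple of `lam` closer to the interval from `0` to `lam`, and
leaves it alone once it is there. -/
theorem runs_shift {σ : State} {lam v x : ℤ} {p j : ℕ} (h1 : σ.reg rOne = 1)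
    (hlam : σ.reg rLam = lam) (hl : 0 < lam) (hp : σ.reg cCell = p) (hv : σ.arr aRem p = v)
    (hx : σ.arr aX p = x) (hj : -(lam * (j + 1)) ≤ v ∧ v < lam * (j + 2)) :
    Runs O shiftProg σ 20 fun σ' => ∃ v', v' % lam = v % lam ∧ -(lam * j) ≤ v' ∧
      v' < lam * (j + 1) ∧ σ'.arr aRem = Function.update (σ.arr aRem) p v' ∧
      σ'.arr aX = Function.update (σ.arr aX) p (x + (v - v')) := by
  refine (runs_wp rfl ?_).le (by decide : shiftProg.size ≤ 20)
  have hj0 : 0 ≤ lam * j := by positivity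
  have e1 : lam * ((j : ℤ) + 1) = lam * j + lam := by ring
  have e2 : lam * ((j : ℤ) + 2) = lam * j + lam + lam := by ring
  rw [e1, e2] at hj
  simp only [e1]
  simp only [shiftProg, wp, wp_skip, wp_neg, ne_eq, Nat.reduceEqDiff, not_false_eq_true,
    State.setReg_reg, State.setReg_arr, State.setCell_arr, State.setCell_reg,
    if_true, if_false, h1, hlam, hp, hv, hx]
  refine ⟨fun h => ⟨v - lam, ?_, by omega, by omega, by trivial, ?_⟩,
    fun h => ⟨fun h' => ⟨v + lam, ?_, by omega, by omega, by trivial, ?_⟩,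
      fun h' => ⟨v, rfl, by omega, by omega, by trivial, ?_⟩⟩⟩
  · exact Int.sub_emod_right v lam
  · congr 1; ring
  · exact Int.add_emod_right v lam
  · congr 1; ring
  · congr 1; ring

/-- Residues are computed by `m` conditional additions or subtractions per cell, since the machine
has no division; `hr` says that `m` passes are enough. -/
theorem runs_reduce {σ : State} {lam : ℤ} {P m : ℕ} (h1 : σ.reg rOne = 1)
    (hlam : σ.reg rLam = lam) (hl : 0 < lam) (hP : σ.reg rPos = P) (hm : σ.reg rReps = m)
    (hr : ∀ p : ℕ, p < P → -(lam * m) ≤ σ.arr aRem p ∧ σ.arr aRem p < lam * (m + 1)) :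
    Runs O reduceProg σ (P * (m * 22 + 8) + 8) fun σ' => ∀ p : ℕ, p < P →
      σ'.arr aRem p = σ.arr aRem p % lam ∧
      σ'.arr aX p = σ.arr aX p + (σ.arr aRem p - σ.arr aRem p % lam) := by
  unfold reduceProg
  refine Runs.bind (runs_wp (Q := fun σ' => σ'.reg cCell = P) rfl (by simp [wp_copy, hP]))
    fun σ₁ e₁ k₁ => ?_
  have r₁ : ∀ y, y ≠ cCell → σ₁.reg y = σ.reg y := fun y hy =>
    k₁.reg y (by simpa [wregs, copy] using hy)
  have a₁ : ∀ a, σ₁.arr a = σ.arr a := fun a => k₁.arr a (by simp [warrs, copy])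
  refine ((runs_forDown (N := P) (B := m * 22 + 6)
    (fun k σ' => ∀ p : ℕ, p < P → if k ≤ p then σ'.arr aRem p = σ.arr aRem p % lam ∧
      σ'.arr aX p = σ.arr aX p + (σ.arr aRem p - σ.arr aRem p % lam) else
      σ'.arr aRem p = σ.arr aRem p ∧ σ'.arr aX p = σ.arr aX p) (by rw [e₁]; rfl)
    (by rw [r₁ _ (by decide), h1]) (by decide) (by decide) (by decide)
    (fun p hp => by rw [if_neg (by omega), a₁, a₁]; exact ⟨rfl, rfl⟩)
    (fun _ _ _ h => by simpa using h) (fun k hk σ' hi hk' hkeep => ?_)).le ?_).imp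
    fun σ₂ e₂ k₂ p hp => by simpa using e₂ p hp
  · have r' : ∀ y ∈ [rOne, rLam, rReps], σ'.reg y = σ.reg y := fun y hy => by
      simp only [List.mem_cons, List.not_mem_nil, or_false] at hy
      rcases hy with rfl | rfl | rfl <;> rw [hkeep.reg _ (by decide), r₁ _ (by decide)]
    refine Runs.bind (runs_wp (Q := fun σ' => σ'.reg cRep = m) rfl
      (by simp [wp_copy, r' rReps (by decide), hm])) fun σ₂ e₂ k₂ => ?_
    have r₂ : ∀ y ∈ [rOne, rLam, cCell], σ₂.reg y = σ'.reg y := fun y hy => by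
      simp only [List.mem_cons, List.not_mem_nil, or_false] at hy
      rcases hy with rfl | rfl | rfl <;> rw [k₂.reg _ (by decide)]
    have a₂ : ∀ a, σ₂.arr a = σ'.arr a := fun a => k₂.arr a (by simp [warrs, copy])
    have hkk := hi k hk
    rw [if_neg (by omega)] at hkk
    refine ((runs_forDown (N := m) (B := 20)
      (fun j σ'' => ∃ v, v % lam = σ.arr aRem k % lam ∧ -(lam * j) ≤ v ∧ v < lam * (j + 1) ∧
        σ''.arr aRem = Function.update (σ'.arr aRem) k v ∧
        σ''.arr aX = Function.update (σ'.arr aX) k (σ.arr aX k + (σ.arr aRem k - v)))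
      (by rw [e₂]; rfl) (by rw [r₂ _ (by decide), r' _ (by decide), h1]) (by decide) (by decide)
      (by decide) ⟨σ.arr aRem k, rfl, (hr k hk).1, (hr k hk).2, ?_, ?_⟩
      (fun _ _ _ h => by simpa using h) (fun j hj σ'' hi' hj' hkeep' => ?_)).le ?_).imp
      fun σ₃ e₃ k₃ p hp => ?_
    · rw [a₂, ← hkk.1, Function.update_eq_self]
    · rw [a₂, sub_self, add_zero, ← hkk.2, Function.update_eq_self]
    · obtain ⟨v, v1, v2, v3, v4, v5⟩ := hi'
      push_cast at v2 v3
      refine (runs_shift (lam := lam) (v := v) (x := σ.arr aX k + (σ.arr aRem k - v)) (p := k)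
        (j := j) ?_ ?_ hl ?_ ?_ ?_ ⟨by linarith, by linarith⟩).imp fun σ₄ e₄ _ => ?_
      · rw [hkeep'.reg _ (by decide), r₂ _ (by decide), r' _ (by decide), h1]
      · rw [hkeep'.reg _ (by decide), r₂ _ (by decide), r' _ (by decide), hlam]
      · rw [hkeep'.reg _ (by decide), r₂ _ (by decide), hk']
      · rw [v4, Function.update_self]
      · rw [v5, Function.update_self]
      · obtain ⟨v', w1, w2, w3, w4, w5⟩ := e₄
        refine ⟨v', w1.trans v1, w2, w3, ?_, ?_⟩
        · rw [w4, v4, Function.update_idem]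
        · rw [w5, v5, Function.update_idem]
          congr 1
          ring
    · simp only [size, copy, Nat.reduceAdd]
      omega
    · obtain ⟨v, v1, v2, v3, v4, v5⟩ := e₃
      simp only [Nat.cast_zero, mul_zero, neg_zero, zero_add, mul_one] at v2 v3
      have hv : v = σ.arr aRem k % lam := by rw [← v1, Int.emod_eq_of_lt v2 v3]
      rw [v4, v5]
      have hp' := hi p hp
      by_cases hpk : p = k
      · subst hpk
        simp [hv]
      · have hne : (p : ℤ) ≠ k := by exact_mod_cast hpk
        rw [Function.update_of_ne hne, Function.update_of_ne hne]
        split_ifs at hp' ⊢ <;> first | exact hp' | omega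
  · simp only [size, copy, Nat.add_assoc, Nat.reduceAdd]
    have : P * (m * 22 + 6 + 2) = P * (m * 22 + 8) := by ring
    omega

/-! ### States that are ready for the dynamic program -/

namespace Flat

/-- The bound for the length of a step. -/
def stepBound (M : Flat) : ℕ := graverBound M.r M.s M.D

/-- The bound for the residuals. -/
def resBound (M : Flat) : ℕ := (2 * (M.D * M.stepBound) + 1) ^ (M.r + M.s)

/-- The registers and arrays of `σ` hold a dynamic program for `M`. -/
def Ready (M : Flat) (σ : State) : Prop :=
  ∃ F : DP, F.Ctx σ ∧ F.Rep M ∧ F.X = fun p : ℕ => σ.arr aX p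

variable {M : Flat} {σ σ' : State}

theorem Ready.keep {R A : List ℕ} (h : M.Ready σ) (hk : Keep R A σ σ')
    (hR : ∀ y < 29, y ≠ rPhase → y ≠ rLam → y ∉ R) (hA : ∀ a ∈ [aLow, aUpp, aCol, aMark, aQ], a ∉ A) :
    M.Ready σ' := by
  obtain ⟨F, h1, h2, -⟩ := h
  exact ⟨_, h1.keep_data hk hR hA, h2.data _ _ _, rfl⟩

theorem Ready.setReg (h : M.Ready σ) {y : ℕ} (hy : 29 ≤ y) (v : ℤ) : M.Ready (σ.setReg y v) :=
  h.keep (R := [y]) (A := []) ⟨fun z hz => by simp at hz; simp [hz], fun _ _ => rfl⟩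
    (fun z hz _ _ hz' => by simp at hz'; omega) (fun _ _ => by simp)

theorem Ready.one (h : M.Ready σ) : σ.reg rOne = 1 := by
  obtain ⟨F, h1, -, -⟩ := h
  exact h1.one

theorem Ready.pos (h : M.Ready σ) : σ.reg rPos = M.size := by
  obtain ⟨F, h1, h2, -⟩ := h
  rw [h1.hP, h2.P_eq]

theorem _root_.NFoldIP.DP.Rep.S_eq {F : DP} (h : F.Rep M) : F.S = M.resBound := by
  rw [h.hS, h.hL, resBound, stepBound]

theorem _root_.NFoldIP.DP.Rep.L_eq {F : DP} (h : F.Rep M) : F.L = M.stepBound := h.hL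

/-- The time of one move. -/
def moveCost (M : Flat) : ℕ := moveTime M.size M.stepBound M.resBound

end Flat

theorem runs_moves {M : Flat} {σ : State} {k N : ℕ} (hO : ∀ q, DConvex (O q)) (hM : M.Ready σ)
    (hph : σ.reg rPhase = 0) (hlam : σ.reg rLam = 2 ^ k) (hN : σ.reg cRep = N)
    (hi : M.MoveInv k N (fun p => σ.arr aX p) fun p => σ.arr aRem p) :
    Runs O (forDown cRep moveProg) σ (N * (M.moveCost + 2) + 1) fun σ' => M.Ready σ' ∧
      M.MoveInv k 0 (fun p => σ'.arr aX p) fun p => σ'.arr aRem p := by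
  refine (runs_forDown (N := N) (B := M.moveCost)
    (fun m σ' => M.Ready σ' ∧ M.MoveInv k m (fun p => σ'.arr aX p) fun p => σ'.arr aRem p)
    (by rw [hN]; rfl) hM.one (by decide) (by decide) (by decide) ⟨hM, hi⟩
    (fun m σ' v h => ⟨h.1.setReg (by decide) v, by simpa using h.2⟩)
    (fun m hm σ' hi' hm' hkeep => ?_))
  obtain ⟨⟨F, h1, h2, h3⟩, h4⟩ := hi'
  have hF0 : ¬ 0 < F.phase := by
    rw [← h1.hphase, hkeep.reg _ (by decide), hph]
    decide
  have hFl : F.lam = 2 ^ k := by rw [← h1.hlam, hkeep.reg _ (by decide), hlam]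
  rw [← h3] at h4
  refine ((runs_move (O := O) h1 ⟨_, h2.path_zero ((h2.adm_one hF0 _).2 h4.good.box)⟩).le
    (by rw [h2.P_eq, h2.S_eq, h2.L_eq]; exact le_rfl)).imp fun σ₁ e₁ k₁ => ?_
  obtain ⟨h, p1, p2, p3⟩ := e₁
  refine ⟨Flat.Ready.keep ⟨F, h1, h2, h3⟩ k₁ (by decide) (by decide), ?_⟩
  rw [k₁.arr aRem (by decide)]
  exact h2.move_one hO hF0 hFl h4 p1 p2 fun p hp => by
    rw [p3, if_pos (by rw [h2.P_eq]; exact hp), add_comm]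

/-- The time of the search for a feasible point. -/
def Flat.feasCost (M : Flat) (K : ℕ) : ℕ :=
  K * (M.size * (5 * M.slackBound * 22 + 8) + 5 * M.slackBound * (M.moveCost + 2) + 20) + 10

theorem runs_feas {M : Flat} {σ : State} {K : ℕ} (hO : ∀ q, DConvex (O q)) (hM : M.Ready σ)
    (hph : σ.reg rPhase = 0) (hK : σ.reg rPows = K) (hpow : ∀ k : ℕ, k < K → σ.arr aPow k = 2 ^ k)
    (hrep : σ.reg rReps = 5 * M.slackBound)
    (hi : M.ScaleInv K (fun p => σ.arr aX p) fun p => σ.arr aRem p) :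
    Runs O feasProg σ (M.feasCost K) fun σ' => M.Ready σ' ∧
      M.ScaleInv 0 (fun p => σ'.arr aX p) fun p => σ'.arr aRem p := by
  unfold feasProg
  refine Runs.bind (runs_wp (Q := fun σ' => σ'.reg cScale = K) rfl (by simp [wp_copy, hK]))
    fun σ₁ e₁ k₁ => ?_
  have hM₁ := hM.keep k₁ (by decide) (by decide)
  rw [← k₁.arr aX (by decide), ← k₁.arr aRem (by decide)] at hi
  refine (runs_forDown (N := K) (B := M.size * (5 * M.slackBound * 22 + 8) +
      5 * M.slackBound * (M.moveCost + 2) + 18)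
    (fun m σ' => M.Ready σ' ∧ M.ScaleInv m (fun p => σ'.arr aX p) fun p => σ'.arr aRem p)
    (by rw [e₁]; rfl) hM₁.one (by decide) (by decide) (by decide) ⟨hM₁, hi⟩
    (fun m σ' v h => ⟨h.1.setReg (by decide) v, by simpa using h.2⟩)
    (fun m hm σ' hi' hm' hkeep => ?_)).le
    (by simp only [Flat.feasCost, size, copy, Nat.add_assoc, Nat.reduceAdd]; omega)
  obtain ⟨h1, h2⟩ := hi'
  unfold scaleProg
  refine Runs.bind (runs_wp (Q := fun σ' => σ'.reg rLam = 2 ^ m) rfl (by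
    simp only [wp, State.setReg_reg, if_true, hm']
    rw [hkeep.arr aPow (by decide), k₁.arr aPow (by decide), hpow m hm])) fun σ₂ e₂ k₂ => ?_
  have h1₂ := h1.keep k₂ (by decide) (by decide)
  have hrep₂ : σ₂.reg rReps = (5 * M.slackBound : ℕ) := by
    rw [k₂.reg _ (by decide), hkeep.reg _ (by decide), k₁.reg _ (by decide), hrep]
    push_cast; rfl
  have hQ := Flat.slackBound_pos (M := M)
  have h0 : (0 : ℤ) < 2 ^ m := by positivity
  refine Runs.bind (runs_reduce h1₂.one e₂ h0 h1₂.pos hrep₂ fun p hp => ?_)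
    fun σ₃ e₃ k₃ => ?_
  -- At the previous scale `|rem| ≤ 2 ^ (m + 1) * slackBound`, which is `2 * slackBound` multiples
  -- of `2 ^ m`; the `5 * slackBound` passes cover this.
  · have h3 := h2.bound p hp
    rw [k₂.arr aRem (by decide)]
    rw [abs_le, pow_succ] at h3
    push_cast
    have h4 : (0 : ℤ) ≤ 2 ^ m * M.slackBound := by positivity
    constructor <;> linarith
  have h1₃ := h1₂.keep k₃ (by decide) (by decide)
  rw [k₂.arr aX (by decide), k₂.arr aRem (by decide)] at e₃
  refine Runs.bind (runs_wp (Q := fun σ' => σ'.reg cRep = (5 * M.slackBound : ℕ)) rfl (by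
    simp only [wp_copy, ne_eq, Nat.reduceEqDiff, not_false_eq_true, State.setReg_reg, if_true]
    rw [k₃.reg _ (by decide), hrep₂])) fun σ₄ e₄ k₄ => ?_
  have h1₄ := h1₃.keep k₄ (by decide) (by decide)
  refine ((runs_moves hO h1₄ (k := m) ?_ ?_ e₄ ?_).le ?_).imp fun σ₅ e₅ _ => ⟨e₅.1, e₅.2.scale⟩
  · rw [k₄.reg _ (by decide), k₃.reg _ (by decide), k₂.reg _ (by decide), hkeep.reg _ (by decide),
      k₁.reg _ (by decide), hph]
  · rw [k₄.reg _ (by decide), k₃.reg _ (by decide), e₂]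
  · rw [k₄.arr aX (by decide), k₄.arr aRem (by decide)]
    exact h2.move.congr (fun p hp => (e₃ p hp).2) fun p hp => (e₃ p hp).1
  · simp only [size, copy, Nat.add_assoc, Nat.reduceAdd]
    omega

theorem runs_slack {M : Flat} {σ : State} (hM : M.Ready σ) (hph : σ.reg rPhase = 0) :
    Runs O slackProg σ (M.size * 18 + 10) fun σ' =>
      σ'.reg vSlack = M.slack fun p => σ.arr aX p := by
  obtain ⟨F, h1, h2, h3⟩ := hM
  have hF0 : ¬ 0 < F.phase := by
    rw [← h1.hphase, hph]
    decide
  rw [← h3, ← h2.total_one (O := O) hF0]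
  unfold slackProg
  refine Runs.bind (runs_wp (Q := fun σ' => σ'.reg cCell = F.P ∧ σ'.reg vSlack = 0) rfl
    (by simp [wp, wp_copy, h1.hP])) fun σ₁ e₁ k₁ => ?_
  have h₁ := h1.keep k₁ (by decide) (by decide)
  refine ((runs_forDown (N := F.P) (B := 16) (fun k σ' => σ'.reg vSlack =
      F.total O F.X - ∑ p ∈ range k, F.cost O p (F.X p)) (by rw [e₁.1]; rfl) h₁.one (by decide)
    (by decide) (by decide) (by rw [e₁.2, DP.total, sub_self])
    (fun _ _ _ h => by simpa using h) (fun k hk σ' hi hk' hkeep => ?_)).le ?_).imp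
    fun σ₂ e₂ k₂ => by rw [e₂]; simp
  · have h' := h₁.keep hkeep (by decide) (by decide)
    refine (runs_wp rfl ?_).le (by decide)
    rw [sum_range_succ] at hi
    simp only [wp, wp_skip, wp_neg, wp_abs, ne_eq, Nat.reduceEqDiff, not_false_eq_true,
      State.setReg_reg, State.setReg_arr, if_true, if_false, hk', h'.hq, h'.hX, hi]
    rw [DP.cost, if_neg hF0]
    constructor
    · intro h
      rw [if_pos (by omega)]
      ring
    · intro h
      rw [if_neg (by omega)]
      ring
  · simp only [size, copy, Nat.reduceAdd, h2.P_eq]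
    omega

end NFoldIP

namespace NFoldIP

open Prog Finset

variable {O : ℤ → ℤ → ℤ}

/-! ### Optimization -/

theorem DP.Ctx.relam {F : DP} {σ σ' : State} {R A : List ℕ} (h : F.Ctx σ) (hk : Keep R A σ σ')
    (hR : ∀ y < 29, y ≠ rLam → y ∉ R) (hA : ∀ a < 20, a ∉ A) :
    ({ F with lam := σ'.reg rLam } : DP).Ctx σ' := by
  have h1 := h.keep_data hk (fun y hy _ h2 => hR y hy h2)
    (fun a ha => hA a (by simp only [List.mem_cons, List.not_mem_nil, or_false] at ha; omega))
  exact
    { h1 with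
      hphase := (hk.reg rPhase (hR _ (by decide) (by decide))).trans h.hphase
      hX := fun p => (congrFun (hk.arr aX (hA _ (by decide))) p).trans (h.hX p) }

/-- The time of `probeProg`. -/
def Flat.probeCost (M : Flat) : ℕ :=
  tableTime M.size M.stepBound M.resBound + 6 * M.resBound + 3 * M.stepBound + 60

/-- `best` is a lower bound for all gains with powers of two as step length, and it is attained
with the step length `lam`. -/
structure DP.IsBest (O : ℤ → ℤ → ℤ) (F : DP) (lo hi : ℕ) (best lam : ℤ) : Prop where
  nonpos : best ≤ 0
  le : ∀ k, lo ≤ k → k < hi → ∀ g, ({ F with lam := 2 ^ k } : DP).Path F.P 0 F.L F.S g →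
    best ≤ ({ F with lam := 2 ^ k } : DP).pathCost O F.P 0 g
  attained : ∃ g, ({ F with lam := lam } : DP).Path F.P 0 F.L F.S g ∧
    ({ F with lam := lam } : DP).pathCost O F.P 0 g ≤ best

/-- The value of the start cell is the least cost change with step length `2 ^ k`, so comparing step
lengths needs the table but no walk through it. -/
theorem runs_probe {M : Flat} {F : DP} {σ : State} {k K : ℕ} {best lam : ℤ} (hF : F.Ctx σ)
    (hR : F.Rep M) (hX : M.Feas F.X) (hpow : σ.arr aPow k = 2 ^ k) (hk : σ.reg cScale = k)
    (hb : σ.reg vBest = best) (hl : σ.reg vLam = lam) (hi : F.IsBest O (k + 1) K best lam) :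
    Runs O probeProg σ M.probeCost fun σ' => ∃ best lam, σ'.reg vBest = best ∧
      σ'.reg vLam = lam ∧ F.IsBest O k K best lam := by
  unfold probeProg
  refine Runs.bind (runs_wp (Q := fun σ' => σ'.reg rLam = 2 ^ k) rfl (by simp [wp, hk, hpow]))
    fun σ₁ e₁ k₁ => ?_
  have h₁ := hF.relam k₁ (by decide) (by decide)
  rw [e₁] at h₁
  have hR₁ : ({ F with lam := 2 ^ k } : DP).Rep M := hR.data _ _ _
  have hw : F.S < F.w := by simp only [DP.w]; omega
  refine Runs.bind ((runs_table h₁).le (T₁ := tableTime M.size M.stepBound M.resBound)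
    (by rw [hR₁.P_eq, hR₁.S_eq, hR₁.L_eq])) fun σ₂ ht k₂ => ?_
  have h₂ := h₁.keep k₂ (by decide) (by decide)
  obtain ⟨h, p1, p2, -⟩ := ht.exists_path (zero_add _) le_rfl hw
    (ht.le_pathCost (zero_add _) le_rfl hw (hR₁.path_zero (hR₁.feas_adm hX))).1
  have hmin := fun h' hp' => (ht.le_pathCost (zero_add _) le_rfl hw (h := h') hp').2
  refine Runs.bind (runs_wp (Q := fun σ' => σ'.reg 74 = (0 : ℕ)) rfl (by simp [wp]))
    fun σ₃ e₃ k₃ => ?_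
  have h₃ := h₂.keep k₃ (by decide) (by decide)
  refine Runs.bind (runs_rowProg h₃ e₃ h₃.hL (by decide) (by decide) (by decide))
    fun σ₄ e₄ k₄ => ?_
  have h₄ := h₃.keep k₄ (by decide) (by decide)
  have hidx : ({ F with lam := 2 ^ k } : DP).idx 0 F.L 0 + F.S =
      ({ F with lam := 2 ^ k } : DP).idx 0 F.L F.S := by
    simp [DP.idx]
  have hS₄ : σ₄.reg rShift = F.S := h₄.hS
  have hl₄ : σ₄.reg rLam = 2 ^ k := h₄.hlam
  have hv₄ : σ₄.arr aVal = σ₂.arr aVal := by rw [k₄.arr _ (by decide), k₃.arr _ (by decide)]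
  have hb₄ : σ₄.reg vBest = best := by
    rw [k₄.reg _ (by decide), k₃.reg _ (by decide), k₂.reg _ (by decide), k₁.reg _ (by decide), hb]
  have hm₄ : σ₄.reg vLam = lam := by
    rw [k₄.reg _ (by decide), k₃.reg _ (by decide), k₂.reg _ (by decide), k₁.reg _ (by decide), hl]
  refine (runs_wp rfl ?_).le ?_
  · dsimp only at e₄ p2 hmin
    simp only [wp, wp_copy, wp_skip, ne_eq, Nat.reduceEqDiff, not_false_eq_true, State.setReg_reg,
      State.setReg_arr, if_true, if_false, e₄, hS₄, hl₄, hv₄, hb₄, hm₄, hidx, ← p2]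
    rw [← p2] at hmin
    refine ⟨fun hc => ⟨_, _, rfl, rfl, ?_, fun k' hk' hK g hg => ?_, h, p1, le_rfl⟩,
      fun hc => ⟨_, _, rfl, rfl, hi.nonpos, fun k' hk' hK g hg => ?_, hi.attained⟩⟩
    · have := hi.nonpos
      omega
    · rcases Nat.eq_or_lt_of_le hk' with rfl | hlt
      · exact hmin g hg
      · have := hi.le k' hlt hK g hg
        omega
    · rcases Nat.eq_or_lt_of_le hk' with rfl | hlt
      · have := hmin g hg
        omega
      · exact hi.le k' hlt hK g hg
  · simp only [Flat.probeCost, size, copy, skip, Nat.reduceAdd, hR.S_eq, hR.L_eq]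
    omega

/-- The time of `augmentProg`. -/
def Flat.augmentCost (M : Flat) (K : ℕ) : ℕ := K * (M.probeCost + 2) + M.moveCost + 20

/-- With `B` the best decrease over all powers of two, the move realizes at least `B`, and by
`DP.Rep.gap_le` the gap to the optimum is at most a multiple of the same `B`. -/
theorem runs_augment {M : Flat} {σ : State} {K : ℕ} (hO' : ∀ v, O (-1) v = 0)
    (hO : ∀ q, DConvex (O q)) (hM : M.Ready σ)
    (hph : σ.reg rPhase = 1) (hX : M.Feas fun p => σ.arr aX p) (hK : σ.reg rPows = K)
    (hpow : ∀ k : ℕ, k < K → σ.arr aPow k = 2 ^ k) (hN : 2 * M.N < 2 ^ K) :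
    Runs O augmentProg σ (M.augmentCost K) fun σ' => M.Ready σ' ∧
      (M.Feas fun p => σ'.arr aX p) ∧ ∃ B : ℤ, 0 ≤ B ∧ σ'.reg vGo = B ∧
        (M.obj O fun p => σ'.arr aX p) + B ≤ M.obj O (fun p => σ.arr aX p) ∧
        ∀ y, M.Feas y →
          M.obj O (fun p => σ.arr aX p) - M.obj O y ≤ 2 * (M.size * M.stepBound) * B := by
  obtain ⟨F, h1, hR, h3⟩ := hM
  rw [← h3] at hX
  have hFp : 0 < F.phase := by rw [← h1.hphase, hph]; decide
  unfold augmentProg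
  refine Runs.bind (runs_wp (Q := fun σ' => σ'.reg vBest = 0 ∧ σ'.reg vLam = 0 ∧
    σ'.reg cScale = K) rfl (by simp [wp, wp_copy, hK])) fun σ₁ e₁ k₁ => ?_
  have h₁ := h1.keep k₁ (by decide) (by decide)
  -- The defaults are best gain `0` and step length `0`, attained by the zero path; if no probe
  -- improves on them, the final move changes nothing.
  refine Runs.bind (runs_forDown (N := K) (B := M.probeCost) (fun k σ' => ∃ best lam,
      σ'.reg vBest = best ∧ σ'.reg vLam = lam ∧ F.IsBest O k K best lam) (by rw [e₁.2.2]; rfl)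
    h₁.one (by decide) (by decide) (by decide) ⟨0, 0, e₁.1, e₁.2.1, le_rfl,
      fun k hk hk' => absurd hk (by omega), fun _ => 0,
      (hR.data _ _ _).path_zero ((hR.data _ _ _).feas_adm hX), by
        rw [DP.pathCost_total]; simp⟩
    (fun _ _ _ h => by simpa using h) (fun k hk σ' hi hk' hkeep => ?_)) fun σ₂ e₂ k₂ => ?_
  · obtain ⟨best, lam, i1, i2, i3⟩ := hi
    refine (runs_probe (F := { F with lam := σ'.reg rLam })
      (h₁.relam hkeep (by decide) (by decide)) (hR.data _ _ _) hX (by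
        rw [hkeep.arr _ (by decide), k₁.arr _ (by decide), hpow k hk]) hk' i1 i2
      ⟨i3.nonpos, i3.le, i3.attained⟩).imp ?_
    rintro σ'' ⟨best, lam, j1, j2, j3⟩ -
    exact ⟨best, lam, j1, j2, j3.nonpos, j3.le, j3.attained⟩
  obtain ⟨best, lam, b1, b2, b3⟩ := e₂
  have h₂ := h₁.relam k₂ (by decide) (by decide)
  refine Runs.bind (runs_wp (Q := fun σ' => σ'.reg rLam = lam) rfl (by simp [wp_copy, b2]))
    fun σ₃ e₃ k₃ => ?_
  have h₃ := h₂.relam k₃ (by decide) (by decide)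
  rw [e₃] at h₃
  have hR₃ : ({ F with lam := lam } : DP).Rep M := hR.data _ _ _
  refine Runs.bind ((runs_move (O := O) h₃ ⟨_, hR₃.path_zero (hR₃.feas_adm hX)⟩).le
    (T₁ := M.moveCost) (by rw [hR₃.P_eq, hR₃.S_eq, hR₃.L_eq]; exact le_rfl)) fun σ₄ e₄ k₄ => ?_
  have hM₄ : M.Ready σ₄ :=
    ⟨_, h₃.keep_data k₄ (by decide) (by decide), hR₃.data _ _ _, rfl⟩
  obtain ⟨h, p1, p2, p3⟩ := e₄
  have hb₄ : σ₄.reg vBest = best := by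
    rw [k₄.reg _ (by decide), k₃.reg _ (by decide), b1]
  refine ((runs_wp (Q := fun σ' => σ'.reg vGo = -best) rfl (by simp [wp_neg, hb₄])).le
    ?_).imp fun σ₅ e₅ k₅ => ?_
  · simp only [Flat.augmentCost, size, copy, neg, Nat.reduceAdd]
    omega
  · obtain ⟨m1, m2⟩ := hR₃.move_two hO' hFp hX p1
      (X' := fun p => σ₄.arr aX p) (fun p hp => by
        have : p < F.P := by rw [hR.P_eq]; exact hp
        dsimp only
        rw [p3, if_pos this, add_comm])
    obtain ⟨g, g1, g2⟩ := b3.attained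
    rw [k₅.arr aX (by decide), ← h3]
    refine ⟨hM₄.keep k₅ (by decide) (by decide), m1, -best, by have := b3.nonpos; omega, e₅, ?_,
      fun y hy => ?_⟩
    · rw [m2]
      have := (p2 g g1).trans g2
      dsimp only at this ⊢
      omega
    · rw [← hR.L_eq]
      exact hR.gap_le hO hO' hFp hX hy (by have := b3.nonpos; omega) hN fun k hk g hg => by
        rw [neg_neg]
        exact b3.le k (Nat.zero_le _) hk g hg

/-- The time of the optimization within `J` rounds. -/
def Flat.optCost (M : Flat) (K J : ℕ) : ℕ := J * (M.augmentCost K + 1) + 10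

/-- A round gains at least `1 / (2m)` of the gap, so the gap shrinks by the factor `(2m - 1) /
(2m)`. Written without fractions, `J` rounds suffice once `gap * (2m - 1) ^ J < (2m) ^ J`. One more
round is allowed for finding that nothing is left to gain. -/
theorem runs_opt {M : Flat} {σ : State} {K J : ℕ} {y : ℕ → ℤ} (hO' : ∀ v, O (-1) v = 0)
    (hO : ∀ q, DConvex (O q)) (hM : M.Ready σ) (hX : M.Feas fun p => σ.arr aX p)
    (hK : σ.reg rPows = K) (hpow : ∀ k : ℕ, k < K → σ.arr aPow k = 2 ^ k)
    (hN : 2 * M.N < 2 ^ K) (hy : M.Feas y) (hymin : ∀ x, M.Feas x → M.obj O y ≤ M.obj O x)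
    (hJ : (M.obj O (fun p => σ.arr aX p) - M.obj O y) *
      (2 * (M.size * M.stepBound) - 1) ^ J < (2 * (M.size * M.stepBound)) ^ J)
    (hm : 0 < M.size * M.stepBound) :
    Runs O optProg σ (M.optCost K (J + 1)) fun σ' => M.Ready σ' ∧
      (M.Feas fun p => σ'.arr aX p) ∧
        ∀ x, M.Feas x → (M.obj O fun p => σ'.arr aX p) ≤ M.obj O x := by
  have hm' : (1 : ℤ) ≤ M.size * M.stepBound := by exact_mod_cast hm
  set m : ℤ := M.size * M.stepBound with hm_def
  unfold optProg
  refine Runs.bind (runs_wp (Q := fun σ' => σ'.reg rPhase = 1 ∧ σ'.reg vGo = 1) rfl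
    (by simp [wp])) fun σ₁ e₁ k₁ => ?_
  have hM₁ := hM.keep k₁ (by decide) (by decide)
  rw [← k₁.arr aX (by decide)] at hX hJ
  -- The exponent is `k - 1` because a positive guard still owes the round that detects optimality.
  refine ((runs_loop (N := J + 1) (B := M.augmentCost K) (fun k σ' => M.Ready σ' ∧
      (M.Feas fun p => σ'.arr aX p) ∧ (0 < σ'.reg vGo → 0 < k ∧
        (M.obj O (fun p => σ'.arr aX p) - M.obj O y) * (2 * m - 1) ^ (k - 1) <
          (2 * m) ^ (k - 1)) ∧
      (¬ 0 < σ'.reg vGo → M.obj O (fun p => σ'.arr aX p) ≤ M.obj O y)) ⟨hM₁, hX, fun _ =>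
        ⟨by omega, hJ⟩, fun h => absurd h (by rw [e₁.2]; decide)⟩
      fun k σ' hi hgo hkeep => ?_).le ?_).imp fun σ₂ e₂ k₂ => ?_
  · obtain ⟨i1, i2, i3, -⟩ := hi
    obtain ⟨hk, i4⟩ := i3 hgo
    refine ⟨k - 1, by omega, (runs_augment hO' hO i1 ?_ i2 ?_ (fun k hk => ?_) hN).imp ?_⟩
    · rw [hkeep.reg _ (by decide), e₁.1]
    · rw [hkeep.reg _ (by decide), k₁.reg _ (by decide), hK]
    · rw [hkeep.arr _ (by decide), k₁.arr _ (by decide), hpow k hk]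
    · rintro σ₂ ⟨j1, j2, B, j3, j4, j5, j6⟩ -
      have hgap := j6 y hy
      have hy2 := hymin _ j2
      refine ⟨j1, j2, fun hpos => ?_, fun hneg => ?_⟩
      -- With exponent `0` the old gap is below `1`, hence at most zero, which leaves no room for a
      -- positive gain `B`.
      · have hk1 : 0 < k - 1 := by
          by_contra h0
          obtain h0 : k - 1 = 0 := by omega
          rw [h0, pow_zero, pow_zero, mul_one] at i4
          omega
        refine ⟨hk1, ?_⟩
        obtain ⟨l, hl⟩ : ∃ l, k - 1 = l + 1 := ⟨k - 2, by omega⟩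
        rw [hl, Nat.add_sub_cancel]
        rw [hl, pow_succ, pow_succ] at i4
        have hp : (0 : ℤ) ≤ (2 * m - 1) ^ l := pow_nonneg (by omega) l
        -- The new gap is at most the old one minus `B`, and the old one is at most `2 * m * B`.
        have h2 : 2 * m * (M.obj O (fun p => σ₂.arr aX p) - M.obj O y) ≤
            (2 * m - 1) * (M.obj O (fun p => σ'.arr aX p) - M.obj O y) := by
          have h3 : 2 * m * (M.obj O (fun p => σ₂.arr aX p) - M.obj O y) ≤
              2 * m * (M.obj O (fun p => σ'.arr aX p) - B - M.obj O y) :=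
            mul_le_mul_of_nonneg_left (by omega) (by omega)
          linarith
        have h3 := mul_le_mul_of_nonneg_right h2 hp
        refine lt_of_mul_lt_mul_left (a := 2 * m) ?_ (by omega)
        linarith
      · have hB0 : B = 0 := by omega
        rw [hB0, mul_zero] at hgap
        omega
  · simp only [Flat.optCost, size, Nat.reduceAdd]
    omega
  · obtain ⟨⟨k, i1, i2, -, i4⟩, i5⟩ := e₂
    exact ⟨i1, i2, fun x hx => (i4 i5).trans (hymin x hx)⟩

/-- The query index of a position is also its cell in the answer. Slack positions write to the cell
`-1`, outside the answer. -/
theorem runs_output {M : Flat} {σ : State} (hM : M.Ready σ) :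
    Runs O outputProg σ (M.size * 5 + 10) fun σ' => σ'.reg 0 = 1 ∧
      ∀ i < M.n, ∀ j < M.t, σ'.arr 6 ((i * M.t + j : ℕ) : ℤ) =
        σ.arr aX ((i * M.brick + j : ℕ) : ℤ) := by
  obtain ⟨F, h1, hR, h3⟩ := hM
  have hbr : M.brick = M.t + (M.r + M.s) := rfl
  unfold outputProg
  refine Runs.bind (runs_wp (Q := fun σ' => σ'.reg cCell = F.P) rfl (by simp [wp_copy, h1.hP]))
    fun σ₁ e₁ k₁ => ?_
  have h₁ := h1.keep k₁ (by decide) (by decide)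
  refine Runs.bind (runs_forDown (N := F.P) (B := 3) (fun k σ' => ∀ i < M.n, ∀ j < M.t,
      k ≤ i * M.brick + j → σ'.arr 6 ((i * M.t + j : ℕ) : ℤ) = F.X (i * M.brick + j))
    (by rw [e₁]; rfl) h₁.one (by decide) (by decide) (by decide)
    (fun i hi j hj hk => absurd hk (by
      have := Flat.pos_lt (M := M) hi (j := j) (by omega)
      rw [hR.P_eq]; omega))
    (fun _ _ _ h => by simpa using h) (fun k hk σ' hi hk' hkeep => ?_)) fun σ₂ e₂ k₂ => ?_
  · refine runs_wp rfl ?_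
    have hq : σ'.arr aQ k = F.q k := by
      rw [hkeep.arr _ (by decide)]; exact h₁.hq k
    have hX : σ'.arr aX k = F.X k := by
      rw [hkeep.arr _ (by decide)]; exact h₁.hX k
    simp only [wp, State.setReg_reg, State.setReg_arr, State.setCell_arr, Nat.reduceEqDiff,
      if_true, if_false, hk', hq, hX]
    intro i hi' j hj hkj
    rw [Function.update_apply]
    have hk'' : k < M.size := by rw [← hR.P_eq]; exact hk
    rcases Flat.pos_cases hk'' with ⟨i₁, hi₁, j₁, hj₁, rfl⟩ | ⟨i₁, hi₁, a, ha, rfl⟩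
    · rw [hR.q_var i₁ hi₁ j₁ hj₁]
      split_ifs with he
      · have he' : i * M.t + j = i₁ * M.t + j₁ := by exact_mod_cast he
        have e2 : j = j₁ := by
          have := congrArg (· % M.t) he'
          simpa [Nat.mul_comm _ M.t, Nat.mul_add_mod, Nat.mod_eq_of_lt hj,
            Nat.mod_eq_of_lt hj₁] using this
        have e3 : i = i₁ := by
          subst e2
          exact Nat.eq_of_mul_eq_mul_right M.t_pos (by omega)
        rw [e2, e3]
      · refine hi i hi' j hj (Nat.lt_of_le_of_ne hkj fun h => he ?_)
        have e2 : j = j₁ := by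
          have := congrArg (· % M.brick) h
          simpa [Flat.mod_eq (M := M) (show j < M.brick by omega),
            Flat.mod_eq (M := M) (show j₁ < M.brick by omega)] using this.symm
        have e3 : i = i₁ := by
          subst e2
          exact Nat.eq_of_mul_eq_mul_right (Flat.brick_pos (M := M)) (by omega)
        rw [e2, e3]
    · rw [hR.q_slack i₁ hi₁ a ha, if_neg (by omega)]
      refine hi i hi' j hj (Nat.lt_of_le_of_ne hkj fun h => ?_)
      have := congrArg (· % M.brick) h
      simp only [Flat.mod_eq (M := M) (show j < M.brick by omega),
        Flat.mod_eq (M := M) (show M.t + a < M.brick by omega)] at this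
      omega
  · refine (runs_wp (c := .const 0 1) rfl ?_).le ?_
    · simp only [wp, State.setReg_reg, State.setReg_arr, if_true, true_and]
      intro i hi j hj
      rw [e₂ i hi j hj (Nat.zero_le _), h3]
    · simp only [size, copy, Nat.reduceAdd, hR.P_eq]
      omega

end NFoldIP

namespace NFoldIP

open Prog Finset

variable {O : ℤ → ℤ → ℤ}

/-! ### Preparation: parameters -/

namespace Flat

/-- The base of the digits. -/
def base (M : Flat) : ℕ := 2 * (M.D * M.stepBound) + 1

/-- The intended content of the registers. -/
def par (M : Flat) : ℕ → ℤ
  | 0 => M.n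
  | 1 => M.r
  | 2 => M.s
  | 3 => M.t
  | 4 => 1
  | 5 => M.D
  | 6 => M.stepBound
  | 7 => M.base
  | 8 => (M.base ^ M.r : ℕ)
  | 9 => M.resBound
  | 10 => (2 * M.resBound + 1 : ℕ)
  | 11 => M.size
  | 12 => M.brick
  | 13 => (M.r + M.s : ℕ)
  | 17 => ((M.size + 1) * (M.stepBound + 1) * (2 * M.resBound + 1) : ℕ)
  | 18 => (5 * M.slackBound : ℕ)
  | 19 => (M.stepBound + 1 : ℕ)
  | 20 => (2 * M.stepBound + 1 : ℕ)
  | 21 => (M.n * M.t : ℕ)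
  | 22 => (M.r * M.t : ℕ)
  | 23 => (M.s * M.t : ℕ)
  | 24 => (M.n * M.t * M.r : ℕ)
  | 25 => (M.n * M.t * M.s : ℕ)
  | 26 => (M.n * M.s : ℕ)
  | 28 => M.N
  | 81 => (M.s * M.D : ℕ)
  | 82 => (2 * M.s * M.D : ℕ)
  | 83 => (2 * M.s * M.D + 1 : ℕ)
  | 84 => (blockBound M.s M.D : ℕ)
  | 85 => (blockBound M.s M.D * M.D : ℕ)
  | 86 => (M.r * (blockBound M.s M.D * M.D) : ℕ)
  | 87 => (2 * M.r * (blockBound M.s M.D * M.D) : ℕ)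
  | 88 => (2 * M.r * (blockBound M.s M.D * M.D) + 1 : ℕ)
  | 89 => ((2 * M.r * (blockBound M.s M.D * M.D) + 1) ^ M.r : ℕ)
  | 90 => (M.D * M.stepBound : ℕ)
  | 91 => (2 * (M.D * M.stepBound) : ℕ)
  | 92 => (2 * M.resBound : ℕ)
  | 93 => (2 * M.stepBound : ℕ)
  | 94 => (M.size + 1 : ℕ)
  | 95 => ((M.size + 1) * (M.stepBound + 1) : ℕ)
  | 96 => ((M.r + M.s) * (M.n * M.t) : ℕ)
  | 97 => ((M.r + M.s) * (M.n * M.t) * M.D : ℕ)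
  | 98 => 10
  | _ => 0

/-- The registers `ys` hold the intended content. -/
def Par (M : Flat) (ys : List ℕ) (σ : State) : Prop := ∀ y ∈ ys, σ.reg y = M.par y

variable {M : Flat} {σ σ' : State} {ys zs : List ℕ}

theorem Par.keep {R A : List ℕ} (h : M.Par ys σ) (hk : Keep R A σ σ') (hR : ∀ y ∈ ys, y ∉ R) :
    M.Par ys σ' := fun y hy => (hk.reg y (hR y hy)).trans (h y hy)

theorem Par.subset (h : M.Par ys σ) (hs : zs ⊆ ys) : M.Par zs σ := fun y hy => h y (hs hy)

theorem Par.cons {z : ℕ} (h : M.Par ys σ) (hz : σ.reg z = M.par z) : M.Par (z :: ys) σ :=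
  List.forall_mem_cons.2 ⟨hz, h⟩

theorem Par.append (h : M.Par ys σ) (h' : M.Par zs σ) : M.Par (ys ++ zs) σ := fun y hy =>
  (List.mem_append.1 hy).elim (h y) (h' y)

/-- The intended contents are collected in the single function `par`, so the parameter code is
checked one instruction at a time, each by an identity between values of `par`. -/
theorem Par.const {z : ℕ} {c : ℤ} (h : M.Par ys σ) (hs : z ∉ ys) (he : M.par z = c) :
    Runs O (.const z c) σ 1 (M.Par (z :: ys)) :=
  (runs_wp (c := .const z c) (Q := fun σ' => σ'.reg z = c) rfl (by simp [wp])).imp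
    fun _ e k => (h.keep k fun y hy => by simp [wregs]; rintro rfl; exact hs hy).cons (e.trans he.symm)

theorem Par.add {z x y : ℕ} (h : M.Par ys σ) (hs : x ∈ ys ∧ y ∈ ys ∧ z ∉ ys)
    (he : M.par z = M.par x + M.par y) : Runs O (.add z x y) σ 1 (M.Par (z :: ys)) :=
  (runs_wp (c := .add z x y) (Q := fun σ' => σ'.reg z = M.par z) rfl
    (by simp [wp, h x hs.1, h y hs.2.1, he])).imp
    fun _ e k => (h.keep k fun y hy => by simp [wregs]; rintro rfl; exact hs.2.2 hy).cons e

theorem Par.mul {z x y : ℕ} (h : M.Par ys σ)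
    (hs : x ∈ ys ∧ y ∈ ys ∧ z ∉ ys ∧ 4 ∈ ys ∧ 30 ∉ ys ∧ z ≠ 30)
    (he : M.par z = M.par x * M.par y) :
    Runs O (mul z x y) σ (3 * (M.par y).natAbs + 7) (M.Par (z :: ys)) := by
  obtain ⟨hx, hy, hz, h4, h30, hz30⟩ := hs
  refine (runs_mul (z := z) (h x hx) (h y hy) (h 4 h4) (fun e => hz (e ▸ hx)) (fun e => hz (e ▸ hy)) hz30
    (fun e => h30 (e ▸ hx)) (fun e => h30 (e ▸ hy)) (fun e => hz (e ▸ h4))).imp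
    fun _ e k => (h.keep k fun y hy => ?_).cons (e.trans he.symm)
  have h1 : y ≠ z := fun e => hz (e ▸ hy)
  have h2 : y ≠ 30 := fun e => h30 (e ▸ hy)
  simp [wregs, Prog.mul, copy, neg, forDown, h1, h2]

theorem Par.pow {z x y a n : ℕ} (h : M.Par ys σ)
    (hs : x ∈ ys ∧ y ∈ ys ∧ z ∉ ys ∧ 4 ∈ ys ∧ 30 ∉ ys ∧ 31 ∉ ys ∧ 32 ∉ ys ∧ z ∉ [30, 31, 32])
    (hx : M.par x = a) (hy : M.par y = n) (he : M.par z = a ^ n) :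
    Runs O (pow z x y) σ (n * (3 * a + 11) + 4) (M.Par (z :: ys)) := by
  obtain ⟨hx', hy', hz, h4, h30, h31, h32, hz'⟩ := hs
  have hne : ∀ y ∈ ys, y ∉ [30, 31, 32] := fun y hy => by
    simp only [List.mem_cons, List.not_mem_nil, or_false, not_or]
    exact ⟨fun e => h30 (e ▸ hy), fun e => h31 (e ▸ hy), fun e => h32 (e ▸ hy)⟩
  refine (runs_pow (z := z) (a := a) (n := n) ((h x hx').trans hx) ((h y hy').trans hy) (h 4 h4)
    (fun e => hz (e ▸ hx')) (fun e => hz (e ▸ hy'))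
    (List.not_mem_cons_of_ne_of_not_mem (fun e => hz (e ▸ h4)) hz') (hne x hx') (hne y hy')).imp
    fun _ e k => (h.keep k fun y hy => ?_).cons (e.trans he.symm)
  have h1 : y ≠ z := fun e => hz (e ▸ hy)
  have h2 := hne y hy
  simp only [List.mem_cons, List.not_mem_nil, or_false, not_or] at h2
  simp [wregs, Prog.pow, Prog.mul, copy, neg, forDown, h1, h2]

end Flat

/-- The dimensions. -/
def dimProg : Prog :=
  .const rOne 1 ;; .add 13 1 2 ;; .add 12 3 13 ;; mul rPos 0 12 ;; mul 21 0 3 ;; mul 22 1 3 ;;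
  mul 23 2 3 ;; mul 24 21 1 ;; mul 25 21 2 ;; mul 26 0 2

theorem runs_dim {M : Flat} {σ : State} (h : M.Par [0, 1, 2, 3] σ) :
    Runs O dimProg σ (6 * M.brick + 12 * M.t + 12 * (M.r + M.s) + 100) fun σ' =>
      M.Par [26, 25, 24, 23, 22, 21, 11, 12, 13, 4, 0, 1, 2, 3] σ' := by
  unfold dimProg
  refine Runs.bind (h.const (by decide) rfl) fun _ h _ => ?_
  refine Runs.bind (h.add (by decide) (by simp [Flat.par])) fun _ h _ => ?_
  refine Runs.bind (h.add (by decide) (by simp [Flat.par, Flat.brick])) fun _ h _ => ?_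
  refine Runs.bind (h.mul (by decide) (by simp [Flat.par, Flat.size])) fun _ h _ => ?_
  refine Runs.bind (h.mul (by decide) (by simp [Flat.par])) fun _ h _ => ?_
  refine Runs.bind (h.mul (by decide) (by simp [Flat.par])) fun _ h _ => ?_
  refine Runs.bind (h.mul (by decide) (by simp [Flat.par])) fun _ h _ => ?_
  refine Runs.bind (h.mul (by decide) (by simp [Flat.par])) fun _ h _ => ?_
  refine Runs.bind (h.mul (by decide) (by simp [Flat.par])) fun _ h _ => ?_
  refine (h.mul (by decide) (by simp [Flat.par])).le ?_
  simp only [Flat.par, Int.natAbs_natCast]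
  omega

/-- The derived parameters. -/
def parProg : Prog :=
  mul 81 2 5 ;; .add 82 81 81 ;; .add 83 82 4 ;; pow 84 83 2 ;; mul 85 84 5 ;; mul 86 1 85 ;;
  .add 87 86 86 ;; .add 88 87 4 ;; pow 89 88 1 ;; mul 6 84 89 ;; mul 90 5 6 ;; .add 91 90 90 ;;
  .add 7 91 4 ;; pow 8 7 1 ;; pow 9 7 13 ;; .add 92 9 9 ;; .add 10 92 4 ;; .add 19 6 4 ;;
  .add 93 6 6 ;; .add 20 93 4 ;; .add 94 11 4 ;; mul 95 94 19 ;; mul 17 95 10 ;; mul 96 13 21 ;;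
  mul 97 96 5 ;; .const 98 10 ;; mul 18 97 98

/-- The time of `parProg`. -/
def Flat.parCost (M : Flat) : ℕ :=
  9 * M.D + M.s * (3 * (2 * M.s * M.D + 1) + 11) + 3 * (blockBound M.s M.D * M.D) +
    M.r * (3 * (2 * M.r * (blockBound M.s M.D * M.D) + 1) + 11) +
    3 * (2 * M.r * (blockBound M.s M.D * M.D) + 1) ^ M.r + 6 * M.stepBound +
    M.r * (3 * M.base + 11) + (M.r + M.s) * (3 * M.base + 11) +
    3 * (2 * M.resBound + 1) + 3 * (M.n * M.t) + 200

theorem runs_par {M : Flat} {σ : State}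
    (h : M.Par [26, 25, 24, 23, 22, 21, 11, 12, 13, 4, 0, 1, 2, 3, 5] σ) :
    Runs O parProg σ M.parCost fun σ' => M.Par [18, 17, 20, 19, 10, 9, 8, 7, 6] σ' := by
  unfold parProg
  refine Runs.bind (h.mul (by decide) (by simp [Flat.par])) fun _ h _ => ?_
  refine Runs.bind (h.add (by decide) (by simp [Flat.par]; ring)) fun _ h _ => ?_
  refine Runs.bind (h.add (by decide) (by simp [Flat.par])) fun _ h _ => ?_
  refine Runs.bind (h.pow (by decide) rfl rfl (by simp [Flat.par, blockBound])) fun _ h _ => ?_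
  refine Runs.bind (h.mul (by decide) (by simp [Flat.par])) fun _ h _ => ?_
  refine Runs.bind (h.mul (by decide) (by simp [Flat.par])) fun _ h _ => ?_
  refine Runs.bind (h.add (by decide) (by simp [Flat.par]; ring)) fun _ h _ => ?_
  refine Runs.bind (h.add (by decide) (by simp [Flat.par])) fun _ h _ => ?_
  refine Runs.bind (h.pow (by decide) rfl rfl (by simp [Flat.par])) fun _ h _ => ?_
  refine Runs.bind (h.mul (by decide) (by simp [Flat.par, Flat.stepBound, graverBound]))
    fun _ h _ => ?_
  refine Runs.bind (h.mul (by decide) (by simp [Flat.par])) fun _ h _ => ?_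
  refine Runs.bind (h.add (by decide) (by simp [Flat.par]; ring)) fun _ h _ => ?_
  refine Runs.bind (h.add (by decide) (by simp [Flat.par, Flat.base])) fun _ h _ => ?_
  refine Runs.bind (h.pow (by decide) rfl rfl (by simp [Flat.par])) fun _ h _ => ?_
  refine Runs.bind (h.pow (by decide) rfl rfl (by simp [Flat.par, Flat.resBound, Flat.base]))
    fun _ h _ => ?_
  refine Runs.bind (h.add (by decide) (by simp [Flat.par]; ring)) fun _ h _ => ?_
  refine Runs.bind (h.add (by decide) (by simp [Flat.par])) fun _ h _ => ?_
  refine Runs.bind (h.add (by decide) (by simp [Flat.par])) fun _ h _ => ?_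
  refine Runs.bind (h.add (by decide) (by simp [Flat.par]; ring)) fun _ h _ => ?_
  refine Runs.bind (h.add (by decide) (by simp [Flat.par])) fun _ h _ => ?_
  refine Runs.bind (h.add (by decide) (by simp [Flat.par])) fun _ h _ => ?_
  refine Runs.bind (h.mul (by decide) (by simp [Flat.par])) fun _ h _ => ?_
  refine Runs.bind (h.mul (by decide) (by simp [Flat.par])) fun _ h _ => ?_
  refine Runs.bind (h.mul (by decide) (by simp [Flat.par])) fun _ h _ => ?_
  refine Runs.bind (h.mul (by decide) (by simp [Flat.par])) fun _ h _ => ?_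
  refine Runs.bind (h.const (by decide) rfl) fun _ h _ => ?_
  refine ((h.mul (by decide) (by simp [Flat.par, Flat.slackBound]; ring)).le ?_).imp
    fun _ h _ => h.subset (by decide)
  have h10 : (10 : ℤ).natAbs = 10 := rfl
  simp only [Flat.par, Int.natAbs_natCast, Flat.parCost, h10]
  omega

/-! ### Preparation: largest entries and powers of two -/

/-- `z := max z |a[p]|` over the cells `p` below the register `y`. -/
def maxProg (z a y : ℕ) : Prog :=
  copy cCell y ;; forDown cCell (.load 73 a cCell ;; abs 74 73 ;; .sub 75 74 z ;;
    .ite 75 (copy z 74) skip)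

theorem runs_max {σ : State} {z a y v m : ℕ} (hv : σ.reg z = v) (hy : σ.reg y = m)
    (h1 : σ.reg rOne = 1) (hz : z ∉ [4, 29, 71, 73, 74, 75]) (hy' : y ≠ 71) :
    Runs O (maxProg z a y) σ (m * 14 + 3) fun σ' =>
      σ'.reg z = (v ⊔ (range m).sup fun p => (σ.arr a p).natAbs : ℕ) := by
  simp only [List.mem_cons, List.not_mem_nil, or_false, not_or] at hz
  unfold maxProg
  refine Runs.bind (runs_wp (Q := fun σ' => σ'.reg cCell = m ∧ σ'.reg z = v) rfl
    (by simp [wp_copy, hy', hy, hz, hv])) fun σ₁ e₁ k₁ => ?_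
  refine ((runs_forDown (N := m) (B := 12) (fun k σ' => ∃ w : ℕ, σ'.reg z = w ∧
      w = v ⊔ (Ico k m).sup fun p => (σ.arr a p).natAbs) (by rw [e₁.1]; rfl)
    (by rw [k₁.reg _ (by simp [wregs, copy]), h1])
    (by simp [wregs, Prog.abs, copy, neg, skip, Ne.symm hz.2.2.1])
    (by simp [wregs, Prog.abs, copy, neg, skip, Ne.symm hz.1]) (by decide)
    ⟨v, e₁.2, by simp⟩ (fun _ _ _ h => by simpa [hz] using h)
    (fun k hk σ' hi hk' hkeep => ?_)).le ?_).imp fun σ₂ e₂ _ => ?_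
  · obtain ⟨w, w1, w2⟩ := hi
    have ha : σ'.arr a k = σ.arr a k := by
      rw [hkeep.arr _ (by simp [warrs, Prog.abs, copy, neg, skip]),
        k₁.arr _ (by simp [warrs, copy])]
    refine (runs_wp rfl ?_).le (by simp [size, Prog.abs, copy, neg, skip])
    have h2 : (Ico k m).sup (fun p => (σ.arr a p).natAbs) =
        (σ.arr a k).natAbs ⊔ (Ico (k + 1) m).sup fun p => (σ.arr a p).natAbs := by
      rw [← insert_Ico_add_one_left_eq_Ico hk, sup_insert]
    simp only [wp, wp_copy, wp_abs, wp_skip, ne_eq, Nat.reduceEqDiff, not_false_eq_true,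
      State.setReg_reg, if_true, if_false, hk', ha, w1, hz, Ne.symm hz.2.2.2.2.1,
      Int.abs_eq_natAbs]
    refine ⟨fun h => ⟨(σ.arr a k).natAbs, by simp, ?_⟩, fun h => ⟨w, rfl, ?_⟩⟩
    · rw [h2]; omega
    · rw [h2]; omega
  · simp only [size, copy, Nat.reduceAdd]; omega
  · obtain ⟨w, w1, w2⟩ := e₂
    rw [w1, w2, range_eq_Ico]

/-- Stores the powers of two up to twice the register `28`, and their number in `rPows`. -/
def powersProg : Prog :=
  (.const rPows 0 ;; .const 33 1 ;; .add 35 28 28 ;; .const 34 1) ;;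
  .loop 34 (.store aPow rPows 33 ;; .add 33 33 33 ;; .add rPows rPows rOne ;; .sub 34 35 33 ;;
    .add 34 34 rOne)

/-- The number of powers of two. -/
def Flat.levels (M : Flat) : ℕ := Nat.log 2 (2 * M.N) + 1

/-- The guard register holds `2 * N - 2 ^ j + 1` after `j` rounds, so the loop stops at the first
power of two beyond `2 * N`. -/
theorem runs_powers {M : Flat} {σ : State} (hN : σ.reg 28 = M.N) (hN0 : 0 < M.N)
    (h1 : σ.reg rOne = 1) :
    Runs O powersProg σ (M.levels * 6 + 5) fun σ' => σ'.reg rPows = M.levels ∧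
      ∀ k : ℕ, k < M.levels → σ'.arr aPow k = 2 ^ k := by
  have hle : ∀ j : ℕ, (2 : ℤ) ^ j ≤ 2 * M.N ↔ j < M.levels := fun j => by
    have : 2 ^ j ≤ 2 * M.N ↔ j ≤ Nat.log 2 (2 * M.N) :=
      (Nat.le_log_iff_pow_le (by norm_num) (by omega)).symm
    rw [Flat.levels, Nat.lt_succ_iff, ← this]
    exact_mod_cast Iff.rfl
  unfold powersProg
  refine Runs.bind (runs_wp (Q := fun σ' => σ'.reg rPows = 0 ∧ σ'.reg 33 = 1 ∧
    σ'.reg 35 = 2 * M.N ∧ σ'.reg 34 = 1) rfl (by simp [wp, hN, two_mul])) fun σ₁ e₁ k₁ => ?_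
  refine ((runs_loop (N := M.levels) (B := 5) (fun k σ' => ∃ j : ℕ, j + k = M.levels ∧
      σ'.reg rPows = j ∧ σ'.reg 33 = 2 ^ j ∧ (∀ i : ℕ, i < j → σ'.arr aPow i = 2 ^ i) ∧
      (0 < σ'.reg 34 ↔ j < M.levels)) ⟨0, by omega, e₁.1, by rw [e₁.2.1]; rfl,
        fun i hi => absurd hi (by omega), by rw [e₁.2.2.2]; simp [Flat.levels]⟩
      fun k σ' hi hgo hkeep => ?_).le ?_).imp fun σ₂ e₂ k₂ => ?_
  · obtain ⟨j, j1, j2, j3, j4, j5⟩ := hi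
    refine ⟨k - 1, by have := j5.1 hgo; omega, runs_wp rfl ?_⟩
    have r1 : σ'.reg rOne = 1 := by rw [hkeep.reg _ (by decide), k₁.reg _ (by decide), h1]
    have r2 : σ'.reg 35 = 2 * M.N := by rw [hkeep.reg _ (by decide), e₁.2.2.1]
    simp only [wp, State.setReg_reg, State.setReg_arr, State.setCell_arr, State.setCell_reg,
      Nat.reduceEqDiff, if_true, if_false, r1, r2, j2, j3]
    refine ⟨j + 1, by have := j5.1 hgo; omega, by push_cast; rfl, by rw [pow_succ]; ring,
      fun i hi => ?_, ?_⟩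
    · rw [Function.update_apply]
      split_ifs with h
      · rw [show i = j by exact_mod_cast h]
      · exact j4 i (by have : i ≠ j := by exact_mod_cast h
                       omega)
    · rw [← hle, pow_succ]; omega
  · simp only [size, Nat.reduceAdd]; omega
  · obtain ⟨⟨k, j, j1, j2, j3, j4, j5⟩, j6⟩ := e₂
    obtain rfl : j = M.levels := by
      have : ¬ j < M.levels := fun h => j6 (j5.2 h)
      omega
    exact ⟨j2, j4⟩

end NFoldIP

namespace NFoldIP

open Prog Finset

variable {O : ℤ → ℤ → ℤ}

/-! ### Preparation: the layout of the positions -/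

namespace Flat

/-- The registers that hold parameters. -/
def pars : List ℕ :=
  [0, 1, 2, 3, 4, 5, 6, 7, 8, 9, 10, 11, 12, 13, 17, 18, 19, 20, 21, 22, 23, 24, 25, 26, 28]

/-- The registers and arrays of `σ` hold the parameters and the input. -/
structure Base (M : Flat) (σ : State) : Prop where
  par : M.Par pars σ
  A : σ.arr 0 = M.A
  B : σ.arr 1 = M.B
  b : σ.arr 2 = M.b
  c : σ.arr 3 = M.c
  lo : σ.arr aLow = M.lo
  hi : σ.arr aUpp = M.hi

variable {M : Flat} {σ σ' : State}

theorem Base.keep {R A : List ℕ} (h : M.Base σ) (hk : Keep R A σ σ') (hR : ∀ y ∈ pars, y ∉ R)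
    (hA : ∀ a < 6, a ∉ A) : M.Base σ' :=
  ⟨h.par.keep hk hR, (hk.arr _ (hA 0 (by decide))).trans h.A,
    (hk.arr _ (hA 1 (by decide))).trans h.B, (hk.arr _ (hA 2 (by decide))).trans h.b,
    (hk.arr _ (hA 3 (by decide))).trans h.c, (hk.arr _ (hA 4 (by decide))).trans h.lo,
    (hk.arr _ (hA 5 (by decide))).trans h.hi⟩

/-- The query index of a position. -/
def query (M : Flat) (p : ℕ) : ℤ :=
  if p % M.brick < M.t then (p / M.brick * M.t + p % M.brick : ℕ) else -1

/-- The starting point. -/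
def start (M : Flat) (p : ℕ) : ℤ := if p % M.brick < M.t then M.lo (M.query p) else 0

/-- The column of a position as a single number. -/
def code (M : Flat) (p : ℕ) : ℤ := ∑ a ∈ range (M.r + M.s), M.col p a * (M.base : ℤ) ^ a

/-- The right-hand side that is left for the slack variables at the starting point. -/
def rest (M : Flat) (p : ℕ) : ℤ :=
  if p % M.brick < M.t then 0
  else if p % M.brick < M.t + M.r then
    if p / M.brick = 0 then M.b ((p % M.brick - M.t : ℕ) : ℤ) -
      ∑ p' ∈ range M.size, M.col p' (p % M.brick - M.t) * M.start p' else 0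
  else M.c ((p / M.brick * M.s + (p % M.brick - M.t - M.r) : ℕ) : ℤ) -
    ∑ j ∈ range M.brick, M.col (p / M.brick * M.brick + j) (p % M.brick - M.t) *
      M.start (p / M.brick * M.brick + j)

end Flat

/-! ### Column entries, their codes and the cells of a position. -/

/-- Register `74` gets the entry in row `73` of the column `72` of the brick `71`. -/
def colProg : Prog :=
  .sub 75 3 72 ;; .ite 75
    (.sub 75 1 73 ;; .ite 75
      (mul 76 71 22 ;; mul 77 73 3 ;; (.add 76 76 77 ;; .add 76 76 72 ;; .load 74 0 76))
      (mul 76 71 23 ;; .sub 78 73 1 ;; mul 77 78 3 ;;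
        (.add 76 76 77 ;; .add 76 76 72 ;; .load 74 1 76)))
    (.sub 75 72 3 ;; .sub 75 75 73 ;; abs 76 75 ;; .ite 76 (.const 74 0) (.const 74 1))

/-- The time of `colProg`. -/
def Flat.colCost (M : Flat) : ℕ := 3 * (M.r * M.t) + 3 * (M.s * M.t) + 3 * M.t + 40

theorem runs_col {M : Flat} {σ : State} {i j a : ℕ} (h : M.Base σ) (hi : σ.reg 71 = i)
    (hj : σ.reg 72 = j) (ha : σ.reg 73 = a) (hjb : j < M.brick) :
    Runs O colProg σ M.colCost fun σ' => σ'.reg 74 = M.col (i * M.brick + j) a := by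
  have ht : σ.reg 3 = M.t := h.par 3 (by decide)
  have hr : σ.reg 1 = M.r := h.par 1 (by decide)
  rw [Flat.col, Flat.mod_eq hjb, Flat.div_eq hjb]
  unfold colProg
  refine Runs.bind (runs_wp (Q := fun σ' => σ'.reg 75 = M.t - j) rfl (by simp [wp, ht, hj]))
    fun σ₁ e₁ k₁ => ?_
  have h₁ := h.keep k₁ (by decide) (by decide)
  have i₁ : σ₁.reg 71 = i := by rw [k₁.reg _ (by decide), hi]
  have j₁ : σ₁.reg 72 = j := by rw [k₁.reg _ (by decide), hj]
  have a₁ : σ₁.reg 73 = a := by rw [k₁.reg _ (by decide), ha]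
  have t₁ : σ₁.reg 3 = M.t := h₁.par 3 (by decide)
  have r₁ : σ₁.reg 1 = M.r := h₁.par 1 (by decide)
  refine Runs.ite (fun hp => ?_) (fun hp => ?_)
  · rw [if_pos (by omega)]
    refine Runs.bind (runs_wp (Q := fun σ' => σ'.reg 75 = M.r - a) rfl (by simp [wp, r₁, a₁]))
      fun σ₂ e₂ k₂ => ?_
    have h₂ := h₁.keep k₂ (by decide) (by decide)
    have i₂ : σ₂.reg 71 = i := by rw [k₂.reg _ (by decide), i₁]
    have j₂ : σ₂.reg 72 = j := by rw [k₂.reg _ (by decide), j₁]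
    have a₂ : σ₂.reg 73 = a := by rw [k₂.reg _ (by decide), a₁]
    have r₂ : σ₂.reg 1 = M.r := h₂.par 1 (by decide)
    refine Runs.ite (fun hp' => ?_) (fun hp' => ?_)
    · rw [if_pos (by omega)]
      refine Runs.bind (runs_mul (a := i) (b := (M.r * M.t : ℕ)) i₂ (h₂.par 22 (by decide))
        (h₂.par 4 (by decide)) (by decide) (by decide) (by decide) (by decide) (by decide)
        (by decide)) fun σ₃ e₃ k₃ => ?_
      have h₃ := h₂.keep k₃ (by decide) (by decide)
      refine Runs.bind (runs_mul (a := a) (b := M.t) (by rw [k₃.reg _ (by decide), a₂])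
        (h₃.par 3 (by decide)) (h₃.par 4 (by decide)) (by decide) (by decide) (by decide)
        (by decide) (by decide) (by decide)) fun σ₄ e₄ k₄ => ?_
      have h₄ := h₃.keep k₄ (by decide) (by decide)
      have j₄ : σ₄.reg 72 = j := by rw [k₄.reg _ (by decide), k₃.reg _ (by decide), j₂]
      have e₃' : σ₄.reg 76 = i * (M.r * M.t : ℕ) := by rw [k₄.reg _ (by decide), e₃]
      refine (runs_wp rfl ?_).le ?_
      · simp only [wp, State.setReg_reg, State.setReg_arr, Nat.reduceEqDiff, if_true, if_false,
          e₃', e₄, j₄, h₄.A]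
        congr 1
        push_cast
        ring
      · simp only [Flat.colCost, size, Int.natAbs_natCast, Nat.reduceAdd]
        omega
    · rw [if_neg (by omega)]
      refine Runs.bind (runs_mul (a := i) (b := (M.s * M.t : ℕ)) i₂ (h₂.par 23 (by decide))
        (h₂.par 4 (by decide)) (by decide) (by decide) (by decide) (by decide) (by decide)
        (by decide)) fun σ₃ e₃ k₃ => ?_
      have h₃ := h₂.keep k₃ (by decide) (by decide)
      refine Runs.bind (runs_wp (Q := fun σ' => σ'.reg 78 = (a - M.r : ℕ)) rfl (by
        simp only [wp, State.setReg_reg, if_true]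
        rw [k₃.reg 73 (by decide), k₃.reg 1 (by decide), a₂, r₂]
        omega)) fun σ₃' e₃' k₃' => ?_
      have h₃' := h₃.keep k₃' (by decide) (by decide)
      refine Runs.bind (runs_mul (b := M.t) e₃'
        (h₃'.par 3 (by decide)) (h₃'.par 4 (by decide)) (by decide) (by decide) (by decide)
        (by decide) (by decide) (by decide)) fun σ₄ e₄ k₄ => ?_
      have h₄ := h₃'.keep k₄ (by decide) (by decide)
      have j₄ : σ₄.reg 72 = j := by
        rw [k₄.reg _ (by decide), k₃'.reg _ (by decide), k₃.reg _ (by decide), j₂]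
      have e₃'' : σ₄.reg 76 = i * (M.s * M.t : ℕ) := by
        rw [k₄.reg _ (by decide), k₃'.reg _ (by decide), e₃]
      refine (runs_wp rfl ?_).le ?_
      · simp only [wp, State.setReg_reg, State.setReg_arr, Nat.reduceEqDiff, if_true, if_false,
          e₃'', e₄, j₄, h₄.B]
        congr 1
        push_cast
        ring
      · simp only [Flat.colCost, size, Int.natAbs_natCast, Nat.reduceAdd]
        omega
  · rw [if_neg (by omega)]
    refine (runs_wp rfl ?_).le ?_
    · simp only [wp, wp_abs, ne_eq, not_false_eq_true, State.setReg_reg, Nat.reduceEqDiff, if_true,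
        if_false, j₁, t₁, a₁]
      refine ⟨fun h0 => ?_, fun h0 => ?_⟩
      · rw [if_neg]
        rw [abs_pos] at h0
        omega
      · rw [if_pos]
        rw [abs_pos, not_not] at h0
        omega
    · simp only [Flat.colCost, size, Prog.abs, copy, neg, Nat.reduceAdd]
      omega

/-- Register `79` gets the column as a single number. -/
def codeProg : Prog :=
  (.const 79 0 ;; copy 73 13) ;; forDown 73 (colProg ;; mul 80 79 7 ;; .add 79 80 74)

/-- The time of `codeProg`. -/
def Flat.codeCost (M : Flat) : ℕ := (M.r + M.s) * (M.colCost + 3 * M.base + 10) + 4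

/-- Horner's scheme from the last row down: with `k` rows left, the register holds the digits of the
rows from `k` on. -/
theorem runs_code {M : Flat} {σ : State} {i j : ℕ} (h : M.Base σ) (hi : σ.reg 71 = i)
    (hj : σ.reg 72 = j) (hjb : j < M.brick) :
    Runs O codeProg σ M.codeCost fun σ' => σ'.reg 79 = M.code (i * M.brick + j) := by
  unfold codeProg
  refine Runs.bind (runs_wp (Q := fun σ' => σ'.reg 79 = 0 ∧ σ'.reg 73 = (M.r + M.s : ℕ)) rfl
    (by simp [wp, wp_copy, show σ.reg 13 = (M.r + M.s : ℕ) from h.par 13 (by decide)]))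
    fun σ₁ e₁ k₁ => ?_
  have h₁ := h.keep k₁ (by decide) (by decide)
  refine ((runs_forDown (N := M.r + M.s) (B := M.colCost + 3 * M.base + 8) (fun k σ' =>
    σ'.reg 79 = ∑ a ∈ range (M.r + M.s - k), M.col (i * M.brick + j) (k + a) * (M.base : ℤ) ^ a)
    (by rw [e₁.2]; rfl) (h₁.par 4 (by decide)) (by decide) (by decide) (by decide)
    (by rw [e₁.1]; simp) (fun _ _ _ h => by simpa using h)
    (fun k hk σ' hi' hk' hkeep => ?_)).le ?_).imp fun σ₂ e₂ _ => ?_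
  · have h' := h₁.keep hkeep (by decide) (by decide)
    refine Runs.bind (runs_col h' (by rw [hkeep.reg _ (by decide), k₁.reg _ (by decide), hi])
      (by rw [hkeep.reg _ (by decide), k₁.reg _ (by decide), hj]) hk' hjb) fun σ₂ e₂ k₂ => ?_
    have h₂ := h'.keep k₂ (by decide) (by decide)
    refine Runs.bind (runs_mul (b := M.base) ((k₂.reg 79 (by decide)).trans hi')
      (h₂.par 7 (by decide)) (h₂.par 4 (by decide)) (by decide) (by decide) (by decide)
      (by decide) (by decide) (by decide)) fun σ₃ e₃ k₃ => ?_
    refine (runs_wp rfl ?_).le ?_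
    · simp only [wp, State.setReg_reg, if_true, e₃]
      rw [k₃.reg _ (by decide), e₂, show M.r + M.s - k = M.r + M.s - (k + 1) + 1 by omega,
        sum_range_succ', sum_mul]
      simp only [pow_zero, mul_one, add_zero, pow_succ, mul_assoc, add_assoc, add_comm 1]
    · simp only [size, Int.natAbs_natCast]
      omega
  · simp only [Flat.codeCost, size, copy, Nat.reduceAdd, Nat.add_assoc]
    omega
  · rw [e₂]
    simp only [Nat.sub_zero, zero_add, Flat.code]

/-- Fills the cells of one position. -/
def cellProg : Prog :=
  codeProg ;; mul 81 71 12 ;; (.add 81 81 72 ;; .store aCol 81 79 ;; .sub 75 3 72) ;;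
  .ite 75 (mul 82 71 3 ;; (.add 82 82 72 ;; .store aQ 81 82 ;; .load 83 aLow 82 ;;
      .store aX 81 83))
    (.const 82 (-1) ;; .store aQ 81 82 ;; .const 83 0 ;; .store aX 81 83)

/-- The time of `cellProg`. -/
def Flat.cellCost (M : Flat) : ℕ := M.codeCost + 3 * M.brick + 3 * M.t + 30

theorem runs_cell {M : Flat} {σ : State} {i j : ℕ} (h : M.Base σ) (hi : σ.reg 71 = i)
    (hj : σ.reg 72 = j) (hjb : j < M.brick) :
    Runs O cellProg σ M.cellCost fun σ' =>
      σ'.arr aCol = Function.update (σ.arr aCol) (i * M.brick + j : ℕ)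
        (M.code (i * M.brick + j)) ∧
      σ'.arr aQ = Function.update (σ.arr aQ) (i * M.brick + j : ℕ) (M.query (i * M.brick + j)) ∧
      σ'.arr aX = Function.update (σ.arr aX) (i * M.brick + j : ℕ) (M.start (i * M.brick + j)) := by
  rw [Flat.start, Flat.query, Flat.mod_eq hjb, Flat.div_eq hjb]
  unfold cellProg
  refine Runs.bind (runs_code h hi hj hjb) fun σ₁ e₁ k₁ => ?_
  have h₁ := h.keep k₁ (by decide) (by decide)
  have i₁ : σ₁.reg 71 = i := by rw [k₁.reg _ (by decide), hi]
  have j₁ : σ₁.reg 72 = j := by rw [k₁.reg _ (by decide), hj]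
  refine Runs.bind (runs_mul (b := M.brick) i₁ (h₁.par 12 (by decide)) (h₁.par 4 (by decide))
    (by decide) (by decide) (by decide) (by decide) (by decide) (by decide)) fun σ₂ e₂ k₂ => ?_
  have h₂ := h₁.keep k₂ (by decide) (by decide)
  have j₂ : σ₂.reg 72 = j := by rw [k₂.reg _ (by decide), j₁]
  have c₂ : σ₂.reg 79 = M.code (i * M.brick + j) := by rw [k₂.reg _ (by decide), e₁]
  have t₂ : σ₂.reg 3 = M.t := h₂.par 3 (by decide)
  have a₂ : ∀ a, σ₂.arr a = σ.arr a := fun a => by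
    rw [k₂.arr _ (by simp [warrs, mul, copy, neg, forDown]), k₁.arr _ (by
      simp [warrs, mul, copy, neg, forDown, codeProg, colProg, Prog.abs])]
  refine Runs.bind (runs_wp (Q := fun σ' => σ'.reg 81 = (i * M.brick + j : ℕ) ∧
    σ'.reg 75 = M.t - j ∧ σ'.arr aCol = Function.update (σ.arr aCol) (i * M.brick + j : ℕ)
      (M.code (i * M.brick + j))) rfl (by
    simp [wp, e₂, j₂, t₂, c₂, a₂])) fun σ₃ e₃ k₃ => ?_
  have h₃ := h₂.keep k₃ (by decide) (by decide)
  have j₃ : σ₃.reg 72 = j := by rw [k₃.reg _ (by decide), j₂]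
  have q₃ : σ₃.arr aQ = σ.arr aQ := by rw [k₃.arr _ (by decide), a₂]
  have x₃ : σ₃.arr aX = σ.arr aX := by rw [k₃.arr _ (by decide), a₂]
  refine Runs.ite (fun hp => ?_) (fun hp => ?_)
  · rw [if_pos (by omega), if_pos (by omega)]
    refine Runs.bind (runs_mul (a := i) (b := M.t)
      (by rw [k₃.reg _ (by decide), k₂.reg _ (by decide), i₁]) (h₃.par 3 (by decide))
      (h₃.par 4 (by decide)) (by decide) (by decide) (by decide) (by decide) (by decide)
      (by decide)) fun σ₄ e₄ k₄ => ?_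
    have h₄ := h₃.keep k₄ (by decide) (by decide)
    have j₄ : σ₄.reg 72 = j := by rw [k₄.reg _ (by decide), j₃]
    have p₄ : σ₄.reg 81 = (i * M.brick + j : ℕ) := by rw [k₄.reg _ (by decide), e₃.1]
    have hq : (i * M.t + j : ℤ) = ((i * M.t + j : ℕ) : ℤ) := by push_cast; rfl
    refine (runs_wp rfl ?_).le ?_
    · simp only [wp, State.setReg_reg, State.setReg_arr, State.setCell_arr, State.setCell_reg,
        Nat.reduceEqDiff, if_true, if_false, e₄, j₄, p₄, h₄.lo, hq]
      rw [k₄.arr aCol (by decide), k₄.arr aQ (by decide), k₄.arr aX (by decide), e₃.2.2, q₃, x₃]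
      exact ⟨rfl, rfl, rfl⟩
    · simp only [Flat.cellCost, size, Int.natAbs_natCast, Nat.reduceAdd]
      omega
  · rw [if_neg (by omega), if_neg (by omega)]
    refine (runs_wp rfl ?_).le ?_
    · simp only [wp, State.setReg_reg, State.setReg_arr, State.setCell_arr, State.setCell_reg,
        Nat.reduceEqDiff, if_true, if_false, e₃.1, e₃.2.2, q₃, x₃, and_self]
    · simp only [Flat.cellCost, size, Int.natAbs_natCast, Nat.reduceAdd]
      omega

/-- Fills the cells of all positions. -/
def layoutProg : Prog :=
  copy 71 0 ;; forDown 71 (copy 72 12 ;; forDown 72 cellProg ;; mul 81 71 12 ;;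
    .store aMark 81 rOne)

/-- The time of `layoutProg`. -/
def Flat.layoutCost (M : Flat) : ℕ :=
  M.n * (M.brick * (M.cellCost + 2) + 3 * M.brick + 20) + 10

/-- The cells of the position `p` are filled. -/
def Flat.Filled (M : Flat) (p : ℕ) (σ : State) : Prop :=
  σ.arr aCol p = M.code p ∧ σ.arr aQ p = M.query p ∧ σ.arr aX p = M.start p

/-- Bricks and positions are treated from the end, so all cells from the current position on are
filled. The first position of a brick is marked after the brick is done. -/
theorem runs_layout {M : Flat} {σ : State} (h : M.Base σ) (hmark : σ.arr aMark = fun _ => 0) :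
    Runs O layoutProg σ M.layoutCost fun σ' => (∀ p < M.size, M.Filled p σ') ∧
      ∀ p < M.size, 0 < σ'.arr aMark p ↔ M.brick ∣ p := by
  unfold layoutProg
  refine Runs.bind (runs_wp (Q := fun σ' => σ'.reg 71 = M.n) rfl
    (by simp [wp_copy, show σ.reg 0 = M.n from h.par 0 (by decide)])) fun σ₁ e₁ k₁ => ?_
  have h₁ := h.keep k₁ (by decide) (by decide)
  refine ((runs_forDown (N := M.n) (B := M.brick * (M.cellCost + 2) + 3 * M.brick + 18)
    (fun i σ' => (∀ p < M.size, i * M.brick ≤ p → M.Filled p σ') ∧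
      ∀ p : ℕ, 0 < σ'.arr aMark p ↔ M.brick ∣ p ∧ i * M.brick ≤ p ∧ p < M.size)
    (by rw [e₁]; rfl) (h₁.par 4 (by decide)) (by decide) (by decide) (by decide)
    ⟨fun p hp hp' => absurd hp (not_lt.2 hp'), fun p => by
      rw [k₁.arr _ (by decide), hmark]
      simp only [lt_self_iff_false, false_iff, not_and, not_lt]
      exact fun _ => id⟩
    (fun _ _ _ h => by simpa [Flat.Filled] using h) (fun i hi σ' hinv hi' hkeep => ?_)).le ?_).imp
    fun σ₂ e₂ _ => ⟨fun p hp => e₂.1 p hp (by simp), fun p hp => by simp [e₂.2 p, hp]⟩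
  · have h' := h₁.keep hkeep (by decide) (by decide)
    have hib : (i + 1) * M.brick = i * M.brick + M.brick := by ring
    refine Runs.bind (runs_wp (Q := fun σ' => σ'.reg 72 = M.brick) rfl
      (by simp [wp_copy, show σ'.reg 12 = M.brick from h'.par 12 (by decide)])) fun σ₂ e₂ k₂ => ?_
    have h₂ := h'.keep k₂ (by decide) (by decide)
    have hf₂ : ∀ p, M.Filled p σ' → M.Filled p σ₂ := fun p hp => by
      unfold Flat.Filled at hp ⊢
      rwa [k₂.arr aCol (by decide), k₂.arr aQ (by decide), k₂.arr aX (by decide)]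
    refine Runs.bind (runs_forDown (N := M.brick) (B := M.cellCost)
      (fun j σ'' => ∀ p < M.size, i * M.brick + j ≤ p → M.Filled p σ'')
      (by rw [e₂]; rfl) (h₂.par 4 (by decide)) (by decide) (by decide) (by decide)
      (fun p hp hp' => hf₂ p (hinv.1 p hp (by omega)))
      (fun _ _ _ h => by simpa [Flat.Filled] using h) (fun j hj σ'' hinv' hj' hkeep' => ?_))
      fun σ₃ e₃ k₃ => ?_
    · have h'' := h₂.keep hkeep' (by decide) (by decide)
      refine (runs_cell h'' (by rw [hkeep'.reg _ (by decide), k₂.reg _ (by decide), hi'])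
        hj' hj).imp fun σ₃ e₃ _ p hp hp' => ?_
      obtain ⟨c1, c2, c3⟩ := e₃
      unfold Flat.Filled
      rw [c1, c2, c3]
      rcases Nat.eq_or_lt_of_le hp' with rfl | hlt
      · simp
      · have hne : (p : ℤ) ≠ (i * M.brick + j : ℕ) := by exact_mod_cast hlt.ne'
        simp only [Function.update_of_ne hne]
        exact hinv' p hp (by omega)
    have h₃ := h₂.keep k₃ (by decide) (by decide)
    refine Runs.bind (runs_mul (a := i) (b := M.brick)
      (by rw [k₃.reg _ (by decide), k₂.reg _ (by decide), hi']) (h₃.par 12 (by decide))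
      (h₃.par 4 (by decide)) (by decide) (by decide) (by decide) (by decide) (by decide)
      (by decide)) fun σ₄ e₄ k₄ => ?_
    have h₄ := h₃.keep k₄ (by decide) (by decide)
    have hm₄ : σ₄.arr aMark = σ'.arr aMark := by
      rw [k₄.arr _ (by decide), k₃.arr _ (by decide), k₂.arr _ (by decide)]
    refine (runs_wp (c := .store aMark 81 rOne) rfl ?_).le ?_
    · simp only [wp, State.setCell_arr, if_true, e₄, hm₄,
        show σ₄.reg 4 = 1 from h₄.par 4 (by decide)]
      refine ⟨fun p hp hp' => ?_, fun p => ?_⟩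
      · have := e₃ p hp hp'
        unfold Flat.Filled at this ⊢
        simp only [State.setCell_arr, Nat.reduceEqDiff, if_false]
        rwa [k₄.arr aCol (by decide), k₄.arr aQ (by decide), k₄.arr aX (by decide)]
      · have hlt := Flat.pos_lt hi (Flat.brick_pos (M := M))
        rw [add_zero] at hlt
        rw [Function.update_apply]
        by_cases hp : p = i * M.brick
        · rw [if_pos (by rw [hp]; push_cast; rfl)]
          simp [hp, hlt]
        · rw [if_neg (by exact_mod_cast hp), hinv.2 p]
          refine and_congr_right fun ⟨k, hk⟩ => and_congr_left fun _ => ?_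
          rw [hk, Nat.mul_comm M.brick k]
          rw [hk, Nat.mul_comm M.brick k] at hp
          have hb := Flat.brick_pos (M := M)
          rw [Nat.mul_le_mul_right_iff hb, Nat.mul_le_mul_right_iff hb]
          have : k ≠ i := fun e => hp (by rw [e])
          omega
    · simp only [size, copy, Nat.reduceAdd, Int.natAbs_natCast]
      omega
  · simp only [Flat.layoutCost, size, copy, Nat.add_assoc, Nat.reduceAdd]
    omega

end NFoldIP

namespace NFoldIP

open Prog Finset

variable {O : ℤ → ℤ → ℤ}

/-! ### Preparation: the remaining right-hand side -/

/-- Subtracts the entry in row `73` of the position `72` of the brick `71`, times the value of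
the position, from register `84`. -/
def termProg : Prog :=
  colProg ;; mul 81 71 12 ;; (.add 81 81 72 ;; .load 82 aX 81) ;; mul 83 82 74 ;; .sub 84 84 83

/-- The time of `termProg`. -/
def Flat.termCost (M : Flat) : ℕ := M.colCost + 3 * M.brick + 3 * M.D + 30

/-- The matrix entry, bounded by `D`, is the second factor of the product; the value of the variable
may be as large as `N`. -/
theorem runs_term {M : Flat} {σ : State} {i j a : ℕ} {v : ℤ} (h : M.Base σ)
    (hX : ∀ p < M.size, M.Filled p σ) (hi : σ.reg 71 = i) (hj : σ.reg 72 = j)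
    (ha : σ.reg 73 = a) (hin : i < M.n) (hjb : j < M.brick) (hv : σ.reg 84 = v) :
    Runs O termProg σ M.termCost fun σ' =>
      σ'.reg 84 = v - M.col (i * M.brick + j) a * M.start (i * M.brick + j) := by
  unfold termProg
  refine Runs.bind (runs_col h hi hj ha hjb) fun σ₁ e₁ k₁ => ?_
  have h₁ := h.keep k₁ (by decide) (by decide)
  refine Runs.bind (runs_mul (a := i) (b := M.brick) (by rw [k₁.reg _ (by decide), hi])
    (h₁.par 12 (by decide)) (h₁.par 4 (by decide)) (by decide) (by decide) (by decide)
    (by decide) (by decide) (by decide)) fun σ₂ e₂ k₂ => ?_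
  have h₂ := h₁.keep k₂ (by decide) (by decide)
  have hXX : σ₂.arr aX ((i * M.brick + j : ℕ) : ℤ) = M.start (i * M.brick + j) := by
    rw [k₂.arr _ (by decide), k₁.arr _ (by decide)]
    exact (hX _ (Flat.pos_lt hin hjb)).2.2
  have j₂ : σ₂.reg 72 = j := by rw [k₂.reg _ (by decide), k₁.reg _ (by decide), hj]
  have hp : (i * M.brick + j : ℤ) = ((i * M.brick + j : ℕ) : ℤ) := by push_cast; rfl
  refine Runs.bind (runs_wp (Q := fun σ' => σ'.reg 82 = M.start (i * M.brick + j)) rfl (by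
    simp only [wp, State.setReg_reg, State.setReg_arr, Nat.reduceEqDiff, if_true, if_false, e₂, j₂,
      hp, hXX])) fun σ₃ e₃ k₃ => ?_
  have h₃ := h₂.keep k₃ (by decide) (by decide)
  have hc := Flat.abs_col_le (M := M) (i * M.brick + j) a
  refine Runs.bind (runs_mul (b := M.col (i * M.brick + j) a) e₃
    (by rw [k₃.reg _ (by decide), k₂.reg _ (by decide), e₁]) (h₃.par 4 (by decide)) (by decide)
    (by decide) (by decide) (by decide) (by decide) (by decide)) fun σ₄ e₄ k₄ => ?_
  refine (runs_wp (c := .sub 84 84 83) rfl ?_).le ?_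
  · simp only [wp, State.setReg_reg, if_true, e₄]
    rw [k₄.reg _ (by decide), k₃.reg _ (by decide), k₂.reg _ (by decide), k₁.reg _ (by decide), hv,
      mul_comm]
  · rw [Int.abs_eq_natAbs] at hc
    simp only [Flat.termCost, size, Int.natAbs_natCast, Nat.reduceAdd]
    omega

/-- Subtracts the product of row `73` with the brick `71` from register `84`. -/
def brickProg : Prog := copy 72 12 ;; forDown 72 termProg

/-- The time of `brickProg`. -/
def Flat.brickCost (M : Flat) : ℕ := M.brick * (M.termCost + 2) + 5

theorem runs_brick {M : Flat} {σ : State} {i a : ℕ} {v : ℤ} (h : M.Base σ)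
    (hX : ∀ p < M.size, M.Filled p σ) (hi : σ.reg 71 = i)
    (ha : σ.reg 73 = a) (hin : i < M.n) (hv : σ.reg 84 = v) :
    Runs O brickProg σ M.brickCost fun σ' => σ'.reg 84 = v -
      ∑ j ∈ range M.brick, M.col (i * M.brick + j) a * M.start (i * M.brick + j) := by
  unfold brickProg
  refine Runs.bind (runs_wp (Q := fun σ' => σ'.reg 72 = M.brick) rfl
    (by simp [wp_copy, show σ.reg 12 = M.brick from h.par 12 (by decide)])) fun σ₁ e₁ k₁ => ?_
  have h₁ := h.keep k₁ (by decide) (by decide)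
  have hX₁ : ∀ p < M.size, M.Filled p σ₁ := fun p hp => by
    have := hX p hp
    unfold Flat.Filled at this ⊢
    rwa [k₁.arr aCol (by decide), k₁.arr aQ (by decide), k₁.arr aX (by decide)]
  refine ((runs_forDown (N := M.brick) (B := M.termCost) (fun k σ' => σ'.reg 84 = v -
      (∑ j ∈ range M.brick, M.col (i * M.brick + j) a * M.start (i * M.brick + j) -
      ∑ j ∈ range k, M.col (i * M.brick + j) a * M.start (i * M.brick + j)))
    (by rw [e₁]; rfl) (h₁.par 4 (by decide)) (by decide) (by decide) (by decide)
    (by rw [k₁.reg _ (by decide), hv]; ring) (fun _ _ _ h => by simpa using h)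
    (fun k hk σ' hi' hk' hkeep => ?_)).le ?_).imp fun σ₂ e₂ _ => by simpa using e₂
  · have h' := h₁.keep hkeep (by decide) (by decide)
    refine (runs_term h' (fun p hp => ?_)
      (by rw [hkeep.reg _ (by decide), k₁.reg _ (by decide), hi]) hk'
      (by rw [hkeep.reg _ (by decide), k₁.reg _ (by decide), ha]) hin hk hi').imp fun σ₂ e₂ _ => ?_
    · have := hX₁ p hp
      unfold Flat.Filled at this ⊢
      rwa [hkeep.arr aCol (by decide), hkeep.arr aQ (by decide), hkeep.arr aX (by decide)]
    · rw [e₂, sum_range_succ]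
      ring
  · simp only [Flat.brickCost, size, copy, Nat.reduceAdd]
    omega

/-- The remaining right-hand side of the top rows. -/
def topProg : Prog :=
  copy 73 1 ;; forDown 73 ((.load 84 2 73 ;; copy 71 0) ;; forDown 71 brickProg ;;
    .add 85 3 73 ;; .store aRem 85 84)

/-- The time of `topProg`. -/
def Flat.topCost (M : Flat) : ℕ := M.r * (M.n * (M.brickCost + 2) + 20) + 10

theorem Flat.rest_top {M : Flat} {a : ℕ} (ha : a < M.r) : M.rest (M.t + a) =
    M.b a - ∑ i ∈ range M.n,
      ∑ j ∈ range M.brick, M.col (i * M.brick + j) a * M.start (i * M.brick + j) := by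
  have hb : M.t + a < M.brick := by unfold Flat.brick; omega
  rw [rest, Nat.mod_eq_of_lt hb, Nat.div_eq_of_lt hb, if_neg (by omega), if_pos (by omega),
    if_pos rfl, Nat.add_sub_cancel_left, size, sum_range_mul]

/-- The right-hand side of a top row that the starting point misses is charged to the slack variable
in the brick `0`. -/
theorem runs_top {M : Flat} {σ : State} (h : M.Base σ) (hX : ∀ p < M.size, M.Filled p σ)
    (h0 : σ.arr aRem = fun _ => 0) :
    Runs O topProg σ M.topCost fun σ' => ∀ p < M.size, p % M.brick < M.t + M.r →
      σ'.arr aRem p = M.rest p := by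
  have hb : M.brick = M.t + (M.r + M.s) := rfl
  have hF : ∀ {R A : List ℕ} {σ σ' : State}, Keep R A σ σ' → aCol ∉ A → aQ ∉ A → aX ∉ A →
      (∀ p < M.size, M.Filled p σ) → ∀ p < M.size, M.Filled p σ' :=
    fun k a1 a2 a3 hX p hp => by
      have := hX p hp
      unfold Flat.Filled at this ⊢
      rwa [k.arr aCol a1, k.arr aQ a2, k.arr aX a3]
  unfold topProg
  refine Runs.bind (runs_wp (Q := fun σ' => σ'.reg 73 = M.r) rfl
    (by simp [wp_copy, show σ.reg 1 = M.r from h.par 1 (by decide)])) fun σ₁ e₁ k₁ => ?_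
  have h₁ := h.keep k₁ (by decide) (by decide)
  have hX₁ := hF k₁ (by decide) (by decide) (by decide) hX
  refine ((runs_forDown (N := M.r) (B := M.n * (M.brickCost + 2) + 18)
    (fun k σ' => ∀ p : ℕ, σ'.arr aRem p = if M.t + k ≤ p ∧ p < M.t + M.r then M.rest p else 0)
    (by rw [e₁]; rfl) (h₁.par 4 (by decide)) (by decide) (by decide) (by decide)
    (fun p => by rw [k₁.arr _ (by decide), h0, if_neg (by omega)])
    (fun _ _ _ h => by simpa using h) (fun k hk σ' hinv hk' hkeep => ?_)).le ?_).imp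
    fun σ₂ e₂ _ p hp hpb => ?_
  · have h' := h₁.keep hkeep (by decide) (by decide)
    have hX' := hF hkeep (by decide) (by decide) (by decide) hX₁
    refine Runs.bind (runs_wp (Q := fun σ'' => σ''.reg 71 = M.n ∧ σ''.reg 84 = M.b k) rfl
      (by simp [wp, wp_copy, h'.b, hk', show σ'.reg 0 = M.n from h'.par 0 (by decide)]))
      fun σ₂ e₂ k₂ => ?_
    have h₂ := h'.keep k₂ (by decide) (by decide)
    have hX₂ := hF k₂ (by decide) (by decide) (by decide) hX'
    refine Runs.bind (runs_forDown (N := M.n) (B := M.brickCost) (fun i σ'' => σ''.reg 84 =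
        M.b k - (∑ i ∈ range M.n,
          ∑ j ∈ range M.brick, M.col (i * M.brick + j) k * M.start (i * M.brick + j) -
          ∑ i ∈ range i,
          ∑ j ∈ range M.brick, M.col (i * M.brick + j) k * M.start (i * M.brick + j)))
      (by rw [e₂.1]; rfl) (h₂.par 4 (by decide)) (by decide) (by decide) (by decide)
      (by rw [e₂.2]; ring) (fun _ _ _ h => by simpa using h)
      (fun i hi σ'' hinv' hi' hkeep' => ?_)) fun σ₃ e₃ k₃ => ?_
    · refine (runs_brick (h₂.keep hkeep' (by decide) (by decide))
        (hF hkeep' (by decide) (by decide) (by decide) hX₂) hi'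
        (by rw [hkeep'.reg _ (by decide), k₂.reg _ (by decide), hk']) hi hinv').imp
        fun σ₃ e₃ _ => ?_
      rw [e₃, sum_range_succ _ i]
      ring
    · have h₃ := h₂.keep k₃ (by decide) (by decide)
      rw [sum_range_zero, sub_zero, ← Flat.rest_top hk] at e₃
      refine (runs_wp rfl ?_).le ?_
      · simp only [wp, State.setReg_reg, State.setReg_arr, State.setCell_arr, Nat.reduceEqDiff,
          if_true, if_false, e₃, show σ₃.reg 3 = M.t from h₃.par 3 (by decide)]
        rw [k₃.reg 73 (by decide), k₂.reg 73 (by decide), hk', k₃.arr aRem (by decide),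
          k₂.arr aRem (by decide)]
        intro p
        rw [Function.update_apply]
        by_cases hp : p = M.t + k
        · rw [if_pos (by rw [hp]; push_cast; rfl), if_pos (by omega), hp]
        · rw [if_neg (by exact_mod_cast hp), hinv p]
          congr 1
          exact propext (by omega)
      · simp only [size, copy, Nat.reduceAdd]
        omega
  · simp only [Flat.topCost, size, copy, Nat.add_assoc, Nat.reduceAdd]
    omega
  · rw [e₂ p]
    split_ifs with hc
    · rfl
    -- At the variables, and at the top-row slack variables of the other bricks, the intended value
    -- is `0`, which is the initial content.
    · unfold Flat.rest
      split_ifs with h1 h2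
      · rfl
      · have h3 := Nat.div_add_mod p M.brick
        rw [h2, mul_zero, zero_add] at h3
        omega
      · rfl

/-- The remaining right-hand side of the other rows. -/
def bottomProg : Prog :=
  copy 71 0 ;; forDown 71 (copy 86 2 ;; forDown 86 (.add 73 1 86 ;; mul 85 71 2 ;;
    (.add 85 85 86 ;; .load 84 3 85) ;; brickProg ;; mul 85 71 12 ;;
    (.add 85 85 3 ;; .add 85 85 73 ;; .store aRem 85 84)))

/-- The time of `bottomProg`. -/
def Flat.bottomCost (M : Flat) : ℕ :=
  M.n * (M.s * (M.brickCost + 3 * M.s + 3 * M.brick + 30) + 20) + 10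

theorem Flat.rest_bottom {M : Flat} {i a : ℕ} (ha : a < M.s) :
    M.rest (i * M.brick + (M.t + (M.r + a))) = M.c ((i * M.s + a : ℕ) : ℤ) -
      ∑ j ∈ range M.brick, M.col (i * M.brick + j) (M.r + a) * M.start (i * M.brick + j) := by
  have hb : M.t + (M.r + a) < M.brick := by unfold Flat.brick; omega
  rw [rest, mod_eq hb, div_eq hb, if_neg (by omega), if_neg (by omega), Nat.add_sub_cancel_left,
    Nat.add_sub_cancel_left]

/-- Again from the end: the cells from the current slack variable on are done, as are all cells that
`topProg` settled. -/
theorem runs_bottom {M : Flat} {σ : State} (h : M.Base σ) (hX : ∀ p < M.size, M.Filled p σ)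
    (h0 : ∀ p < M.size, p % M.brick < M.t + M.r → σ.arr aRem p = M.rest p) :
    Runs O bottomProg σ M.bottomCost fun σ' => ∀ p < M.size, σ'.arr aRem p = M.rest p := by
  have hb : M.brick = M.t + (M.r + M.s) := rfl
  have hF : ∀ {R A : List ℕ} {σ σ' : State}, Keep R A σ σ' → aCol ∉ A → aQ ∉ A → aX ∉ A →
      (∀ p < M.size, M.Filled p σ) → ∀ p < M.size, M.Filled p σ' :=
    fun k a1 a2 a3 hX p hp => by
      have := hX p hp
      unfold Flat.Filled at this ⊢
      rwa [k.arr aCol a1, k.arr aQ a2, k.arr aX a3]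
  unfold bottomProg
  refine Runs.bind (runs_wp (Q := fun σ' => σ'.reg 71 = M.n) rfl
    (by simp [wp_copy, show σ.reg 0 = M.n from h.par 0 (by decide)])) fun σ₁ e₁ k₁ => ?_
  have h₁ := h.keep k₁ (by decide) (by decide)
  have hX₁ := hF k₁ (by decide) (by decide) (by decide) hX
  refine ((runs_forDown (N := M.n) (B := M.s * (M.brickCost + 3 * M.s + 3 * M.brick + 30) + 18)
    (fun i σ' => ∀ p < M.size, i * M.brick ≤ p ∨ p % M.brick < M.t + M.r →
      σ'.arr aRem p = M.rest p)
    (by rw [e₁]; rfl) (h₁.par 4 (by decide)) (by decide) (by decide) (by decide)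
    (fun p hp hp' => by
      rw [k₁.arr _ (by decide)]
      exact h0 p hp (hp'.resolve_left (not_le.2 hp)))
    (fun _ _ _ h => by simpa using h) (fun i hi σ' hinv hi' hkeep => ?_)).le ?_).imp
    fun σ₂ e₂ _ p hp => e₂ p hp (Or.inl (by simp))
  · have h' := h₁.keep hkeep (by decide) (by decide)
    have hX' := hF hkeep (by decide) (by decide) (by decide) hX₁
    have hib : (i + 1) * M.brick = i * M.brick + M.brick := by ring
    refine Runs.bind (runs_wp (Q := fun σ'' => σ''.reg 86 = M.s) rfl
      (by simp [wp_copy, show σ'.reg 2 = M.s from h'.par 2 (by decide)])) fun σ₂ e₂ k₂ => ?_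
    have h₂ := h'.keep k₂ (by decide) (by decide)
    have hX₂ := hF k₂ (by decide) (by decide) (by decide) hX'
    refine ((runs_forDown (N := M.s) (B := M.brickCost + 3 * M.s + 3 * M.brick + 28)
      (fun a σ'' => ∀ p < M.size, i * M.brick + (M.t + (M.r + a)) ≤ p ∨ p % M.brick < M.t + M.r →
        σ''.arr aRem p = M.rest p)
      (by rw [e₂]; rfl) (h₂.par 4 (by decide)) (by decide) (by decide) (by decide)
      (fun p hp hp' => by
        rw [k₂.arr _ (by decide)]
        exact hinv p hp (hp'.imp_left fun h => by omega))
      (fun _ _ _ h => by simpa using h) (fun a ha σ'' hinv' ha' hkeep' => ?_)).le ?_).imp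
      fun σ₃ e₃ k₃ p hp hp' => ?_
    · have h'' := h₂.keep hkeep' (by decide) (by decide)
      have hX'' := hF hkeep' (by decide) (by decide) (by decide) hX₂
      have i'' : σ''.reg 71 = i := by rw [hkeep'.reg _ (by decide), k₂.reg _ (by decide), hi']
      refine Runs.bind (runs_wp (Q := fun σ' => σ'.reg 73 = (M.r + a : ℕ)) rfl
        (by simp [wp, ha', show σ''.reg 1 = M.r from h''.par 1 (by decide)])) fun σ₃ e₃ k₃ => ?_
      have h₃ := h''.keep k₃ (by decide) (by decide)
      refine Runs.bind (runs_mul (a := i) (b := M.s) (by rw [k₃.reg _ (by decide), i''])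
        (h₃.par 2 (by decide)) (h₃.par 4 (by decide)) (by decide) (by decide) (by decide)
        (by decide) (by decide) (by decide)) fun σ₄ e₄ k₄ => ?_
      have h₄ := h₃.keep k₄ (by decide) (by decide)
      have a₄ : σ₄.reg 86 = a := by rw [k₄.reg _ (by decide), k₃.reg _ (by decide), ha']
      refine Runs.bind (runs_wp (Q := fun σ' => σ'.reg 84 = M.c ((i * M.s + a : ℕ) : ℤ)) rfl
        (by simp [wp, h₄.c, a₄, e₄])) fun σ₅ e₅ k₅ => ?_
      have h₅ := h₄.keep k₅ (by decide) (by decide)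
      have i₅ : σ₅.reg 71 = i := by
        rw [k₅.reg _ (by decide), k₄.reg _ (by decide), k₃.reg _ (by decide), i'']
      have a₅ : σ₅.reg 73 = (M.r + a : ℕ) := by
        rw [k₅.reg _ (by decide), k₄.reg _ (by decide), e₃]
      refine Runs.bind (runs_brick h₅ (hF k₅ (by decide) (by decide) (by decide)
        (hF k₄ (by decide) (by decide) (by decide) (hF k₃ (by decide) (by decide) (by decide)
          hX''))) i₅ a₅ hi e₅) fun σ₆ e₆ k₆ => ?_
      have h₆ := h₅.keep k₆ (by decide) (by decide)
      rw [← Flat.rest_bottom ha] at e₆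
      refine Runs.bind (runs_mul (a := i) (b := M.brick) (by rw [k₆.reg _ (by decide), i₅])
        (h₆.par 12 (by decide)) (h₆.par 4 (by decide)) (by decide) (by decide) (by decide)
        (by decide) (by decide) (by decide)) fun σ₇ e₇ k₇ => ?_
      have h₇ := h₆.keep k₇ (by decide) (by decide)
      refine (runs_wp rfl ?_).le ?_
      · simp only [wp, State.setReg_reg, State.setReg_arr, State.setCell_arr, Nat.reduceEqDiff,
          if_true, if_false, e₇, show σ₇.reg 3 = M.t from h₇.par 3 (by decide)]
        rw [k₇.reg 73 (by decide), k₆.reg 73 (by decide), a₅, k₇.reg 84 (by decide), e₆,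
          k₇.arr aRem (by decide), k₆.arr aRem (by decide), k₅.arr aRem (by decide),
          k₄.arr aRem (by decide), k₃.arr aRem (by decide)]
        intro p hp hp'
        rw [Function.update_apply]
        by_cases hpa : p = i * M.brick + (M.t + (M.r + a))
        · rw [if_pos (by rw [hpa]; push_cast; ring), hpa]
        · rw [if_neg (fun h => hpa (by
            have : (p : ℤ) = (i * M.brick + (M.t + (M.r + a)) : ℕ) := by
              rw [h]; push_cast; ring
            exact_mod_cast this))]
          exact hinv' p hp (hp'.imp_left fun h => by omega)
      · simp only [size, Int.natAbs_natCast, Nat.reduceAdd]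
        omega
    · simp only [size, copy, Nat.add_assoc, Nat.reduceAdd]
      omega
    · by_cases hlt : i * M.brick + (M.t + (M.r + 0)) ≤ p
      · exact e₃ p hp (Or.inl hlt)
      · refine e₃ p hp (Or.inr (hp'.elim (fun h => ?_) id))
        obtain ⟨j, rfl⟩ := Nat.exists_eq_add_of_le h
        rw [Flat.mod_eq (by omega)]
        omega
  · simp only [Flat.bottomCost, size, copy, Nat.add_assoc, Nat.reduceAdd]
    omega

/-- Register `87` is set if a lower bound exceeds the upper bound. -/
def checkProg : Prog :=
  (.const 87 0 ;; copy 71 21) ;; forDown 71 (.load 73 4 71 ;; .load 74 5 71 ;; .sub 75 73 74 ;;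
    .ite 75 (.const 87 1) skip)

/-- Crossing bounds must be excluded separately, since the search starts at the lower bounds and
requires all its points to lie in the box. -/
theorem runs_check {M : Flat} {σ : State} (h : M.Base σ) :
    Runs O checkProg σ (M.n * M.t * 8 + 10) fun σ' =>
      0 < σ'.reg 87 ↔ ∃ z < M.n * M.t, M.hi (z : ℕ) < M.lo (z : ℕ) := by
  unfold checkProg
  refine Runs.bind (runs_wp (Q := fun σ' => σ'.reg 71 = (M.n * M.t : ℕ) ∧ σ'.reg 87 = 0) rfl
    (by simp [wp, wp_copy, show σ.reg 21 = (M.n * M.t : ℕ) from h.par 21 (by decide)]))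
    fun σ₁ e₁ k₁ => ?_
  have h₁ := h.keep k₁ (by decide) (by decide)
  refine ((runs_forDown (N := M.n * M.t) (B := 6) (fun k σ' => 0 < σ'.reg 87 ↔
      ∃ z < M.n * M.t, k ≤ z ∧ M.hi (z : ℕ) < M.lo (z : ℕ)) (by rw [e₁.1]; rfl)
    (h₁.par 4 (by decide)) (by decide) (by decide) (by decide)
    (by
      rw [e₁.2]
      simp only [lt_self_iff_false, false_iff, not_exists, not_and]
      intro z hz hz'
      omega)
    (fun _ _ _ h => by simpa using h) (fun k hk σ' hi hk' hkeep => ?_)).le ?_).imp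
    fun σ₂ e₂ _ => by simpa using e₂
  · have h' := h₁.keep hkeep (by decide) (by decide)
    refine (runs_wp rfl ?_).le (by decide)
    simp only [wp, wp_skip, State.setReg_reg, State.setReg_arr, Nat.reduceEqDiff, if_true,
      if_false, hk', h'.lo, h'.hi]
    refine ⟨fun hc => ?_, fun hc => ?_⟩
    · simp only [zero_lt_one, true_iff]
      exact ⟨k, hk, le_rfl, by omega⟩
    · rw [hi]
      constructor
      · rintro ⟨z, z1, z2, z3⟩
        exact ⟨z, z1, by omega, z3⟩
      · rintro ⟨z, z1, z2, z3⟩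
        refine ⟨z, z1, Nat.lt_of_le_of_ne z2 fun e => hc ?_, z3⟩
        rw [← e] at z3
        omega
  · simp only [size, copy, Nat.reduceAdd]
    omega

/-! ### The starting point -/

namespace Flat

variable {M : Flat}

theorem start_var {i j : ℕ} (hj : j < M.t) :
    M.start (i * M.brick + j) = M.lo ((i * M.t + j : ℕ) : ℤ) := by
  have hb : j < M.brick := by unfold brick; omega
  rw [start, query, mod_eq hb, div_eq hb, if_pos hj, if_pos hj]

theorem start_slack {i a : ℕ} (ha : a < M.r + M.s) : M.start (i * M.brick + (M.t + a)) = 0 := by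
  have hb : M.t + a < M.brick := by unfold brick; omega
  rw [start, mod_eq hb, if_neg (by omega)]

theorem rest_var {i j : ℕ} (hj : j < M.t) : M.rest (i * M.brick + j) = 0 := by
  have hb : j < M.brick := by unfold brick; omega
  rw [rest, mod_eq hb, if_pos hj]

theorem rest_top' {i a : ℕ} (ha : a < M.r) : M.rest (i * M.brick + (M.t + a)) =
    if i = 0 then M.b a - ∑ i ∈ range M.n, M.dot M.start i a else 0 := by
  split_ifs with hi
  · rw [hi, zero_mul, zero_add, rest_top ha]
    congr 1
    refine sum_congr rfl fun i _ => ?_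
    rw [sum_row _ _ (by omega), start_slack (by omega), add_zero]
  · have hb : M.t + a < M.brick := by unfold brick; omega
    rw [rest, mod_eq hb, div_eq hb, if_neg (by omega), if_pos (by omega), if_neg hi]

theorem rest_bottom' {i a : ℕ} (ha : a < M.s) : M.rest (i * M.brick + (M.t + (M.r + a))) =
    M.c ((i * M.s + a : ℕ) : ℤ) - M.dot M.start i (M.r + a) := by
  rw [rest_bottom ha, sum_row _ _ (by omega), start_slack (by omega), add_zero]

theorem abs_dot_start (i a : ℕ) : |M.dot M.start i a| ≤ M.t * M.D * M.N :=
  abs_dot_le (fun j hj => by rw [start_var hj]; exact M.hlo _) a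

/-- The starting point has entries at most `N`, so the rows of the matrix produce at most `n * t * D
* N`, to which a right-hand side of at most `N` is added. -/
theorem abs_rest_le {p : ℕ} (hp : p < M.size) : |M.rest p| ≤ M.N * M.slackBound := by
  have h1 : 1 ≤ M.t * M.D := Nat.mul_pos M.t_pos M.D_pos
  have h2 : 1 ≤ M.n * (M.t * M.D) := Nat.mul_pos M.n_pos h1
  have h3 : M.n * (M.t * M.D) * 2 ≤ M.slackBound := by
    calc M.n * (M.t * M.D) * 2 = 2 * (1 * M.n * M.t * M.D) := by ring
      _ ≤ 2 * ((M.r + M.s) * M.n * M.t * M.D) := by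
        gcongr
        have := M.r_pos
        omega
      _ = _ := rfl
  have h3' : ((M.n : ℤ) * (M.t * M.D)) * 2 ≤ M.slackBound := by exact_mod_cast h3
  have h2' : (1 : ℤ) ≤ M.n * (M.t * M.D) := by exact_mod_cast h2
  have hN : (0 : ℤ) ≤ M.N := by positivity
  have h4 := mul_le_mul_of_nonneg_left h3' hN
  have h5 := mul_le_mul_of_nonneg_left h2' hN
  have hn : (1 : ℤ) ≤ M.n := by exact_mod_cast M.n_pos
  have h6 : (M.t : ℤ) * M.D * M.N ≤ M.n * (M.t * M.D) * M.N := by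
    rw [mul_assoc (M.n : ℤ)]
    exact le_mul_of_one_le_left (by positivity) hn
  rcases pos_cases hp with ⟨i, hi, j, hj, rfl⟩ | ⟨i, hi, a, ha, rfl⟩
  · rw [rest_var hj, abs_zero]
    positivity
  · by_cases har : a < M.r
    · rw [rest_top' har]
      split_ifs
      · have h7 : |∑ i ∈ range M.n, M.dot M.start i a| ≤ M.n * (M.t * M.D) * M.N := by
          calc _ ≤ ∑ i ∈ range M.n, |M.dot M.start i a| := abs_sum_le_sum_abs _ _
            _ ≤ ∑ i ∈ range M.n, (M.t * M.D * M.N : ℤ) := sum_le_sum fun i _ => abs_dot_start i a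
            _ = _ := by rw [sum_const, card_range, nsmul_eq_mul]; ring
        have h8 := M.hb a
        refine (abs_sub _ _).trans ?_
        linarith
      · rw [abs_zero]
        positivity
    · obtain ⟨a', rfl⟩ := Nat.exists_eq_add_of_le (not_lt.1 har)
      rw [rest_bottom' (by omega)]
      have h7 := abs_dot_start (M := M) i (M.r + a')
      have h8 := M.hc ((i * M.s + a' : ℕ) : ℤ)
      refine (abs_sub _ _).trans ?_
      linarith

/-- At the start `X` has no slack and the whole discrepancy is remainder, of total size at most
`slackBound * N`. Since `2 * N` is below `2 ^ levels`, this fits the invariant, and the clause for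
scale `1` is void because `levels` is positive. -/
theorem scaleInv_start (hbox : ∀ z < M.n * M.t, M.lo (z : ℕ) ≤ M.hi (z : ℕ)) :
    M.ScaleInv M.levels M.start M.rest := by
  have hz : ∀ i < M.n, ∀ j < M.t, i * M.t + j < M.n * M.t := fun i hi j hj => by
    have : (i + 1) * M.t ≤ M.n * M.t := Nat.mul_le_mul_right _ hi
    rw [add_mul, one_mul] at this
    omega
  have hlev : 2 * M.N < 2 ^ M.levels := Nat.lt_pow_succ_log_self (by norm_num) _
  have hlev' : (2 * M.N : ℤ) ≤ 2 ^ M.levels := by exact_mod_cast hlev.le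
  have hQ : (1 : ℤ) ≤ M.slackBound := by exact_mod_cast slackBound_pos (M := M)
  have hN : (0 : ℤ) ≤ M.N := by positivity
  have hdot : ∀ i < M.n, ∀ a, M.dot (fun p => M.start p + M.rest p) i a = M.dot M.start i a :=
    fun i hi a => dot_congr (fun j hj => by rw [rest_var hj, add_zero]) a
  refine ⟨⟨fun i hi j hj => ?_, ⟨fun a ha => ?_, fun i hi a ha => ?_⟩, fun i hi j hj => rest_var hj,
    fun i hi a ha => ?_⟩, fun p hp => ?_, fun _ => ?_, fun h => absurd h (Nat.succ_ne_zero _)⟩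
  · rw [start_var hj]
    exact ⟨le_rfl, hbox _ (hz i hi j hj)⟩
  · have e : ∀ i ∈ range M.n, M.dot (fun p => M.start p + M.rest p) i a +
        (M.start (i * M.brick + (M.t + a)) + M.rest (i * M.brick + (M.t + a))) =
        M.dot M.start i a +
          if i = 0 then M.b a - ∑ i ∈ range M.n, M.dot M.start i a else 0 := fun i hi => by
      rw [hdot i (mem_range.1 hi), start_slack (a := a) (by omega), zero_add, rest_top' ha]
    refine (sum_congr rfl e).trans ?_
    rw [sum_add_distrib, sum_ite_eq', if_pos (mem_range.2 M.n_pos)]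
    ring
  · beta_reduce
    rw [hdot i hi, start_slack (a := M.r + a) (by omega), rest_bottom' ha]
    ring
  · rw [start_slack ha]
    exact dvd_zero _
  · refine (abs_rest_le hp).trans (mul_le_mul_of_nonneg_right ?_ (by omega))
    omega
  · have h1 : M.slack M.start = 0 := slack_of_zero fun i hi a ha => start_slack ha
    have h2 : M.slack M.rest ≤ M.slackBound * M.N := by
      have htD : (1 : ℤ) ≤ M.t * M.D := by exact_mod_cast Nat.mul_pos M.t_pos M.D_pos
      have hn : (1 : ℤ) ≤ M.n := by exact_mod_cast M.n_pos
      have htN : (M.N : ℤ) ≤ M.t * M.D * M.N := le_mul_of_one_le_left hN htD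
      have hn' : (M.t * M.D * M.N : ℤ) ≤ M.n * (M.t * M.D * M.N) :=
        le_mul_of_one_le_left (by positivity) hn
      have e1 : M.slack M.rest ≤ ∑ i ∈ range M.n,
          ((M.r : ℤ) * (if i = 0 then 2 * (M.n * (M.t * M.D * M.N) : ℤ) else (0 : ℤ)) +
            M.s * (2 * (M.t * M.D * M.N : ℤ))) := by
        refine sum_le_sum fun i hi => ?_
        rw [sum_range_add]
        refine add_le_add ?_ ?_
        · refine (sum_le_sum (g := fun _ => if i = 0 then 2 * (M.n * (M.t * M.D * M.N) : ℤ)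
            else (0 : ℤ)) fun a ha => ?_).trans (by rw [sum_const, card_range, nsmul_eq_mul])
          rw [rest_top' (mem_range.1 ha)]
          split_ifs
          · have h7 : |∑ i ∈ range M.n, M.dot M.start i a| ≤ M.n * (M.t * M.D * M.N) := by
              calc _ ≤ ∑ i ∈ range M.n, |M.dot M.start i a| := abs_sum_le_sum_abs _ _
                _ ≤ ∑ i ∈ range M.n, (M.t * M.D * M.N : ℤ) :=
                    sum_le_sum fun i _ => abs_dot_start i a
                _ = _ := by rw [sum_const, card_range, nsmul_eq_mul]
            have h8 := M.hb a
            refine (abs_sub _ _).trans ?_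
            linarith
          · rw [abs_zero]
        · refine (sum_le_sum (g := fun _ => 2 * (M.t * M.D * M.N : ℤ)) fun a ha => ?_).trans
            (by rw [sum_const, card_range, nsmul_eq_mul])
          rw [rest_bottom' (mem_range.1 ha)]
          have h7 := abs_dot_start (M := M) i (M.r + a)
          have h8 := M.hc ((i * M.s + a : ℕ) : ℤ)
          refine (abs_sub _ _).trans ?_
          linarith
      refine e1.trans (le_of_eq ?_)
      rw [sum_add_distrib, ← mul_sum, sum_ite_eq', if_pos (mem_range.2 M.n_pos), sum_const,
        card_range, nsmul_eq_mul, slackBound]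
      push_cast
      ring
    rw [h1]
    nlinarith

end Flat

end NFoldIP

namespace NFoldIP

open Prog Finset

variable {O : ℤ → ℤ → ℤ}

/-! ### The whole program -/

/-- The largest entries. -/
def largestProg : Prog :=
  (.const 5 1 ;; maxProg 5 0 24 ;; maxProg 5 1 25) ;; copy 28 5 ;; maxProg 28 2 1 ;;
    maxProg 28 3 26 ;; maxProg 28 4 21 ;; maxProg 28 5 21

/-- The preparation. -/
def setupProg : Prog :=
  dimProg ;; largestProg ;; parProg ;; powersProg ;; layoutProg ;; topProg ;; bottomProg ;;
    checkProg

/-- The algorithm. -/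
def nfoldProg : Prog := setupProg ;; .ite 87 (.const 0 0) solveProg

namespace Flat

/-- The initial state of the algorithm for `M`. -/
structure Init (M : Flat) (σ : State) : Prop where
  par : M.Par [0, 1, 2, 3] σ
  A : σ.arr 0 = M.A
  B : σ.arr 1 = M.B
  b : σ.arr 2 = M.b
  c : σ.arr 3 = M.c
  lo : σ.arr aLow = M.lo
  hi : σ.arr aUpp = M.hi
  zero : ∀ a, 6 ≤ a → σ.arr a = fun _ => 0
  D_eq : M.D = 1 ⊔ ((range (M.n * M.t * M.r)).sup fun p => (M.A p).natAbs) ⊔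
    (range (M.n * M.t * M.s)).sup fun p => (M.B p).natAbs
  N_eq : M.N = M.D ⊔ ((range M.r).sup fun p => (M.b p).natAbs) ⊔
    ((range (M.n * M.s)).sup fun p => (M.c p).natAbs) ⊔
    ((range (M.n * M.t)).sup fun p => (M.lo p).natAbs) ⊔
    (range (M.n * M.t)).sup fun p => (M.hi p).natAbs

/-- The state after the preparation. -/
structure Prepared (M : Flat) (σ : State) : Prop where
  base : M.Base σ
  filled : ∀ p < M.size, M.Filled p σ
  mark : ∀ p < M.size, 0 < σ.arr aMark p ↔ M.brick ∣ p
  rem : ∀ p < M.size, σ.arr aRem p = M.rest p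
  pows : σ.reg rPows = M.levels
  pow : ∀ k : ℕ, k < M.levels → σ.arr aPow k = 2 ^ k

/-- The time of `setupProg`. -/
def setupCost (M : Flat) : ℕ :=
  6 * M.brick + 12 * M.t + 12 * (M.r + M.s) + 14 * (M.n * M.t * M.r) + 14 * (M.n * M.t * M.s) +
    14 * M.r + 14 * (M.n * M.s) + 36 * (M.n * M.t) + M.parCost + 6 * M.levels + M.layoutCost +
    M.topCost + M.bottomCost + 150

variable {M : Flat} {σ : State}

theorem Init.keep {R A : List ℕ} {σ' : State} (h : M.Init σ) (hk : Keep R A σ σ')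
    (hR : ∀ y ∈ [0, 1, 2, 3], y ∉ R) (hA : A = []) : M.Init σ' := by
  have ha : ∀ a, σ'.arr a = σ.arr a := fun a => hk.arr a (by simp [hA])
  exact
    { h with
      par := h.par.keep hk hR
      A := (ha _).trans h.A
      B := (ha _).trans h.B
      b := (ha _).trans h.b
      c := (ha _).trans h.c
      lo := (ha _).trans h.lo
      hi := (ha _).trans h.hi
      zero := fun a h' => (ha a).trans (h.zero a h') }

theorem runs_largest (h : M.Init σ) (h' : M.Par [26, 25, 24, 21, 4, 1] σ) :
    Runs O largestProg σ (14 * (M.n * M.t * M.r) + 14 * (M.n * M.t * M.s) + 14 * M.r +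
      14 * (M.n * M.s) + 28 * (M.n * M.t) + 24) fun σ' => M.Par [5, 28] σ' := by
  unfold largestProg
  have hA := h.D_eq
  have hN := h.N_eq
  refine Runs.bind (T₁ := 14 * (M.n * M.t * M.r) + 14 * (M.n * M.t * M.s) + 7)
    (P := fun σ' => σ'.reg 5 = M.D) ?_ fun σ₁ e₁ k₁ => ?_
  · refine Runs.bind (runs_wp (Q := fun σ' => σ'.reg 5 = (1 : ℕ)) rfl (by simp [wp]))
      fun σ₁ e₁ k₁ => ?_
    have h₁ := h.keep k₁ (by decide) rfl
    have p₁ := h'.keep k₁ (by decide)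
    refine Runs.bind (runs_max e₁ (p₁ 24 (by decide)) (p₁ 4 (by decide)) (by decide) (by decide))
      fun σ₂ e₂ k₂ => ?_
    have h₂ := h₁.keep k₂ (by decide) rfl
    have p₂ := p₁.keep k₂ (by decide)
    refine ((runs_max e₂ (p₂ 25 (by decide)) (p₂ 4 (by decide)) (by decide) (by decide)).imp
      fun σ₃ e₃ k₃ => ?_).le ?_
    · rw [e₃, h₂.B, h₁.A, ← hA]
    · simp only [Prog.size]
      omega
  have h₁ := h.keep k₁ (by decide) rfl
  have p₁ := h'.keep k₁ (by decide)
  refine Runs.bind (runs_wp (Q := fun σ' => σ'.reg 28 = M.D ∧ σ'.reg 5 = M.D) rfl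
    (by simp [wp_copy, e₁])) fun σ₂ e₂ k₂ => ?_
  have h₂ := h₁.keep k₂ (by decide) rfl
  have p₂ := p₁.keep k₂ (by decide)
  refine Runs.bind (runs_max e₂.1 (p₂ 1 (by decide)) (p₂ 4 (by decide)) (by decide) (by decide))
    fun σ₃ e₃ k₃ => ?_
  have h₃ := h₂.keep k₃ (by decide) rfl
  have p₃ := p₂.keep k₃ (by decide)
  refine Runs.bind (runs_max e₃ (p₃ 26 (by decide)) (p₃ 4 (by decide)) (by decide) (by decide))
    fun σ₄ e₄ k₄ => ?_
  have h₄ := h₃.keep k₄ (by decide) rfl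
  have p₄ := p₃.keep k₄ (by decide)
  refine Runs.bind (runs_max e₄ (p₄ 21 (by decide)) (p₄ 4 (by decide)) (by decide) (by decide))
    fun σ₅ e₅ k₅ => ?_
  have h₅ := h₄.keep k₅ (by decide) rfl
  have p₅ := p₄.keep k₅ (by decide)
  refine ((runs_max e₅ (p₅ 21 (by decide)) (p₅ 4 (by decide)) (by decide) (by decide)).imp
    fun σ₆ e₆ k₆ => ?_).le ?_
  · simp only [Par, List.forall_mem_cons, List.not_mem_nil, false_imp_iff, implies_true, and_true]
    constructor
    · rw [k₆.reg _ (by decide), k₅.reg _ (by decide), k₄.reg _ (by decide), k₃.reg _ (by decide),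
        e₂.2]
      rfl
    · rw [e₆, h₅.hi, h₄.lo, h₃.c, h₂.b, ← hN]
      rfl
  · simp only [Prog.size, copy]
    omega

theorem runs_setup (h : M.Init σ) : Runs O setupProg σ M.setupCost fun σ' => M.Prepared σ' ∧
    (0 < σ'.reg 87 ↔ ∃ z < M.n * M.t, M.hi (z : ℕ) < M.lo (z : ℕ)) := by
  unfold setupProg
  refine Runs.bind (runs_dim h.par) fun σ₁ e₁ k₁ => ?_
  have h₁ := h.keep k₁ (by decide) rfl
  refine Runs.bind (runs_largest h₁ (e₁.subset (by decide))) fun σ₂ e₂ k₂ => ?_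
  have h₂ := h₁.keep k₂ (by decide) rfl
  have p₂ := e₂.append (e₁.keep k₂ (by decide))
  refine Runs.bind (runs_par (p₂.subset (by decide))) fun σ₃ e₃ k₃ => ?_
  have h₃ := h₂.keep k₃ (by decide) rfl
  have p₃ := e₃.append (p₂.keep k₃ (by decide))
  have hN0 : 0 < M.N := by
    have := h.N_eq
    have := M.D_pos
    omega
  have b₃ : M.Base σ₃ := ⟨p₃.subset (by decide), h₃.A, h₃.B, h₃.b, h₃.c, h₃.lo, h₃.hi⟩
  refine Runs.bind (runs_powers (p₃ 28 (by decide)) hN0 (p₃ 4 (by decide))) fun σ₄ e₄ k₄ => ?_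
  have b₄ := b₃.keep k₄ (by decide) (by decide)
  refine Runs.bind (runs_layout b₄ (by rw [k₄.arr _ (by decide), h₃.zero _ (by decide)]))
    fun σ₅ e₅ k₅ => ?_
  have b₅ := b₄.keep k₅ (by decide) (by decide)
  refine Runs.bind (runs_top b₅ e₅.1 (by
    rw [k₅.arr _ (by decide), k₄.arr _ (by decide), h₃.zero _ (by decide)])) fun σ₆ e₆ k₆ => ?_
  have b₆ := b₅.keep k₆ (by decide) (by decide)
  have f₆ : ∀ p < M.size, M.Filled p σ₆ := fun p hp => by
    have := e₅.1 p hp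
    unfold Filled at this ⊢
    rwa [k₆.arr aCol (by decide), k₆.arr aQ (by decide), k₆.arr aX (by decide)]
  refine Runs.bind (runs_bottom b₆ f₆ e₆) fun σ₇ e₇ k₇ => ?_
  have b₇ := b₆.keep k₇ (by decide) (by decide)
  have f₇ : ∀ p < M.size, M.Filled p σ₇ := fun p hp => by
    have := f₆ p hp
    unfold Filled at this ⊢
    rwa [k₇.arr aCol (by decide), k₇.arr aQ (by decide), k₇.arr aX (by decide)]
  refine ((runs_check b₇).imp fun σ₈ e₈ k₈ => ⟨⟨b₇.keep k₈ (by decide) (by decide), fun p hp => ?_,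
    fun p hp => ?_, fun p hp => ?_, ?_, fun k hk => ?_⟩, e₈⟩).le ?_
  · simp only [setupCost]
    omega
  · have := f₇ p hp
    unfold Filled at this ⊢
    rwa [k₈.arr aCol (by decide), k₈.arr aQ (by decide), k₈.arr aX (by decide)]
  · rw [k₈.arr _ (by decide), k₇.arr _ (by decide), k₆.arr _ (by decide), e₅.2 p hp]
  · rw [k₈.arr _ (by decide), e₇ p hp]
  · rw [k₈.reg _ (by decide), k₇.reg _ (by decide), k₆.reg _ (by decide), k₅.reg _ (by decide),
      e₄.1]
  · rw [k₈.arr _ (by decide), k₇.arr _ (by decide), k₆.arr _ (by decide), k₅.arr _ (by decide),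
      e₄.2 k hk]

theorem Prepared.ready (h : M.Prepared σ) : M.Ready σ := by
  have hp : ∀ y ∈ pars, σ.reg y = M.par y := h.base.par
  refine ⟨{ P := M.size, L := M.stepBound, S := M.resBound, R := M.base ^ M.r
            E := fun p => σ.arr aCol p, mark := fun p => σ.arr aMark p
            phase := σ.reg rPhase, lam := σ.reg rLam
            X := fun p => σ.arr aX p, q := fun p => σ.arr aQ p, lo := M.lo, hi := M.hi },
    ⟨hp 4 (by decide), hp 6 (by decide), hp 8 (by decide), hp 9 (by decide), hp 10 (by decide),
      hp 11 (by decide), rfl, rfl, hp 17 (by decide), hp 19 (by decide), hp 20 (by decide),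
      fun _ => rfl, fun _ => rfl, fun _ => rfl, fun _ => rfl, h.base.lo, h.base.hi⟩,
    ⟨⟨brick_pos, M.r_pos, rfl, rfl, abs_col_le, fun p hp => ?_, rfl, rfl, h.mark⟩,
      fun i hi j hj => ?_, fun i hi a ha => ?_, rfl, rfl⟩, rfl⟩
  · refine (h.filled p hp).1.trans ?_
    simp only [code]
    push_cast
    rfl
  · have hb : j < M.brick := by unfold brick; omega
    refine (h.filled _ (pos_lt hi hb)).2.1.trans ?_
    rw [query, mod_eq hb, div_eq hb, if_pos hj]
  · have hb : M.t + a < M.brick := by unfold brick; omega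
    refine (h.filled _ (pos_lt hi hb)).2.1.trans ?_
    rw [query, mod_eq hb, if_neg (by omega)]

theorem Prepared.keep {R A : List ℕ} {σ' : State} (h : M.Prepared σ) (hk : Keep R A σ σ')
    (hR : ∀ y < 29, y ≠ rPhase → y ≠ rLam → y ∉ R) (hA : A = []) : M.Prepared σ' := by
  have ha : ∀ a, σ'.arr a = σ.arr a := fun a => hk.arr a (by simp [hA])
  have hr : ∀ y ∈ pars, y < 29 ∧ y ≠ rPhase ∧ y ≠ rLam := by decide
  refine ⟨h.base.keep hk (fun y hy => hR y (hr y hy).1 (hr y hy).2.1 (hr y hy).2.2)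
    (by simp [hA]), fun p hp => ?_, ?_, ?_,
    (hk.reg _ (hR _ (by decide) (by decide) (by decide))).trans h.pows, ?_⟩
  · have := h.filled p hp
    unfold Filled at this ⊢
    rwa [ha, ha, ha]
  · rw [ha]; exact h.mark
  · rw [ha]; exact h.rem
  · rw [ha]; exact h.pow

/-- The time of `nfoldProg`. -/
def totalCost (M : Flat) (J : ℕ) : ℕ :=
  M.setupCost + M.feasCost M.levels + M.optCost M.levels (J + 1) + 23 * M.size + 40

/-- The first phase ends with zero slack exactly if a feasible point exists. The hypothesis `hy`
supplies the optimum and the number of rounds, which only the analysis uses. -/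
theorem runs_solve {J : ℕ} (hO' : ∀ v, O (-1) v = 0) (hO : ∀ q, DConvex (O q)) (h : M.Prepared σ)
    (hbox : ∀ z < M.n * M.t, M.lo (z : ℕ) ≤ M.hi (z : ℕ)) (hm : 0 < M.size * M.stepBound)
    (hy : (∃ v, M.Feas v) → ∃ y, M.Feas y ∧ (∀ x, M.Feas x → M.obj O y ≤ M.obj O x) ∧
      ∀ x, M.Feas x → (M.obj O x - M.obj O y) *
        (2 * (M.size * M.stepBound) - 1) ^ J < (2 * (M.size * M.stepBound)) ^ J) :
    Runs O solveProg σ (M.feasCost M.levels + M.optCost M.levels (J + 1) + 23 * M.size + 30)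
      fun σ' => (σ'.reg 0 = 1 ∧ ∃ v, M.Feas v ∧ (∀ x, M.Feas x → M.obj O v ≤ M.obj O x) ∧
          ∀ i < M.n, ∀ j < M.t, σ'.arr 6 ((i * M.t + j : ℕ) : ℤ) = v (i * M.brick + j)) ∨
        (σ'.reg 0 = 0 ∧ ¬ ∃ v, M.Feas v) := by
  have hN : 2 * M.N < 2 ^ M.levels := Nat.lt_pow_succ_log_self (by norm_num) _
  unfold solveProg
  refine Runs.bind (runs_wp (Q := fun σ' => σ'.reg rPhase = 0) rfl (by simp [wp]))
    fun σ₁ e₁ k₁ => ?_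
  have h₁ := h.keep k₁ (by decide) rfl
  refine Runs.bind (runs_feas hO h₁.ready e₁ h₁.pows h₁.pow
    ((h₁.base.par 18 (by decide)).trans (by simp [Flat.par]))
    ((scaleInv_start hbox).congr (fun p hp => (h₁.filled p hp).2.2) h₁.rem)) fun σ₂ e₂ k₂ => ?_
  have q₂ : σ₂.reg rPhase = 0 := (k₂.reg _ (by decide)).trans e₁
  refine Runs.bind (runs_slack e₂.1 q₂) fun σ₃ e₃ k₃ => ?_
  have r₃ := e₂.1.keep k₃ (by decide) (by decide)
  have hX : (fun p : ℕ => σ₃.arr aX p) = fun p : ℕ => σ₂.arr aX p := by rw [k₃.arr _ (by decide)]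
  have hs := slack_nonneg (M := M) fun p : ℕ => σ₂.arr aX p
  refine Runs.ite (fun hp => ?_) (fun hp => ?_)
  · refine (runs_wp rfl ?_).le (by simp only [Prog.size]; omega)
    rw [e₃] at hp
    right
    exact ⟨by simp, e₂.2.feas_iff.2 hp.ne'⟩
  · have hF : M.Feas fun p : ℕ => σ₃.arr aX p := by
      rw [hX]
      exact e₂.2.feas_iff.1 (by rw [e₃] at hp; omega)
    obtain ⟨y, y1, y2, y3⟩ := hy ⟨_, hF⟩
    have w₃ : σ₃.reg rPows = M.levels := by
      rw [k₃.reg _ (by decide), k₂.reg _ (by decide), h₁.pows]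
    have v₃ : ∀ k : ℕ, k < M.levels → σ₃.arr aPow k = 2 ^ k := fun k hk => by
      rw [k₃.arr _ (by decide), k₂.arr _ (by decide), h₁.pow k hk]
    refine Runs.bind (runs_opt hO' hO r₃ hF w₃ v₃ hN y1 y2 (y3 _ hF) hm) fun σ₄ e₄ k₄ => ?_
    refine ((runs_output e₄.1).imp fun σ₅ e₅ _ =>
      Or.inl ⟨e₅.1, fun p => σ₄.arr aX p, e₄.2.1, e₄.2.2, e₅.2⟩).le ?_
    simp only [Prog.size]
    omega

theorem runs_nfold {J : ℕ} (hO' : ∀ v, O (-1) v = 0) (hO : ∀ q, DConvex (O q)) (h : M.Init σ)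
    (hm : 0 < M.size * M.stepBound)
    (hy : (∃ v, M.Feas v) → ∃ y, M.Feas y ∧ (∀ x, M.Feas x → M.obj O y ≤ M.obj O x) ∧
      ∀ x, M.Feas x → (M.obj O x - M.obj O y) *
        (2 * (M.size * M.stepBound) - 1) ^ J < (2 * (M.size * M.stepBound)) ^ J) :
    Runs O nfoldProg σ (M.totalCost J) fun σ' =>
      (σ'.reg 0 = 1 ∧ ∃ v, M.Feas v ∧ (∀ x, M.Feas x → M.obj O v ≤ M.obj O x) ∧
          ∀ i < M.n, ∀ j < M.t, σ'.arr 6 ((i * M.t + j : ℕ) : ℤ) = v (i * M.brick + j)) ∨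
        (σ'.reg 0 = 0 ∧ ¬ ∃ v, M.Feas v) := by
  unfold nfoldProg totalCost
  refine Runs.bind (runs_setup h) fun σ₁ e₁ k₁ => ?_
  refine Runs.ite (fun hp => ?_) (fun hp => ?_)
  · refine (runs_wp rfl ?_).le (by simp only [Prog.size]; omega)
    right
    refine ⟨by simp, fun ⟨v, hv⟩ => ?_⟩
    obtain ⟨z, z1, z2⟩ := e₁.2.1 hp
    have h1 := hv.box (z / M.t) (Nat.div_lt_of_lt_mul (by rwa [mul_comm])) (z % M.t)
      (Nat.mod_lt _ M.t_pos)
    rw [Nat.mul_comm, Nat.div_add_mod] at h1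
    omega
  · refine (runs_solve hO' hO e₁.1 (fun z hz => ?_) hm hy).le (by omega)
    by_contra hlt
    exact hp (e₁.2.2 ⟨z, hz, by omega⟩)

end Flat

end NFoldIP

namespace NFoldIP

open Prog Finset

/-! ### Instances as arrays -/

theorem natAbs_arrayOf_le {k C : ℕ} {v : Fin k → ℤ} (h : ∀ p, (v p).natAbs ≤ C) (z : ℤ) :
    (arrayOf v z).natAbs ≤ C := by
  unfold arrayOf
  split_ifs
  · exact h _
  · simp

theorem abs_arrayOf_le_sup {k k' : ℕ} (v : Fin k → ℤ) (hk : k' = k) (z : ℤ) :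
    |arrayOf v z| ≤ ((range k').sup fun p => (arrayOf v (p : ℕ)).natAbs : ℕ) := by
  subst hk
  rw [Int.abs_eq_natAbs]
  by_cases h : 0 ≤ z ∧ z.toNat < k'
  · have := le_sup (f := fun p => (arrayOf v (p : ℕ)).natAbs) (mem_range.2 h.2)
    simp only [Int.toNat_of_nonneg h.1] at this
    exact_mod_cast this
  · rw [show arrayOf v z = 0 from dif_neg h]
    simp

theorem sup_arrayOf_le {k C : ℕ} {v : Fin k → ℤ} (h : ∀ p, (v p).natAbs ≤ C) (m : ℕ) :
    ((range m).sup fun p => (arrayOf v (p : ℕ)).natAbs) ≤ C :=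
  Finset.sup_le fun _ _ => natAbs_arrayOf_le h _

theorem arrayOf_neg_one {k : ℕ} (v : Fin k → ℤ) : arrayOf v (-1) = 0 := dif_neg (by simp)

namespace Instance

variable {n r s t : ℕ}

theorem encode_arr_zero (I : Instance n r s t) : I.encode.arr 0 =
    arrayOf (k := n * (r * t)) fun p => I.A (finProdFinEquiv.symm p).1
      (finProdFinEquiv.symm (finProdFinEquiv.symm p).2).1
      (finProdFinEquiv.symm (finProdFinEquiv.symm p).2).2 := rfl

theorem encode_arr_one (I : Instance n r s t) : I.encode.arr 1 =
    arrayOf (k := n * (s * t)) fun p => I.B (finProdFinEquiv.symm p).1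
      (finProdFinEquiv.symm (finProdFinEquiv.symm p).2).1
      (finProdFinEquiv.symm (finProdFinEquiv.symm p).2).2 := rfl

theorem encode_arr_two (I : Instance n r s t) : I.encode.arr 2 =
    arrayOf (k := r) fun p => I.b (Sum.inl p) := rfl

theorem encode_arr_three (I : Instance n r s t) : I.encode.arr 3 =
    arrayOf (k := n * s) fun p => I.b (Sum.inr (finProdFinEquiv.symm p)) := rfl

theorem encode_arr_four (I : Instance n r s t) : I.encode.arr 4 =
    arrayOf (k := n * t) fun p => I.l (finProdFinEquiv.symm p) := rfl

theorem encode_arr_five (I : Instance n r s t) : I.encode.arr 5 =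
    arrayOf (k := n * t) fun p => I.u (finProdFinEquiv.symm p) := rfl

/-- The largest entry of the constraint matrix, at least `1`. -/
def entryBound (I : Instance n r s t) : ℕ :=
  1 ⊔ ((range (n * t * r)).sup fun p => (I.encode.arr 0 p).natAbs) ⊔
    (range (n * t * s)).sup fun p => (I.encode.arr 1 p).natAbs

/-- The largest entry of the input, at least `1`. -/
def inputBound (I : Instance n r s t) : ℕ :=
  I.entryBound ⊔ ((range r).sup fun p => (I.encode.arr 2 p).natAbs) ⊔
    ((range (n * s)).sup fun p => (I.encode.arr 3 p).natAbs) ⊔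
    ((range (n * t)).sup fun p => (I.encode.arr 4 p).natAbs) ⊔
    (range (n * t)).sup fun p => (I.encode.arr 5 p).natAbs

/-- The program is not told `Δ`. It works with the largest entry of the matrix, at least `1`, and
this is at most `Δ`. -/
theorem entryBound_le {I : Instance n r s t} {Δ : ℕ} (h : I.EntriesBounded Δ) (hΔ : 0 < Δ) :
    I.entryBound ≤ Δ := by
  unfold entryBound
  rw [encode_arr_zero, encode_arr_one]
  refine sup_le (sup_le hΔ (sup_arrayOf_le (fun p => ?_) _)) (sup_arrayOf_le (fun p => ?_) _)
  · have := h.1 (finProdFinEquiv.symm p).1 (finProdFinEquiv.symm (finProdFinEquiv.symm p).2).1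
      (finProdFinEquiv.symm (finProdFinEquiv.symm p).2).2
    rw [Int.abs_eq_natAbs] at this
    exact_mod_cast this
  · have := h.2 (finProdFinEquiv.symm p).1 (finProdFinEquiv.symm (finProdFinEquiv.symm p).2).1
      (finProdFinEquiv.symm (finProdFinEquiv.symm p).2).2
    rw [Int.abs_eq_natAbs] at this
    exact_mod_cast this

theorem inputBound_le (I : Instance n r s t) : I.inputBound ≤ max 1 I.largest := by
  have hA : ∀ i a j, (I.A i a j).natAbs ≤ I.largest := fun i a j => by
    unfold largest
    refine le_sup_of_le_left (le_sup_of_le_left (le_sup_of_le_left (le_sup_of_le_left ?_)))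
    exact (le_sup (f := fun j => (I.A i a j).natAbs) (mem_univ j)).trans
      ((le_sup (f := fun a => univ.sup fun j => (I.A i a j).natAbs) (mem_univ a)).trans
        (le_sup (f := fun i => univ.sup fun a => univ.sup fun j => (I.A i a j).natAbs)
          (mem_univ i)))
  have hB : ∀ i a j, (I.B i a j).natAbs ≤ I.largest := fun i a j => by
    unfold largest
    refine le_sup_of_le_left (le_sup_of_le_left (le_sup_of_le_left (le_sup_of_le_right ?_)))
    exact (le_sup (f := fun j => (I.B i a j).natAbs) (mem_univ j)).trans
      ((le_sup (f := fun a => univ.sup fun j => (I.B i a j).natAbs) (mem_univ a)).trans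
        (le_sup (f := fun i => univ.sup fun a => univ.sup fun j => (I.B i a j).natAbs)
          (mem_univ i)))
  have hb : ∀ k, (I.b k).natAbs ≤ max 1 I.largest := fun k => by
    unfold largest
    exact le_max_of_le_right (le_sup_of_le_left (le_sup_of_le_left (le_sup_of_le_right
      (le_sup (f := fun k => (I.b k).natAbs) (mem_univ k)))))
  have hl : ∀ k, (I.l k).natAbs ≤ max 1 I.largest := fun k => by
    unfold largest
    exact le_max_of_le_right (le_sup_of_le_left (le_sup_of_le_right
      (le_sup (f := fun k => (I.l k).natAbs) (mem_univ k))))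
  have hu : ∀ k, (I.u k).natAbs ≤ max 1 I.largest := fun k => by
    unfold largest
    exact le_max_of_le_right (le_sup_of_le_right
      (le_sup (f := fun k => (I.u k).natAbs) (mem_univ k)))
  have hE : I.EntriesBounded (max 1 I.largest) :=
    ⟨fun i a j => by
      rw [Int.abs_eq_natAbs]; exact_mod_cast le_max_of_le_right (hA i a j),
    fun i a j => by
      rw [Int.abs_eq_natAbs]; exact_mod_cast le_max_of_le_right (hB i a j)⟩
  have hD : I.entryBound ≤ max 1 I.largest := entryBound_le hE (by omega)
  unfold inputBound
  rw [encode_arr_two, encode_arr_three, encode_arr_four, encode_arr_five]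
  exact sup_le (sup_le (sup_le (sup_le hD (sup_arrayOf_le (fun _ => hb _) _))
    (sup_arrayOf_le (fun _ => hb _) _)) (sup_arrayOf_le (fun _ => hl _) _))
    (sup_arrayOf_le (fun _ => hu _) _)

theorem abs_arr_zero_le (I : Instance n r s t) (z : ℤ) : |I.encode.arr 0 z| ≤ I.entryBound := by
  unfold entryBound
  rw [encode_arr_zero]
  refine (abs_arrayOf_le_sup (k' := n * t * r) _ (by ring) z).trans ?_
  exact Int.ofNat_le.2 (le_sup_of_le_left le_sup_right)

theorem abs_arr_one_le (I : Instance n r s t) (z : ℤ) : |I.encode.arr 1 z| ≤ I.entryBound := by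
  unfold entryBound
  rw [encode_arr_one]
  refine (abs_arrayOf_le_sup (k' := n * t * s) _ (by ring) z).trans ?_
  exact Int.ofNat_le.2 le_sup_right

theorem abs_arr_two_le (I : Instance n r s t) (z : ℤ) : |I.encode.arr 2 z| ≤ I.inputBound := by
  unfold inputBound
  rw [encode_arr_two]
  refine (abs_arrayOf_le_sup _ rfl z).trans ?_
  exact Int.ofNat_le.2 (le_sup_of_le_left (le_sup_of_le_left (le_sup_of_le_left le_sup_right)))

theorem abs_arr_three_le (I : Instance n r s t) (z : ℤ) : |I.encode.arr 3 z| ≤ I.inputBound := by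
  unfold inputBound
  rw [encode_arr_three]
  refine (abs_arrayOf_le_sup _ rfl z).trans ?_
  exact Int.ofNat_le.2 (le_sup_of_le_left (le_sup_of_le_left le_sup_right))

theorem abs_arr_four_le (I : Instance n r s t) (z : ℤ) : |I.encode.arr 4 z| ≤ I.inputBound := by
  unfold inputBound
  rw [encode_arr_four]
  refine (abs_arrayOf_le_sup _ rfl z).trans ?_
  exact Int.ofNat_le.2 (le_sup_of_le_left le_sup_right)

theorem abs_arr_five_le (I : Instance n r s t) (z : ℤ) : |I.encode.arr 5 z| ≤ I.inputBound := by
  unfold inputBound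
  rw [encode_arr_five]
  refine (abs_arrayOf_le_sup _ rfl z).trans ?_
  exact Int.ofNat_le.2 le_sup_right

theorem entryBound_pos (I : Instance n r s t) : 0 < I.entryBound :=
  Nat.lt_of_lt_of_le one_pos (le_sup_of_le_left le_sup_left)

theorem inputBound_pos (I : Instance n r s t) : 0 < I.inputBound := by
  unfold inputBound
  exact I.entryBound_pos.trans_le
    (le_sup_of_le_left (le_sup_of_le_left (le_sup_of_le_left le_sup_left)))

/-- The instance with flat positions and slack variables. -/
def flat (I : Instance n r s t) (hn : 0 < n) (hr : 0 < r) (hs : 0 < s) (ht : 0 < t) : Flat where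
  n := n
  r := r
  s := s
  t := t
  D := I.entryBound
  N := I.inputBound
  A := I.encode.arr 0
  B := I.encode.arr 1
  b := I.encode.arr 2
  c := I.encode.arr 3
  lo := I.encode.arr 4
  hi := I.encode.arr 5
  n_pos := hn
  r_pos := hr
  s_pos := hs
  t_pos := ht
  D_pos := I.entryBound_pos
  hA := I.abs_arr_zero_le
  hB := I.abs_arr_one_le
  hb := I.abs_arr_two_le
  hc := I.abs_arr_three_le
  hlo := I.abs_arr_four_le
  hhi := I.abs_arr_five_le
  lo_neg := by rw [encode_arr_four, arrayOf_neg_one]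
  hi_neg := by rw [encode_arr_five, arrayOf_neg_one]

variable {I : Instance n r s t} {hn : 0 < n} {hr : 0 < r} {hs : 0 < s} {ht : 0 < t}

theorem init_flat : (I.flat hn hr hs ht).Init I.encode where
  par := by
    simp only [Flat.Par, List.forall_mem_cons, List.not_mem_nil, false_imp_iff, implies_true,
      and_true]
    exact ⟨rfl, rfl, rfl, rfl⟩
  A := rfl
  B := rfl
  b := rfl
  c := rfl
  lo := rfl
  hi := rfl
  zero := fun a ha => match a, ha with
    | _ + 6, _ => rfl
  D_eq := rfl
  N_eq := rfl

theorem pos_lt_brick (j : Fin t) : (j : ℕ) < (I.flat hn hr hs ht).brick :=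
  Nat.lt_add_right _ j.2

theorem col_flat_top (i : Fin n) (a : Fin r) (j : Fin t) :
    (I.flat hn hr hs ht).col (i * (I.flat hn hr hs ht).brick + j) a = I.A i a j := by
  have hj := pos_lt_brick (I := I) (hn := hn) (hr := hr) (hs := hs) (ht := ht) j
  rw [Flat.col, Flat.mod_eq hj, Flat.div_eq hj, 
    if_pos (show (j : ℕ) < (I.flat hn hr hs ht).t from j.2),
    if_pos (show (a : ℕ) < (I.flat hn hr hs ht).r from a.2)]
  have h := rowMajor_apply (fun p : Fin n × Fin (r * t) =>
    I.A p.1 (finProdFinEquiv.symm p.2).1 (finProdFinEquiv.symm p.2).2) i (finProdFinEquiv (a, j))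
  rw [Equiv.symm_apply_apply] at h
  refine Eq.trans (congrArg _ ?_) h
  simp [finProdFinEquiv, flat]
  ring

theorem col_flat_bottom (i : Fin n) (a : Fin s) (j : Fin t) :
    (I.flat hn hr hs ht).col (i * (I.flat hn hr hs ht).brick + j) (r + a) = I.B i a j := by
  have hj := pos_lt_brick (I := I) (hn := hn) (hr := hr) (hs := hs) (ht := ht) j
  rw [Flat.col, Flat.mod_eq hj, Flat.div_eq hj, 
    if_pos (show (j : ℕ) < (I.flat hn hr hs ht).t from j.2),
    if_neg (show ¬ r + (a : ℕ) < (I.flat hn hr hs ht).r from Nat.not_lt.2 (Nat.le_add_right _ _))]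
  have h := rowMajor_apply (fun p : Fin n × Fin (s * t) =>
    I.B p.1 (finProdFinEquiv.symm p.2).1 (finProdFinEquiv.symm p.2).2) i (finProdFinEquiv (a, j))
  rw [Equiv.symm_apply_apply] at h
  refine Eq.trans (congrArg _ ?_) h
  simp [finProdFinEquiv, flat]
  ring

/-- The values of the variables in a point with flat positions. -/
def unflat (v : ℕ → ℤ) (w : ℕ) : Fin n × Fin t → ℤ := fun p => v (p.1 * w + p.2)

/-- With all slack variables zero, the flat equations are the rows of the matrix equation: the top
rows sum over all bricks, and each bottom row sees its own brick. -/
theorem feas_flat {v : ℕ → ℤ} : (I.flat hn hr hs ht).Feas v ↔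
    (∀ i < n, ∀ a < r + s, v (i * (I.flat hn hr hs ht).brick + (t + a)) = 0) ∧
      unflat v (I.flat hn hr hs ht).brick ∈ I.feasible := by
  set M := I.flat hn hr hs ht with hM
  have hbox : M.Box v ↔ I.l ≤ unflat v M.brick ∧ unflat v M.brick ≤ I.u := by
    have hl : ∀ (i : Fin n) (j : Fin t), M.lo ((i * M.t + j : ℕ) : ℤ) = I.l (i, j) :=
      fun i j => by rw [← rowMajor_apply I.l i j]; push_cast; rfl
    have hu : ∀ (i : Fin n) (j : Fin t), M.hi ((i * M.t + j : ℕ) : ℤ) = I.u (i, j) :=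
      fun i j => by rw [← rowMajor_apply I.u i j]; push_cast; rfl
    constructor
    · intro h
      refine ⟨fun p => ?_, fun p => ?_⟩
      · rw [← hl]; exact (h p.1 p.1.2 p.2 p.2.2).1
      · rw [← hu]; exact (h p.1 p.1.2 p.2 p.2.2).2
    · rintro ⟨h1, h2⟩ i hi j hj
      have h3 := h1 (⟨i, hi⟩, ⟨j, hj⟩)
      have h4 := h2 (⟨i, hi⟩, ⟨j, hj⟩)
      rw [← hl] at h3
      rw [← hu] at h4
      exact ⟨h3, h4⟩
  have hdot : ∀ (i : Fin n) (a : Fin r), M.dot v i a =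
      ∑ j, I.A i a j * unflat v M.brick (i, j) := fun i a => by
    rw [Flat.dot, show M.t = t from rfl, Finset.sum_range]
    exact sum_congr rfl fun j _ => by rw [hM, col_flat_top]; rfl
  have hdot' : ∀ (i : Fin n) (a : Fin s), M.dot v i (r + a) =
      ∑ j, I.B i a j * unflat v M.brick (i, j) := fun i a => by
    rw [Flat.dot, show M.t = t from rfl, Finset.sum_range]
    exact sum_congr rfl fun j _ => by rw [hM, col_flat_bottom]; rfl
  have htop : ∀ a : Fin r, I.constraintMatrix.mulVec (unflat v M.brick) (Sum.inl a) =
      ∑ i ∈ range n, M.dot v i a := fun a => by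
    rw [Finset.sum_range, sum_congr rfl fun i _ => hdot i a, Matrix.mulVec, dotProduct,
      Fintype.sum_prod_type]
    rfl
  have hbot : ∀ (i : Fin n) (a : Fin s),
      I.constraintMatrix.mulVec (unflat v M.brick) (Sum.inr (i, a)) = M.dot v i (r + a) :=
    fun i a => by
      rw [hdot', Matrix.mulVec, dotProduct, Fintype.sum_prod_type, sum_eq_single i]
      · simp [constraintMatrix]
      · intro k _ hk
        simp [constraintMatrix, Ne.symm hk]
      · simp
  have hb : ∀ a : Fin r, M.b (a : ℕ) = I.b (Sum.inl a) := fun a => by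
    show arrayOf (fun a : Fin r => I.b (Sum.inl a)) ((a : ℕ) : ℤ) = _
    rw [arrayOf, dif_pos ⟨by positivity, by simp⟩]
    simp
  have hc : ∀ (i : Fin n) (a : Fin s), M.c ((i * s + a : ℕ) : ℤ) = I.b (Sum.inr (i, a)) :=
    fun i a => by
      rw [← rowMajor_apply (fun p : Fin n × Fin s => I.b (Sum.inr p)) i a]; push_cast; rfl
  constructor
  · rintro ⟨h1, ⟨h2, h3⟩, h4⟩
    refine ⟨h4, funext fun k => ?_, hbox.1 h1⟩
    rcases k with a | ⟨i, a⟩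
    · rw [htop, ← hb]
      refine Eq.trans (sum_congr rfl fun i hi => ?_) (h2 a a.2)
      rw [h4 i (mem_range.1 hi) a (Nat.lt_add_right _ a.2), add_zero]
    · rw [hbot, ← hc]
      refine Eq.trans ?_ (h3 i i.2 a a.2)
      rw [h4 i i.2 (M.r + a) (Nat.add_lt_add_left a.2 _), add_zero]
      rfl
  · rintro ⟨h4, h5, h6⟩
    replace h4 : ∀ i < M.n, ∀ a < M.r + M.s, v (i * M.brick + (M.t + a)) = 0 := h4
    refine ⟨hbox.2 h6, ⟨fun a ha => ?_, fun i hi a ha => ?_⟩, h4⟩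
    · have h7 := congrFun h5 (Sum.inl ⟨a, ha⟩)
      rw [htop, ← hb] at h7
      refine Eq.trans (sum_congr rfl fun i hi => ?_) h7
      rw [h4 i (mem_range.1 hi) a (Nat.lt_add_right _ ha), add_zero]
    · have h7 := congrFun h5 (Sum.inr (⟨i, hi⟩, ⟨a, ha⟩))
      rw [hbot, ← hc] at h7
      rw [h4 i hi (M.r + a) (Nat.add_lt_add_left ha _), add_zero]
      exact h7

/-- Extending a feasible point by zero slack transfers feasibility and optimality between the two
formulations. -/
theorem exists_flat (x : Fin n × Fin t → ℤ) (hx : x ∈ I.feasible) :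
    ∃ v, (I.flat hn hr hs ht).Feas v ∧ unflat v (I.flat hn hr hs ht).brick = x := by
  set M := I.flat hn hr hs ht with hM
  let v : ℕ → ℤ := fun p => if p % M.brick < t then
    rowMajor x (((p / M.brick : ℕ) : ℤ) * t + ((p % M.brick : ℕ) : ℤ)) else 0
  have hv : unflat v M.brick = x := funext fun p => by
    have hj := pos_lt_brick (I := I) (hn := hn) (hr := hr) (hs := hs) (ht := ht) p.2
    simp only [unflat, v]
    rw [Flat.mod_eq hj, Flat.div_eq hj, if_pos p.2.2, rowMajor_apply]
  refine ⟨v, feas_flat.2 ⟨fun i hi a ha => ?_, by rw [← hM, hv]; exact hx⟩, hv⟩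
  have hj : t + a < M.brick := Nat.add_lt_add_left ha _
  simp only [v]
  rw [← hM, Flat.mod_eq hj, if_neg (by omega)]

end Instance

/-! ### Separable convex functions -/

/-- A query at a point with one nonzero coordinate returns that summand plus the other summands at
zero, which is a constant. -/
theorem SeparableConvex.single {ι : Type} [Fintype ι] [DecidableEq ι] {f : (ι → ℤ) → ℤ}
    (hf : SeparableConvex f) : ∃ (g : ι → ℝ → ℝ) (c : ι → ℝ),
      (∀ p, ConvexOn ℝ Set.univ (g p)) ∧ (∀ x : ι → ℤ, (f x : ℝ) = ∑ p, g p (x p : ℝ)) ∧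
      ∀ p (v : ℤ), (f (Pi.single p v) : ℝ) = g p v + c p := by
  obtain ⟨g, hg, hx⟩ := hf
  refine ⟨g, fun p => ∑ q ∈ univ.erase p, g q 0, hg, hx, fun p v => ?_⟩
  rw [hx, ← add_sum_erase _ _ (mem_univ p), Pi.single_eq_same]
  congr 1
  exact sum_congr rfl fun q hq => by
    rw [Pi.single_eq_of_ne (ne_of_mem_erase hq), Int.cast_zero]

/-- The constants cancel in differences, so the oracle determines the objective as far as
optimization is concerned. -/
theorem SeparableConvex.sub_eq {ι : Type} [Fintype ι] [DecidableEq ι] {f : (ι → ℤ) → ℤ}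
    (hf : SeparableConvex f) (x y : ι → ℤ) :
    f x - f y = ∑ p, f (Pi.single p (x p)) - ∑ p, f (Pi.single p (y p)) := by
  obtain ⟨g, c, -, hx, hs⟩ := hf.single
  have : (f x - f y : ℝ) = ∑ p, (f (Pi.single p (x p)) : ℝ) - ∑ p, (f (Pi.single p (y p)) : ℝ) := by
    rw [hx, hx]
    simp only [hs, sum_add_distrib]
    ring
  exact_mod_cast this

/-- If `a` and `b` agree in sign, `x + a` and `x + b` are convex combinations of `x` and `x + a + b`
with exchanged weights, so the two convexity inequalities add up. -/
theorem dconvex_of_convexOn {g : ℝ → ℝ} (hg : ConvexOn ℝ Set.univ g) {c : ℤ → ℤ} {d : ℝ}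
    (hc : ∀ v : ℤ, (c v : ℝ) = g v + d) : DConvex c := by
  intro x a b hab
  have h0 : (0 : ℝ) ≤ a * b := by exact_mod_cast hab
  suffices h : g (x + a) + g (x + b) ≤ g x + g (x + a + b) by
    have h1 : (c (x + a) + c (x + b) : ℝ) ≤ c x + c (x + a + b) := by
      rw [hc, hc, hc, hc]
      push_cast
      linarith
    exact_mod_cast h1
  generalize (x : ℝ) = x, (a : ℝ) = a, (b : ℝ) = b at *
  by_cases hs : a + b = 0
  · have ha : a = 0 := by nlinarith [sq_nonneg a, sq_nonneg b]
    have hb : b = 0 := by linarith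
    simp [ha, hb]
  have h2 : 0 < (a + b) ^ 2 := by positivity
  have ha : 0 ≤ a / (a + b) := by
    rw [show a / (a + b) = (a * (a + b)) / (a + b) ^ 2 by field_simp]
    exact div_nonneg (by nlinarith [sq_nonneg a]) h2.le
  have hb : 0 ≤ b / (a + b) := by
    rw [show b / (a + b) = (b * (a + b)) / (a + b) ^ 2 by field_simp]
    exact div_nonneg (by nlinarith [sq_nonneg b]) h2.le
  have h1 : a / (a + b) + b / (a + b) = 1 := by field_simp
  have e1 := hg.2 (Set.mem_univ x) (Set.mem_univ (x + a + b)) hb ha (by linarith)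
  have e2 := hg.2 (Set.mem_univ x) (Set.mem_univ (x + a + b)) ha hb h1
  simp only [smul_eq_mul] at e1 e2
  have k1 : b / (a + b) * x + a / (a + b) * (x + a + b) = x + a := by field_simp; ring
  have k2 : a / (a + b) * x + b / (a + b) * (x + a + b) = x + b := by field_simp; ring
  rw [k1] at e1
  rw [k2] at e2
  have k3 : a / (a + b) = 1 - b / (a + b) := by linarith
  rw [k3] at e1 e2
  linarith

variable {n r s t : ℕ} {f : (Fin n × Fin t → ℤ) → ℤ}

theorem dconvex_oracle (hf : SeparableConvex f) (q : ℤ) : DConvex (coordinateOracle f q) := by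
  obtain ⟨g, c, hg, -, hs⟩ := hf.single
  by_cases h : 0 ≤ q ∧ q.toNat < n * t
  · have e : coordinateOracle f q = fun v =>
        f (Pi.single (finProdFinEquiv.symm ⟨q.toNat, h.2⟩) v) := funext fun v => by
      rw [coordinateOracle, rowMajor, arrayOf, dif_pos h]
    rw [e]
    exact dconvex_of_convexOn (hg _) (hs _)
  · have e : coordinateOracle f q = fun _ => 0 := funext fun v => by
      rw [coordinateOracle, rowMajor, arrayOf, dif_neg h]
    rw [e]
    exact dconvex_zero

theorem oracle_neg_one (v : ℤ) : coordinateOracle f (-1) v = 0 := by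
  rw [coordinateOracle, rowMajor, arrayOf_neg_one]

theorem obj_flat {I : Instance n r s t} {hn : 0 < n} {hr : 0 < r} {hs : 0 < s} {ht : 0 < t}
    (v : ℕ → ℤ) : (I.flat hn hr hs ht).obj (coordinateOracle f) v =
      ∑ p, f (Pi.single p (Instance.unflat v (I.flat hn hr hs ht).brick p)) := by
  rw [Flat.obj, Fintype.sum_prod_type]
  set M := I.flat hn hr hs ht with hM
  rw [show M.n = n from rfl, show M.t = t from rfl, Finset.sum_range]
  refine sum_congr rfl fun i _ => ?_
  rw [Finset.sum_range]
  refine sum_congr rfl fun j _ => ?_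
  have h := rowMajor_apply (fun ij : Fin n × Fin t =>
    f (Pi.single ij (v (i * M.brick + j)))) i j
  rw [coordinateOracle]
  push_cast
  exact h

/-! ### The number of augmentations -/

/-- Bernoulli's inequality without fractions: `(1 + 1 / a) ^ k ≥ 1 + k / a` for `k = a + 1`. -/
theorem two_mul_pow_le (a : ℕ) (ha : 0 < a) : 2 * a ^ (a + 1) ≤ (a + 1) ^ (a + 1) := by
  have key : ∀ k : ℕ, a ^ k * (a + k) ≤ (a + 1) ^ k * a := fun k => by
    induction k with
    | zero => simp
    | succ k ih =>
      calc a ^ (k + 1) * (a + (k + 1)) = a ^ k * (a * (a + k + 1)) := by ring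
        _ ≤ a ^ k * ((a + k) * (a + 1)) := Nat.mul_le_mul_left _ (by nlinarith)
        _ = a ^ k * (a + k) * (a + 1) := by ring
        _ ≤ (a + 1) ^ k * a * (a + 1) := Nat.mul_le_mul_right _ ih
        _ = (a + 1) ^ (k + 1) * a := by ring
  refine Nat.le_of_mul_le_mul_right ?_ ha
  calc 2 * a ^ (a + 1) * a = a ^ (a + 1) * (2 * a) := by ring
    _ ≤ a ^ (a + 1) * (a + (a + 1)) := Nat.mul_le_mul_left _ (by omega)
    _ ≤ _ := key _

/-- With `a = 2m - 1`, every `2m` rounds at least halve the gap, so `2m * q` rounds bring a gap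
below `2 ^ q` under `1`. -/
theorem gap_mul_pow_lt {m : ℕ} (hm : 0 < m) {d : ℤ} {q : ℕ} (hd : d < 2 ^ q) :
    d * (2 * m - 1) ^ (2 * m * q) < (2 * m) ^ (2 * m * q) := by
  obtain ⟨a, ha⟩ : ∃ a, 2 * m = a + 1 := ⟨2 * m - 1, by omega⟩
  have h1 := two_mul_pow_le a (by omega)
  have h2 : ((2 : ℤ) * a ^ (a + 1)) ^ q ≤ ((a + 1 : ℤ) ^ (a + 1)) ^ q :=
    pow_le_pow_left₀ (by positivity) (by exact_mod_cast h1) _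
  have h3 : (2 : ℤ) * m = a + 1 := by exact_mod_cast ha
  rw [h3, ha, add_sub_cancel_right, pow_mul, pow_mul]
  refine lt_of_lt_of_le ?_ h2
  rw [mul_pow]
  have ha0 : (0 : ℤ) < a := by exact_mod_cast (by omega : 0 < a)
  exact mul_lt_mul_of_pos_right hd (by positivity)

/-! ### The result of the algorithm -/

/-- The bound for the number of augmentations. -/
def Flat.rounds (M : Flat) (d : ℤ) : ℕ := 2 * (M.size * M.stepBound) * (Nat.log 2 d.toNat + 1)

theorem Flat.stepBound_pos {M : Flat} : 0 < M.stepBound := by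
  unfold stepBound graverBound blockBound
  positivity

/-- The program never learns the objective range `M`; it enters only through the number of rounds in
the time bound. Without feasible points any `M` will do, as no round takes place. -/
theorem exists_exec {I : Instance n r s t} (hn : 0 < n) (hr : 0 < r) (hs : 0 < s) (ht : 0 < t)
    (hf : SeparableConvex f) {M : ℤ} (hM : I.feasible.Nonempty →
      IsGreatest {d : ℤ | ∃ x ∈ I.feasible, ∃ y ∈ I.feasible, d = f x - f y} M) :
    ∃ T σ, Exec (coordinateOracle f) nfoldProg I.encode T σ ∧ I.IsAnswer f σ ∧
      T ≤ (I.flat hn hr hs ht).totalCost ((I.flat hn hr hs ht).rounds M) := by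
  set F := I.flat hn hr hs ht with hF
  have hobj : ∀ v w, F.obj (coordinateOracle f) v - F.obj (coordinateOracle f) w =
      f (Instance.unflat v F.brick) - f (Instance.unflat w F.brick) := fun v w => by
    rw [hF, obj_flat, obj_flat, hf.sub_eq]
  have hm : 0 < F.size * F.stepBound :=
    Nat.mul_pos (Nat.mul_pos hn Flat.brick_pos) Flat.stepBound_pos
  have hy : (∃ v, F.Feas v) → ∃ y, F.Feas y ∧
      (∀ x, F.Feas x → F.obj (coordinateOracle f) y ≤ F.obj (coordinateOracle f) x) ∧
      ∀ x, F.Feas x → (F.obj (coordinateOracle f) x - F.obj (coordinateOracle f) y) *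
        (2 * (F.size * F.stepBound) - 1) ^ F.rounds M <
          (2 * (F.size * F.stepBound)) ^ F.rounds M := by
    rintro ⟨v, hv⟩
    -- The second point of a pair that attains the largest difference is a minimizer.
    obtain ⟨⟨x, hx, y, hy, rfl⟩, h2⟩ := hM ⟨_, (Instance.feas_flat.1 hv).2⟩
    obtain ⟨w, w1, w2⟩ := Instance.exists_flat (hn := hn) (hr := hr) (hs := hs) (ht := ht) y hy
    rw [← hF] at w1 w2
    refine ⟨w, w1, fun z hz => ?_, fun z hz => ?_⟩
    · have h3 := h2 ⟨x, hx, _, (Instance.feas_flat.1 hz).2, rfl⟩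
      have h4 := hobj z w
      rw [w2] at h4
      simp only [← hF] at h3
      omega
    · have h3 := h2 ⟨_, (Instance.feas_flat.1 hz).2, y, hy, rfl⟩
      have h4 := hobj z w
      rw [w2] at h4
      simp only [← hF] at h3
      rw [h4]
      have h5 : (f x - f y).toNat < 2 ^ (Nat.log 2 (f x - f y).toNat + 1) :=
        Nat.lt_pow_succ_log_self (by norm_num) _
      have h6 : f x - f y < 2 ^ (Nat.log 2 (f x - f y).toNat + 1) :=
        lt_of_le_of_lt (Int.self_le_toNat _) (by exact_mod_cast h5)
      have h7 := gap_mul_pow_lt hm (h3.trans_lt h6)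
      push_cast at h7
      exact h7
  obtain ⟨T, σ, h1, h2, h3⟩ := Flat.runs_nfold (O := coordinateOracle f) (J := F.rounds M)
    oracle_neg_one (dconvex_oracle hf) (Instance.init_flat (I := I) (hn := hn)
    (hr := hr) (hs := hs) (ht := ht)) hm hy
  refine ⟨T, σ, h1, ?_, h2⟩
  rcases h3 with ⟨h4, v, h5, h6, h7⟩ | ⟨h4, h5⟩
  · left
    have e : (fun ij : Fin n × Fin t => σ.arr 6 (((ij.1 : ℕ) : ℤ) * t + ((ij.2 : ℕ) : ℤ))) =
        Instance.unflat v F.brick := funext fun ij => by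
      have := h7 ij.1 ij.1.2 ij.2 ij.2.2
      push_cast at this
      exact this
    rw [e]
    refine ⟨h4, (Instance.feas_flat.1 h5).2, fun y hy => ?_⟩
    obtain ⟨w, w1, w2⟩ := Instance.exists_flat (hn := hn) (hr := hr) (hs := hs) (ht := ht) y hy
    have h8 := h6 w w1
    have h9 := hobj v w
    rw [← hF] at w2
    rw [w2] at h9
    exact sub_nonpos.1 (h9 ▸ sub_nonpos.2 h8)
  · right
    refine ⟨h4, Set.eq_empty_iff_forall_notMem.2 fun x hx => h5 ?_⟩
    obtain ⟨w, w1, -⟩ := Instance.exists_flat (hn := hn) (hr := hr) (hs := hs) (ht := ht) x hx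
    exact ⟨w, w1⟩

end NFoldIP

namespace NFoldIP

open Prog Finset

/-! ### The running time -/

namespace Flat

/-- `U` bounds the parameters of `M` that do not depend on `n` and `t`. -/
structure Dom (M : Flat) (U : ℕ) : Prop where
  one : 1 ≤ U
  sum : M.r + M.s + 1 ≤ U
  D : M.D ≤ U
  block : blockBound M.s M.D ≤ U
  top : (2 * M.r * (blockBound M.s M.D * M.D) + 1) ^ M.r ≤ U
  step : M.stepBound ≤ U
  base : M.base ≤ U
  res : M.resBound ≤ U

variable {M : Flat} {U : ℕ}

theorem Dom.brick_le (h : M.Dom U) : M.brick ≤ M.t * U := by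
  have := h.sum
  have := M.t_pos
  unfold brick
  calc M.t + (M.r + M.s) ≤ M.t + M.t * (M.r + M.s) :=
        Nat.add_le_add_left (Nat.le_mul_of_pos_left _ M.t_pos) _
    _ = M.t * (M.r + M.s + 1) := by ring
    _ ≤ M.t * U := Nat.mul_le_mul_left _ h.sum

/-- The four factors `U` stand for the budgets, the steps, the residuals and the number of positions
per variable. Writing the variables as successors makes the difference of the two sides a polynomial
with nonnegative coefficients, which `positivity` accepts; the later estimates proceed alike. -/
theorem tableTime_le {P L S a : ℕ} (ha : 1 ≤ a) (hU : 1 ≤ U) (hP : P ≤ a * U) (hL : L ≤ U)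
    (hS : S ≤ U) : tableTime P L S ≤ 2000 * (a * U ^ 4) := by
  obtain ⟨a, rfl⟩ := Nat.exists_eq_add_of_le' ha
  obtain ⟨U, rfl⟩ := Nat.exists_eq_add_of_le' hU
  calc tableTime P L S ≤ tableTime ((a + 1) * (U + 1)) (U + 1) (U + 1) := by
        unfold tableTime; gcongr
    _ ≤ _ := by
        unfold tableTime
        zify
        rw [← sub_nonneg]
        ring_nf
        positivity

theorem moveTime_le {P L S a : ℕ} (ha : 1 ≤ a) (hU : 1 ≤ U) (hP : P ≤ a * U) (hL : L ≤ U)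
    (hS : S ≤ U) : moveTime P L S ≤ 2200 * (a * U ^ 4) := by
  have h1 := tableTime_le ha hU hP hL hS
  have h2 : P * (6 * S + 9 * L + 60) + 20 ≤ 200 * (a * U ^ 4) := by
    obtain ⟨a, rfl⟩ := Nat.exists_eq_add_of_le' ha
    obtain ⟨U, rfl⟩ := Nat.exists_eq_add_of_le' hU
    calc _ ≤ (a + 1) * (U + 1) * (6 * (U + 1) + 9 * (U + 1) + 60) + 20 := by gcongr
      _ ≤ _ := by
        zify
        rw [← sub_nonneg]
        ring_nf
        positivity
  unfold moveTime
  omega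

theorem Dom.size_le (h : M.Dom U) : M.size ≤ M.n * M.t * U := by
  unfold size
  rw [mul_assoc]
  exact Nat.mul_le_mul_left _ h.brick_le

theorem Dom.moveCost_le (h : M.Dom U) : M.moveCost ≤ 2200 * (M.n * M.t * U ^ 4) :=
  moveTime_le (Nat.mul_pos M.n_pos M.t_pos) h.one h.size_le h.step h.res

theorem Dom.probeCost_le (h : M.Dom U) : M.probeCost ≤ 2200 * (M.n * M.t * U ^ 4) := by
  have h1 := tableTime_le (Nat.mul_pos M.n_pos M.t_pos) h.one h.size_le h.step h.res
  have h2 : U ≤ M.n * M.t * U ^ 4 :=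
    (Nat.le_self_pow (by norm_num) U).trans
      (Nat.le_mul_of_pos_left _ (Nat.mul_pos M.n_pos M.t_pos))
  have := h.step
  have := h.res
  have := h.one
  unfold probeCost
  omega

theorem Dom.augmentCost_le (h : M.Dom U) {K : ℕ} (hK : 1 ≤ K) :
    M.augmentCost K ≤ 4500 * (K * (M.n * M.t * U ^ 4)) := by
  have h0 : 1 ≤ M.n * M.t * U ^ 4 :=
    Nat.mul_pos (Nat.mul_pos M.n_pos M.t_pos) (Nat.pow_pos h.one)
  have h1 : K * (M.probeCost + 2) ≤ K * (2202 * (M.n * M.t * U ^ 4)) :=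
    Nat.mul_le_mul_left _ (by have := h.probeCost_le; omega)
  have h2 : M.n * M.t * U ^ 4 ≤ K * (M.n * M.t * U ^ 4) := Nat.le_mul_of_pos_left _ hK
  have h3 : K * (2202 * (M.n * M.t * U ^ 4)) = 2202 * (K * (M.n * M.t * U ^ 4)) := by ring
  have := h.moveCost_le
  unfold augmentCost
  omega

/-- At most `3 * n * t * U ^ 2 * q` rounds, each with `K` tables of cost proportional to `n * t * U
^ 4`. -/
theorem Dom.optCost_le (h : M.Dom U) {K q : ℕ} (hK : 1 ≤ K) (hq : 1 ≤ q) :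
    M.optCost K (2 * (M.size * M.stepBound) * q + 1) ≤
      15000 * ((M.n * M.t) ^ 2 * K * q * U ^ 6) := by
  have hn := Nat.mul_pos M.n_pos M.t_pos
  have h1 : 2 * (M.size * M.stepBound) * q + 1 ≤ 3 * (M.n * M.t * U ^ 2 * q) := by
    have h2 : M.size * M.stepBound * q ≤ M.n * M.t * U * U * q := by
      gcongr
      · exact h.size_le
      · exact h.step
    have h3 : 1 ≤ M.n * M.t * U ^ 2 * q :=
      Nat.mul_pos (Nat.mul_pos hn (Nat.pow_pos h.one)) hq
    have h4 : M.n * M.t * U * U * q = M.n * M.t * U ^ 2 * q := by ring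
    have h5 : 2 * (M.size * M.stepBound) * q = 2 * (M.size * M.stepBound * q) := by ring
    omega
  have h2 : 1 ≤ K * (M.n * M.t * U ^ 4) := Nat.mul_pos hK (Nat.mul_pos hn (Nat.pow_pos h.one))
  have h3 := h.augmentCost_le hK
  have h4 : 1 ≤ (M.n * M.t) ^ 2 * K * q * U ^ 6 :=
    Nat.mul_pos (Nat.mul_pos (Nat.mul_pos (Nat.pow_pos hn) hK) hq) (Nat.pow_pos h.one)
  unfold optCost
  calc _ ≤ 3 * (M.n * M.t * U ^ 2 * q) * (4501 * (K * (M.n * M.t * U ^ 4))) + 10 := by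
        gcongr
        omega
    _ = 13503 * ((M.n * M.t) ^ 2 * K * q * U ^ 6) + 10 := by ring
    _ ≤ _ := by omega

theorem Dom.slackBound_le (h : M.Dom U) : M.slackBound ≤ 2 * (M.n * M.t * U ^ 2) := by
  have h1 : M.r + M.s ≤ U := by have := h.sum; omega
  unfold slackBound
  calc 2 * ((M.r + M.s) * M.n * M.t * M.D) ≤ 2 * (U * M.n * M.t * U) := by
        gcongr
        exact h.D
    _ = _ := by ring

/-- At each of the `K` scales there are about `n * t * U ^ 2` moves of cost proportional to `n * t *
U ^ 4`; reducing the remainders costs no more than that. -/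
theorem Dom.feasCost_le (h : M.Dom U) {K : ℕ} (hK : 1 ≤ K) :
    M.feasCost K ≤ 30000 * ((M.n * M.t) ^ 2 * K * U ^ 6) := by
  have hn := Nat.mul_pos M.n_pos M.t_pos
  have h1 := h.slackBound_le
  have h2 := h.size_le
  have h3 := h.moveCost_le
  have hU := h.one
  unfold feasCost
  generalize M.n * M.t = a at *
  calc _ ≤ K * (a * U * (5 * (2 * (a * U ^ 2)) * 22 + 8) +
          5 * (2 * (a * U ^ 2)) * (2200 * (a * U ^ 4) + 2) + 20) + 10 := by gcongr
    _ ≤ _ := by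
      obtain ⟨a, rfl⟩ := Nat.exists_eq_add_of_le' hn
      obtain ⟨U, rfl⟩ := Nat.exists_eq_add_of_le' hU
      obtain ⟨K, rfl⟩ := Nat.exists_eq_add_of_le' hK
      zify
      rw [← sub_nonneg]
      ring_nf
      positivity

theorem Dom.parCost_le (h : M.Dom U) : M.parCost ≤ 400 * (M.n * M.t * U ^ 4) := by
  have hn := Nat.mul_pos M.n_pos M.t_pos
  have hr : M.r ≤ U := by have := h.sum; omega
  have hs : M.s ≤ U := by have := h.sum; omega
  have hrs : M.r + M.s ≤ U := by have := h.sum; omega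
  have h1 := h.one
  have h2 := h.D
  have h3 := h.block
  have h4 := h.top
  have h5 := h.step
  have h6 := h.base
  have h7 := h.res
  unfold parCost
  generalize M.n * M.t = a, (2 * M.r * (blockBound M.s M.D * M.D) + 1) ^ M.r = b at *
  calc _ ≤ 9 * U + U * (3 * (2 * U * U + 1) + 11) + 3 * (U * U) +
        U * (3 * (2 * U * (U * U) + 1) + 11) + 3 * U + 6 * U +
        U * (3 * U + 11) + U * (3 * U + 11) + 3 * (2 * U + 1) + 3 * a + 200 := by gcongr
    _ ≤ _ := by
      obtain ⟨a, rfl⟩ := Nat.exists_eq_add_of_le' hn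
      obtain ⟨U, rfl⟩ := Nat.exists_eq_add_of_le' h1
      zify
      rw [← sub_nonneg]
      ring_nf
      positivity

theorem Dom.colCost_le (h : M.Dom U) : M.colCost ≤ 50 * (M.t * U) := by
  have h0 : 1 ≤ M.t * U := Nat.mul_pos M.t_pos h.one
  have h1 : M.r * M.t + M.s * M.t + M.t ≤ M.t * U := by
    calc _ = M.t * (M.r + M.s + 1) := by ring
      _ ≤ _ := Nat.mul_le_mul_left _ h.sum
  unfold colCost
  omega

theorem Dom.cellCost_le (h : M.Dom U) : M.cellCost ≤ 120 * (M.t * U ^ 2) := by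
  have ht := M.t_pos
  have h1 := h.one
  have hrs : M.r + M.s ≤ U := by have := h.sum; omega
  have h2 := h.colCost_le
  have h3 := h.base
  have h4 := h.brick_le
  unfold cellCost codeCost
  generalize M.t = t at *
  calc _ ≤ U * (50 * (t * U) + 3 * U + 10) + 4 + 3 * (t * U) + 3 * t + 30 := by gcongr
    _ ≤ _ := by
      obtain ⟨t, rfl⟩ := Nat.exists_eq_add_of_le' ht
      obtain ⟨U, rfl⟩ := Nat.exists_eq_add_of_le' h1
      zify
      rw [← sub_nonneg]
      ring_nf
      positivity

theorem Dom.layoutCost_le (h : M.Dom U) : M.layoutCost ≤ 200 * ((M.n * M.t) ^ 2 * U ^ 4) := by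
  have hn := M.n_pos
  have ht := M.t_pos
  have h1 := h.one
  have h2 := h.cellCost_le
  have h4 := h.brick_le
  unfold layoutCost
  generalize M.t = t, M.n = n at *
  calc _ ≤ n * (t * U * (120 * (t * U ^ 2) + 2) + 3 * (t * U) + 20) + 10 := by gcongr
    _ ≤ _ := by
      obtain ⟨n, rfl⟩ := Nat.exists_eq_add_of_le' hn
      obtain ⟨t, rfl⟩ := Nat.exists_eq_add_of_le' ht
      obtain ⟨U, rfl⟩ := Nat.exists_eq_add_of_le' h1
      zify
      rw [← sub_nonneg]
      ring_nf
      positivity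

theorem Dom.brickCost_le (h : M.Dom U) : M.brickCost ≤ 100 * (M.t ^ 2 * U ^ 2) := by
  have ht := M.t_pos
  have h1 := h.one
  have h2 := h.colCost_le
  have h3 := h.D
  have h4 := h.brick_le
  unfold brickCost termCost
  generalize M.t = t at *
  calc _ ≤ t * U * (50 * (t * U) + 3 * (t * U) + 3 * U + 30 + 2) + 5 := by gcongr
    _ ≤ _ := by
      obtain ⟨t, rfl⟩ := Nat.exists_eq_add_of_le' ht
      obtain ⟨U, rfl⟩ := Nat.exists_eq_add_of_le' h1
      zify
      rw [← sub_nonneg]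
      ring_nf
      positivity

theorem Dom.topCost_le (h : M.Dom U) : M.topCost ≤ 200 * ((M.n * M.t) ^ 2 * U ^ 4) := by
  have hn := M.n_pos
  have ht := M.t_pos
  have h1 := h.one
  have h2 := h.brickCost_le
  have hr : M.r ≤ U := by have := h.sum; omega
  unfold topCost
  generalize M.t = t, M.n = n at *
  calc _ ≤ U * (n * (100 * (t ^ 2 * U ^ 2) + 2) + 20) + 10 := by gcongr
    _ ≤ _ := by
      obtain ⟨n, rfl⟩ := Nat.exists_eq_add_of_le' hn
      obtain ⟨t, rfl⟩ := Nat.exists_eq_add_of_le' ht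
      obtain ⟨U, rfl⟩ := Nat.exists_eq_add_of_le' h1
      zify
      rw [← sub_nonneg]
      ring_nf
      positivity

theorem Dom.bottomCost_le (h : M.Dom U) : M.bottomCost ≤ 200 * ((M.n * M.t) ^ 2 * U ^ 4) := by
  have hn := M.n_pos
  have ht := M.t_pos
  have h1 := h.one
  have h2 := h.brickCost_le
  have h4 := h.brick_le
  have hs : M.s ≤ U := by have := h.sum; omega
  unfold bottomCost
  generalize M.t = t, M.n = n at *
  calc _ ≤ n * (U * (100 * (t ^ 2 * U ^ 2) + 3 * U + 3 * (t * U) + 30) + 20) + 10 := by gcongr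
    _ ≤ _ := by
      obtain ⟨n, rfl⟩ := Nat.exists_eq_add_of_le' hn
      obtain ⟨t, rfl⟩ := Nat.exists_eq_add_of_le' ht
      obtain ⟨U, rfl⟩ := Nat.exists_eq_add_of_le' h1
      zify
      rw [← sub_nonneg]
      ring_nf
      positivity

theorem Dom.setupCost_le (h : M.Dom U) :
    M.setupCost ≤ 2000 * ((M.n * M.t) ^ 2 * U ^ 4 * M.levels) := by
  have hn := M.n_pos
  have ht := M.t_pos
  have h1 := h.one
  have h2 := h.brick_le
  have h3 := h.parCost_le
  have h4 := h.layoutCost_le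
  have h5 := h.topCost_le
  have h6 := h.bottomCost_le
  have hr : M.r ≤ U := by have := h.sum; omega
  have hs : M.s ≤ U := by have := h.sum; omega
  have hrs : M.r + M.s ≤ U := by have := h.sum; omega
  have hl : 1 ≤ M.levels := Nat.le_add_left _ _
  unfold setupCost
  generalize M.t = t, M.n = n, M.levels = l at *
  calc _ ≤ 6 * (t * U) + 12 * t + 12 * U + 14 * (n * t * U) + 14 * (n * t * U) + 14 * U +
        14 * (n * U) + 36 * (n * t) + 400 * (n * t * U ^ 4) + 6 * l +
        200 * ((n * t) ^ 2 * U ^ 4) + 200 * ((n * t) ^ 2 * U ^ 4) + 200 * ((n * t) ^ 2 * U ^ 4) +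
        150 := by gcongr
    _ ≤ _ := by
      obtain ⟨n, rfl⟩ := Nat.exists_eq_add_of_le' hn
      obtain ⟨t, rfl⟩ := Nat.exists_eq_add_of_le' ht
      obtain ⟨U, rfl⟩ := Nat.exists_eq_add_of_le' h1
      obtain ⟨l, rfl⟩ := Nat.exists_eq_add_of_le' hl
      zify
      rw [← sub_nonneg]
      ring_nf
      positivity

theorem Dom.totalCost_le (h : M.Dom U) {q : ℕ} (hq : 1 ≤ q) :
    M.totalCost (2 * (M.size * M.stepBound) * q) ≤
      50000 * ((M.n * M.t) ^ 2 * M.levels * q * U ^ 6) := by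
  have hn := Nat.mul_pos M.n_pos M.t_pos
  have hU := h.one
  have hl : 1 ≤ M.levels := Nat.le_add_left _ _
  have h1 := h.setupCost_le
  have h2 := h.feasCost_le hl
  have h3 := h.optCost_le hl hq
  have h4 := h.size_le
  unfold totalCost
  generalize M.n * M.t = a, M.levels = l at *
  have e1 : a ^ 2 * U ^ 4 * l ≤ a ^ 2 * l * q * U ^ 6 := by
    calc a ^ 2 * U ^ 4 * l = a ^ 2 * l * 1 * U ^ 4 := by ring
      _ ≤ a ^ 2 * l * q * U ^ 6 := by gcongr; norm_num
  have e2 : a ^ 2 * l * U ^ 6 ≤ a ^ 2 * l * q * U ^ 6 := by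
    calc a ^ 2 * l * U ^ 6 = a ^ 2 * l * 1 * U ^ 6 := by ring
      _ ≤ a ^ 2 * l * q * U ^ 6 := by gcongr
  have e3 : a * U ≤ a ^ 2 * l * q * U ^ 6 := by
    calc a * U = a ^ 1 * 1 * 1 * U ^ 1 := by ring
      _ ≤ a ^ 2 * l * q * U ^ 6 := by gcongr <;> norm_num
  have e4 : 1 ≤ a * U := Nat.mul_pos hn hU
  omega

/-- Each bound is a power of `3x` with `x = r * s * Δ`: the block bound has exponent `s`, the step
bound `s + (s + 1) r`, the base of the digits one more, and the residual bound `r + s` times the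
latter. The last one dominates and yields the exponent `O(r²s + rs²)`. -/
theorem dom_pow {Δ : ℕ} (hΔ : M.D ≤ Δ) :
    M.Dom ((3 * (M.r * M.s * Δ)) ^ (4 * (M.r ^ 2 * M.s + M.r * M.s ^ 2))) := by
  have hr := M.r_pos
  have hs := M.s_pos
  have hD := M.D_pos
  set x := M.r * M.s * Δ with hx
  have hx1 : 1 ≤ x := Nat.mul_pos (Nat.mul_pos hr hs) (hD.trans_le hΔ)
  have hy : 1 ≤ 3 * x := by omega
  have hDx : M.D ≤ x := hΔ.trans (Nat.le_mul_of_pos_left _ (Nat.mul_pos hr hs))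
  have hsD : M.s * M.D ≤ x := by
    rw [hx, mul_assoc]
    exact (Nat.mul_le_mul_left _ hΔ).trans (Nat.le_mul_of_pos_left _ hr)
  have hrD : M.r * M.D ≤ x := by
    rw [hx, mul_assoc]
    exact Nat.mul_le_mul_left _ (hΔ.trans (Nat.le_mul_of_pos_left _ hs))
  have hrs : M.r * M.s ≤ x := Nat.le_mul_of_pos_right _ (hD.trans_le hΔ)
  have hb : blockBound M.s M.D ≤ (3 * x) ^ M.s := by
    unfold blockBound
    refine Nat.pow_le_pow_left ?_ _
    rw [mul_assoc]
    omega
  have hb0 : 1 ≤ blockBound M.s M.D := by unfold blockBound; exact Nat.pow_pos (by omega)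
  have ht : (2 * M.r * (blockBound M.s M.D * M.D) + 1) ^ M.r ≤ (3 * x) ^ ((M.s + 1) * M.r) := by
    rw [pow_mul]
    refine Nat.pow_le_pow_left ?_ _
    have h1 : M.r * M.D * blockBound M.s M.D ≤ x * (3 * x) ^ M.s := Nat.mul_le_mul hrD hb
    have h2 : 1 ≤ M.r * M.D * blockBound M.s M.D := Nat.mul_pos (Nat.mul_pos hr hD) hb0
    have h3 : 2 * M.r * (blockBound M.s M.D * M.D) = 2 * (M.r * M.D * blockBound M.s M.D) := by
      ring
    have h4 : (3 * x) ^ (M.s + 1) = 3 * (x * (3 * x) ^ M.s) := by ring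
    omega
  have hL : M.stepBound ≤ (3 * x) ^ (M.s + (M.s + 1) * M.r) := by
    rw [pow_add]
    exact Nat.mul_le_mul hb ht
  have hB : M.base ≤ (3 * x) ^ (M.s + (M.s + 1) * M.r + 1) := by
    have h1 : M.D * M.stepBound ≤ x * (3 * x) ^ (M.s + (M.s + 1) * M.r) := Nat.mul_le_mul hDx hL
    have h2 : 1 ≤ M.D * M.stepBound := Nat.mul_pos hD stepBound_pos
    rw [pow_succ, base]
    have h3 : (3 * x) ^ (M.s + (M.s + 1) * M.r) * (3 * x) =
      3 * (x * (3 * x) ^ (M.s + (M.s + 1) * M.r)) := by ring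
    omega
  have hS : M.resBound ≤ (3 * x) ^ ((M.s + (M.s + 1) * M.r + 1) * (M.r + M.s)) := by
    rw [pow_mul]
    exact Nat.pow_le_pow_left hB _
  -- The left side is `r * s + r + s + 1`, and each of the four summands is at most `r * s`.
  have e0 : M.s + (M.s + 1) * M.r + 1 ≤ 4 * (M.r * M.s) := by nlinarith
  have e1 : (M.s + (M.s + 1) * M.r + 1) * (M.r + M.s) ≤
      4 * (M.r ^ 2 * M.s + M.r * M.s ^ 2) :=
    (Nat.mul_le_mul_right _ e0).trans (by ring_nf; rfl)
  have e2 : M.s + (M.s + 1) * M.r + 1 ≤ 4 * (M.r ^ 2 * M.s + M.r * M.s ^ 2) :=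
    (Nat.le_mul_of_pos_right _ (by omega)).trans e1
  have hp : ∀ {k}, k ≤ 4 * (M.r ^ 2 * M.s + M.r * M.s ^ 2) →
      (3 * x) ^ k ≤ (3 * x) ^ (4 * (M.r ^ 2 * M.s + M.r * M.s ^ 2)) :=
    fun h => Nat.pow_le_pow_right hy h
  have h1 : 3 * x ≤ (3 * x) ^ (4 * (M.r ^ 2 * M.s + M.r * M.s ^ 2)) :=
    (pow_one (3 * x)).ge.trans (hp (by omega))
  refine ⟨hy.trans h1, ?_, ?_, hb.trans (hp (by omega)), ht.trans (hp (by omega)),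
    hL.trans (hp (by omega)), hB.trans (hp e2), hS.trans (hp e1)⟩
  · have : M.r + M.s ≤ M.r * M.s + 1 := by nlinarith
    omega
  · omega

end Flat

/-- The factor `3` is absorbed by `3x ≤ x ^ 3` when `x ≥ 2`. When `x = 1` all powers of `x` are `1`,
but then the exponent is fixed and the power of `3` is an absolute constant. -/
theorem pow_mul_le {x e : ℕ} (hx : 1 ≤ x) (he : x = 1 → e = 2) (k : ℕ) :
    (3 * x) ^ (4 * e * k) ≤ 3 ^ (8 * k) * x ^ (12 * k * e) := by
  rcases Nat.eq_or_lt_of_le hx with rfl | hx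
  · rw [he rfl]
    simp only [mul_one, one_pow]
    ring_nf
    exact le_rfl
  · calc (3 * x) ^ (4 * e * k) ≤ (x ^ 3) ^ (4 * e * k) := by
          refine Nat.pow_le_pow_left ?_ _
          nlinarith [Nat.mul_le_mul hx hx]
      _ = 1 * x ^ (12 * k * e) := by rw [← pow_mul, one_mul]; congr 1; ring
      _ ≤ _ := Nat.mul_le_mul_right _ (Nat.one_le_pow _ _ (by norm_num))

theorem Instance.one_le_phi {n r s t : ℕ} (I : Instance n r s t) : 1 ≤ I.phi := by
  unfold phi
  rw [Real.le_logb_iff_rpow_le (by norm_num) (by positivity)]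
  simp

theorem one_le_logb_max (M : ℤ) : 1 ≤ Real.logb 2 (max 2 (M : ℝ)) := by
  rw [Real.le_logb_iff_rpow_le (by norm_num) (by positivity)]
  simp

/-- One for the offset, one for the factor `2` in `2 * N`, and `φ` itself, with `φ ≥ 1`. The
program's `N` is at least `1`, which the maximum with `2` in `φ` covers. -/
theorem levels_flat_le {n r s t : ℕ} {I : Instance n r s t} {hn : 0 < n} {hr : 0 < r} {hs : 0 < s}
    {ht : 0 < t} : ((I.flat hn hr hs ht).levels : ℝ) ≤ 3 * I.phi := by
  have h1 := I.one_le_phi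
  have h2 : ∀ N : ℕ, 0 < N → N ≤ max 1 I.largest → (Nat.log 2 (2 * N) : ℝ) ≤ 1 + I.phi := by
    intro N hN hNl
    refine (Real.natLog_le_logb _ _).trans ?_
    push_cast
    rw [Real.logb_mul (by norm_num) (by positivity), Real.logb_self_eq_one (by norm_num)]
    have h3 : (N : ℝ) ≤ max 2 (I.largest : ℝ) := by
      rw [le_max_iff] at hNl ⊢
      rcases hNl with h | h
      · left
        exact_mod_cast h.trans (by norm_num)
      · right
        exact_mod_cast h
    have h4 := Real.logb_le_logb_of_le (b := 2) (by norm_num) (by positivity) h3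
    unfold Instance.phi
    linarith
  have h3 := h2 _ I.inputBound_pos I.inputBound_le
  have h4 : ((I.flat hn hr hs ht).levels : ℝ) = Nat.log 2 (2 * I.inputBound) + 1 := by
    rw [Flat.levels, Nat.cast_succ]
    rfl
  rw [h4]
  linarith

theorem natLog_toNat_le (M : ℤ) :
    ((Nat.log 2 M.toNat + 1 : ℕ) : ℝ) ≤ 2 * Real.logb 2 (max 2 (M : ℝ)) := by
  have h1 := one_le_logb_max M
  have h2 : (Nat.log 2 M.toNat : ℝ) ≤ Real.logb 2 (max 2 (M : ℝ)) := by
    rcases Nat.eq_zero_or_pos M.toNat with h | h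
    · rw [h]
      simp only [Nat.log_zero_right, Nat.cast_zero]
      linarith
    · refine (Real.natLog_le_logb _ _).trans
        (Real.logb_le_logb_of_le (by norm_num) (by exact_mod_cast h) (le_max_of_le_right ?_))
      have : (M.toNat : ℤ) = M := Int.toNat_of_nonneg (by omega)
      exact_mod_cast this.le
  push_cast
  linarith

end NFoldIP

/-- One program and one constant `K` serve all instances: the generalized `n`-fold integer program
`min f(x)` with finite bounds and separable convex `f : ℤ^{nt} → ℤ` is solved in at most
`K · n² t² · φ · log M · (r s Δ) ^ (K (r² s + r s²))` steps, where `log M` is read as `1` if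
`M < 2` or if there is no feasible integer point. -/
theorem mainTheorem8 :
    ∃ (prog : NFoldIP.Prog) (K : ℕ),
      ∀ (n r s t Δ : ℕ), 0 < n → 0 < r → 0 < s → 0 < t → 0 < Δ →
      ∀ (I : NFoldIP.Instance n r s t), I.EntriesBounded Δ →
      ∀ (f : (Fin n × Fin t → ℤ) → ℤ), NFoldIP.SeparableConvex f →
      ∀ (M : ℤ),
        (I.feasible.Nonempty →
          IsGreatest {d : ℤ | ∃ x ∈ I.feasible, ∃ y ∈ I.feasible, d = f x - f y} M) →
      ∃ (T : ℕ) (σ : NFoldIP.State),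
        NFoldIP.Exec (NFoldIP.coordinateOracle f) prog I.encode T σ ∧
        I.IsAnswer f σ ∧
        (T : ℝ) ≤ K * (n : ℝ) ^ 2 * (t : ℝ) ^ 2 * I.phi * Real.logb 2 (max 2 (M : ℝ)) *
          ((r : ℝ) * s * Δ) ^ (K * (r ^ 2 * s + r * s ^ 2)) := by
  -- The constant is `50000` from the total cost, `3` from the levels, `2` from the logarithm of `M`
  -- and `3 ^ 48` from the powers of `3`. It also serves in the exponent, where `72` would be
  -- enough.
  refine ⟨NFoldIP.nfoldProg, 300000 * 3 ^ 48, ?_⟩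
  intro n r s t Δ hn hr hs ht hΔ I hI f hf M hM
  obtain ⟨T, σ, h1, h2, h3⟩ := NFoldIP.exists_exec hn hr hs ht hf hM
  refine ⟨T, σ, h1, h2, ?_⟩
  have hx : 1 ≤ r * s * Δ := Nat.mul_pos (Nat.mul_pos hr hs) hΔ
  have h4 := (NFoldIP.Flat.dom_pow (M := I.flat hn hr hs ht)
    (NFoldIP.Instance.entryBound_le hI hΔ)).totalCost_le (q := Nat.log 2 M.toNat + 1) (by omega)
  have h5 : T ≤ 50000 * ((n * t) ^ 2 * (I.flat hn hr hs ht).levels * (Nat.log 2 M.toNat + 1) *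
      ((3 * (r * s * Δ)) ^ (4 * (r ^ 2 * s + r * s ^ 2))) ^ 6) := h3.trans h4
  have h6 : ((3 * (r * s * Δ)) ^ (4 * (r ^ 2 * s + r * s ^ 2))) ^ 6 ≤
      3 ^ 48 * (r * s * Δ) ^ (300000 * 3 ^ 48 * (r ^ 2 * s + r * s ^ 2)) := by
    rw [← pow_mul]
    -- If `r * s * Δ = 1`, then `r = s = 1` and `r ^ 2 * s + r * s ^ 2 = 2`.
    refine (NFoldIP.pow_mul_le hx (fun h => ?_) 6).trans
      (Nat.mul_le_mul_left _ (Nat.pow_le_pow_right hx (Nat.mul_le_mul_right _ (by norm_num))))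
    have h7 := Nat.eq_one_of_mul_eq_one_right h
    rw [Nat.eq_one_of_mul_eq_one_right h7, Nat.eq_one_of_mul_eq_one_left h7]
    rfl
  generalize 300000 * 3 ^ 48 * (r ^ 2 * s + r * s ^ 2) = E at *
  have h7 : (T : ℝ) ≤ 50000 * (((n : ℝ) * t) ^ 2 * (3 * I.phi) *
      (2 * Real.logb 2 (max 2 (M : ℝ))) * (3 ^ 48 * ((r : ℝ) * s * Δ) ^ E)) := by
    have h8 : (T : ℝ) ≤ 50000 * (((n : ℝ) * t) ^ 2 * (I.flat hn hr hs ht).levels *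
        (Nat.log 2 M.toNat + 1 : ℕ) * (3 ^ 48 * ((r : ℝ) * s * Δ) ^ E)) := by
      have h9 := h5.trans (Nat.mul_le_mul_left _ (Nat.mul_le_mul_left _ h6))
      exact_mod_cast h9
    refine h8.trans ?_
    have := I.one_le_phi
    gcongr
    · exact NFoldIP.levels_flat_le
    · exact NFoldIP.natLog_toNat_le M
  refine h7.trans (le_of_eq ?_)
  push_cast
  ring
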